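/- Let $\gamma>\alpha>\beta\ge 1$ and $\bar u>0$ be real numbers, and let $f\in C[0,\infty)\cap C^1(0,\infty)\cap C^2(0,\bar u)$ satisfy $f(0)=0$ and $f>0$ on $(0,\infty)$. Assume that $g:=f^{1/\beta}$ satisfies (G1) $g'(u)>0$ and $g''(u)>0$ for all $u\in(0,\bar u)$; (G2) the finite limit $q:=\lim_{u\to0^+}\frac{g'(u)^2}{g(u)g''(u)}$ exists; (G3) if $q=1$, then $\frac{g'(u)^2}{g(u)g''(u)}\ge1$ for all small $u>0$; (G4) $g'(u)>0$ for all $0<u<\infty$. Consider the problem $$ (\mathrm P_\lambda)\qquad \begin{cases} s^{-(\gamma-1)}\left(s^{\alpha}|v'|^{\beta-1}v'\right)'+\dfrac{\lambda}{f(1-v)}=0, & 0<s<1,\\ v(s)>0, & 0<s<1,\\ v(1)=0, \end{cases} $$ where $\lambda>0$, and where a solution is a function $v\in C^2(0,1)\cap C[0,1]$ with $v<1$ on $(0,1)$. A pair $(\lambda,v)$ with $v$ solving $(\mathrm P_\lambda)$ is called a regular solution if $0\le v<1$ on $[0,1]$, and a degenerate solution if $v(0)=1$. Then the following hold. (i)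 There is exactly one degenerate solution $(\bar\lambda,\bar v)$. The set of all regular solutions is a curve $$\mathcal C=\{(\lambda(\tau),v(\cdot,\tau)) : 0<\tau<1\},\qquad v(0,\tau)=\tau,$$ with $\tau\mapsto(\lambda(\tau),v(\cdot,\tau))\in\mathbb R\times C[0,1]$ continuous on $(0,1)$, and, as $\tau\to1^-$, $$\lambda(\tau)\to\bar\lambda\qquad\text{and}\qquad v(\cdot,\tau)\to\bar v\ \text{ in } C[0,1].$$ (ii) Let $\theta:=1+\frac{\gamma-\alpha}{\beta}$, $\kappa:=\beta\gamma+\alpha-\beta$ and $$q_c:=\frac12+\frac{\theta(\beta+1)^2}{4(\sqrt{\kappa}-\sqrt\theta)^2-2\theta(\beta+1)^2},$$ with $q_c:=\infty$ if the denominator is not positive. If $q<q_c$, then $\mathcal C$ has infinitely many turning points around $\bar\lambda$: there are $0<t_0<t_1<t_2<\dots<1$ with $t_n\to1$ such that for every $n\ge 0$ one has $\lambda(t_{2n})>\bar\lambda>\lambda(t_{2n+1})$, the function $\lambda(\cdot)$ attains at $t_{2n}$ its maximum over some interval $[a,b]\subset(0,1)$ with $a<t_{2n}<b$, whose endpoints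 satisfy $\lambda(a)<\lambda(t_{2n})$ and $\lambda(b)<\lambda(t_{2n})$, and it attains at $t_{2n+1}$ its minimum over some interval $[a',b']\subset(0,1)$ with $a'<t_{2n+1}<b'$, whose endpoints satisfy $\lambda(a')>\lambda(t_{2n+1})$ and $\lambda(b')>\lambda(t_{2n+1})$. Hence, for $\lambda=\bar\lambda$, problem $(\mathrm P_{\lambda})$ has infinitely many regular solutions. -/

import Mathlib

open Set Filter Topology

noncomputable section

namespace MEMS

/-- `g = f ^ (1 / β)`. -/
def gOf (β : ℝ) (f : ℝ → ℝ) : ℝ → ℝ := fun u => f u ^ (1 / β)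

/-- The quotient `g'(u) ^ 2 / (g(u) g''(u))`. -/
def growthQuotient (β : ℝ) (f : ℝ → ℝ) (u : ℝ) : ℝ :=
  deriv (gOf β f) u ^ 2 / (gOf β f u * deriv (deriv (gOf β f)) u)

/-- A continuous function on `[0, 1]` as a function on `ℝ` (constant to the left and to the right
of the interval); only its values on `[0, 1]` are ever used. -/
def onReal (v : C(Icc (0 : ℝ) 1, ℝ)) : ℝ → ℝ := IccExtend (zero_le_one' ℝ) v

/-- `(lam, v)` is a solution of the Dirichlet problem
`s ^ (-(γ - 1)) (s ^ α |v'| ^ (β - 1) v')' + lam / f (1 - v) = 0`, `v > 0` on `(0, 1)`, `v 1 = 0`,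
with `lam > 0` and `v ∈ C² (0, 1) ∩ C [0, 1]`. Since `f 0 = 0`, the equation has a meaning
only where `v < 1`. -/
structure IsSolution (α β γ : ℝ) (f : ℝ → ℝ) (lam : ℝ) (v : C(Icc (0 : ℝ) 1, ℝ)) : Prop where
  lam_pos : 0 < lam
  contDiffOn : ContDiffOn ℝ 2 (onReal v) (Ioo 0 1)
  pos : ∀ s ∈ Ioo (0 : ℝ) 1, 0 < onReal v s
  lt_one : ∀ s ∈ Ioo (0 : ℝ) 1, onReal v s < 1
  equation : ∀ s ∈ Ioo (0 : ℝ) 1,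
    s ^ (-(γ - 1)) *
        deriv (fun r => r ^ α * (|deriv (onReal v) r| ^ (β - 1) * deriv (onReal v) r)) s +
      lam / f (1 - onReal v s) = 0
  boundary : v 1 = 0

/-- A regular solution: `0 ≤ v < 1` on the whole of `[0, 1]`. -/
def IsRegularSolution (α β γ : ℝ) (f : ℝ → ℝ) (lam : ℝ) (v : C(Icc (0 : ℝ) 1, ℝ)) : Prop :=
  IsSolution α β γ f lam v ∧ ∀ s, 0 ≤ v s ∧ v s < 1

/-- A degenerate solution: `v 0 = 1`. -/
def IsDegenerateSolution (α β γ : ℝ) (f : ℝ → ℝ) (lam : ℝ) (v : C(Icc (0 : ℝ) 1, ℝ)) : Prop :=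
  IsSolution α β γ f lam v ∧ v 0 = 1

/-- `τ ↦ (Λ τ, V τ)`, `0 < τ < 1`, is a continuous parametrization of the set of all regular
solutions by the value `τ = v 0` at the centre. -/
structure IsBifurcationCurve (α β γ : ℝ) (f : ℝ → ℝ) (Λ : ℝ → ℝ)
    (V : ℝ → C(Icc (0 : ℝ) 1, ℝ)) : Prop where
  central_value : ∀ τ ∈ Ioo (0 : ℝ) 1, V τ 0 = τ
  regular_iff : ∀ lam v, IsRegularSolution α β γ f lam v ↔
    ∃ τ ∈ Ioo (0 : ℝ) 1, lam = Λ τ ∧ v = V τ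
  continuousOn_lam : ContinuousOn Λ (Ioo 0 1)
  continuousOn_v : ContinuousOn V (Ioo 0 1)

/-- The curve turns back to the left at the parameter `τ₀`: near `τ₀` it stays in
`lam ≤ Λ τ₀`, and it leaves the line `lam = Λ τ₀` to the left on both sides of `τ₀`. -/
def TurnsLeftAt (Λ : ℝ → ℝ) (τ₀ : ℝ) : Prop :=
  ∃ a b, 0 < a ∧ a < τ₀ ∧ τ₀ < b ∧ b < 1 ∧
    (∀ τ ∈ Icc a b, Λ τ ≤ Λ τ₀) ∧ Λ a < Λ τ₀ ∧ Λ b < Λ τ₀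

/-- The curve turns back to the right at the parameter `τ₀`. -/
def TurnsRightAt (Λ : ℝ → ℝ) (τ₀ : ℝ) : Prop :=
  ∃ a b, 0 < a ∧ a < τ₀ ∧ τ₀ < b ∧ b < 1 ∧
    (∀ τ ∈ Icc a b, Λ τ₀ ≤ Λ τ) ∧ Λ τ₀ < Λ a ∧ Λ τ₀ < Λ b

/-- The curve has infinitely many turning points around `lbar`: along some sequence of parameters
increasing to `1` it turns back alternately to the left, at a value `> lbar` of `lam`, and to the
right, at a value `< lbar` of `lam`. -/
def HasInfinitelyManyTurningPointsAround (Λ : ℝ → ℝ) (lbar : ℝ) : Prop :=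
  ∃ t : ℕ → ℝ, StrictMono t ∧ (∀ n, t n ∈ Ioo (0 : ℝ) 1) ∧ Tendsto t atTop (𝓝 1) ∧
    (∀ n, TurnsLeftAt Λ (t (2 * n)) ∧ lbar < Λ (t (2 * n))) ∧
    (∀ n, TurnsRightAt Λ (t (2 * n + 1)) ∧ Λ (t (2 * n + 1)) < lbar)

/-- `θ = 1 + (γ - α) / β`. -/
def theta (α β γ : ℝ) : ℝ := 1 + (γ - α) / β

/-- `4 (√τ - √θ) ^ 2 - 2 θ (β + 1) ^ 2` with `τ = β γ + α - β`. -/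
def qcDenom (α β γ : ℝ) : ℝ :=
  4 * (√(β * γ + α - β) - √(theta α β γ)) ^ 2 - 2 * theta α β γ * (β + 1) ^ 2

open Classical in
/-- The critical exponent `1 / 2 + θ (β + 1) ^ 2 / (4 (√τ - √θ) ^ 2 - 2 θ (β + 1) ^ 2)`, to be read
as `∞` if the denominator is not positive; with this reading `1 < qc ↔ α - β < 4 θ`. -/
def qc (α β γ : ℝ) : EReal :=
  if qcDenom α β γ ≤ 0 then ⊤
  else ((1 / 2 + theta α β γ * (β + 1) ^ 2 / qcDenom α β γ : ℝ) : EReal)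

end MEMS

end

noncomputable section
namespace MEMS

/-! ### Calculus on intervals -/

/-! Put `u = 1 - v`, `h = 1 / f`, and rescale the radius so that `λ` disappears: the equation
becomes `(r ^ α (u') ^ β)' = r ^ (γ - 1) h u`, and `λ` is recovered from the radius at which `u`
reaches `1`. The flux of a solution has a sign, so `u` is strictly increasing and can replace `r` as
the independent variable. A solution is then an orbit `(ρ, Y) = (log r, log (r ^ α (u') ^ β))` with
`ρ → -∞` at the starting value `σ = 1 - v 0`, and `λ = exp (β θ ρ(1))`. Part (i) amounts to this:
for every `σ ∈ [0, 1)` there is exactly one orbit, and it depends continuously on `σ`, also at `σ =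
0`, the degenerate case.

For `σ > 0` existence is a contraction argument in the variable `r ^ θ` (`exists_isOrbit`). The
equation is singular at the start, so uniqueness and continuity rest on an energy that does not
increase along two orbits (`antitoneOn_orbitEnergy`, `tendsto_orbit`).

For `σ = 0` the coordinates `A = r u' g' / g` and `B = r ^ γ h / y`, where `y = exp Y`, with time `L
= log g`, give a system of Lotka–Volterra type. Its coefficient `D = 1 - g g'' / g' ^ 2` tends to `δ
= 1 - 1 / q ≥ 0`. A Lyapunov function, strict even for `δ = 0`, makes the equilibrium attract
uniformly from compact sets (`exists_attraction_time`). Regular orbits reach such a set within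
bounded time; singular ones, having an infinite past, visit one arbitrarily early and hence stay
near the equilibrium (`IsGrowth.exists_near_equilibrium`). The linearization contracts differences
of orbits (`IsGrowth.exists_contraction`), so orbits with small `σ` are close to each other; this
yields existence and uniqueness of the singular orbit and convergence to it
(`IsGrowth.exists_close`).

For part (ii), `q < q_c` makes the eigenvalues at the equilibrium non-real (`spiral_of_lt_qc`). The
difference between a regular orbit and the singular one then rotates at a rate bounded below in the
time `L`, and this time is unbounded as `σ → 0`. Away from the equilibrium less than half a turn can
be undone, since the difference crosses the axis of equal `ρ` in one sense only. So the winding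
angle tends to infinity (`tendsto_winding`). It is continuous in `σ`, and its cosine has the sign of
the difference of `ρ(1)`; hence `λ` lies on either side of its degenerate value for arbitrarily
small `σ`. The extrema between successive zeros of `λ - λbar` are the turning points
(`infinitely_many_turning_points`). -/

lemma monotoneOn_of_hasDerivAt {s : Set ℝ} (hs : Convex ℝ s) {φ φ' : ℝ → ℝ}
    (h : ∀ x ∈ s, HasDerivAt φ (φ' x) x) (h0 : ∀ x ∈ s, 0 ≤ φ' x) : MonotoneOn φ s :=
  monotoneOn_of_deriv_nonneg hs (fun x hx => (h x hx).continuousAt.continuousWithinAt)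
    (fun x hx => (h x (interior_subset hx)).differentiableAt.differentiableWithinAt)
    (fun x hx => by rw [(h x (interior_subset hx)).deriv]; exact h0 x (interior_subset hx))

lemma antitoneOn_of_hasDerivAt {s : Set ℝ} (hs : Convex ℝ s) {φ φ' : ℝ → ℝ}
    (h : ∀ x ∈ s, HasDerivAt φ (φ' x) x) (h0 : ∀ x ∈ s, φ' x ≤ 0) : AntitoneOn φ s :=
  antitoneOn_of_deriv_nonpos hs (fun x hx => (h x hx).continuousAt.continuousWithinAt)
    (fun x hx => (h x (interior_subset hx)).differentiableAt.differentiableWithinAt)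
    (fun x hx => by rw [(h x (interior_subset hx)).deriv]; exact h0 x (interior_subset hx))

lemma strictMonoOn_of_hasDerivAt {s : Set ℝ} (hs : Convex ℝ s) {φ φ' : ℝ → ℝ}
    (h : ∀ x ∈ s, HasDerivAt φ (φ' x) x) (h0 : ∀ x ∈ s, 0 < φ' x) : StrictMonoOn φ s :=
  strictMonoOn_of_deriv_pos hs (fun x hx => (h x hx).continuousAt.continuousWithinAt)
    (fun x hx => by rw [(h x (interior_subset hx)).deriv]; exact h0 x (interior_subset hx))

/-- The logarithmic mean: a secant of the exponential function. -/
lemma exists_exp_sub_exp (x y : ℝ) :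
    ∃ c, min (Real.exp x) (Real.exp y) ≤ c ∧ c ≤ max (Real.exp x) (Real.exp y) ∧
      Real.exp x - Real.exp y = c * (x - y) := by
  rcases lt_trichotomy x y with h | h | h
  · obtain ⟨c, hc, hc'⟩ := exists_hasDerivAt_eq_slope Real.exp Real.exp h
      Real.continuous_exp.continuousOn (fun x _ => Real.hasDerivAt_exp x)
    refine ⟨Real.exp c, (min_le_left _ _).trans (Real.exp_le_exp.2 hc.1.le),
      (Real.exp_le_exp.2 hc.2.le).trans (le_max_right _ _), ?_⟩
    rw [hc']; field_simp [sub_ne_zero.2 h.ne']; ring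
  · subst h; exact ⟨Real.exp x, by simp, by simp, by simp⟩
  · obtain ⟨c, hc, hc'⟩ := exists_hasDerivAt_eq_slope Real.exp Real.exp h
      Real.continuous_exp.continuousOn (fun x _ => Real.hasDerivAt_exp x)
    refine ⟨Real.exp c, (min_le_right _ _).trans (Real.exp_le_exp.2 hc.1.le),
      (Real.exp_le_exp.2 hc.2.le).trans (le_max_left _ _), ?_⟩
    rw [hc']; field_simp [sub_ne_zero.2 h.ne']

/-- The inverse of a function with positive derivative on an open interval. -/
lemma exists_inverse_of_hasDerivAt_pos {φ φ' : ℝ → ℝ} {a b l m : ℝ} (hab : a < b)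
    (hd : ∀ x ∈ Ioo a b, HasDerivAt φ (φ' x) x) (hpos : ∀ x ∈ Ioo a b, 0 < φ' x)
    (hl : Tendsto φ (𝓝[>] a) (𝓝 l)) (hm : Tendsto φ (𝓝[<] b) (𝓝 m)) :
    ∃ ψ : ℝ → ℝ, (∀ x ∈ Ioo a b, φ x ∈ Ioo l m ∧ ψ (φ x) = x) ∧
      (∀ y ∈ Ioo l m, ψ y ∈ Ioo a b ∧ φ (ψ y) = y ∧ HasDerivAt ψ (φ' (ψ y))⁻¹ y) ∧
      StrictMonoOn ψ (Ioo l m) ∧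
      Tendsto ψ (𝓝[>] l) (𝓝[>] a) ∧ Tendsto ψ (𝓝[<] m) (𝓝[<] b) := by
  have hcont : ContinuousOn φ (Ioo a b) := fun x hx => (hd x hx).continuousAt.continuousWithinAt
  have hmono : StrictMonoOn φ (Ioo a b) := strictMonoOn_of_hasDerivAt (convex_Ioo a b) hd hpos
  have hmaps : ∀ x ∈ Ioo a b, φ x ∈ Ioo l m := by
    intro x hx
    constructor
    · obtain ⟨x', hx'⟩ := exists_between hx.1
      have hx'm : x' ∈ Ioo a b := ⟨hx'.1, hx'.2.trans hx.2⟩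
      refine lt_of_le_of_lt (le_of_tendsto hl ?_) (hmono hx'm hx hx'.2)
      filter_upwards [Ioo_mem_nhdsGT hx'.1] with t ht
      exact (hmono ⟨ht.1, ht.2.trans hx'm.2⟩ hx'm ht.2).le
    · obtain ⟨x', hx'⟩ := exists_between hx.2
      have hx'm : x' ∈ Ioo a b := ⟨hx.1.trans hx'.1, hx'.2⟩
      refine lt_of_lt_of_le (hmono hx hx'm hx'.1) (ge_of_tendsto hm ?_)
      filter_upwards [Ioo_mem_nhdsLT hx'.2] with t ht
      exact (hmono hx'm ⟨hx'm.1.trans ht.1, ht.2⟩ ht.1).le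
  have hsurj : ∀ y ∈ Ioo l m, ∃ x ∈ Ioo a b, φ x = y := by
    intro y hy
    have h1 : ∀ᶠ t in 𝓝[>] a, φ t < y := hl.eventually (gt_mem_nhds hy.1)
    have h2 : ∀ᶠ t in 𝓝[<] b, y < φ t := hm.eventually (lt_mem_nhds hy.2)
    obtain ⟨t1, ht1, ht1'⟩ := (h1.and (Ioo_mem_nhdsGT hab)).exists
    obtain ⟨t2, ht2, ht2'⟩ := (h2.and (Ioo_mem_nhdsLT hab)).exists
    exact (convex_Ioo a b).isPreconnected.intermediate_value ht1' ht2' hcont ⟨ht1.le, ht2.le⟩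
  choose! ψ hψ using hsurj
  have hleft : ∀ x ∈ Ioo a b, ψ (φ x) = x := fun x hx =>
    hmono.injOn (hψ _ (hmaps x hx)).1 hx (hψ _ (hmaps x hx)).2
  have hψmono : StrictMonoOn ψ (Ioo l m) := by
    intro y1 h1 y2 h2 h12
    by_contra hcon
    have := hmono.monotoneOn (hψ y2 h2).1 (hψ y1 h1).1 (not_lt.1 hcon)
    rw [(hψ y2 h2).2, (hψ y1 h1).2] at this
    exact absurd h12 (not_lt.2 this)
  have himg : ψ '' Ioo l m = Ioo a b := by
    ext x; constructor
    · rintro ⟨y, hy, rfl⟩; exact (hψ y hy).1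
    · intro hx; exact ⟨φ x, hmaps x hx, hleft x hx⟩
  have hψc : ∀ y ∈ Ioo l m, ContinuousAt ψ y := by
    intro y hy
    refine hψmono.continuousAt_of_image_mem_nhds (Ioo_mem_nhds hy.1 hy.2) ?_
    rw [himg]; exact Ioo_mem_nhds (hψ y hy).1.1 (hψ y hy).1.2
  have hlm : l < m := by
    have := hmaps ((a + b) / 2) ⟨by linarith, by linarith⟩
    exact this.1.trans this.2
  refine ⟨ψ, fun x hx => ⟨hmaps x hx, hleft x hx⟩, fun y hy => ⟨(hψ y hy).1, (hψ y hy).2, ?_⟩,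
    hψmono, ?_, ?_⟩
  · refine HasDerivAt.of_local_left_inverse (hψc y hy) (hd _ (hψ y hy).1)
      (hpos _ (hψ y hy).1).ne' ?_
    filter_upwards [Ioo_mem_nhds hy.1 hy.2] with z hz using (hψ z hz).2
  · have hin : ∀ᶠ y in 𝓝[>] l, ψ y ∈ Ioi a := by
      filter_upwards [Ioo_mem_nhdsGT hlm] with y hy using (hψ y hy).1.1
    refine tendsto_nhdsWithin_iff.2 ⟨?_, hin⟩
    refine tendsto_order.2 ⟨fun c hc => hin.mono fun y hy => hc.trans hy, fun c hc => ?_⟩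
    obtain ⟨x, hx⟩ := exists_between (lt_min hc hab)
    have hx' : x ∈ Ioo a b := ⟨hx.1, hx.2.trans_le (min_le_right _ _)⟩
    filter_upwards [Ioo_mem_nhdsGT (hmaps x hx').1] with y hy
    have hy' : y ∈ Ioo l m := ⟨hy.1, hy.2.trans (hmaps x hx').2⟩
    have := hψmono hy' (hmaps x hx') hy.2
    rw [hleft x hx'] at this
    exact this.trans (hx.2.trans_le (min_le_left _ _))
  · have hin : ∀ᶠ y in 𝓝[<] m, ψ y ∈ Iio b := by
      filter_upwards [Ioo_mem_nhdsLT hlm] with y hy using (hψ y hy).1.2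
    refine tendsto_nhdsWithin_iff.2 ⟨?_, hin⟩
    refine tendsto_order.2 ⟨fun c hc => ?_, fun c hc => hin.mono fun y hy => lt_trans hy hc⟩
    obtain ⟨x, hx⟩ := exists_between (max_lt hc hab)
    have hx' : x ∈ Ioo a b := ⟨(le_max_right _ _).trans_lt hx.1, hx.2⟩
    filter_upwards [Ioo_mem_nhdsLT (hmaps x hx').2] with y hy
    have hy' : y ∈ Ioo l m := ⟨(hmaps x hx').1.trans hy.1, hy.2⟩
    have := hψmono (hmaps x hx') hy' hy.1
    rw [hleft x hx'] at this
    exact ((le_max_left _ _).trans_lt hx.1).trans this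

/-- Monotone functions on `[0, 1]` with a common end value converge uniformly to a continuous
function if their level points converge. -/
lemma tendstoUniformlyOn_of_level_points {ι : Type*} {F : Filter ι} {w : ι → ℝ → ℝ} {w₀ : ℝ → ℝ}
    {s : ι → ℝ → ℝ} {s₀ : ℝ → ℝ} {σ : ι → ℝ} {σ₀ : ℝ}
    (hσ : Tendsto σ F (𝓝 σ₀))
    (hmono : ∀ᶠ i in F, MonotoneOn (w i) (Icc 0 1)) (hmono₀ : MonotoneOn w₀ (Icc 0 1))
    (hw0 : ∀ᶠ i in F, w i 0 = σ i) (hw1 : ∀ᶠ i in F, w i 1 = 1)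
    (hw0' : w₀ 0 = σ₀) (hw1' : w₀ 1 = 1)
    (hs : ∀ c ∈ Ioo σ₀ 1, ∀ᶠ i in F, s i c ∈ Icc 0 1 ∧ w i (s i c) = c)
    (hs₀ : ∀ c ∈ Ioo σ₀ 1, s₀ c ∈ Icc 0 1 ∧ w₀ (s₀ c) = c)
    (hlim : ∀ c ∈ Ioo σ₀ 1, Tendsto (fun i => s i c) F (𝓝 (s₀ c))) :
    TendstoUniformlyOn w w₀ F (Icc 0 1) := by
  rw [← tendstoLocallyUniformlyOn_iff_tendstoUniformlyOn_of_compact isCompact_Icc,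
    Metric.tendstoLocallyUniformlyOn_iff]
  intro ε hε x hx
  have hx0 : (0 : ℝ) ∈ Icc (0 : ℝ) 1 := ⟨le_rfl, zero_le_one⟩
  have hx1 : (1 : ℝ) ∈ Icc (0 : ℝ) 1 := ⟨zero_le_one, le_rfl⟩
  -- A level `c` slightly above `w₀ x` is attained by `w₀` strictly to the right of `x`, hence by `w
  -- i` to the right of a fixed `m > x`; monotonicity keeps `w i` below `c` up to `m`. If levels
  -- slightly above `w₀ x` exceed `1`, the common end value gives the bound.
  have hup : ∃ t ∈ 𝓝[Icc 0 1] x, (∀ᶠ i in F, ∀ y ∈ t, w i y < w₀ x + ε / 2) ∧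
      ∀ y ∈ t, w₀ y < w₀ x + ε / 2 := by
    by_cases h : 1 < w₀ x + ε / 2
    · refine ⟨Icc 0 1, self_mem_nhdsWithin, ?_, fun y hy => ?_⟩
      · filter_upwards [hmono, hw1] with i hi hi1 y hy
        exact lt_of_le_of_lt (hi1 ▸ hi hy hx1 hy.2) h
      · exact lt_of_le_of_lt (hw1' ▸ hmono₀ hy hx1 hy.2) h
    · have hlow : σ₀ ≤ w₀ x := hw0' ▸ hmono₀ hx0 hx hx.1
      obtain ⟨c, hc⟩ := exists_between (show w₀ x < w₀ x + ε / 2 by linarith)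
      have hcm : c ∈ Ioo σ₀ 1 := ⟨by linarith [hc.1], by linarith [hc.2]⟩
      have hlt : x < s₀ c := by
        by_contra hcon
        have := hmono₀ (hs₀ c hcm).1 hx (not_lt.1 hcon)
        rw [(hs₀ c hcm).2] at this; linarith [hc.1]
      obtain ⟨m, hm⟩ := exists_between hlt
      refine ⟨Icc 0 1 ∩ Iio m, inter_mem_nhdsWithin _ (Iio_mem_nhds hm.1), ?_, fun y hy => ?_⟩
      · filter_upwards [hmono, hs c hcm, (hlim c hcm).eventually (lt_mem_nhds hm.2)]
          with i hi hsi hmi y hy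
        have := hi hy.1 hsi.1 (le_of_lt (lt_trans hy.2 hmi))
        rw [hsi.2] at this; linarith [hc.2]
      · have := hmono₀ hy.1 (hs₀ c hcm).1 (le_of_lt (lt_trans hy.2 hm.2))
        rw [(hs₀ c hcm).2] at this; linarith [hc.2]
  have hdn : ∃ t ∈ 𝓝[Icc 0 1] x, (∀ᶠ i in F, ∀ y ∈ t, w₀ x - ε / 2 < w i y) ∧
      ∀ y ∈ t, w₀ x - ε / 2 < w₀ y := by
    by_cases h : w₀ x - ε / 2 < σ₀
    · refine ⟨Icc 0 1, self_mem_nhdsWithin, ?_, fun y hy => ?_⟩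
      · filter_upwards [hmono, hw0, hσ.eventually (lt_mem_nhds h)] with i hi hi0 hi1 y hy
        exact lt_of_lt_of_le hi1 (hi0 ▸ hi hx0 hy hy.1)
      · exact lt_of_lt_of_le h (hw0' ▸ hmono₀ hx0 hy hy.1)
    · have hle : w₀ x ≤ 1 := hw1' ▸ hmono₀ hx hx1 hx.2
      obtain ⟨c, hc⟩ := exists_between (show w₀ x - ε / 2 < w₀ x by linarith)
      have hcm : c ∈ Ioo σ₀ 1 := ⟨by linarith [hc.1], by linarith [hc.2]⟩
      have hlt : s₀ c < x := by
        by_contra hcon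
        have := hmono₀ hx (hs₀ c hcm).1 (not_lt.1 hcon)
        rw [(hs₀ c hcm).2] at this; linarith [hc.2]
      obtain ⟨m, hm⟩ := exists_between hlt
      refine ⟨Icc 0 1 ∩ Ioi m, inter_mem_nhdsWithin _ (Ioi_mem_nhds hm.2), ?_, fun y hy => ?_⟩
      · filter_upwards [hmono, hs c hcm, (hlim c hcm).eventually (gt_mem_nhds hm.1)]
          with i hi hsi hmi y hy
        have := hi hsi.1 hy.1 (le_of_lt (lt_trans hmi hy.2))
        rw [hsi.2] at this; linarith [hc.1]
      · have := hmono₀ (hs₀ c hcm).1 hy.1 (le_of_lt (lt_trans hm.1 hy.2))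
        rw [(hs₀ c hcm).2] at this; linarith [hc.1]
  obtain ⟨t1, ht1, h1, h1'⟩ := hup
  obtain ⟨t2, ht2, h2, h2'⟩ := hdn
  refine ⟨t1 ∩ t2, inter_mem ht1 ht2, ?_⟩
  filter_upwards [h1, h2] with i hi1 hi2 y hy
  rw [Real.dist_eq, abs_lt]
  have := hi1 y hy.1; have := hi2 y hy.2; have := h1' y hy.1; have := h2' y hy.2
  constructor <;> linarith

end MEMS
end

noncomputable section
namespace MEMS

/-! ### The equation with the unknown `u = 1 - v` as independent variable -/

/-- Admissible constants; `k = α / β - 1`. -/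
structure Admissible (β k γ : ℝ) : Prop where
  one_le : 1 ≤ β
  k_pos : 0 < k
  γ_pos : 0 < γ
  θ_pos : 0 < γ / β - k

/-- Admissible right-hand sides `h = 1 / f`. -/
structure Nonlinearity (h : ℝ → ℝ) : Prop where
  pos : ∀ u, 0 < u → 0 < h u
  anti : AntitoneOn h (Ioi 0)
  contDiffOn : ContDiffOn ℝ 1 h (Ioi 0)

/-- `ρ = log r` and `Y = log (r ^ α (u') ^ β)` as functions of `u ∈ (σ, e)`, for a solution `u`
of `(r ^ α (u') ^ β)' = r ^ (γ - 1) h u` with `u = σ` at `r = 0`. -/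
structure IsOrbit (β k γ : ℝ) (h : ℝ → ℝ) (σ e : ℝ) (ρ Y : ℝ → ℝ) : Prop where
  deriv_ρ : ∀ u ∈ Ioo σ e, HasDerivAt ρ (Real.exp (k * ρ u - Y u / β)) u
  deriv_Y : ∀ u ∈ Ioo σ e,
    HasDerivAt Y (h u * Real.exp ((γ + k) * ρ u - (1 + 1 / β) * Y u)) u
  tendsto_ρ : Tendsto ρ (𝓝[>] σ) atBot

/-- The speed of `r ^ θ` for a constant right-hand side. -/
def speed (β k γ : ℝ) (h : ℝ → ℝ) (u : ℝ) : ℝ := (γ / β - k) * (γ / h u) ^ (1 / β)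

variable {β k γ : ℝ} {h : ℝ → ℝ} {σ e : ℝ} {ρ Y : ℝ → ℝ}

lemma Admissible.β_pos (hp : Admissible β k γ) : 0 < β := by linarith [hp.one_le]

namespace IsOrbit

lemma mono_right (ho : IsOrbit β k γ h σ e ρ Y) {e' : ℝ} (he : e' ≤ e) :
    IsOrbit β k γ h σ e' ρ Y :=
  ⟨fun u hu => ho.deriv_ρ u ⟨hu.1, hu.2.trans_le he⟩,
    fun u hu => ho.deriv_Y u ⟨hu.1, hu.2.trans_le he⟩, ho.tendsto_ρ⟩

lemma strictMono_ρ (ho : IsOrbit β k γ h σ e ρ Y) : StrictMonoOn ρ (Ioo σ e) :=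
  strictMonoOn_of_hasDerivAt (convex_Ioo _ _) ho.deriv_ρ fun _ _ => Real.exp_pos _

lemma strictMono_Y (ho : IsOrbit β k γ h σ e ρ Y) (hh : Nonlinearity h) (hσ : 0 ≤ σ) :
    StrictMonoOn Y (Ioo σ e) :=
  strictMonoOn_of_hasDerivAt (convex_Ioo _ _) ho.deriv_Y fun u hu =>
    mul_pos (hh.pos u (hσ.trans_lt hu.1)) (Real.exp_pos _)

lemma continuousOn_ρ (ho : IsOrbit β k γ h σ e ρ Y) : ContinuousOn ρ (Ioo σ e) :=
  fun u hu => (ho.deriv_ρ u hu).continuousAt.continuousWithinAt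

lemma continuousOn_Y (ho : IsOrbit β k γ h σ e ρ Y) : ContinuousOn Y (Ioo σ e) :=
  fun u hu => (ho.deriv_Y u hu).continuousAt.continuousWithinAt

/-- If `Y` stayed above some `c`, the derivative `-k exp (-Y / β)` of `r ^ (-k)` would be bounded,
and `r ^ (-k)` could not blow up at the finite point `σ`. This needs `k > 0`, that is `α > β`. -/
lemma tendsto_Y (ho : IsOrbit β k γ h σ e ρ Y) (hp : Admissible β k γ) (hh : Nonlinearity h)
    (hσ : 0 ≤ σ) (hσe : σ < e) : Tendsto Y (𝓝[>] σ) atBot := by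
  rw [tendsto_atBot]
  intro c
  by_contra hcon
  have hge : ∀ u ∈ Ioo σ e, c ≤ Y u := by
    intro u hu
    by_contra hu'
    apply hcon
    filter_upwards [Ioo_mem_nhdsGT hu.1] with w hw
    exact ((ho.strictMono_Y hh hσ ⟨hw.1, hw.2.trans hu.2⟩ hu hw.2).trans (not_le.1 hu')).le
  have hmono : MonotoneOn (fun u => Real.exp (-k * ρ u) + k * Real.exp (-c / β) * u)
      (Ioo σ e) := by
    refine monotoneOn_of_hasDerivAt (convex_Ioo _ _)
      (φ' := fun u => Real.exp (-k * ρ u) * (-k * Real.exp (k * ρ u - Y u / β)) +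
        k * Real.exp (-c / β) * 1) (fun u hu => ?_) fun u hu => ?_
    · exact (((ho.deriv_ρ u hu).const_mul (-k)).exp).add ((hasDerivAt_id u).const_mul _)
    · have e1 : Real.exp (-k * ρ u) * (-k * Real.exp (k * ρ u - Y u / β)) =
          -(k * Real.exp (-Y u / β)) := by
        rw [mul_left_comm, ← Real.exp_add]; ring_nf
      have e2 : Real.exp (-Y u / β) ≤ Real.exp (-c / β) := by
        apply Real.exp_le_exp.2
        exact div_le_div_of_nonneg_right (by linarith [hge u hu]) hp.β_pos.le
      rw [e1]; nlinarith [hp.k_pos]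
  have htop : Tendsto (fun u => Real.exp (-k * ρ u)) (𝓝[>] σ) atTop :=
    Real.tendsto_exp_atTop.comp (ho.tendsto_ρ.const_mul_atBot_of_neg (by linarith [hp.k_pos]))
  obtain ⟨u0, hu0⟩ := exists_between hσe
  obtain ⟨u, hu, hu'⟩ := ((htop.eventually (eventually_gt_atTop
    (Real.exp (-k * ρ u0) + k * Real.exp (-c / β) * u0))).and (Ioo_mem_nhdsGT hu0.1)).exists
  have := hmono ⟨hu'.1, hu'.2.trans hu0.2⟩ hu0 hu'.2.le
  have h3 : 0 ≤ k * Real.exp (-c / β) * u :=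
    mul_nonneg (mul_nonneg hp.k_pos.le (Real.exp_pos _).le) (hσ.trans hu'.1.le)
  dsimp only at this
  linarith

/-- Compares the flux `y` with the flux `c r ^ γ / γ` of a constant right-hand side `c`; the sign of
the derivative is that of `h - c`, which monotonicity of `h` controls. -/
lemma hasDerivAt_exp_Y_sub (ho : IsOrbit β k γ h σ e ρ Y) (c : ℝ) (hγ : γ ≠ 0) {u : ℝ}
    (hu : u ∈ Ioo σ e) :
    HasDerivAt (fun u => Real.exp (Y u) - c * (Real.exp (γ * ρ u) / γ))
      ((h u - c) * Real.exp ((γ + k) * ρ u - Y u / β)) u := by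
  refine (((ho.deriv_Y u hu).exp).sub
    (((((ho.deriv_ρ u hu).const_mul γ).exp).div_const γ).const_mul c)).congr_deriv ?_
  have e1 : Real.exp (Y u) * (h u * Real.exp ((γ + k) * ρ u - (1 + 1 / β) * Y u)) =
      h u * Real.exp ((γ + k) * ρ u - Y u / β) := by
    rw [mul_left_comm, ← Real.exp_add]; ring_nf
  have e2 : Real.exp (γ * ρ u) * (γ * Real.exp (k * ρ u - Y u / β)) / γ =
      Real.exp ((γ + k) * ρ u - Y u / β) := by
    rw [mul_left_comm, ← Real.exp_add]; field_simp; ring_nf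
  rw [e1, e2]; ring

lemma tendsto_exp_Y_sub (ho : IsOrbit β k γ h σ e ρ Y) (hp : Admissible β k γ)
    (hh : Nonlinearity h) (hσ : 0 ≤ σ) (hσe : σ < e) (c : ℝ) :
    Tendsto (fun u => Real.exp (Y u) - c * (Real.exp (γ * ρ u) / γ)) (𝓝[>] σ) (𝓝 0) := by
  have h1 := Real.tendsto_exp_atBot.comp (ho.tendsto_Y hp hh hσ hσe)
  have h2 := Real.tendsto_exp_atBot.comp (ho.tendsto_ρ.const_mul_atBot hp.γ_pos)
  simpa using h1.sub ((h2.div_const γ).const_mul c)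

/-- The flux is the integral of `r ^ (γ - 1) h`, and `h` is smallest at the upper end `u`. -/
lemma le_exp_Y (ho : IsOrbit β k γ h σ e ρ Y) (hp : Admissible β k γ) (hh : Nonlinearity h)
    (hσ : 0 ≤ σ) {u : ℝ} (hu : u ∈ Ioo σ e) :
    h u * (Real.exp (γ * ρ u) / γ) ≤ Real.exp (Y u) := by
  have hmono : MonotoneOn (fun w => Real.exp (Y w) - h u * (Real.exp (γ * ρ w) / γ))
      (Ioc σ u) := by
    refine monotoneOn_of_hasDerivAt (convex_Ioc _ _)
      (fun w hw => ho.hasDerivAt_exp_Y_sub (h u) hp.γ_pos.ne' ⟨hw.1, hw.2.trans_lt hu.2⟩)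
      fun w hw => mul_nonneg ?_ (Real.exp_pos _).le
    exact sub_nonneg.2 (hh.anti (hσ.trans_lt hw.1) (hσ.trans_lt hu.1) hw.2)
  have := le_of_tendsto (ho.tendsto_exp_Y_sub hp hh hσ (hu.1.trans hu.2) (h u)) (b := _) <| by
    filter_upwards [Ioc_mem_nhdsGT hu.1] with w hw
    exact hmono hw ⟨hu.1, le_rfl⟩ hw.2
  linarith

/-- For `σ > 0` the value `h σ` bounds `h` from above along the orbit. For `σ = 0` monotonicity on
`(0, ∞)` gives no such bound. -/
lemma exp_Y_le (ho : IsOrbit β k γ h σ e ρ Y) (hp : Admissible β k γ) (hh : Nonlinearity h)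
    (hσ : 0 < σ) {u : ℝ} (hu : u ∈ Ioo σ e) :
    Real.exp (Y u) ≤ h σ * (Real.exp (γ * ρ u) / γ) := by
  have hmono : AntitoneOn (fun w => Real.exp (Y w) - h σ * (Real.exp (γ * ρ w) / γ))
      (Ioc σ u) := by
    refine antitoneOn_of_hasDerivAt (convex_Ioc _ _)
      (fun w hw => ho.hasDerivAt_exp_Y_sub (h σ) hp.γ_pos.ne' ⟨hw.1, hw.2.trans_lt hu.2⟩)
      fun w hw => mul_nonpos_of_nonpos_of_nonneg ?_ (Real.exp_pos _).le
    exact sub_nonpos.2 (hh.anti hσ (hσ.trans hw.1) hw.1.le)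
  have := ge_of_tendsto (ho.tendsto_exp_Y_sub hp hh hσ.le (hu.1.trans hu.2) (h σ)) (b := _) <| by
    filter_upwards [Ioc_mem_nhdsGT hu.1] with w hw
    exact hmono hw ⟨hu.1, le_rfl⟩ hw.2
  linarith

/-- `B ≤ γ`, where `B = r ^ γ h / y`. -/
lemma B_le (ho : IsOrbit β k γ h σ e ρ Y) (hp : Admissible β k γ) (hh : Nonlinearity h)
    (hσ : 0 ≤ σ) {u : ℝ} (hu : u ∈ Ioo σ e) : h u * Real.exp (γ * ρ u - Y u) ≤ γ := by
  have := ho.le_exp_Y hp hh hσ hu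
  rw [Real.exp_sub, mul_div_assoc', div_le_iff₀ (Real.exp_pos _)]
  rw [mul_div_assoc', div_le_iff₀ hp.γ_pos] at this
  linarith

lemma le_B (ho : IsOrbit β k γ h σ e ρ Y) (hp : Admissible β k γ) (hh : Nonlinearity h)
    (hσ : 0 < σ) {u : ℝ} (hu : u ∈ Ioo σ e) :
    γ ≤ h σ * Real.exp (γ * ρ u - Y u) := by
  have := ho.exp_Y_le hp hh hσ hu
  rw [Real.exp_sub, mul_div_assoc', le_div_iff₀ (Real.exp_pos _)]
  rw [mul_div_assoc', le_div_iff₀ hp.γ_pos] at this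
  linarith

/-- The power `r ^ θ` is the convenient measure of the radius: its slope in `u` depends only on `r ^
γ / y`, which the flux estimates bound in terms of `h`. -/
lemma hasDerivAt_exp_θρ (ho : IsOrbit β k γ h σ e ρ Y) {u : ℝ} (hu : u ∈ Ioo σ e) :
    HasDerivAt (fun u => Real.exp ((γ / β - k) * ρ u))
      ((γ / β - k) * Real.exp (γ * ρ u - Y u) ^ (1 / β)) u := by
  convert ((ho.deriv_ρ u hu).const_mul (γ / β - k)).exp using 1
  rw [mul_left_comm, ← Real.exp_add, ← Real.exp_mul]
  ring_nf

lemma tendsto_exp_θρ (ho : IsOrbit β k γ h σ e ρ Y) (hp : Admissible β k γ) :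
    Tendsto (fun u => Real.exp ((γ / β - k) * ρ u)) (𝓝[>] σ) (𝓝 0) :=
  Real.tendsto_exp_atBot.comp (ho.tendsto_ρ.const_mul_atBot hp.θ_pos)

end IsOrbit

lemma speed_pos (hp : Admissible β k γ) (hh : Nonlinearity h) {u : ℝ} (hu : 0 < u) :
    0 < speed β k γ h u :=
  mul_pos hp.θ_pos (Real.rpow_pos_of_pos (div_pos hp.γ_pos (hh.pos u hu)) _)

lemma speed_mono (hp : Admissible β k γ) (hh : Nonlinearity h) :
    MonotoneOn (speed β k γ h) (Ioi 0) := by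
  intro u hu w hw huw
  refine mul_le_mul_of_nonneg_left ?_ hp.θ_pos.le
  refine Real.rpow_le_rpow (div_pos hp.γ_pos (hh.pos u hu)).le ?_ (by
    have := hp.β_pos; positivity)
  exact div_le_div_of_nonneg_left hp.γ_pos.le (hh.pos w hw) (hh.anti hu hw huw)

lemma Nonlinearity.continuousOn (hh : Nonlinearity h) : ContinuousOn h (Ioi 0) :=
  hh.contDiffOn.continuousOn

lemma continuousOn_speed (hp : Admissible β k γ) (hh : Nonlinearity h) :
    ContinuousOn (speed β k γ h) (Ioi 0) := by
  refine continuousOn_const.mul ?_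
  refine (continuousOn_const.div hh.continuousOn fun u hu => (hh.pos u hu).ne').rpow_const ?_
  intro u hu; exact Or.inl (div_pos hp.γ_pos (hh.pos u hu)).ne'

namespace IsOrbit

/-- By `B_le` the slope of `r ^ θ` is at most the speed at the current point, hence at most that at
the upper end, and `r ^ θ` vanishes at the start. -/
lemma exp_θρ_le (ho : IsOrbit β k γ h σ e ρ Y) (hp : Admissible β k γ) (hh : Nonlinearity h)
    (hσ : 0 ≤ σ) {u : ℝ} (hu : u ∈ Ioo σ e) :
    Real.exp ((γ / β - k) * ρ u) ≤ speed β k γ h u * (u - σ) := by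
  have hu0 : 0 < u := hσ.trans_lt hu.1
  have hmono : AntitoneOn (fun w => Real.exp ((γ / β - k) * ρ w) - speed β k γ h u * (w - σ))
      (Ioc σ u) := by
    refine antitoneOn_of_hasDerivAt (convex_Ioc _ _)
      (fun w hw => (ho.hasDerivAt_exp_θρ ⟨hw.1, hw.2.trans_lt hu.2⟩).sub
        (((hasDerivAt_id w).sub_const σ).const_mul _)) fun w hw => ?_
    have hw0 : 0 < w := hσ.trans_lt hw.1
    have h1 : Real.exp (γ * ρ w - Y w) ≤ γ / h w := by
      rw [le_div_iff₀ (hh.pos w hw0), mul_comm]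
      exact ho.B_le hp hh hσ ⟨hw.1, hw.2.trans_lt hu.2⟩
    have h2 : (γ / β - k) * Real.exp (γ * ρ w - Y w) ^ (1 / β) ≤ speed β k γ h w :=
      mul_le_mul_of_nonneg_left (Real.rpow_le_rpow (Real.exp_pos _).le h1 (by
        have := hp.β_pos; positivity)) hp.θ_pos.le
    have h3 := speed_mono hp hh hw0 hu0 hw.2
    linarith
  have hlim : Tendsto (fun w => Real.exp ((γ / β - k) * ρ w) - speed β k γ h u * (w - σ))
      (𝓝[>] σ) (𝓝 0) := by
    have h2 : Tendsto (fun w : ℝ => speed β k γ h u * (w - σ)) (𝓝[>] σ) (𝓝 0) :=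
      tendsto_nhdsWithin_of_tendsto_nhds (Continuous.tendsto' (by fun_prop) _ _ (by simp))
    simpa using (ho.tendsto_exp_θρ hp).sub h2
  have := ge_of_tendsto hlim (b := _) <| by
    filter_upwards [Ioc_mem_nhdsGT hu.1] with w hw
    exact hmono hw ⟨hu.1, le_rfl⟩ hw.2
  linarith

lemma le_exp_θρ (ho : IsOrbit β k γ h σ e ρ Y) (hp : Admissible β k γ) (hh : Nonlinearity h)
    (hσ : 0 < σ) {u : ℝ} (hu : u ∈ Ioo σ e) :
    speed β k γ h σ * (u - σ) ≤ Real.exp ((γ / β - k) * ρ u) := by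
  have hmono : MonotoneOn (fun w => Real.exp ((γ / β - k) * ρ w) - speed β k γ h σ * (w - σ))
      (Ioc σ u) := by
    refine monotoneOn_of_hasDerivAt (convex_Ioc _ _)
      (fun w hw => (ho.hasDerivAt_exp_θρ ⟨hw.1, hw.2.trans_lt hu.2⟩).sub
        (((hasDerivAt_id w).sub_const σ).const_mul _)) fun w hw => ?_
    have h1 : γ / h σ ≤ Real.exp (γ * ρ w - Y w) := by
      rw [div_le_iff₀ (hh.pos σ hσ), mul_comm]
      exact ho.le_B hp hh hσ ⟨hw.1, hw.2.trans_lt hu.2⟩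
    have h2 : speed β k γ h σ ≤ (γ / β - k) * Real.exp (γ * ρ w - Y w) ^ (1 / β) :=
      mul_le_mul_of_nonneg_left (Real.rpow_le_rpow (div_pos hp.γ_pos (hh.pos σ hσ)).le h1 (by
        have := hp.β_pos; positivity)) hp.θ_pos.le
    linarith
  have hlim : Tendsto (fun w => Real.exp ((γ / β - k) * ρ w) - speed β k γ h σ * (w - σ))
      (𝓝[>] σ) (𝓝 0) := by
    have h2 : Tendsto (fun w : ℝ => speed β k γ h σ * (w - σ)) (𝓝[>] σ) (𝓝 0) :=
      tendsto_nhdsWithin_of_tendsto_nhds (Continuous.tendsto' (by fun_prop) _ _ (by simp))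
    simpa using (ho.tendsto_exp_θρ hp).sub h2
  have := le_of_tendsto hlim (b := _) <| by
    filter_upwards [Ioc_mem_nhdsGT hu.1] with w hw
    exact hmono hw ⟨hu.1, le_rfl⟩ hw.2
  linarith

end IsOrbit

lemma abs_exp_sub_exp_le {x y M : ℝ} (hx : x ≤ M) (hy : y ≤ M) :
    |Real.exp x - Real.exp y| ≤ Real.exp M * |x - y| := by
  obtain ⟨c, hc1, hc2, hc⟩ := exists_exp_sub_exp x y
  have hc0 : 0 < c := lt_of_lt_of_le (lt_min (Real.exp_pos _) (Real.exp_pos _)) hc1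
  rw [hc, abs_mul, abs_of_pos hc0]
  exact mul_le_mul_of_nonneg_right (hc2.trans (max_le (Real.exp_le_exp.2 hx)
    (Real.exp_le_exp.2 hy))) (abs_nonneg _)

/-- Continuous dependence of orbits on their value at `u₁`, uniformly in the starting point. -/
lemma exists_dist_orbit_le (hp : Admissible β k γ) (hh : Nonlinearity h) {u₁ u₂ e C : ℝ}
    (h0 : 0 < u₁) (h2 : u₂ < e) :
    ∃ K : ℝ, ∀ σ σ' ρ Y ρ' Y', 0 ≤ σ → σ < u₁ → 0 ≤ σ' → σ' < u₁ →
      IsOrbit β k γ h σ e ρ Y → IsOrbit β k γ h σ' e ρ' Y' →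
      -C ≤ ρ u₁ → |Y u₁| ≤ C → -C ≤ ρ' u₁ → |Y' u₁| ≤ C →
      ∀ u ∈ Icc u₁ u₂, dist (ρ u, Y u) (ρ' u, Y' u) ≤
        dist (ρ u₁, Y u₁) (ρ' u₁, Y' u₁) * Real.exp (K * (u - u₁)) := by
  have hβ := hp.β_pos
  have hk := hp.k_pos
  have hγ := hp.γ_pos
  have hθ := hp.θ_pos
  -- `R` and `Z` bound `ρ` and `Y` on `[u₁, u₂]` from above: `R` by the growth estimate for `r ^ θ`,
  -- `Z` because beyond `u₁` the flux grows at most as for the constant `h u₁`. `M₁` and `M₂` bound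
  -- the exponents of the vector field on the resulting box, so its Lipschitz constant `K` does not
  -- depend on the starting points.
  set R := Real.log (speed β k γ h u₂ * u₂) / (γ / β - k) with hR
  set Z := Real.log (Real.exp C + h u₁ * (Real.exp (γ * R) / γ)) with hZ
  set M₁ := k * R + C / β with hM₁
  set M₂ := (γ + k) * R + (1 + 1 / β) * C with hM₂
  have hh1 := hh.pos u₁ h0
  set K := Real.exp M₁ * (k + 1 / β) + h u₁ * (Real.exp M₂ * (γ + k + (1 + 1 / β))) with hK
  have hK0 : 0 ≤ K := by positivity
  refine ⟨K, ?_⟩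
  intro σ σ' ρ Y ρ' Y' hσ hσ1 hσ' hσ1' ho ho' hρ hY hρ' hY'
  by_cases h12 : u₁ ≤ u₂
  swap
  · intro u hu; exact absurd (hu.1.trans hu.2) h12
  have hbox : ∀ σ ρ Y, 0 ≤ σ → σ < u₁ → IsOrbit β k γ h σ e ρ Y → -C ≤ ρ u₁ → |Y u₁| ≤ C →
      ∀ u ∈ Icc u₁ u₂, (-C ≤ ρ u ∧ ρ u ≤ R) ∧ (-C ≤ Y u ∧ Y u ≤ Z) := by
    intro σ ρ Y hσ hσ1 ho hρ hY u hu
    have hum : u ∈ Ioo σ e := ⟨hσ1.trans_le hu.1, hu.2.trans_lt h2⟩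
    have hu1m : u₁ ∈ Ioo σ e := ⟨hσ1, h12.trans_lt h2⟩
    have hu0 : 0 < u := h0.trans_le hu.1
    have hρR : ρ u ≤ R := by
      rw [hR, le_div_iff₀ hθ, Real.le_log_iff_exp_le
        (mul_pos (speed_pos hp hh (h0.trans_le h12)) (h0.trans_le h12)), mul_comm]
      refine (ho.exp_θρ_le hp hh hσ hum).trans ?_
      exact mul_le_mul (speed_mono hp hh hu0 (h0.trans_le h12) hu.2) (by linarith [hu.2])
        (by linarith [hum.1]) (speed_pos hp hh (h0.trans_le h12)).le
    refine ⟨⟨hρ.trans (ho.strictMono_ρ.monotoneOn hu1m hum hu.1), hρR⟩,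
      ((abs_le.1 hY).1).trans ((ho.strictMono_Y hh hσ).monotoneOn hu1m hum hu.1), ?_⟩
    have hanti : AntitoneOn (fun w => Real.exp (Y w) - h u₁ * (Real.exp (γ * ρ w) / γ))
        (Icc u₁ u) := by
      refine antitoneOn_of_hasDerivAt (convex_Icc _ _)
        (fun w hw => ho.hasDerivAt_exp_Y_sub (h u₁) hγ.ne'
          ⟨hσ1.trans_le hw.1, hw.2.trans_lt hum.2⟩)
        fun w hw => mul_nonpos_of_nonpos_of_nonneg ?_ (Real.exp_pos _).le
      exact sub_nonpos.2 (hh.anti h0 (h0.trans_le hw.1) hw.1)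
    have h3 := hanti ⟨le_rfl, hu.1⟩ ⟨hu.1, le_rfl⟩ hu.1
    dsimp only at h3
    have h4 : Real.exp (γ * ρ u) ≤ Real.exp (γ * R) :=
      Real.exp_le_exp.2 (mul_le_mul_of_nonneg_left hρR hγ.le)
    have h5 : h u₁ * (Real.exp (γ * ρ u) / γ) ≤ h u₁ * (Real.exp (γ * R) / γ) :=
      mul_le_mul_of_nonneg_left (div_le_div_of_nonneg_right h4 hγ.le) hh1.le
    have h6 : Real.exp (Y u₁) ≤ Real.exp C := Real.exp_le_exp.2 (abs_le.1 hY).2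
    have h7 : 0 < h u₁ * (Real.exp (γ * ρ u₁) / γ) := by positivity
    rw [hZ, Real.le_log_iff_exp_le (by positivity)]
    linarith
  have hlip : ∀ t ∈ Ico u₁ u₂, LipschitzOnWith K.toNNReal
      (fun p : ℝ × ℝ => (Real.exp (k * p.1 - p.2 / β),
        h t * Real.exp ((γ + k) * p.1 - (1 + 1 / β) * p.2)))
      {p | (-C ≤ p.1 ∧ p.1 ≤ R) ∧ (-C ≤ p.2 ∧ p.2 ≤ Z)} := by
    intro t ht
    refine LipschitzOnWith.of_dist_le_mul fun p hp q hq => ?_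
    rw [Real.coe_toNNReal K hK0]
    have hd1 : |p.1 - q.1| ≤ dist p q := by rw [← Real.dist_eq]; exact le_max_left _ _
    have hd2 : |p.2 - q.2| ≤ dist p q := by rw [← Real.dist_eq]; exact le_max_right _ _
    have hd0 : 0 ≤ dist p q := dist_nonneg
    have hb : ∀ p : ℝ × ℝ, (-C ≤ p.1 ∧ p.1 ≤ R) ∧ (-C ≤ p.2 ∧ p.2 ≤ Z) →
        k * p.1 - p.2 / β ≤ M₁ ∧ (γ + k) * p.1 - (1 + 1 / β) * p.2 ≤ M₂ := by
      intro p hp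
      have h1 : k * p.1 ≤ k * R := mul_le_mul_of_nonneg_left hp.1.2 hk.le
      have h2 : -C / β ≤ p.2 / β := div_le_div_of_nonneg_right hp.2.1 hβ.le
      have h3 : (γ + k) * p.1 ≤ (γ + k) * R := mul_le_mul_of_nonneg_left hp.1.2 (by linarith)
      have h4 : (1 + 1 / β) * (-C) ≤ (1 + 1 / β) * p.2 :=
        mul_le_mul_of_nonneg_left hp.2.1 (by positivity)
      constructor
      · rw [hM₁]; rw [neg_div] at h2; linarith
      · rw [hM₂]; linarith
    have hlin : ∀ a b : ℝ, 0 ≤ a → 0 ≤ b →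
        |(a * p.1 - b * p.2) - (a * q.1 - b * q.2)| ≤ (a + b) * dist p q := by
      intro a b ha hb
      have : (a * p.1 - b * p.2) - (a * q.1 - b * q.2) =
          a * (p.1 - q.1) - b * (p.2 - q.2) := by ring
      rw [this]
      refine (abs_sub _ _).trans ?_
      rw [abs_mul, abs_mul, abs_of_nonneg ha, abs_of_nonneg hb, add_mul]
      exact add_le_add (mul_le_mul_of_nonneg_left hd1 ha) (mul_le_mul_of_nonneg_left hd2 hb)
    have e1 : dist (Real.exp (k * p.1 - p.2 / β)) (Real.exp (k * q.1 - q.2 / β)) ≤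
        Real.exp M₁ * (k + 1 / β) * dist p q := by
      rw [Real.dist_eq]
      refine (abs_exp_sub_exp_le (hb p hp).1 (hb q hq).1).trans ?_
      rw [mul_assoc]
      refine mul_le_mul_of_nonneg_left ?_ (Real.exp_pos _).le
      have := hlin k (1 / β) hk.le (by positivity)
      simpa [div_eq_inv_mul] using this
    have e2 : dist (h t * Real.exp ((γ + k) * p.1 - (1 + 1 / β) * p.2))
        (h t * Real.exp ((γ + k) * q.1 - (1 + 1 / β) * q.2)) ≤
        h u₁ * (Real.exp M₂ * (γ + k + (1 + 1 / β))) * dist p q := by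
      have ht0 : 0 < t := h0.trans_le ht.1
      rw [Real.dist_eq, ← mul_sub, abs_mul, abs_of_pos (hh.pos t ht0), mul_assoc]
      refine mul_le_mul (hh.anti h0 ht0 ht.1) ?_ (abs_nonneg _) hh1.le
      refine (abs_exp_sub_exp_le (hb p hp).2 (hb q hq).2).trans ?_
      rw [mul_assoc]
      exact mul_le_mul_of_nonneg_left (hlin _ _ (by linarith) (by positivity)) (Real.exp_pos _).le
    have p1 : 0 ≤ Real.exp M₁ * (k + 1 / β) * dist p q := by positivity
    have p2 : 0 ≤ h u₁ * (Real.exp M₂ * (γ + k + (1 + 1 / β))) * dist p q := by positivity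
    have e3 : K * dist p q = Real.exp M₁ * (k + 1 / β) * dist p q +
        h u₁ * (Real.exp M₂ * (γ + k + (1 + 1 / β))) * dist p q := by rw [hK]; ring
    exact (Prod.dist_eq).le.trans <| max_le (e1.trans (by linarith)) (e2.trans (by linarith))
  have hcd : ∀ σ ρ Y, σ < u₁ → IsOrbit β k γ h σ e ρ Y →
      ContinuousOn (fun u => (ρ u, Y u)) (Icc u₁ u₂) ∧
      ∀ t ∈ Ico u₁ u₂, HasDerivWithinAt (fun u => (ρ u, Y u))
        (Real.exp (k * ρ t - Y t / β),
          h t * Real.exp ((γ + k) * ρ t - (1 + 1 / β) * Y t)) (Ici t) t := by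
    intro σ ρ Y hσ1 ho
    have hsub : Icc u₁ u₂ ⊆ Ioo σ e := fun u hu => ⟨hσ1.trans_le hu.1, hu.2.trans_lt h2⟩
    refine ⟨(ho.continuousOn_ρ.mono hsub).prodMk (ho.continuousOn_Y.mono hsub), fun t ht => ?_⟩
    exact ((ho.deriv_ρ t (hsub (Ico_subset_Icc_self ht))).prodMk
      (ho.deriv_Y t (hsub (Ico_subset_Icc_self ht)))).hasDerivWithinAt
  have := dist_le_of_trajectories_ODE_of_mem (v := fun t (p : ℝ × ℝ) =>
      (Real.exp (k * p.1 - p.2 / β), h t * Real.exp ((γ + k) * p.1 - (1 + 1 / β) * p.2)))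
    (s := fun _ => {p | (-C ≤ p.1 ∧ p.1 ≤ R) ∧ (-C ≤ p.2 ∧ p.2 ≤ Z)})
    (K := K.toNNReal) hlip (hcd σ ρ Y hσ1 ho).1 (hcd σ ρ Y hσ1 ho).2
    (fun t ht => hbox σ ρ Y hσ hσ1 ho hρ hY t (Ico_subset_Icc_self ht))
    (hcd σ' ρ' Y' hσ1' ho').1 (hcd σ' ρ' Y' hσ1' ho').2
    (fun t ht => hbox σ' ρ' Y' hσ' hσ1' ho' hρ' hY' t (Ico_subset_Icc_self ht)) le_rfl
  rwa [Real.coe_toNNReal K hK0] at this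

end MEMS
end

noncomputable section
namespace MEMS

/-! ### Attraction in an asymptotically autonomous Lotka–Volterra system -/

/-- At the first point where `f` reaches `M` the bound `M` holds on all earlier points, so the
implication gives `f ≤ M' < M` there, a contradiction. -/
lemma le_of_bootstrap {f : ℝ → ℝ} {a b M M' : ℝ} (hf : ContinuousOn f (Icc a b)) (hM : M' < M)
    (h : ∀ u ∈ Icc a b, (∀ w ∈ Icc a u, f w ≤ M) → f u ≤ M') (ha : f a ≤ M) :
    ∀ u ∈ Icc a b, f u ≤ M' := by
  by_cases hS : ∃ u ∈ Icc a b, M ≤ f u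
  swap
  · push Not at hS
    exact fun u hu => h u hu fun w hw => (hS w ⟨hw.1, hw.2.trans hu.2⟩).le
  exfalso
  have hcl : IsCompact (Icc a b ∩ f ⁻¹' Ici M) :=
    isCompact_Icc.of_isClosed_subset (hf.preimage_isClosed_of_isClosed isClosed_Icc isClosed_Ici)
      inter_subset_left
  obtain ⟨u, hu, hleast⟩ := hcl.exists_isLeast (by obtain ⟨u, hu, hu'⟩ := hS; exact ⟨u, hu, hu'⟩)
  have hlt : ∀ w ∈ Icc a u, w ≠ u → f w < M := by
    intro w hw hwu
    by_contra hcon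
    exact hwu (le_antisymm hw.2 (hleast ⟨⟨hw.1, hw.2.trans hu.1.2⟩, not_lt.1 hcon⟩))
  have hfu : f u ≤ M := by
    obtain ⟨w, hw, hwM⟩ := intermediate_value_Icc hu.1.1
      (hf.mono (Icc_subset_Icc_right hu.1.2)) ⟨ha, hu.2⟩
    have : w = u := by
      by_contra hwu; exact (hlt w hw hwu).ne hwM
    rw [← this, hwM]
  have := h u hu.1 fun w hw => by
    by_cases hwu : w = u
    · rw [hwu]; exact hfu
    · exact (hlt w hw hwu).le
  have h3 : M ≤ f u := hu.2
  linarith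

/-- The building block of the Lotka–Volterra Lyapunov function. -/
def entropy (s : ℝ) : ℝ := s - 1 - Real.log s

lemma entropy_nonneg {s : ℝ} (hs : 0 < s) : 0 ≤ entropy s := by
  have := Real.log_le_sub_one_of_pos hs
  unfold entropy; linarith

lemma entropy_le {s : ℝ} (hs : 0 < s) : entropy s ≤ (s - 1) ^ 2 / s := by
  have := Real.one_sub_inv_le_log_of_pos hs
  have h2 : (s - 1) ^ 2 / s = s - 2 + s⁻¹ := by field_simp; ring
  rw [h2]; unfold entropy; linarith

lemma hasDerivAt_entropy {s : ℝ} (hs : s ≠ 0) : HasDerivAt entropy (1 - s⁻¹) s :=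
  ((hasDerivAt_id s).sub_const 1).sub (Real.hasDerivAt_log hs)

/-- The difference of the two sides has derivative `(s - 1) (1 / s - 1 / T)`, so on `(0, T]` it is
least at `s = 1`, where both sides vanish. -/
lemma le_entropy {s T : ℝ} (hs : 0 < s) (hT : 1 ≤ T) (hsT : s ≤ T) :
    (s - 1) ^ 2 / (2 * T) ≤ entropy s := by
  have hd : ∀ x ∈ Ioc 0 T, HasDerivAt (fun x => entropy x - (x - 1) ^ 2 / (2 * T))
      ((x - 1) * (x⁻¹ - T⁻¹)) x := by
    intro x hx
    refine ((hasDerivAt_entropy hx.1.ne').sub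
      ((((hasDerivAt_id x).sub_const 1).pow 2).div_const (2 * T))).congr_deriv ?_
    have := hx.1.ne'
    have hT0 : T ≠ 0 := by linarith
    simp; field_simp
  have hinv : ∀ x ∈ Ioc 0 T, 0 ≤ x⁻¹ - T⁻¹ := fun x hx =>
    sub_nonneg.2 (inv_anti₀ hx.1 hx.2)
  have h1 : entropy 1 - (1 - 1) ^ 2 / (2 * T) = 0 := by simp [entropy]
  have key : entropy 1 - (1 - 1) ^ 2 / (2 * T) ≤ entropy s - (s - 1) ^ 2 / (2 * T) := by
    rcases le_total s 1 with h | h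
    · refine antitoneOn_of_hasDerivAt (s := Ioc 0 1) (convex_Ioc _ _)
        (fun x hx => hd x ⟨hx.1, hx.2.trans hT⟩) (fun x hx => ?_) ⟨hs, h⟩ ⟨one_pos, le_rfl⟩ h
      exact mul_nonpos_of_nonpos_of_nonneg (by linarith [hx.2]) (hinv x ⟨hx.1, hx.2.trans hT⟩)
    · refine monotoneOn_of_hasDerivAt (s := Icc 1 T) (convex_Icc _ _)
        (fun x hx => hd x ⟨one_pos.trans_le hx.1, hx.2⟩) (fun x hx => ?_) ⟨le_rfl, hT⟩ ⟨h, hsT⟩ h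
      exact mul_nonneg (by linarith [hx.1]) (hinv x ⟨one_pos.trans_le hx.1, hx.2⟩)
  rw [h1] at key; linarith

/-- The entropy is large both near `0`, through the logarithm, and near infinity, since `log s ≤ s /
2`. Its sublevel sets are therefore compact in `(0, ∞)`. -/
lemma bounds_of_entropy_le {s c : ℝ} (hs : 0 < s) (h : entropy s ≤ c) :
    Real.exp (-c - 1) ≤ s ∧ s ≤ 2 * (c + 1) := by
  have h2 : Real.log (s / 2) ≤ s / 2 - 1 := Real.log_le_sub_one_of_pos (by positivity)
  rw [Real.log_div hs.ne' two_ne_zero] at h2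
  have h3 : Real.log 2 ≤ 1 := by
    have := Real.log_le_sub_one_of_pos (show (0 : ℝ) < 2 by norm_num); linarith
  unfold entropy at h
  refine ⟨?_, by linarith⟩
  rw [← Real.le_log_iff_exp_le hs]; linarith

/-- `A' = ω (-k + B / β - D A)` and `B' = ω B (γ - β A - B) / A` on `s`, where `A` and `B` are
positive and `L' = ω > 0`. -/
structure IsLotkaVolterra (β k γ : ℝ) (D L ω A B : ℝ → ℝ) (s : Set ℝ) : Prop where
  deriv_L : ∀ u ∈ s, HasDerivAt L (ω u) u
  ω_pos : ∀ u ∈ s, 0 < ω u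
  A_pos : ∀ u ∈ s, 0 < A u
  B_pos : ∀ u ∈ s, 0 < B u
  deriv_A : ∀ u ∈ s, HasDerivAt A (ω u * (-k + B u / β - D u * A u)) u
  deriv_B : ∀ u ∈ s, HasDerivAt B (ω u * (B u * (γ - β * A u - B u) / A u)) u

lemma IsLotkaVolterra.mono {β k γ : ℝ} {D L ω A B : ℝ → ℝ} {s t : Set ℝ}
    (h : IsLotkaVolterra β k γ D L ω A B s) (hts : t ⊆ s) :
    IsLotkaVolterra β k γ D L ω A B t :=
  ⟨fun u hu => h.deriv_L u (hts hu), fun u hu => h.ω_pos u (hts hu),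
    fun u hu => h.A_pos u (hts hu), fun u hu => h.B_pos u (hts hu),
    fun u hu => h.deriv_A u (hts hu), fun u hu => h.deriv_B u (hts hu)⟩

/-- The coordinates of the equilibrium for `D = δ`. -/
def Aeq (β k γ δ : ℝ) : ℝ := (γ / β - k) / (1 + δ)

def Beq (β k γ δ : ℝ) : ℝ := γ - β * Aeq β k γ δ

variable {β k γ δ : ℝ}

lemma Aeq_pos (hp : Admissible β k γ) (hδ : 0 ≤ δ) : 0 < Aeq β k γ δ :=
  div_pos hp.θ_pos (by linarith)

lemma Beq_pos (hp : Admissible β k γ) (hδ : 0 ≤ δ) : 0 < Beq β k γ δ := by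
  have h1 : Aeq β k γ δ ≤ γ / β - k := div_le_self hp.θ_pos.le (by linarith)
  have h2 : β * Aeq β k γ δ ≤ γ - β * k := by
    calc _ ≤ β * (γ / β - k) := mul_le_mul_of_nonneg_left h1 hp.β_pos.le
      _ = γ - β * k := by rw [mul_sub, mul_div_cancel₀ _ hp.β_pos.ne']
  have := mul_pos hp.β_pos hp.k_pos
  unfold Beq; linarith

/-- The vanishing of `A'` at the equilibrium; that of `B'` is the definition of `Beq`. -/
lemma Beq_div (hp : Admissible β k γ) (hδ : 0 ≤ δ) :
    Beq β k γ δ / β = k + δ * Aeq β k γ δ := by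
  have h1 : Aeq β k γ δ * (1 + δ) = γ / β - k := by
    unfold Aeq; rw [div_mul_cancel₀]; linarith
  unfold Beq
  rw [sub_div, mul_div_cancel_left₀ _ hp.β_pos.ne']; linarith

/-- The strict Lyapunov function. -/
def lyapunov (β k γ δ ε a b : ℝ) : ℝ :=
  β * Aeq β k γ δ * entropy (a / Aeq β k γ δ) + Beq β k γ δ / β * entropy (b / Beq β k γ δ) +
    ε * ((a - Aeq β k γ δ) * (b - Beq β k γ δ))

/-- The weights of the two entropies are such that the products of the deviations of `A` and `B`
cancel. The remaining damping is lost in the direction of `A` when `δ = 0`; the cross term with `ε`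
restores it through `-ε β (A - Aeq) ^ 2 B / A`. Terms with `D - δ` are the non-autonomous error. -/
lemma hasDerivAt_lyapunov (hp : Admissible β k γ) (hδ : 0 ≤ δ) {D L ω A B : ℝ → ℝ} {s : Set ℝ}
    (h : IsLotkaVolterra β k γ D L ω A B s) (ε : ℝ) {u : ℝ} (hu : u ∈ s) :
    HasDerivAt (fun u => lyapunov β k γ δ ε (A u) (B u))
      (ω u * (-(β * δ * (A u - Aeq β k γ δ) ^ 2 + (B u - Beq β k γ δ) ^ 2 / β) / A u -
        β * (A u - Aeq β k γ δ) * (D u - δ) +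
        ε * ((B u - Beq β k γ δ) * ((B u - Beq β k γ δ) / β - δ * (A u - Aeq β k γ δ) -
            (D u - δ) * A u) +
          (A u - Aeq β k γ δ) * (B u * (-β * (A u - Aeq β k γ δ) - (B u - Beq β k γ δ)) / A u))))
      u := by
  have hA := h.A_pos u hu
  have hB := h.B_pos u hu
  have hAe := Aeq_pos hp hδ
  have hBe := Beq_pos hp hδ
  have hβ := hp.β_pos
  have hrel := Beq_div hp hδ
  have hBdef : Beq β k γ δ = γ - β * Aeq β k γ δ := rfl
  have dA := h.deriv_A u hu
  have dB := h.deriv_B u hu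
  have e1 := (hasDerivAt_entropy (div_pos hA hAe).ne').comp u (dA.div_const (Aeq β k γ δ))
  have e2 := (hasDerivAt_entropy (div_pos hB hBe).ne').comp u (dB.div_const (Beq β k γ δ))
  have e3 := (dA.sub_const (Aeq β k γ δ)).mul (dB.sub_const (Beq β k γ δ))
  refine (((e1.const_mul (β * Aeq β k γ δ)).add (e2.const_mul (Beq β k γ δ / β))).add
    (e3.const_mul ε)).congr_deriv ?_
  have hk : k = Beq β k γ δ / β - δ * Aeq β k γ δ := by linarith
  have hγ : γ = Beq β k γ δ + β * Aeq β k γ δ := by rw [hBdef]; ring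
  generalize Aeq β k γ δ = a at *
  generalize Beq β k γ δ = b at *
  have f1 : -k + B u / β - D u * A u = (B u - b) / β - δ * (A u - a) - (D u - δ) * A u := by
    rw [hk]; field_simp; ring
  have f2 : γ - β * A u - B u = -β * (A u - a) - (B u - b) := by rw [hγ]; ring
  rw [f1, f2]
  field_simp
  ring

/-- The algebra behind the strictness of the Lyapunov function. -/
lemma exists_lyapunov_bound {β δ a₀ a₁ b₀ b₁ X Z m : ℝ} (hβ : 0 < β) (hδ : 0 ≤ δ) (ha₀ : 0 < a₀)
    (ha : a₀ ≤ a₁) (hb₀ : 0 < b₀) (hb : b₀ ≤ b₁) (hX : 0 ≤ X) (hZ : 0 ≤ Z) (hm : 0 < m) :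
    ∃ ε c C, 0 < ε ∧ ε ≤ m ∧ 0 < c ∧ 0 < C ∧ ∀ A B x y d, A ∈ Icc a₀ a₁ → B ∈ Icc b₀ b₁ →
      |x| ≤ X → |y| ≤ Z →
      -(β * δ * x ^ 2 + y ^ 2 / β) / A - β * x * d +
        ε * (y * (y / β - δ * x - d * A) + x * (B * (-β * x - y) / A)) ≤
      -c * (x ^ 2 + y ^ 2) + C * |d| := by
  have ha₁ : 0 < a₁ := ha₀.trans_le ha
  have hb₁ : 0 < b₁ := hb₀.trans_le hb
  set r := b₀ / a₁ with hr
  set q := δ + b₁ / a₀ with hq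
  have hr0 : 0 < r := by positivity
  have hq0 : 0 < q := by positivity
  set κ := 1 / (2 * β * a₁) with hκ
  have hκ0 : 0 < κ := by positivity
  -- The damping in `y` is at least `2 κ y ^ 2`. The cross term produces `y ^ 2` directly and
  -- through completing the square in `-(δ + B / A) x y`; this choice of `ε` lets it use up at most
  -- half of the damping.
  set ε := min m (κ / (1 / β + q ^ 2 / (2 * β * r))) with hε
  have hε0 : 0 < ε := by positivity
  have hε1 : ε * (1 / β + q ^ 2 / (2 * β * r)) ≤ κ := by
    rw [← le_div_iff₀ (by positivity)]; exact min_le_right _ _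
  refine ⟨ε, min κ (ε * (β * r / 2)), β * X + ε * Z * a₁ + 1, hε0, min_le_left _ _,
    by positivity, by positivity, ?_⟩
  intro A B x y d hA hB hx hy
  have hA0 : 0 < A := ha₀.trans_le hA.1
  have hB0 : 0 < B := hb₀.trans_le hB.1
  have t1 : -(β * δ * x ^ 2 + y ^ 2 / β) / A ≤ -(2 * κ) * y ^ 2 := by
    rw [div_le_iff₀ hA0]
    have h1 : 0 ≤ β * δ * x ^ 2 := by positivity
    have h2 : 2 * κ * A ≤ 1 / β := by
      rw [hκ]
      calc 2 * (1 / (2 * β * a₁)) * A ≤ 2 * (1 / (2 * β * a₁)) * a₁ :=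
            mul_le_mul_of_nonneg_left hA.2 (by positivity)
        _ = 1 / β := by field_simp
    have h3 : 2 * κ * A * y ^ 2 ≤ 1 / β * y ^ 2 := mul_le_mul_of_nonneg_right h2 (sq_nonneg y)
    have h4 : y ^ 2 / β = 1 / β * y ^ 2 := by ring
    rw [h4]; linarith
  have t2 : -(β * x * d) ≤ β * X * |d| := by
    have h1 : -(x * d) ≤ X * |d| := by
      calc -(x * d) ≤ |x * d| := neg_le_abs _
        _ = |x| * |d| := abs_mul _ _
        _ ≤ X * |d| := mul_le_mul_of_nonneg_right hx (abs_nonneg _)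
    nlinarith
  have t3 : -(y * d * A) ≤ Z * a₁ * |d| := by
    calc -(y * d * A) ≤ |y * d * A| := neg_le_abs _
      _ = |y| * |d| * A := by rw [abs_mul, abs_mul, abs_of_pos hA0]
      _ ≤ Z * |d| * a₁ := by gcongr; exact hA.2
      _ = Z * a₁ * |d| := by ring
  set g := B / A with hg
  have hg1 : r ≤ g := div_le_div₀ hB0.le hB.1 hA0 hA.2
  have hg2 : g ≤ b₁ / a₀ := div_le_div₀ hb₁.le hB.2 ha₀ hA.1
  have t4 : x * (B * (-β * x - y) / A) = -(β * g * x ^ 2) - g * (x * y) := by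
    rw [hg]; field_simp
  have t5 : -((δ + g) * (x * y)) ≤ β * r / 2 * x ^ 2 + q ^ 2 / (2 * β * r) * y ^ 2 := by
    have hs0 : 0 ≤ δ + g := by positivity
    have hs1 : δ + g ≤ q := by rw [hq]; linarith
    have h1 : (δ + g) ^ 2 ≤ q ^ 2 := by gcongr
    have h2 : 0 ≤ (β * r * x + (δ + g) * y) ^ 2 / (2 * β * r) := by positivity
    have h3 : (β * r * x + (δ + g) * y) ^ 2 / (2 * β * r) =
        β * r / 2 * x ^ 2 + (δ + g) * (x * y) + (δ + g) ^ 2 / (2 * β * r) * y ^ 2 := by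
      field_simp; ring
    have h4 : (δ + g) ^ 2 / (2 * β * r) * y ^ 2 ≤ q ^ 2 / (2 * β * r) * y ^ 2 := by gcongr
    linarith
  have t6 : -(β * g * x ^ 2) ≤ -(β * r * x ^ 2) := by
    have : β * r * x ^ 2 ≤ β * g * x ^ 2 := by gcongr
    linarith
  have t7 : ε * (y * (y / β - δ * x - d * A) + x * (B * (-β * x - y) / A)) ≤
      ε * ((1 / β + q ^ 2 / (2 * β * r)) * y ^ 2 - β * r / 2 * x ^ 2 + Z * a₁ * |d|) := by
    refine mul_le_mul_of_nonneg_left ?_ hε0.le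
    rw [t4]
    have : y * (y / β - δ * x - d * A) = 1 / β * y ^ 2 - δ * (x * y) - y * d * A := by ring
    rw [this]; linarith
  have t8 : ε * (1 / β + q ^ 2 / (2 * β * r)) * y ^ 2 ≤ κ * y ^ 2 :=
    mul_le_mul_of_nonneg_right hε1 (sq_nonneg y)
  have t9 : min κ (ε * (β * r / 2)) * x ^ 2 ≤ ε * (β * r / 2) * x ^ 2 :=
    mul_le_mul_of_nonneg_right (min_le_right _ _) (sq_nonneg x)
  have t10 : min κ (ε * (β * r / 2)) * y ^ 2 ≤ κ * y ^ 2 :=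
    mul_le_mul_of_nonneg_right (min_le_left _ _) (sq_nonneg y)
  have t11 := abs_nonneg d
  linarith

end MEMS
end

/-! ### Uniform attraction to the equilibrium -/

noncomputable section
namespace MEMS

variable {β k γ δ : ℝ}

/-- Both entropy terms are non-negative, so each is bounded by `V₁`, and an entropy bound confines
its argument to a compact part of `(0, ∞)`. There entropy and squared deviation are comparable,
which turns the Lyapunov inequality into exponential decay. -/
lemma lyapunov_region (hp : Admissible β k γ) (hδ : 0 ≤ δ) {V₁ : ℝ} (hV : 0 ≤ V₁) :
    ∃ a₀ a₁ b₀ b₁ m M : ℝ, 0 < a₀ ∧ a₀ ≤ a₁ ∧ 0 < b₀ ∧ b₀ ≤ b₁ ∧ 0 < m ∧ 0 < M ∧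
      ∀ A B, 0 < A → 0 < B → lyapunov β k γ δ 0 A B ≤ V₁ → A ∈ Icc a₀ a₁ ∧ B ∈ Icc b₀ b₁ ∧
        m * ((A - Aeq β k γ δ) ^ 2 + (B - Beq β k γ δ) ^ 2) ≤ lyapunov β k γ δ 0 A B ∧
        lyapunov β k γ δ 0 A B ≤ M * ((A - Aeq β k γ δ) ^ 2 + (B - Beq β k γ δ) ^ 2) := by
  have hAe := Aeq_pos hp hδ
  have hBe := Beq_pos hp hδ
  have hβ := hp.β_pos
  unfold lyapunov
  generalize Aeq β k γ δ = a at *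
  generalize Beq β k γ δ = b at *
  set cA := V₁ / (β * a) with hcA
  set cB := V₁ / (b / β) with hcB
  have hcA0 : 0 ≤ cA := by positivity
  have hcB0 : 0 ≤ cB := by positivity
  have hA1 : 0 < a * Real.exp (-cA - 1) := by positivity
  have hB1 : 0 < b * Real.exp (-cB - 1) := by positivity
  have hle : ∀ c : ℝ, 0 ≤ c → Real.exp (-c - 1) ≤ 2 * (c + 1) := fun c hc => by
    have : Real.exp (-c - 1) ≤ 1 := Real.exp_le_one_iff.2 (by linarith)
    linarith
  refine ⟨a * Real.exp (-cA - 1), a * (2 * (cA + 1)), b * Real.exp (-cB - 1),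
    b * (2 * (cB + 1)), min (β / (2 * a * (2 * (cA + 1)))) (1 / (2 * β * b * (2 * (cB + 1)))),
    β / (a * Real.exp (-cA - 1)) + 1 / (β * (b * Real.exp (-cB - 1))), hA1,
    mul_le_mul_of_nonneg_left (hle cA hcA0) hAe.le, hB1,
    mul_le_mul_of_nonneg_left (hle cB hcB0) hBe.le, by positivity, by positivity, ?_⟩
  intro A B hA hB hV
  have hsA : 0 < A / a := by positivity
  have hsB : 0 < B / b := by positivity
  have nA := entropy_nonneg hsA
  have nB := entropy_nonneg hsB
  have pA : 0 ≤ β * a * entropy (A / a) := by positivity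
  have pB : 0 ≤ b / β * entropy (B / b) := by positivity
  have eA : entropy (A / a) ≤ cA := by
    rw [hcA, le_div_iff₀ (by positivity)]; linarith
  have eB : entropy (B / b) ≤ cB := by
    rw [hcB, le_div_iff₀ (by positivity)]; linarith
  obtain ⟨bA1, bA2⟩ := bounds_of_entropy_le hsA eA
  obtain ⟨bB1, bB2⟩ := bounds_of_entropy_le hsB eB
  have lA := le_entropy hsA (by linarith) bA2
  have lB := le_entropy hsB (by linarith) bB2
  have uA := entropy_le hsA
  have uB := entropy_le hsB
  rw [le_div_iff₀ hAe] at bA1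
  rw [div_le_iff₀ hAe] at bA2
  rw [le_div_iff₀ hBe] at bB1
  rw [div_le_iff₀ hBe] at bB2
  refine ⟨⟨by linarith, by linarith⟩, ⟨by linarith, by linarith⟩, ?_, ?_⟩
  · have h1 : β / (2 * a * (2 * (cA + 1))) * (A - a) ^ 2 ≤ β * a * entropy (A / a) := by
      calc _ = β * a * ((A / a - 1) ^ 2 / (2 * (2 * (cA + 1)))) := by field_simp
        _ ≤ _ := mul_le_mul_of_nonneg_left lA (by positivity)
    have h2 : 1 / (2 * β * b * (2 * (cB + 1))) * (B - b) ^ 2 ≤ b / β * entropy (B / b) := by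
      calc _ = b / β * ((B / b - 1) ^ 2 / (2 * (2 * (cB + 1)))) := by field_simp
        _ ≤ _ := mul_le_mul_of_nonneg_left lB (by positivity)
    have h3 := mul_le_mul_of_nonneg_right (min_le_left (β / (2 * a * (2 * (cA + 1))))
      (1 / (2 * β * b * (2 * (cB + 1))))) (sq_nonneg (A - a))
    have h4 := mul_le_mul_of_nonneg_right (min_le_right (β / (2 * a * (2 * (cA + 1))))
      (1 / (2 * β * b * (2 * (cB + 1))))) (sq_nonneg (B - b))
    linarith
  · have h1 : β * a * entropy (A / a) ≤ β / (a * Real.exp (-cA - 1)) * (A - a) ^ 2 := by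
      calc _ ≤ β * a * ((A / a - 1) ^ 2 / (A / a)) := mul_le_mul_of_nonneg_left uA (by positivity)
        _ = β / A * (A - a) ^ 2 := by field_simp
        _ ≤ _ := by gcongr; linarith
    have h2 : b / β * entropy (B / b) ≤ 1 / (β * (b * Real.exp (-cB - 1))) * (B - b) ^ 2 := by
      calc _ ≤ b / β * ((B / b - 1) ^ 2 / (B / b)) := mul_le_mul_of_nonneg_left uB (by positivity)
        _ = 1 / (β * B) * (B - b) ^ 2 := by field_simp
        _ ≤ _ := by gcongr; linarith
    have p1 : 0 ≤ β / (a * Real.exp (-cA - 1)) * (B - b) ^ 2 := by positivity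
    have p2 : 0 ≤ 1 / (β * (b * Real.exp (-cB - 1))) * (A - a) ^ 2 := by positivity
    linarith

lemma exists_lyapunov_le (hp : Admissible β k γ) (hδ : 0 ≤ δ) {a₀ a₁ b₀ b₁ : ℝ}
    (ha : 0 < a₀) (hb : 0 < b₀) :
    ∃ V₀, 0 ≤ V₀ ∧ ∀ A ∈ Icc a₀ a₁, ∀ B ∈ Icc b₀ b₁, lyapunov β k γ δ 0 A B ≤ V₀ := by
  have hAe := Aeq_pos hp hδ
  have hBe := Beq_pos hp hδ
  have hβ := hp.β_pos
  unfold lyapunov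
  generalize Aeq β k γ δ = a at *
  generalize Beq β k γ δ = b at *
  refine ⟨|β * a * (a₁ / a - Real.log (a₀ / a)) + b / β * (b₁ / b - Real.log (b₀ / b))|,
    abs_nonneg _, fun A hA B hB => le_trans ?_ (le_abs_self _)⟩
  have key : ∀ a a₀ a₁ A : ℝ, 0 < a → 0 < a₀ → A ∈ Icc a₀ a₁ →
      entropy (A / a) ≤ a₁ / a - Real.log (a₀ / a) := by
    intro a a₀ a₁ A ha ha₀ hA
    have h1 : A / a ≤ a₁ / a := div_le_div_of_nonneg_right hA.2 ha.le
    have h2 : Real.log (a₀ / a) ≤ Real.log (A / a) :=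
      Real.log_le_log (by positivity) (div_le_div_of_nonneg_right hA.1 ha.le)
    unfold entropy; linarith
  rw [zero_mul, add_zero]
  exact add_le_add (mul_le_mul_of_nonneg_left (key _ _ _ _ hAe ha hA) (by positivity))
    (mul_le_mul_of_nonneg_left (key _ _ _ _ hBe hb hB) (by positivity))

/-- From a compact set of initial values, solutions get close to the equilibrium within a uniform
time and stay there. -/
theorem exists_attraction_time (hp : Admissible β k γ) (hδ : 0 ≤ δ) {a₀ a₁ b₀ b₁ ε : ℝ}
    (ha : 0 < a₀) (hb : 0 < b₀) (hε : 0 < ε) :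
    ∃ T η : ℝ, 0 < η ∧ ∀ (D L ω A B : ℝ → ℝ) (u₁ u₂ : ℝ),
      IsLotkaVolterra β k γ D L ω A B (Icc u₁ u₂) →
      (∀ u ∈ Icc u₁ u₂, |D u - δ| ≤ η) → A u₁ ∈ Icc a₀ a₁ → B u₁ ∈ Icc b₀ b₁ →
      ∀ u ∈ Icc u₁ u₂, L u₁ + T ≤ L u →
        |A u - Aeq β k γ δ| < ε ∧ |B u - Beq β k γ δ| < ε := by
  obtain ⟨V₀, hV₀, hV₀b⟩ := exists_lyapunov_le (a₁ := a₁) (b₁ := b₁) hp hδ ha hb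
  obtain ⟨c₀, c₁, d₀, d₁, m, M, hc₀, hc, hd₀, hd, hm, hM, hreg⟩ :=
    lyapunov_region hp hδ (show 0 ≤ 3 * V₀ + 1 by linarith)
  have hAe := Aeq_pos hp hδ
  have hBe := Beq_pos hp hδ
  obtain ⟨e, c, C, he, hem, hc3, hC, halg⟩ := exists_lyapunov_bound (X := c₁ + Aeq β k γ δ)
    (Z := d₁ + Beq β k γ δ) hp.β_pos hδ hc₀ hc hd₀ hd (by linarith) (by linarith) hm
  -- Let `V` be the sum of entropies and `W` the function with the cross term. On the level set `V ≤
  -- 3 V₀ + 1` one has `V ≤ 2 W ≤ 3 V ≤ 3 M |deviation| ^ 2`, so the derivative of `W` in the time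
  -- `L` is at most `-r W + C η`.
  set r := 2 * c / (3 * M) with hr
  have hr0 : 0 < r := by positivity
  -- The persistent error `2 C η / r` must be small twice: at most `1 / 2`, so that the level set is
  -- not left, and at most `ε ^ 2 m / 4`, so that the final deviation is below `ε`.
  set η := min 1 (ε ^ 2 * m / 2) * r / (4 * C) with hη
  have hη0 : 0 < η := by positivity
  have hηb : 2 * (C * η / r) ≤ min 1 (ε ^ 2 * m / 2) / 2 := by
    apply le_of_eq; rw [hη]; field_simp; norm_num
  have hη1 : 2 * (C * η / r) ≤ 1 / 2 := hηb.trans (by linarith [min_le_left 1 (ε ^ 2 * m / 2)])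
  have hη2 : 2 * (C * η / r) ≤ ε ^ 2 * m / 4 :=
    hηb.trans (by linarith [min_le_right 1 (ε ^ 2 * m / 2)])
  obtain ⟨T, hT⟩ : ∃ T : ℝ, 3 * V₀ * Real.exp (-r * T) < ε ^ 2 * m / 2 := by
    have : Tendsto (fun T => 3 * V₀ * Real.exp (-r * T)) atTop (𝓝 (3 * V₀ * 0)) :=
      (Real.tendsto_exp_atBot.comp
        (tendsto_id.const_mul_atTop_of_neg (by linarith))).const_mul _
    rw [mul_zero] at this
    exact (this.eventually (gt_mem_nhds (by positivity))).exists
  refine ⟨T, η, hη0, ?_⟩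
  intro D L ω A B u₁ u₂ hLV hD hA₁ hB₁
  have hcmp : ∀ A B, 0 < A → 0 < B → lyapunov β k γ δ 0 A B ≤ 3 * V₀ + 1 →
      lyapunov β k γ δ 0 A B ≤ 2 * lyapunov β k γ δ e A B ∧
      2 * lyapunov β k γ δ e A B ≤ 3 * lyapunov β k γ δ 0 A B := by
    intro A B hA hB hV
    have h1 := (hreg A B hA hB hV).2.2.1
    have h2 : lyapunov β k γ δ e A B = lyapunov β k γ δ 0 A B +
        e * ((A - Aeq β k γ δ) * (B - Beq β k γ δ)) := by unfold lyapunov; ring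
    generalize A - Aeq β k γ δ = x at *
    generalize B - Beq β k γ δ = y at *
    have h3 : e * (x ^ 2 + y ^ 2) ≤ m * (x ^ 2 + y ^ 2) :=
      mul_le_mul_of_nonneg_right hem (by positivity)
    have h4 : 0 ≤ e * (x + y) ^ 2 := by positivity
    have h5 : 0 ≤ e * (x - y) ^ 2 := by positivity
    rw [h2]
    constructor <;> nlinarith
  -- Gronwall in the time `L`: `(W - C η / r) exp (r L)` is antitone as long as the level set has
  -- not been left.
  have hdecay : ∀ u ∈ Icc u₁ u₂,
      (∀ w ∈ Icc u₁ u, lyapunov β k γ δ 0 (A w) (B w) ≤ 3 * V₀ + 1) →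
      lyapunov β k γ δ 0 (A u) (B u) ≤
        2 * (C * η / r) + 3 * V₀ * Real.exp (-r * (L u - L u₁)) := by
    intro u hu hle
    have hanti : AntitoneOn (fun w => (lyapunov β k γ δ e (A w) (B w) - C * η / r) *
        Real.exp (r * L w)) (Icc u₁ u) := by
      refine antitoneOn_of_hasDerivAt (convex_Icc _ _) (fun w hw =>
        ((hasDerivAt_lyapunov hp hδ hLV e (show w ∈ Icc u₁ u₂ from
          ⟨hw.1, hw.2.trans hu.2⟩)).sub_const _).mul
        (((hLV.deriv_L w ⟨hw.1, hw.2.trans hu.2⟩).const_mul r).exp)) fun w hw => ?_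
      have hwm : w ∈ Icc u₁ u₂ := ⟨hw.1, hw.2.trans hu.2⟩
      have hω := hLV.ω_pos w hwm
      have hVw := hle w hw
      have hAw := hLV.A_pos w hwm
      have hBw := hLV.B_pos w hwm
      obtain ⟨r1, r2, -, r4⟩ := hreg _ _ hAw hBw hVw
      have hal := halg (A w) (B w) (A w - Aeq β k γ δ) (B w - Beq β k γ δ) (D w - δ) r1 r2
        (by rw [abs_le]; constructor <;> linarith [r1.1, r1.2])
        (by rw [abs_le]; constructor <;> linarith [r2.1, r2.2])
      have hW := (hcmp _ _ hAw hBw hVw).2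
      have hdd : C * |D w - δ| ≤ C * η := mul_le_mul_of_nonneg_left (hD w hwm) hC.le
      have hrW : r * lyapunov β k γ δ e (A w) (B w) ≤
          c * ((A w - Aeq β k γ δ) ^ 2 + (B w - Beq β k γ δ) ^ 2) := by
        have : lyapunov β k γ δ e (A w) (B w) ≤
            3 / 2 * (M * ((A w - Aeq β k γ δ) ^ 2 + (B w - Beq β k γ δ) ^ 2)) := by linarith
        calc r * lyapunov β k γ δ e (A w) (B w) ≤ r * _ := mul_le_mul_of_nonneg_left this hr0.le
          _ = _ := by rw [hr]; field_simp
      have hfin := hal.trans (show _ ≤ -r * (lyapunov β k γ δ e (A w) (B w) - C * η / r) by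
        have : r * (C * η / r) = C * η := by field_simp
        linarith)
      have hE := Real.exp_pos (r * L w)
      have := mul_le_mul_of_nonneg_left hfin (mul_pos hω hE).le
      generalize -(β * δ * (A w - Aeq β k γ δ) ^ 2 + (B w - Beq β k γ δ) ^ 2 / β) / A w -
        β * (A w - Aeq β k γ δ) * (D w - δ) +
        e * ((B w - Beq β k γ δ) * ((B w - Beq β k γ δ) / β - δ * (A w - Aeq β k γ δ) -
            (D w - δ) * A w) +
          (A w - Aeq β k γ δ) * (B w * (-β * (A w - Aeq β k γ δ) - (B w - Beq β k γ δ)) / A w))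
        = Q at *
      linarith
    have h1 := hanti ⟨le_rfl, hu.1⟩ ⟨hu.1, le_rfl⟩ hu.1
    dsimp only at h1
    have hu1m : u₁ ∈ Icc u₁ u₂ := ⟨le_rfl, hu.1.trans hu.2⟩
    have hW1 := (hcmp _ _ (hLV.A_pos u₁ hu1m) (hLV.B_pos u₁ hu1m) (hle u₁ ⟨le_rfl, hu.1⟩)).2
    have hV1 := hV₀b _ hA₁ _ hB₁
    have hVu := (hcmp _ _ (hLV.A_pos u hu) (hLV.B_pos u hu) (hle u ⟨hu.1, le_rfl⟩)).1
    have hEE : Real.exp (r * L u₁) = Real.exp (-r * (L u - L u₁)) * Real.exp (r * L u) := by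
      rw [← Real.exp_add]; ring_nf
    have h2 : lyapunov β k γ δ e (A u) (B u) - C * η / r ≤
        (lyapunov β k γ δ e (A u₁) (B u₁) - C * η / r) * Real.exp (-r * (L u - L u₁)) := by
      rw [hEE, ← mul_assoc] at h1
      exact le_of_mul_le_mul_right h1 (Real.exp_pos _)
    have h3 : (lyapunov β k γ δ e (A u₁) (B u₁) - C * η / r) * Real.exp (-r * (L u - L u₁)) ≤
        3 / 2 * V₀ * Real.exp (-r * (L u - L u₁)) := by
      refine mul_le_mul_of_nonneg_right ?_ (Real.exp_pos _).le
      have : 0 < C * η / r := by positivity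
      linarith
    linarith
  have hLmono : MonotoneOn L (Icc u₁ u₂) := monotoneOn_of_hasDerivAt (convex_Icc _ _)
    hLV.deriv_L fun u hu => (hLV.ω_pos u hu).le
  -- The bootstrap closes because the decay estimate returns `3 V₀ + 1 / 2`, strictly below the
  -- assumed level `3 V₀ + 1`.
  have hstay : ∀ u ∈ Icc u₁ u₂, lyapunov β k γ δ 0 (A u) (B u) ≤ 3 * V₀ + 1 / 2 := by
    intro u hu
    have hu1m : u₁ ∈ Icc u₁ u₂ := ⟨le_rfl, hu.1.trans hu.2⟩
    refine le_of_bootstrap (M := 3 * V₀ + 1)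
      (f := fun u => lyapunov β k γ δ 0 (A u) (B u)) (fun u hu => ?_) (by linarith)
      (fun u hu hle => ?_) ?_ u hu
    · exact (hasDerivAt_lyapunov hp hδ hLV 0 hu).continuousAt.continuousWithinAt
    · refine (hdecay u hu hle).trans ?_
      have : Real.exp (-r * (L u - L u₁)) ≤ 1 := Real.exp_le_one_iff.2 (by
        have := hLmono ⟨le_rfl, hu.1.trans hu.2⟩ hu hu.1
        have := mul_nonneg hr0.le (sub_nonneg.2 this)
        linarith)
      have := mul_le_mul_of_nonneg_left this (show 0 ≤ 3 * V₀ by linarith)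
      linarith
    · linarith [hV₀b _ hA₁ _ hB₁]
  intro u hu hLu
  have hV := hdecay u hu fun w hw => (hstay w ⟨hw.1, hw.2.trans hu.2⟩).trans (by linarith)
  have hexp : 3 * V₀ * Real.exp (-r * (L u - L u₁)) ≤ 3 * V₀ * Real.exp (-r * T) := by
    refine mul_le_mul_of_nonneg_left (Real.exp_le_exp.2 ?_) (by linarith)
    have := mul_le_mul_of_nonneg_left (show T ≤ L u - L u₁ by linarith) hr0.le
    linarith
  have h1 := (hreg _ _ (hLV.A_pos u hu) (hLV.B_pos u hu)
    ((hstay u hu).trans (by linarith))).2.2.1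
  have h2 : m * ((A u - Aeq β k γ δ) ^ 2 + (B u - Beq β k γ δ) ^ 2) < m * ε ^ 2 := by
    have hp2 : 0 < m * ε ^ 2 := by positivity
    have hp3 : ε ^ 2 * m = m * ε ^ 2 := mul_comm _ _
    rw [hp3] at hη2 hT
    linarith
  have h3 := lt_of_mul_lt_mul_left h2 hm.le
  constructor
  · exact abs_lt_of_sq_lt_sq (by linarith [sq_nonneg (B u - Beq β k γ δ)]) hε.le
  · exact abs_lt_of_sq_lt_sq (by linarith [sq_nonneg (A u - Aeq β k γ δ)]) hε.le

end MEMS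
end

noncomputable section
namespace MEMS

/-! ### The growth of `g` near zero and orbits in Lotka–Volterra coordinates -/

/-- With `g = h ^ (-1 / β)`: `L = log g`, `ω = L' = g' / g` and `D = 1 - g g'' / g' ^ 2`. -/
structure IsGrowth (β δ u₁ : ℝ) (h L ω D : ℝ → ℝ) : Prop where
  deriv_L : ∀ u ∈ Ioo 0 u₁, HasDerivAt L (ω u) u
  ω_pos : ∀ u ∈ Ioo 0 u₁, 0 < ω u
  deriv_ω : ∀ u ∈ Ioo 0 u₁, HasDerivAt ω (-(ω u ^ 2 * D u)) u
  D_nonneg : ∀ u ∈ Ioo 0 u₁, 0 ≤ D u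
  D_le : ∀ u ∈ Ioo 0 u₁, D u ≤ δ + 1
  tendsto_D : Tendsto D (𝓝[>] 0) (𝓝 δ)
  tendsto_L : Tendsto L (𝓝[>] 0) atBot
  h_eq : ∀ u ∈ Ioo 0 u₁, h u = Real.exp (-β * L u)

/-- `r u' g' / g` along an orbit. -/
def Acoord (β k : ℝ) (ω ρ Y : ℝ → ℝ) (u : ℝ) : ℝ := ω u * Real.exp (Y u / β - k * ρ u)

/-- `r ^ γ h / y` along an orbit. -/
def Bcoord (γ : ℝ) (h ρ Y : ℝ → ℝ) (u : ℝ) : ℝ := h u * Real.exp (γ * ρ u - Y u)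

variable {β k γ δ u₁ σ e : ℝ} {h L ω D ρ Y : ℝ → ℝ}

lemma IsGrowth.strictMono_L (hg : IsGrowth β δ u₁ h L ω D) : StrictMonoOn L (Ioo 0 u₁) :=
  strictMonoOn_of_hasDerivAt (convex_Ioo _ _) hg.deriv_L hg.ω_pos

lemma IsGrowth.δ_nonneg (hg : IsGrowth β δ u₁ h L ω D) (h0 : 0 < u₁) : 0 ≤ δ := by
  refine ge_of_tendsto hg.tendsto_D ?_
  filter_upwards [Ioo_mem_nhdsGT h0] with u hu using hg.D_nonneg u hu

/-- Along an orbit `ρ' = ω / A` and `Y' = B ω / A`. The system results from the logarithmic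
derivatives of `A` and `B`, with `ω' / ω = -ω D` and `h' / h = -β ω`. -/
lemma IsGrowth.isLotkaVolterra (hg : IsGrowth β δ u₁ h L ω D) (hp : Admissible β k γ)
    (ho : IsOrbit β k γ h σ e ρ Y) (hσ : 0 ≤ σ) (he : u₁ ≤ e) :
    IsLotkaVolterra β k γ D L ω (Acoord β k ω ρ Y) (Bcoord γ h ρ Y) (Ioo σ u₁) := by
  have hs : ∀ u ∈ Ioo σ u₁, u ∈ Ioo 0 u₁ := fun u hu => ⟨hσ.trans_lt hu.1, hu.2⟩
  have hs' : ∀ u ∈ Ioo σ u₁, u ∈ Ioo σ e := fun u hu => ⟨hu.1, hu.2.trans_le he⟩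
  have hh : ∀ u ∈ Ioo σ u₁, 0 < h u := fun u hu => by rw [hg.h_eq u (hs u hu)]; positivity
  have hβ := hp.β_pos
  have hA : ∀ u ∈ Ioo σ u₁, 0 < Acoord β k ω ρ Y u := fun u hu =>
    mul_pos (hg.ω_pos u (hs u hu)) (Real.exp_pos _)
  refine ⟨fun u hu => hg.deriv_L u (hs u hu), fun u hu => hg.ω_pos u (hs u hu), hA,
    fun u hu => mul_pos (hh u hu) (Real.exp_pos _), fun u hu => ?_, fun u hu => ?_⟩
  · have dρ := ho.deriv_ρ u (hs' u hu)
    have dY := ho.deriv_Y u (hs' u hu)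
    refine ((hg.deriv_ω u (hs u hu)).mul
      ((dY.div_const β).sub (dρ.const_mul k)).exp).congr_deriv ?_
    have e1 : Real.exp (Y u / β - k * ρ u) * Real.exp (k * ρ u - Y u / β) = 1 := by
      rw [← Real.exp_add]; simp
    have e2 : Real.exp (Y u / β - k * ρ u) *
        Real.exp ((γ + k) * ρ u - (1 + 1 / β) * Y u) = Real.exp (γ * ρ u - Y u) := by
      rw [← Real.exp_add]; ring_nf
    simp only [Acoord, Bcoord]
    rw [← e2]
    linear_combination (-(ω u * k)) * e1
  · have dρ := ho.deriv_ρ u (hs' u hu)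
    have dY := ho.deriv_Y u (hs' u hu)
    have dh : HasDerivAt h (Real.exp (-β * L u) * (-β * ω u)) u := by
      refine (((hg.deriv_L u (hs u hu)).const_mul (-β)).exp).congr_of_eventuallyEq ?_
      filter_upwards [Ioo_mem_nhds (hs u hu).1 (hs u hu).2] with w hw using hg.h_eq w hw
    refine (dh.mul ((dρ.const_mul γ).sub dY).exp).congr_deriv ?_
    rw [← hg.h_eq u (hs u hu)]
    have hω := hg.ω_pos u (hs u hu)
    have e1 : Real.exp (k * ρ u - Y u / β) = (Real.exp (Y u / β - k * ρ u))⁻¹ := by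
      rw [← Real.exp_neg]; ring_nf
    have e2 : Real.exp ((γ + k) * ρ u - (1 + 1 / β) * Y u) =
        Real.exp (γ * ρ u - Y u) * (Real.exp (Y u / β - k * ρ u))⁻¹ := by
      rw [← Real.exp_neg, ← Real.exp_add]; ring_nf
    simp only [Acoord, Bcoord, Pi.sub_apply]
    rw [e1, e2]
    have hE := Real.exp_pos (Y u / β - k * ρ u)
    field_simp
    ring

lemma IsGrowth.eventually_lt (hg : IsGrowth β δ u₁ h L ω D) {w : ℝ} (hw : 0 < w) (c : ℝ) :
    ∃ u ∈ Ioo 0 w, L u < c := by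
  obtain ⟨u, hu, hu'⟩ := ((hg.tendsto_L.eventually (eventually_lt_atBot c)).and
    (Ioo_mem_nhdsGT hw)).exists
  exact ⟨u, hu', hu⟩

/-- Regular orbits pass through a fixed compact set of the Lotka–Volterra plane. -/
lemma IsGrowth.exists_entry_regular (hg : IsGrowth β δ u₁ h L ω D) (hp : Admissible β k γ)
    (hh : Nonlinearity h) (h0 : 0 < u₁) :
    ∃ T a₀ a₁ b₀ b₁ : ℝ, 0 < T ∧ 0 < a₀ ∧ 0 < b₀ ∧ ∀ σ e ρ Y, 0 < σ → u₁ ≤ e →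
      IsOrbit β k γ h σ e ρ Y → ∀ u ∈ Ioo σ u₁, L u = L σ + T →
      Acoord β k ω ρ Y u ∈ Icc a₀ a₁ ∧ Bcoord γ h ρ Y u ∈ Icc b₀ b₁ := by
  have hδ := hg.δ_nonneg h0
  have hβ := hp.β_pos
  have hγ := hp.γ_pos
  have hθ := hp.θ_pos
  set θ := γ / β - k with hθd
  -- With respect to `L` the slope of `A` equals `θ` when `A = 0` and `B = γ`. Up to time `T` one
  -- has `A ≤ θ T` and `B ≥ γ (1 - β T)`, which costs at most half of that slope.
  set T := θ / (2 * (γ + (δ + 1) * θ)) with hT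
  have hT0 : 0 < T := by positivity
  have hTe : (γ + (δ + 1) * θ) * T = θ / 2 := by rw [hT]; field_simp
  refine ⟨T, θ / 2 * T, θ * T, γ * Real.exp (-β * T), γ, hT0, by positivity, by positivity, ?_⟩
  intro σ e ρ Y hσ he ho u hu hLu
  have hσ1 : σ < u₁ := hu.1.trans hu.2
  have hσm : σ ∈ Ioo 0 u₁ := ⟨hσ, hσ1⟩
  have hLV := hg.isLotkaVolterra hp ho hσ.le he
  have hs' : ∀ u ∈ Ioo σ u₁, u ∈ Ioo σ e := fun u hu => ⟨hu.1, hu.2.trans_le he⟩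
  have hs : ∀ u ∈ Ioo σ u₁, u ∈ Ioo 0 u₁ := fun u hu => ⟨hσ.trans hu.1, hu.2⟩
  have hBle : ∀ w ∈ Ioo σ u₁, Bcoord γ h ρ Y w ≤ γ := fun w hw =>
    ho.B_le hp hh hσ.le (hs' w hw)
  have hBge : ∀ w ∈ Ioo σ u₁, γ * Real.exp (-β * (L w - L σ)) ≤ Bcoord γ h ρ Y w := by
    intro w hw
    have h1 := ho.le_B hp hh hσ (hs' w hw)
    have h2 : h w = h σ * Real.exp (-β * (L w - L σ)) := by
      rw [hg.h_eq w (hs w hw), hg.h_eq σ hσm, ← Real.exp_add]; ring_nf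
    unfold Bcoord
    rw [h2]
    nlinarith [Real.exp_pos (-β * (L w - L σ))]
  have hωc : ContinuousAt ω σ := (hg.deriv_ω σ hσm).continuousAt
  have hLc : ContinuousAt L σ := (hg.deriv_L σ hσm).continuousAt
  -- The bound `y ≤ h σ r ^ γ / γ` makes `A` at most a multiple of `ω r ^ θ`, which vanishes at a
  -- regular start.
  have hA0 : Tendsto (Acoord β k ω ρ Y) (𝓝[>] σ) (𝓝 0) := by
    have hup : Tendsto (fun w => ω w * ((h σ / γ) ^ (1 / β) * Real.exp (θ * ρ w))) (𝓝[>] σ)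
        (𝓝 0) := by
      simpa using (hωc.tendsto.mono_left nhdsWithin_le_nhds).mul
        ((ho.tendsto_exp_θρ hp).const_mul ((h σ / γ) ^ (1 / β)))
    refine tendsto_of_tendsto_of_tendsto_of_le_of_le' tendsto_const_nhds hup ?_ ?_
    · filter_upwards [Ioo_mem_nhdsGT hσ1] with w hw using (hLV.A_pos w hw).le
    · filter_upwards [Ioo_mem_nhdsGT hσ1] with w hw
      refine mul_le_mul_of_nonneg_left ?_ (hLV.ω_pos w hw).le
      have h1 := ho.exp_Y_le hp hh hσ (hs' w hw)
      have hhσ := hh.pos σ hσ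
      calc Real.exp (Y w / β - k * ρ w) = Real.exp (Y w) ^ (1 / β) * Real.exp (-k * ρ w) := by
            rw [← Real.exp_mul, ← Real.exp_add]; ring_nf
        _ ≤ (h σ * (Real.exp (γ * ρ w) / γ)) ^ (1 / β) * Real.exp (-k * ρ w) := by gcongr
        _ = (h σ / γ * Real.exp (γ * ρ w)) ^ (1 / β) * Real.exp (-k * ρ w) := by ring_nf
        _ = (h σ / γ) ^ (1 / β) * Real.exp (θ * ρ w) := by
          rw [Real.mul_rpow (by positivity) (by positivity), ← Real.exp_mul, mul_assoc,
            ← Real.exp_add, hθd]; ring_nf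
  have hlim : ∀ c : ℝ, Tendsto (fun w => Acoord β k ω ρ Y w - c * (L w - L σ)) (𝓝[>] σ)
      (𝓝 0) := by
    intro c
    have := hA0.sub (((hLc.tendsto.mono_left nhdsWithin_le_nhds).sub_const (L σ)).const_mul c)
    simpa using this
  have hAle : ∀ w ∈ Ioo σ u₁, Acoord β k ω ρ Y w ≤ θ * (L w - L σ) := by
    intro w hw
    have hanti : AntitoneOn (fun w => Acoord β k ω ρ Y w - θ * (L w - L σ)) (Ioo σ u₁) := by
      refine antitoneOn_of_hasDerivAt (convex_Ioo _ _) (fun w hw => (hLV.deriv_A w hw).sub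
        (((hLV.deriv_L w hw).sub_const _).const_mul θ)) fun w hw => ?_
      have h1 : Bcoord γ h ρ Y w / β ≤ γ / β := div_le_div_of_nonneg_right (hBle w hw) hβ.le
      have h2 := mul_nonneg (hg.D_nonneg w (hs w hw)) (hLV.A_pos w hw).le
      have h3 : -k + Bcoord γ h ρ Y w / β - D w * Acoord β k ω ρ Y w - θ ≤ 0 := by
        rw [hθd]; linarith
      have := mul_nonpos_of_nonneg_of_nonpos (hLV.ω_pos w hw).le h3
      linarith
    have := ge_of_tendsto (hlim θ) (b := _) <| by
      filter_upwards [Ioo_mem_nhdsGT hw.1] with x hx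
      exact hanti ⟨hx.1, hx.2.trans hw.2⟩ hw hx.2.le
    linarith
  have hLmono := hg.strictMono_L.monotoneOn
  have hAge : θ / 2 * (L u - L σ) ≤ Acoord β k ω ρ Y u := by
    have hmono : MonotoneOn (fun w => Acoord β k ω ρ Y w - θ / 2 * (L w - L σ)) (Ioc σ u) := by
      have hsub : ∀ w ∈ Ioc σ u, w ∈ Ioo σ u₁ := fun w hw => ⟨hw.1, hw.2.trans_lt hu.2⟩
      refine monotoneOn_of_hasDerivAt (convex_Ioc _ _) (fun w hw =>
        (hLV.deriv_A w (hsub w hw)).sub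
        (((hLV.deriv_L w (hsub w hw)).sub_const _).const_mul (θ / 2))) fun w hw => ?_
      have hw' := hsub w hw
      have hLw : L w - L σ ≤ T := by linarith [hLmono (hs w hw') (hs u hu) hw.2]
      have hA1 : Acoord β k ω ρ Y w ≤ θ * T :=
        (hAle w hw').trans (mul_le_mul_of_nonneg_left hLw hθ.le)
      have h2 : D w * Acoord β k ω ρ Y w ≤ (δ + 1) * (θ * T) :=
        mul_le_mul (hg.D_le w (hs w hw')) hA1 (hLV.A_pos w hw').le (by linarith)
      have h4 : γ * (1 - β * T) ≤ Bcoord γ h ρ Y w := by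
        refine le_trans (mul_le_mul_of_nonneg_left ?_ hγ.le) (hBge w hw')
        have := Real.add_one_le_exp (-β * (L w - L σ))
        nlinarith
      have h5 : γ / β - γ * T ≤ Bcoord γ h ρ Y w / β := by
        rw [le_div_iff₀ hβ]
        calc _ = γ * (1 - β * T) := by field_simp
          _ ≤ _ := h4
      have h3 : 0 ≤ -k + Bcoord γ h ρ Y w / β - D w * Acoord β k ω ρ Y w - θ / 2 := by
        linarith
      have := mul_nonneg (hLV.ω_pos w hw').le h3
      linarith
    have := le_of_tendsto (hlim (θ / 2)) (b := _) <| by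
      filter_upwards [Ioc_mem_nhdsGT hu.1] with x hx
      exact hmono hx ⟨hu.1, le_rfl⟩ hx.2
    linarith
  have hLs : L u - L σ = T := by linarith
  have h1 := hAle u hu
  have h2 := hBge u hu
  rw [hLs] at hAge h1 h2
  exact ⟨⟨hAge, h1⟩, ⟨h2, hBle u hu⟩⟩

end MEMS
end

/-! ### Orbits with an infinite past: boundedness and return to a compact set -/

noncomputable section
namespace MEMS

/-- Wherever `f` meets the level `c` it is increasing, so it cannot pass below it. -/
lemma barrier_le {f f' : ℝ → ℝ} {a b c : ℝ} (hf : ∀ x ∈ Icc a b, HasDerivAt f (f' x) x)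
    (hc : ∀ x ∈ Icc a b, f x = c → 0 < f' x) (ha : c ≤ f a) : ∀ x ∈ Icc a b, c ≤ f x := by
  intro x hx
  have := image_le_of_deriv_right_lt_deriv_boundary (f := fun x => -f x) (f' := fun x => -f' x)
    (a := a) (b := b) (B := fun _ => -c) (B' := fun _ => 0)
    (fun x hx => (hf x hx).continuousAt.continuousWithinAt.neg)
    (fun x hx => (hf x (Ico_subset_Icc_self hx)).hasDerivWithinAt.neg) (by linarith)
    (fun x => hasDerivAt_const x _)
    (fun x hx h => by
      have := hc x (Ico_subset_Icc_self hx) (by linarith); linarith) hx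
  linarith

variable {β k γ δ u₁ e : ℝ} {h L ω D ρ Y A B : ℝ → ℝ}

/-- Along solutions that exist for all negative times, `A` is bounded. -/
lemma IsLotkaVolterra.A_le (hLV : IsLotkaVolterra β k γ D L ω A B (Ioo 0 u₁))
    (hp : Admissible β k γ) (hL : ∀ w, 0 < w → ∀ c, ∃ u ∈ Ioo 0 w, L u < c)
    (hD : ∀ u ∈ Ioo 0 u₁, 0 ≤ D u) (hB : ∀ u ∈ Ioo 0 u₁, B u ≤ γ) :
    ∀ u ∈ Ioo 0 u₁, A u ≤ 2 * γ / β + 2 / β ^ 2 * γ := by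
  have hβ := hp.β_pos
  have hγ := hp.γ_pos
  have hk := hp.k_pos
  have hBd : ∀ w ∈ Ioo 0 u₁, 2 * γ / β ≤ A w →
      B w * (γ - β * A w - B w) / A w ≤ -(β / 2) * B w := by
    intro w hw hAw
    have hA := hLV.A_pos w hw
    have hBw := hLV.B_pos w hw
    rw [div_le_iff₀ hA]
    rw [div_le_iff₀ hβ] at hAw
    have : γ - β * A w - B w ≤ -(β / 2) * A w := by linarith
    have := mul_le_mul_of_nonneg_left this hBw.le
    linarith
  -- If `A` were at least `2 γ / β` on an initial interval, `B exp (β L / 2)` would be antitone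
  -- there. As `L → -∞` in the past, `B` would be unbounded, against `B ≤ γ`.
  have hex : ∀ w ∈ Ioo 0 u₁, ∃ u ∈ Ioo 0 w, A u < 2 * γ / β := by
    intro w hw
    by_contra! hcon
    have hsub : ∀ x ∈ Ioo 0 w, x ∈ Ioo 0 u₁ := fun x hx => ⟨hx.1, hx.2.trans hw.2⟩
    have hanti : AntitoneOn (fun x => B x * Real.exp (β / 2 * L x)) (Ioo 0 w) := by
      refine antitoneOn_of_hasDerivAt (convex_Ioo _ _) (fun x hx =>
        (hLV.deriv_B x (hsub x hx)).mul (((hLV.deriv_L x (hsub x hx)).const_mul (β / 2)).exp))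
        fun x hx => ?_
      have h1 := hBd x (hsub x hx) (hcon x hx)
      have h2 := mul_nonneg (hLV.ω_pos x (hsub x hx)).le (Real.exp_pos (β / 2 * L x)).le
      have := mul_le_mul_of_nonneg_left h1 h2
      linarith
    have hw2 : w / 2 ∈ Ioo 0 w := ⟨by linarith [hw.1], by linarith [hw.1]⟩
    set c := B (w / 2) * Real.exp (β / 2 * L (w / 2)) with hc
    have hc0 : 0 < c := mul_pos (hLV.B_pos _ (hsub _ hw2)) (Real.exp_pos _)
    obtain ⟨x, hx, hxL⟩ := hL (w / 2) hw2.1 (2 / β * Real.log (c / (2 * γ)))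
    have hx' : x ∈ Ioo 0 w := ⟨hx.1, hx.2.trans hw2.2⟩
    have h1 := hanti hx' hw2 hx.2.le
    have h2 : Real.exp (β / 2 * L x) < c / (2 * γ) := by
      rw [← Real.lt_log_iff_exp_lt (by positivity)]
      calc β / 2 * L x < β / 2 * (2 / β * Real.log (c / (2 * γ))) := by gcongr
        _ = _ := by field_simp
    have h3 : B x * Real.exp (β / 2 * L x) ≤ γ * (c / (2 * γ)) :=
      mul_le_mul (hB x (hsub x hx')) h2.le (Real.exp_pos _).le hγ.le
    have h4 : γ * (c / (2 * γ)) = c / 2 := by field_simp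
    have h5 : c ≤ B x * Real.exp (β / 2 * L x) := h1
    linarith
  intro u hu
  by_contra! hcon
  obtain ⟨w, hw, hwA⟩ := hex u hu
  have hsub : Icc w u ⊆ Ioo 0 u₁ := fun x hx => ⟨hw.1.trans_le hx.1, hx.2.trans_lt hu.2⟩
  have hAc : ContinuousOn A (Icc w u) :=
    fun x hx => (hLV.deriv_A x (hsub hx)).continuousAt.continuousWithinAt
  have hK : 2 * γ / β < A u := lt_of_le_of_lt (by
    have : 0 ≤ 2 / β ^ 2 * γ := by positivity
    linarith) hcon
  have hcl : IsCompact (Icc w u ∩ A ⁻¹' {2 * γ / β}) :=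
    isCompact_Icc.of_isClosed_subset (hAc.preimage_isClosed_of_isClosed isClosed_Icc
      isClosed_singleton) inter_subset_left
  obtain ⟨t, ht, htmax⟩ := hcl.exists_isGreatest (by
    obtain ⟨t, ht, ht'⟩ := intermediate_value_Icc hw.2.le hAc ⟨hwA.le, hK.le⟩
    exact ⟨t, ht, ht'⟩)
  have hge : ∀ x ∈ Icc t u, 2 * γ / β ≤ A x := by
    intro x hx
    by_contra! hx'
    obtain ⟨y, hy, hy'⟩ := intermediate_value_Icc hx.2
      (hAc.mono (Icc_subset_Icc_left (ht.1.1.trans hx.1))) ⟨hx'.le, hK.le⟩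
    have hyt : y ≤ t := htmax ⟨⟨ht.1.1.trans (hx.1.trans hy.1), hy.2⟩, hy'⟩
    have : x = y := le_antisymm hy.1 (hyt.trans hx.1)
    rw [this, hy'] at hx'
    exact lt_irrefl _ hx'
  have hsub' : Icc t u ⊆ Ioo 0 u₁ := (Icc_subset_Icc_left ht.1.1).trans hsub
  -- After its last crossing `t` of the level `2 γ / β`, the production `B / β` of `A` is paid for
  -- by the loss of `B`, so this combination bounds `A u` by its value at `t`.
  have hanti : AntitoneOn (fun x => A x + 2 / β ^ 2 * B x) (Icc t u) := by
    refine antitoneOn_of_hasDerivAt (convex_Icc _ _) (fun x hx =>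
      (hLV.deriv_A x (hsub' hx)).add ((hLV.deriv_B x (hsub' hx)).const_mul _)) fun x hx => ?_
    have hω := hLV.ω_pos x (hsub' hx)
    have h1 := hBd x (hsub' hx) (hge x hx)
    have h2 := mul_nonneg (hD x (hsub' hx)) (hLV.A_pos x (hsub' hx)).le
    have h3 := mul_le_mul_of_nonneg_left h1 (show 0 ≤ 2 / β ^ 2 by positivity)
    have h4 : 2 / β ^ 2 * (-(β / 2) * B x) = -(B x / β) := by field_simp
    have h5 : -k + B x / β - D x * A x +
        2 / β ^ 2 * (B x * (γ - β * A x - B x) / A x) ≤ 0 := by linarith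
    have := mul_nonpos_of_nonneg_of_nonpos hω.le h5
    linarith
  have h1 := hanti ⟨le_rfl, ht.1.2⟩ ⟨ht.1.2, le_rfl⟩ ht.1.2
  have h2 : A t = 2 * γ / β := ht.2
  have h3 : 2 / β ^ 2 * B t ≤ 2 / β ^ 2 * γ :=
    mul_le_mul_of_nonneg_left (hB t (hsub' ⟨le_rfl, ht.1.2⟩)) (by positivity)
  have h4 : 0 < 2 / β ^ 2 * B u := mul_pos (by positivity) (hLV.B_pos u hu)
  dsimp only at h1
  linarith

/-- Solutions that exist for all negative times return to a fixed compact set. -/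
lemma IsLotkaVolterra.exists_entry (hLV : IsLotkaVolterra β k γ D L ω A B (Ioo 0 u₁))
    (hp : Admissible β k γ) (hL : ∀ w, 0 < w → ∀ c, ∃ u ∈ Ioo 0 w, L u < c) {Δ : ℝ}
    (hD : ∀ u ∈ Ioo 0 u₁, 0 ≤ D u) (hΔ : ∀ u ∈ Ioo 0 u₁, D u ≤ Δ) (hΔ0 : 0 ≤ Δ)
    (hB : ∀ u ∈ Ioo 0 u₁, B u ≤ γ) {u₀ : ℝ} (hu₀ : u₀ ∈ Ioo 0 u₁) :
    ∃ u ∈ Ioo 0 u₀, (γ / β - k) / (2 * (2 + Δ)) ≤ A u ∧ β * k / 2 ≤ B u := by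
  have hβ := hp.β_pos
  have hγ := hp.γ_pos
  have hk := hp.k_pos
  have hθ := hp.θ_pos
  have hAle := hLV.A_le hp hL hD hB
  set θ := γ / β - k with hθd
  have hγθ : γ = β * k + β * θ := by rw [hθd]; field_simp; ring
  set a := θ / (2 * (2 + Δ)) with ha
  have ha0 : 0 < a := by positivity
  have haΔ : 2 * a + Δ * a = θ / 2 := by rw [ha]; field_simp
  have haθ : 2 * a ≤ θ / 2 := by nlinarith
  have hβk : 0 < β * k := mul_pos hβ hk
  have hβaθ : 2 * (β * a) ≤ β * θ / 2 := by nlinarith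
  have hβa : 0 < β * a := mul_pos hβ ha0
  -- Otherwise `A < a` wherever `B ≥ β k / 2`. If `B` stayed below `β k / 2` in the past, `A` would
  -- decrease linearly in `L` and be unbounded there. Once `B` has reached this level, `A < a`
  -- prevents it from falling back; so `A < a` and `B ≥ β k / 2` everywhere. Then `B` must already
  -- be near `γ`, for otherwise it would grow at least like `exp (β L)` and vanish in the past. But
  -- then `A` grows at rate at least `θ / 2` and would be negative in the past.
  by_contra! hcon
  have hsub : ∀ x ∈ Ioo 0 u₀, x ∈ Ioo 0 u₁ := fun x hx => ⟨hx.1, hx.2.trans hu₀.2⟩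
  -- At `B = c` one has `A < a`, hence `γ - β A - B > β a > 0` and `B` is increasing: such levels
  -- are barriers.
  have hbar : ∀ c, β * k / 2 ≤ c → c ≤ γ - 2 * (β * a) → ∀ w ∈ Ioo 0 u₀, c ≤ B w →
      ∀ u ∈ Ioo 0 u₀, w ≤ u → c ≤ B u := by
    intro c hc1 hc2 w hw hwB u hu hwu
    have hs : ∀ x ∈ Icc w u, x ∈ Ioo 0 u₀ := fun x hx => ⟨hw.1.trans_le hx.1, hx.2.trans_lt hu.2⟩
    refine barrier_le (fun x hx => hLV.deriv_B x (hsub x (hs x hx))) (fun x hx hxB => ?_) hwB u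
      ⟨hwu, le_rfl⟩
    have hx' := hsub x (hs x hx)
    have hAx : A x < a := by
      by_contra! h
      exact absurd (hcon x (hs x hx) h) (not_lt.2 (by rw [hxB]; exact hc1))
    have := mul_lt_mul_of_pos_left hAx hβ
    refine mul_pos (hLV.ω_pos x hx') (div_pos (mul_pos (hLV.B_pos x hx') ?_) (hLV.A_pos x hx'))
    rw [hxB]; linarith
  have hB1 : ∀ u ∈ Ioo 0 u₀, β * k / 2 ≤ B u := by
    intro u hu
    have hex : ∃ w ∈ Ioo 0 u, β * k / 2 ≤ B w := by
      by_contra! hno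
      have hs : ∀ x ∈ Ioo 0 u, x ∈ Ioo 0 u₁ := fun x hx => ⟨hx.1, hx.2.trans (hsub u hu).2⟩
      have hanti : AntitoneOn (fun x => A x + k / 2 * L x) (Ioo 0 u) := by
        refine antitoneOn_of_hasDerivAt (convex_Ioo _ _) (fun x hx =>
          (hLV.deriv_A x (hs x hx)).add ((hLV.deriv_L x (hs x hx)).const_mul _)) fun x hx => ?_
        have h1 : B x / β ≤ k / 2 := by
          rw [div_le_iff₀ hβ]; linarith [hno x hx]
        have h2 := mul_nonneg (hD x (hs x hx)) (hLV.A_pos x (hs x hx)).le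
        have h5 : -k + B x / β - D x * A x + k / 2 ≤ 0 := by linarith
        have := mul_nonpos_of_nonneg_of_nonpos (hLV.ω_pos x (hs x hx)).le h5
        linarith
      have hw2 : u / 2 ∈ Ioo 0 u := ⟨by linarith [hu.1], by linarith [hu.1]⟩
      obtain ⟨x, hx, hxL⟩ := hL (u / 2) hw2.1
        (2 / k * (A (u / 2) + k / 2 * L (u / 2) - (2 * γ / β + 2 / β ^ 2 * γ)))
      have hx' : x ∈ Ioo 0 u := ⟨hx.1, hx.2.trans hw2.2⟩
      have h1 := hanti hx' hw2 hx.2.le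
      have h2 := hAle x (hs x hx')
      have h3 := mul_lt_mul_of_pos_left hxL (show 0 < k / 2 by positivity)
      have h4 : k / 2 * (2 / k * (A (u / 2) + k / 2 * L (u / 2) -
        (2 * γ / β + 2 / β ^ 2 * γ))) = A (u / 2) + k / 2 * L (u / 2) -
        (2 * γ / β + 2 / β ^ 2 * γ) := by field_simp
      dsimp only at h1
      linarith
    obtain ⟨w, hw, hwB⟩ := hex
    exact hbar _ le_rfl (by linarith) w ⟨hw.1, hw.2.trans hu.2⟩ hwB u hu hw.2.le
  have hA1 : ∀ u ∈ Ioo 0 u₀, A u < a := by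
    intro u hu
    by_contra! h
    exact absurd (hcon u hu h) (not_lt.2 (hB1 u hu))
  have hB2 : ∀ u ∈ Ioo 0 u₀, γ - 2 * (β * a) ≤ B u := by
    intro w hw
    by_contra! hwB
    have hs : ∀ x ∈ Ioc 0 w, x ∈ Ioo 0 u₀ := fun x hx => ⟨hx.1, hx.2.trans_lt hw.2⟩
    have hlt : ∀ x ∈ Ioc 0 w, B x < γ - 2 * (β * a) := by
      intro x hx
      by_contra! hxB
      exact absurd (hbar _ (by linarith) le_rfl x (hs x hx) hxB w hw hx.2) (not_le.2 hwB)
    have hmono : MonotoneOn (fun x => B x * Real.exp (-β * L x)) (Ioc 0 w) := by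
      refine monotoneOn_of_hasDerivAt (convex_Ioc _ _) (fun x hx =>
        (hLV.deriv_B x (hsub x (hs x hx))).mul
          (((hLV.deriv_L x (hsub x (hs x hx))).const_mul (-β)).exp)) fun x hx => ?_
      have hx' := hsub x (hs x hx)
      have hAx := hLV.A_pos x hx'
      have h1 : β * B x ≤ B x * (γ - β * A x - B x) / A x := by
        rw [le_div_iff₀ hAx]
        have e1 : β * A x ≤ β * a := mul_le_mul_of_nonneg_left (hA1 x (hs x hx)).le hβ.le
        have : β * A x ≤ γ - β * A x - B x := by linarith [hlt x hx]
        have := mul_le_mul_of_nonneg_left this (hLV.B_pos x hx').le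
        linarith
      have h2 := mul_nonneg (hLV.ω_pos x hx').le (Real.exp_pos (-β * L x)).le
      have := mul_le_mul_of_nonneg_left h1 h2
      linarith
    set c := B w * Real.exp (-β * L w) with hc
    have hc0 : 0 < c := mul_pos (hLV.B_pos _ (hsub w hw)) (Real.exp_pos _)
    obtain ⟨x, hx, hxL⟩ := hL w hw.1 (-(1 / β * Real.log (c / (β * k / 2))))
    have hx' : x ∈ Ioc 0 w := ⟨hx.1, hx.2.le⟩
    have h1 : B x * Real.exp (-β * L x) ≤ c := hmono hx' ⟨hw.1, le_rfl⟩ hx.2.le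
    have h2 : c / (β * k / 2) < Real.exp (-β * L x) := by
      rw [← Real.log_lt_iff_lt_exp (by positivity)]
      have := mul_lt_mul_of_pos_left hxL hβ
      have e : β * -(1 / β * Real.log (c / (β * k / 2))) = -Real.log (c / (β * k / 2)) := by
        field_simp
      linarith
    have h3 : β * k / 2 * Real.exp (-β * L x) ≤ B x * Real.exp (-β * L x) :=
      mul_le_mul_of_nonneg_right (hB1 x (hs x hx')) (Real.exp_pos _).le
    rw [div_lt_iff₀ (by positivity)] at h2
    linarith
  have hmono : MonotoneOn (fun x => A x - θ / 2 * L x) (Ioo 0 u₀) := by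
    refine monotoneOn_of_hasDerivAt (convex_Ioo _ _) (fun x hx =>
      (hLV.deriv_A x (hsub x hx)).sub ((hLV.deriv_L x (hsub x hx)).const_mul _)) fun x hx => ?_
    have hx' := hsub x hx
    have h1 : θ + k - 2 * a ≤ B x / β := by
      rw [le_div_iff₀ hβ]
      have := hB2 x hx
      linarith
    have h2 : D x * A x ≤ Δ * a := mul_le_mul (hΔ x hx') (hA1 x hx).le (hLV.A_pos x hx').le hΔ0
    have h3 : 0 ≤ -k + B x / β - D x * A x - θ / 2 := by linarith
    have := mul_nonneg (hLV.ω_pos x hx').le h3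
    linarith
  have hw2 : u₀ / 2 ∈ Ioo 0 u₀ := ⟨by linarith [hu₀.1], by linarith [hu₀.1]⟩
  obtain ⟨x, hx, hxL⟩ := hL (u₀ / 2) hw2.1 (2 / θ * -(A (u₀ / 2) - θ / 2 * L (u₀ / 2)))
  have hx' : x ∈ Ioo 0 u₀ := ⟨hx.1, hx.2.trans hw2.2⟩
  have h1 := hmono hx' hw2 hx.2.le
  have h2 := hLV.A_pos x (hsub x hx')
  have h3 := mul_lt_mul_of_pos_left hxL (show 0 < θ / 2 by positivity)
  have h4 : θ / 2 * (2 / θ * -(A (u₀ / 2) - θ / 2 * L (u₀ / 2))) =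
    -(A (u₀ / 2) - θ / 2 * L (u₀ / 2)) := by field_simp
  dsimp only at h1
  linarith

/-- Near zero the orbits stay close to the equilibrium of the Lotka–Volterra system. -/
theorem IsGrowth.exists_near_equilibrium (hg : IsGrowth β δ u₁ h L ω D) (hp : Admissible β k γ)
    (hh : Nonlinearity h) (h0 : 0 < u₁) {ε : ℝ} (hε : 0 < ε) :
    ∃ T u₀ : ℝ, u₀ ∈ Ioo 0 u₁ ∧
      (∀ σ e ρ Y, 0 < σ → u₁ ≤ e → IsOrbit β k γ h σ e ρ Y → ∀ u ∈ Ioo σ u₀, L σ + T ≤ L u →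
        |Acoord β k ω ρ Y u - Aeq β k γ δ| < ε ∧ |Bcoord γ h ρ Y u - Beq β k γ δ| < ε) ∧
      (∀ e ρ Y, u₁ ≤ e → IsOrbit β k γ h 0 e ρ Y → ∀ u ∈ Ioo 0 u₀,
        |Acoord β k ω ρ Y u - Aeq β k γ δ| < ε ∧ |Bcoord γ h ρ Y u - Beq β k γ δ| < ε) := by
  have hδ := hg.δ_nonneg h0
  have hβ := hp.β_pos
  have hγ := hp.γ_pos
  obtain ⟨S, a₀, a₁, b₀, b₁, hS, ha, hb, hreg⟩ := hg.exists_entry_regular hp hh h0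
  obtain ⟨T₁, η₁, hη₁, hatt₁⟩ := exists_attraction_time (a₁ := a₁) (b₁ := b₁) hp hδ ha hb hε
  obtain ⟨T₂, η₂, hη₂, hatt₂⟩ := exists_attraction_time
    (a₁ := 2 * γ / β + 2 / β ^ 2 * γ) (b₁ := γ) hp hδ
    (show 0 < (γ / β - k) / (2 * (2 + (δ + 1))) from div_pos hp.θ_pos (by linarith))
    (show 0 < β * k / 2 from by have := mul_pos hβ hp.k_pos; linarith) hε
  have hDn : ∀ᶠ u in 𝓝[>] 0, |D u - δ| < min η₁ η₂ := by
    have := hg.tendsto_D.eventually (Metric.ball_mem_nhds δ (lt_min hη₁ hη₂))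
    filter_upwards [this] with u hu
    rwa [Real.dist_eq] at hu
  obtain ⟨c, hc, hcD⟩ := mem_nhdsGT_iff_exists_Ioo_subset.1 hDn
  have hc : 0 < c := hc
  set u₀ := min c (u₁ / 2) with hu₀
  have hu₀p : 0 < u₀ := lt_min hc (by linarith)
  have hu₀1 : u₀ < u₁ := (min_le_right _ _).trans_lt (by linarith)
  have hDu : ∀ u ∈ Ioo 0 u₀, |D u - δ| ≤ min η₁ η₂ := fun u hu =>
    (hcD ⟨hu.1, hu.2.trans_le (min_le_left _ _)⟩ : |D u - δ| < min η₁ η₂).le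
  -- `S` is the time after which the compact set is met and `T₁` the attraction time from it. The
  -- maximum keeps the entry point before `u` whatever the sign of `T₁`.
  refine ⟨max S (S + T₁), u₀, ⟨hu₀p, hu₀1⟩, ?_, ?_⟩
  · intro σ e ρ Y hσ he ho u hu hLu
    have hLV := hg.isLotkaVolterra hp ho hσ.le he
    have hsub : ∀ x ∈ Icc σ u, x ∈ Ioo 0 u₁ := fun x hx =>
      ⟨hσ.trans_le hx.1, (hx.2.trans_lt hu.2).trans hu₀1⟩
    obtain ⟨w, hw, hwL⟩ : ∃ w ∈ Icc σ u, L w = L σ + S :=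
      intermediate_value_Icc hu.1.le
        (fun x hx => (hg.deriv_L x (hsub x hx)).continuousAt.continuousWithinAt)
        ⟨by linarith, (by linarith [le_max_left S (S + T₁)])⟩
    have hσw : σ < w := by
      refine lt_of_le_of_ne hw.1 fun h => ?_
      rw [← h] at hwL; linarith
    have hwm : w ∈ Ioo σ u₁ := ⟨hσw, (hsub w hw).2⟩
    obtain ⟨r1, r2⟩ := hreg σ e ρ Y hσ he ho w hwm hwL
    exact hatt₁ D L ω _ _ w u
      (hLV.mono fun x hx => ⟨hσw.trans_le hx.1, (hx.2.trans_lt hu.2).trans hu₀1⟩)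
      (fun x hx => (hDu x ⟨hσ.trans_le (hw.1.trans hx.1), hx.2.trans_lt hu.2⟩).trans
        (min_le_left _ _)) r1 r2 u ⟨hw.2, le_rfl⟩
      (by linarith [le_max_right S (S + T₁)])
  · intro e ρ Y he ho u hu
    have hLV := hg.isLotkaVolterra hp ho le_rfl he
    have hBle : ∀ x ∈ Ioo 0 u₁, Bcoord γ h ρ Y x ≤ γ := fun x hx =>
      ho.B_le hp hh le_rfl ⟨hx.1, hx.2.trans_le he⟩
    have hL : ∀ w, 0 < w → ∀ c, ∃ u ∈ Ioo 0 w, L u < c := fun w hw c => hg.eventually_lt hw c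
    -- A singular orbit has entry points arbitrarily far in the past; one is taken more than the
    -- attraction time `T₂` before `u`.
    obtain ⟨v, hv, hvL⟩ := hL u hu.1 (L u - T₂)
    obtain ⟨w, hw, hwA, hwB⟩ := hLV.exists_entry hp hL hg.D_nonneg hg.D_le (by linarith) hBle
      (u₀ := v) ⟨hv.1, (hv.2.trans hu.2).trans hu₀1⟩
    have hw1 : w ∈ Ioo 0 u₁ := ⟨hw.1, ((hw.2.trans hv.2).trans hu.2).trans hu₀1⟩
    have hLw : L w < L v := hg.strictMono_L hw1 ⟨hv.1, (hv.2.trans hu.2).trans hu₀1⟩ hw.2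
    exact hatt₂ D L ω _ _ w u
      (hLV.mono fun x hx => ⟨hw.1.trans_le hx.1, (hx.2.trans_lt hu.2).trans hu₀1⟩)
      (fun x hx => (hDu x ⟨hw.1.trans_le hx.1, hx.2.trans_lt hu.2⟩).trans (min_le_right _ _))
      ⟨hwA, hLV.A_le hp hL hg.D_nonneg hBle w hw1⟩ ⟨hwB, hBle w hw1⟩ u
      ⟨(hw.2.trans hv.2).le, le_rfl⟩ (by linarith)

end MEMS
end

noncomputable section
namespace MEMS

/-! ### Linearization at the equilibrium -/

variable {β k γ δ u₁ σ σ' e : ℝ} {h L ω D ρ Y ρ' Y' : ℝ → ℝ}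

/-- `μ = B / A` at the equilibrium. -/
def ratioEq (β k γ δ : ℝ) : ℝ := Beq β k γ δ / Aeq β k γ δ

lemma ratioEq_pos (hp : Admissible β k γ) (hδ : 0 ≤ δ) : 0 < ratioEq β k γ δ :=
  div_pos (Beq_pos hp hδ) (Aeq_pos hp hδ)

/-- Together with `inv_Aeq_rel₂` this evaluates the linear system for differences of orbits at the
equilibrium. With `μ = ratioEq` its matrix has rows `(-δ, μ / β)` and `(-β, -μ)`. -/
lemma inv_Aeq_rel₁ (hp : Admissible β k γ) (hδ : 0 ≤ δ) :
    k * (Aeq β k γ δ)⁻¹ = ratioEq β k γ δ / β - δ := by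
  have h1 := Beq_div hp hδ
  have hA := Aeq_pos hp hδ
  have : ratioEq β k γ δ / β = (Beq β k γ δ / β) * (Aeq β k γ δ)⁻¹ := by
    unfold ratioEq; ring
  rw [this, h1]; field_simp; ring

lemma inv_Aeq_rel₂ (hp : Admissible β k γ) (hδ : 0 ≤ δ) :
    γ * (Aeq β k γ δ)⁻¹ = ratioEq β k γ δ + β := by
  have hA := Aeq_pos hp hδ
  unfold ratioEq Beq; field_simp; ring

/-- The perturbation of a bilinear expression. -/
lemma abs_perturbation_le {k β γ η s t a b : ℝ} (hβ : 0 < β) (hk : 0 ≤ k) (hγ : 0 ≤ γ)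
    (hs : |s| ≤ η) (ht : |t| ≤ η) :
    |k * s * a + t / β * (b - a)| ≤ η * (k + 1 / β) * (|a| + |b|) ∧
    |-γ * s * a - t * (b - a)| ≤ η * (γ + 1) * (|a| + |b|) := by
  have hη : 0 ≤ η := (abs_nonneg s).trans hs
  have hba : |b - a| ≤ |a| + |b| := by rw [add_comm]; exact abs_sub b a
  have ha : |a| ≤ |a| + |b| := by linarith [abs_nonneg b]
  have h1 : |s * a| ≤ η * (|a| + |b|) := by
    rw [abs_mul]; exact mul_le_mul hs ha (abs_nonneg _) hη
  have h2 : |t * (b - a)| ≤ η * (|a| + |b|) := by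
    rw [abs_mul]; exact mul_le_mul ht hba (abs_nonneg _) hη
  constructor
  · have e : k * s * a + t / β * (b - a) = k * (s * a) + 1 / β * (t * (b - a)) := by ring
    rw [e]
    refine (abs_add_le _ _).trans ?_
    rw [abs_mul k, abs_mul (1 / β), abs_of_nonneg hk, abs_of_pos (show 0 < 1 / β by positivity)]
    have := mul_le_mul_of_nonneg_left h1 hk
    have := mul_le_mul_of_nonneg_left h2 (show 0 ≤ 1 / β by positivity)
    linarith
  · have e : -γ * s * a - t * (b - a) = -(γ * (s * a)) - t * (b - a) := by ring
    rw [e]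
    refine (abs_sub _ _).trans ?_
    rw [abs_neg, abs_mul γ, abs_of_nonneg hγ]
    have := mul_le_mul_of_nonneg_left h1 hγ
    linarith

/-- Here `a` and `b` stand for the differences of `log A` and `log B`. For the equilibrium matrix
the mixed products cancel in the derivative of `β a ^ 2 + (μ / β) b ^ 2`, leaving no damping of `a`
if `δ = 0`; a small multiple of `a b` supplies it. The strict inequality survives coefficients
within `η` of the equilibrium. -/
lemma exists_contraction_form (hp : Admissible β k γ) (hδ : 0 ≤ δ) :
    ∃ ε c C η : ℝ, 0 < c ∧ 0 < C ∧ 0 < η ∧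
      (∀ a b : ℝ, c * (a ^ 2 + b ^ 2) ≤
          β * a ^ 2 + ratioEq β k γ δ / β * b ^ 2 + 2 * ε * (a * b) ∧
        β * a ^ 2 + ratioEq β k γ δ / β * b ^ 2 + 2 * ε * (a * b) ≤ C * (a ^ 2 + b ^ 2)) ∧
      ∀ a b p m a' b' : ℝ, |p - (Aeq β k γ δ)⁻¹| ≤ η → |m - ratioEq β k γ δ| ≤ η →
        a' = k * p * a + m / β * (b - a) → b' = -γ * p * a - m * (b - a) →
        2 * (β * (a * a') + ratioEq β k γ δ / β * (b * b') + ε * (a' * b + a * b')) ≤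
          -c * (a ^ 2 + b ^ 2) := by
  have hβ := hp.β_pos
  have hk := hp.k_pos
  have hγ := hp.γ_pos
  have hμ := ratioEq_pos hp hδ
  have r1 := inv_Aeq_rel₁ hp hδ
  have r2 := inv_Aeq_rel₂ hp hδ
  generalize ratioEq β k γ δ = μ at *
  generalize (Aeq β k γ δ)⁻¹ = p₀ at *
  set ε := min (min (β / 2) (μ / (2 * β)))
    (μ ^ 2 / (2 * β) / (μ / β + (δ + μ) ^ 2 / (2 * β))) with hε
  have hε0 : 0 < ε := by positivity
  have hε1 : ε ≤ β / 2 := (min_le_left _ _).trans (min_le_left _ _)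
  have hε2 : ε ≤ μ / (2 * β) := (min_le_left _ _).trans (min_le_right _ _)
  have hε3 : ε * (μ / β + (δ + μ) ^ 2 / (2 * β)) ≤ μ ^ 2 / (2 * β) := by
    rw [← le_div_iff₀ (by positivity)]; exact min_le_right _ _
  set c₀ := min (ε * β / 2) (μ ^ 2 / (2 * β)) with hc₀
  have hc₀0 : 0 < c₀ := by positivity
  -- `K` collects the constants of the perturbation terms, which are at most `η K (|a| + |b|) ^ 2`.
  -- Since `(|a| + |b|) ^ 2 ≤ 2 (a ^ 2 + b ^ 2)`, taking `η = c₀ / (4 K)` costs at most half of the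
  -- damping `c₀`.
  set K := β * (k + 1 / β) + μ / β * (γ + 1) + ε * (k + 1 / β + (γ + 1)) with hK
  have hK0 : 0 < K := by positivity
  set c := min c₀ (min (β / 2) (μ / (2 * β))) with hc
  have hc0 : 0 < c := by positivity
  refine ⟨ε, c, β + μ / β + ε, c₀ / (4 * K), hc0, by positivity, by positivity, ?_, ?_⟩
  · intro a b
    have s1 := mul_nonneg hε0.le (sq_nonneg (a + b))
    have s2 := mul_nonneg hε0.le (sq_nonneg (a - b))
    have c1 : c ≤ β / 2 := (min_le_right _ _).trans (min_le_left _ _)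
    have c2 : c ≤ μ / (2 * β) := (min_le_right _ _).trans (min_le_right _ _)
    have d1 := mul_le_mul_of_nonneg_right c1 (sq_nonneg a)
    have d2 := mul_le_mul_of_nonneg_right c2 (sq_nonneg b)
    have d3 := mul_le_mul_of_nonneg_right hε1 (sq_nonneg a)
    have d4 := mul_le_mul_of_nonneg_right hε2 (sq_nonneg b)
    have e1 : μ / β = 2 * (μ / (2 * β)) := by field_simp
    have p1 : 0 ≤ μ / β * a ^ 2 := by positivity
    have p2 : 0 ≤ β * b ^ 2 := by positivity
    constructor
    · rw [e1]; nlinarith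
    · nlinarith
  · intro a b p m a' b' hpp hmm ha' hb'
    set s := p - p₀ with hs
    set t := m - μ with ht
    set da := k * s * a + t / β * (b - a) with hda
    set db := -γ * s * a - t * (b - a) with hdb
    have ea : a' = -δ * a + μ / β * b + da := by
      rw [ha', hda, hs, ht]; linear_combination r1 * a
    have eb : b' = -β * a - μ * b + db := by
      rw [hb', hdb, hs, ht]; linear_combination -r2 * a
    obtain ⟨q1, q2⟩ := abs_perturbation_le (a := a) (b := b) hβ hk.le hγ.le hpp hmm
    rw [← hda] at q1
    rw [← hdb] at q2
    set η := c₀ / (4 * K) with hη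
    have hη0 : 0 < η := by positivity
    set n := |a| + |b| with hn
    have hn0 : 0 ≤ n := by positivity
    have ha_n : |a| ≤ n := by rw [hn]; linarith [abs_nonneg b]
    have hb_n : |b| ≤ n := by rw [hn]; linarith [abs_nonneg a]
    have hn2 : n ^ 2 ≤ 2 * (a ^ 2 + b ^ 2) := by
      rw [hn, ← sq_abs a, ← sq_abs b]; linarith [sq_nonneg (|a| - |b|)]
    have hprod : ∀ x y X : ℝ, |x| ≤ n → |y| ≤ X * n → x * y ≤ X * n ^ 2 := by
      intro x y X hx hy
      calc x * y ≤ |x * y| := le_abs_self _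
        _ = |x| * |y| := abs_mul _ _
        _ ≤ n * (X * n) := mul_le_mul hx hy (abs_nonneg _) hn0
        _ = X * n ^ 2 := by ring
    have g1 := mul_le_mul_of_nonneg_left (hprod a da _ ha_n q1) hβ.le
    have g2 := mul_le_mul_of_nonneg_left (hprod b db _ hb_n q2)
      (show 0 ≤ μ / β by positivity)
    have g3 := mul_le_mul_of_nonneg_left (hprod b da _ hb_n q1) hε0.le
    have g4 := mul_le_mul_of_nonneg_left (hprod a db _ ha_n q2) hε0.le
    have gsum : β * (a * da) + μ / β * (b * db) + ε * (da * b + a * db) ≤ η * K * n ^ 2 := by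
      rw [hK]; linarith
    have g5 : η * K * n ^ 2 ≤ c₀ / 2 * (a ^ 2 + b ^ 2) := by
      have : η * K = c₀ / 4 := by rw [hη]; field_simp
      rw [this]
      have := mul_le_mul_of_nonneg_left hn2 (show 0 ≤ c₀ / 4 by positivity)
      linarith
    have main : β * (a * (-δ * a + μ / β * b)) + μ / β * (b * (-β * a - μ * b)) +
        ε * ((-δ * a + μ / β * b) * b + a * (-β * a - μ * b)) ≤ -c₀ * (a ^ 2 + b ^ 2) := by
      have e1 : β * (a * (-δ * a + μ / β * b)) + μ / β * (b * (-β * a - μ * b)) +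
        ε * ((-δ * a + μ / β * b) * b + a * (-β * a - μ * b)) =
        -(β * δ * a ^ 2) - μ ^ 2 / β * b ^ 2 +
        ε * (μ / β * b ^ 2 - β * a ^ 2 - (δ + μ) * (a * b)) := by field_simp; ring
      have e2 : -((δ + μ) * (a * b)) ≤ β / 2 * a ^ 2 + (δ + μ) ^ 2 / (2 * β) * b ^ 2 := by
        have : 0 ≤ (β * a + (δ + μ) * b) ^ 2 / (2 * β) := by positivity
        have e : (β * a + (δ + μ) * b) ^ 2 / (2 * β) =
          β / 2 * a ^ 2 + (δ + μ) * (a * b) + (δ + μ) ^ 2 / (2 * β) * b ^ 2 := by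
          field_simp; ring
        linarith
      have e3 := mul_le_mul_of_nonneg_left e2 hε0.le
      have e4 := mul_le_mul_of_nonneg_right hε3 (sq_nonneg b)
      have e5 := mul_le_mul_of_nonneg_right (min_le_left (ε * β / 2) (μ ^ 2 / (2 * β)))
        (sq_nonneg a)
      have e6 := mul_le_mul_of_nonneg_right (min_le_right (ε * β / 2) (μ ^ 2 / (2 * β)))
        (sq_nonneg b)
      have e7 : 0 ≤ β * δ * a ^ 2 := by positivity
      have e8 : μ ^ 2 / β = 2 * (μ ^ 2 / (2 * β)) := by field_simp
      rw [e1, e8]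
      linarith
    have c1 : c ≤ c₀ := min_le_left _ _
    have c2 := mul_le_mul_of_nonneg_right c1 (show 0 ≤ a ^ 2 + b ^ 2 by positivity)
    rw [ea, eb]
    linarith

/-- At the equilibrium `a b' - b a' = -(β a ^ 2 + (μ - δ) a b + (μ / β) b ^ 2)`, and `hspiral` is
the negativity of the discriminant of this form, equivalently non-real eigenvalues. The estimate
therefore persists under small changes of the coefficients. -/
lemma exists_rotation_form (hp : Admissible β k γ) (hδ : 0 ≤ δ)
    (hspiral : (ratioEq β k γ δ - δ) ^ 2 < 4 * ratioEq β k γ δ) :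
    ∃ c η : ℝ, 0 < c ∧ 0 < η ∧
      ∀ a b p m a' b' : ℝ, |p - (Aeq β k γ δ)⁻¹| ≤ η → |m - ratioEq β k γ δ| ≤ η →
        a' = k * p * a + m / β * (b - a) → b' = -γ * p * a - m * (b - a) →
        a * b' - b * a' ≤ -c * (a ^ 2 + b ^ 2) := by
  have hβ := hp.β_pos
  have hk := hp.k_pos
  have hγ := hp.γ_pos
  have hμ := ratioEq_pos hp hδ
  have r1 := inv_Aeq_rel₁ hp hδ
  have r2 := inv_Aeq_rel₂ hp hδ
  generalize ratioEq β k γ δ = μ at *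
  generalize (Aeq β k γ δ)⁻¹ = p₀ at *
  obtain ⟨c₀, hc₀, hform⟩ : ∃ c₀ : ℝ, 0 < c₀ ∧ ∀ a b : ℝ,
      c₀ * (a ^ 2 + b ^ 2) ≤ β * a ^ 2 + (μ - δ) * (a * b) + μ / β * b ^ 2 := by
    set d := 4 * μ - (μ - δ) ^ 2 with hd
    have hd0 : 0 < d := by rw [hd]; linarith
    refine ⟨min (d / (8 * β)) (d / (8 * (μ / β))) , by positivity, fun a b => ?_⟩
    set κ := μ / β with hκ
    have hκ0 : 0 < κ := by positivity
    have hμκ : μ = β * κ := by rw [hκ]; field_simp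
    have f1 : d / (8 * κ) * a ^ 2 ≤ (β * a ^ 2 + (μ - δ) * (a * b) + κ * b ^ 2) / 2 := by
      have : (β * a ^ 2 + (μ - δ) * (a * b) + κ * b ^ 2) =
          (2 * κ * b + (μ - δ) * a) ^ 2 / (4 * κ) + d / (4 * κ) * a ^ 2 := by
        rw [hd, hμκ]; field_simp; ring
      rw [this]
      have h1 : 0 ≤ (2 * κ * b + (μ - δ) * a) ^ 2 / (4 * κ) := by positivity
      have h2 : d / (8 * κ) = d / (4 * κ) / 2 := by field_simp; norm_num
      rw [h2]; linarith
    have f2 : d / (8 * β) * b ^ 2 ≤ (β * a ^ 2 + (μ - δ) * (a * b) + κ * b ^ 2) / 2 := by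
      have : (β * a ^ 2 + (μ - δ) * (a * b) + κ * b ^ 2) =
          (2 * β * a + (μ - δ) * b) ^ 2 / (4 * β) + d / (4 * β) * b ^ 2 := by
        rw [hd, hμκ]; field_simp; ring
      rw [this]
      have h1 : 0 ≤ (2 * β * a + (μ - δ) * b) ^ 2 / (4 * β) := by positivity
      have h2 : d / (8 * β) = d / (4 * β) / 2 := by field_simp; norm_num
      rw [h2]; linarith
    have g1 := mul_le_mul_of_nonneg_right (min_le_right (d / (8 * β)) (d / (8 * κ)))
      (sq_nonneg a)
    have g2 := mul_le_mul_of_nonneg_right (min_le_left (d / (8 * β)) (d / (8 * κ)))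
      (sq_nonneg b)
    linarith
  set K := k + 1 / β + (γ + 1) with hK
  have hK0 : 0 < K := by positivity
  refine ⟨c₀ / 2, c₀ / (4 * K), by positivity, by positivity, ?_⟩
  intro a b p m a' b' hpp hmm ha' hb'
  set s := p - p₀ with hs
  set t := m - μ with ht
  set da := k * s * a + t / β * (b - a) with hda
  set db := -γ * s * a - t * (b - a) with hdb
  have ea : a' = -δ * a + μ / β * b + da := by
    rw [ha', hda, hs, ht]; linear_combination r1 * a
  have eb : b' = -β * a - μ * b + db := by
    rw [hb', hdb, hs, ht]; linear_combination -r2 * a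
  obtain ⟨q1, q2⟩ := abs_perturbation_le (a := a) (b := b) hβ hk.le hγ.le hpp hmm
  rw [← hda] at q1
  rw [← hdb] at q2
  set η := c₀ / (4 * K) with hη
  have hη0 : 0 < η := by positivity
  set n := |a| + |b| with hn
  have hn0 : 0 ≤ n := by positivity
  have ha_n : |a| ≤ n := by rw [hn]; linarith [abs_nonneg b]
  have hb_n : |-b| ≤ n := by rw [hn, abs_neg]; linarith [abs_nonneg a]
  have hn2 : n ^ 2 ≤ 2 * (a ^ 2 + b ^ 2) := by
    rw [hn, ← sq_abs a, ← sq_abs b]; linarith [sq_nonneg (|a| - |b|)]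
  have hprod : ∀ x y X : ℝ, |x| ≤ n → |y| ≤ X * n → x * y ≤ X * n ^ 2 := by
    intro x y X hx hy
    calc x * y ≤ |x * y| := le_abs_self _
      _ = |x| * |y| := abs_mul _ _
      _ ≤ n * (X * n) := mul_le_mul hx hy (abs_nonneg _) hn0
      _ = X * n ^ 2 := by ring
  have g1 := hprod a db _ ha_n q2
  have g2 := hprod (-b) da _ hb_n q1
  have g5 : η * K * n ^ 2 ≤ c₀ / 2 * (a ^ 2 + b ^ 2) := by
    have : η * K = c₀ / 4 := by rw [hη]; field_simp
    rw [this]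
    have := mul_le_mul_of_nonneg_left hn2 (show 0 ≤ c₀ / 4 by positivity)
    linarith
  have g6 : a * db + -b * da ≤ η * K * n ^ 2 := by rw [hK]; linarith
  have main := hform a b
  rw [ea, eb]
  linarith

/-- The difference of two orbits solves a linear system. -/
lemma exists_linear_difference (hh : Nonlinearity h) {u : ℝ} (hu : 0 < u) :
    ∃ p m : ℝ, 0 < p ∧ 0 < m ∧
      (min (Real.exp (k * ρ u - Y u / β)) (Real.exp (k * ρ' u - Y' u / β)) ≤ p ∧
        p ≤ max (Real.exp (k * ρ u - Y u / β)) (Real.exp (k * ρ' u - Y' u / β))) ∧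
      (min (h u * Real.exp ((γ + k) * ρ u - (1 + 1 / β) * Y u))
          (h u * Real.exp ((γ + k) * ρ' u - (1 + 1 / β) * Y' u)) ≤ m ∧
        m ≤ max (h u * Real.exp ((γ + k) * ρ u - (1 + 1 / β) * Y u))
          (h u * Real.exp ((γ + k) * ρ' u - (1 + 1 / β) * Y' u))) ∧
      Real.exp (k * ρ u - Y u / β) - Real.exp (k * ρ' u - Y' u / β) =
        p * (k * (ρ u - ρ' u) - (Y u - Y' u) / β) ∧
      h u * Real.exp ((γ + k) * ρ u - (1 + 1 / β) * Y u) -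
          h u * Real.exp ((γ + k) * ρ' u - (1 + 1 / β) * Y' u) =
        m * ((γ + k) * (ρ u - ρ' u) - (1 + 1 / β) * (Y u - Y' u)) := by
  have hhu := hh.pos u hu
  obtain ⟨p, hp1, hp2, hpe⟩ := exists_exp_sub_exp (k * ρ u - Y u / β) (k * ρ' u - Y' u / β)
  obtain ⟨m, hm1, hm2, hme⟩ := exists_exp_sub_exp ((γ + k) * ρ u - (1 + 1 / β) * Y u)
    ((γ + k) * ρ' u - (1 + 1 / β) * Y' u)
  have hp0 : 0 < p := (lt_min (Real.exp_pos _) (Real.exp_pos _)).trans_le hp1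
  have hm0 : 0 < m := (lt_min (Real.exp_pos _) (Real.exp_pos _)).trans_le hm1
  refine ⟨p, h u * m, hp0, mul_pos hhu hm0, ⟨hp1, hp2⟩, ⟨?_, ?_⟩, ?_, ?_⟩
  · rw [← mul_min_of_nonneg _ _ hhu.le]; exact mul_le_mul_of_nonneg_left hm1 hhu.le
  · rw [← mul_max_of_nonneg _ _ hhu.le]; exact mul_le_mul_of_nonneg_left hm2 hhu.le
  · rw [hpe]; ring
  · rw [← mul_sub, hme]; ring

lemma exists_near_radius (hp : Admissible β k γ) (hδ : 0 ≤ δ) {η : ℝ} (hη : 0 < η) :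
    ∃ ε > 0, ∀ A B : ℝ, |A - Aeq β k γ δ| < ε → |B - Beq β k γ δ| < ε →
      0 < A ∧ |A⁻¹ - (Aeq β k γ δ)⁻¹| ≤ η ∧ |B / A - ratioEq β k γ δ| ≤ η := by
  have hA := Aeq_pos hp hδ
  have c1 : Tendsto (fun q : ℝ × ℝ => q.1⁻¹) (𝓝 (Aeq β k γ δ, Beq β k γ δ))
      (𝓝 (Aeq β k γ δ)⁻¹) := (continuous_fst.tendsto _).inv₀ hA.ne'
  have c2 : Tendsto (fun q : ℝ × ℝ => q.2 / q.1) (𝓝 (Aeq β k γ δ, Beq β k γ δ))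
      (𝓝 (ratioEq β k γ δ)) := (continuous_snd.tendsto _).div (continuous_fst.tendsto _) hA.ne'
  have c0 : ∀ᶠ q : ℝ × ℝ in 𝓝 (Aeq β k γ δ, Beq β k γ δ), 0 < q.1 :=
    (continuous_fst.tendsto _).eventually (lt_mem_nhds hA)
  have := (c0.and (c1.eventually (Metric.ball_mem_nhds _ hη))).and
    (c2.eventually (Metric.ball_mem_nhds _ hη))
  obtain ⟨ε, hε, hball⟩ := Metric.eventually_nhds_iff.1 this
  refine ⟨ε, hε, fun A B hAε hBε => ?_⟩
  obtain ⟨⟨q0, q1⟩, q2⟩ := hball (show dist (A, B) (Aeq β k γ δ, Beq β k γ δ) < ε by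
    rw [Prod.dist_eq]; exact max_lt hAε hBε)
  exact ⟨q0, by simpa [Real.dist_eq] using q1.le, by simpa [Real.dist_eq] using q2.le⟩

/-- Near the equilibrium the difference of two orbits solves a linear system with nearly constant
coefficients. -/
lemma IsGrowth.linear_difference_near (hg : IsGrowth β δ u₁ h L ω D)
    (hh : Nonlinearity h) {u η ε : ℝ} (hu : u ∈ Ioo 0 u₁)
    (hε : ∀ A B : ℝ, |A - Aeq β k γ δ| < ε → |B - Beq β k γ δ| < ε →
      0 < A ∧ |A⁻¹ - (Aeq β k γ δ)⁻¹| ≤ η ∧ |B / A - ratioEq β k γ δ| ≤ η)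
    (h1 : |Acoord β k ω ρ Y u - Aeq β k γ δ| < ε ∧ |Bcoord γ h ρ Y u - Beq β k γ δ| < ε)
    (h2 : |Acoord β k ω ρ' Y' u - Aeq β k γ δ| < ε ∧ |Bcoord γ h ρ' Y' u - Beq β k γ δ| < ε) :
    ∃ p m : ℝ, |p - (Aeq β k γ δ)⁻¹| ≤ η ∧ |m - ratioEq β k γ δ| ≤ η ∧
      Real.exp (k * ρ u - Y u / β) - Real.exp (k * ρ' u - Y' u / β) =
        ω u * (p * (k * (ρ u - ρ' u) - (Y u - Y' u) / β)) ∧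
      h u * Real.exp ((γ + k) * ρ u - (1 + 1 / β) * Y u) -
          h u * Real.exp ((γ + k) * ρ' u - (1 + 1 / β) * Y' u) =
        ω u * (m * ((γ + k) * (ρ u - ρ' u) - (1 + 1 / β) * (Y u - Y' u))) := by
  have hω := hg.ω_pos u hu
  obtain ⟨p, m, -, -, ⟨hp1, hp2⟩, ⟨hm1, hm2⟩, hpe, hme⟩ :=
    exists_linear_difference (ρ := ρ) (Y := Y) (ρ' := ρ') (Y' := Y') (γ := γ) (k := k) (β := β) hh hu.1
  have key : ∀ ρ Y : ℝ → ℝ, Real.exp (k * ρ u - Y u / β) = ω u * (Acoord β k ω ρ Y u)⁻¹ ∧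
      h u * Real.exp ((γ + k) * ρ u - (1 + 1 / β) * Y u) =
        ω u * (Bcoord γ h ρ Y u / Acoord β k ω ρ Y u) := by
    intro ρ Y
    have e1 : Real.exp (k * ρ u - Y u / β) = (Real.exp (Y u / β - k * ρ u))⁻¹ := by
      rw [← Real.exp_neg]; ring_nf
    have e2 : Real.exp ((γ + k) * ρ u - (1 + 1 / β) * Y u) =
        Real.exp (γ * ρ u - Y u) * (Real.exp (Y u / β - k * ρ u))⁻¹ := by
      rw [← Real.exp_neg, ← Real.exp_add]; ring_nf
    have hE := Real.exp_pos (Y u / β - k * ρ u)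
    simp only [Acoord, Bcoord]
    rw [e1, e2]
    constructor <;> field_simp
  obtain ⟨k1, k2⟩ := key ρ Y
  obtain ⟨k1', k2'⟩ := key ρ' Y'
  obtain ⟨-, n1, n2⟩ := hε _ _ h1.1 h1.2
  obtain ⟨-, n1', n2'⟩ := hε _ _ h2.1 h2.2
  -- A mean value between two coefficients that are `η`-close to the equilibrium is itself
  -- `η`-close.
  have hmid : ∀ x y z w : ℝ, |x - w| ≤ η → |y - w| ≤ η → min (ω u * x) (ω u * y) ≤ z →
      z ≤ max (ω u * x) (ω u * y) → |z / ω u - w| ≤ η := by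
    intro x y z w hx hy hz1 hz2
    rw [← mul_min_of_nonneg _ _ hω.le] at hz1
    rw [← mul_max_of_nonneg _ _ hω.le] at hz2
    have z1 : min x y ≤ z / ω u := by rw [le_div_iff₀ hω, mul_comm]; exact hz1
    have z2 : z / ω u ≤ max x y := by rw [div_le_iff₀ hω, mul_comm]; exact hz2
    rw [abs_le] at hx hy ⊢
    constructor
    · rcases min_le_iff.1 z1 with h | h <;> linarith
    · rcases le_max_iff.1 z2 with h | h <;> linarith
  refine ⟨p / ω u, m / ω u, ?_, ?_, ?_, ?_⟩
  · rw [k1, k1'] at hp1 hp2; exact hmid _ _ _ _ n1 n1' hp1 hp2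
  · rw [k2, k2'] at hm1 hm2; exact hmid _ _ _ _ n2 n2' hm1 hm2
  · rw [hpe]; field_simp
  · rw [hme]; field_simp

/-- The two pairs of linear coordinates are comparable. -/
lemma exists_coordinate_comparison (hp : Admissible β k γ) :
    ∃ K₁ K₂ : ℝ, 0 < K₁ ∧ 0 < K₂ ∧
      (∀ x y : ℝ, (y / β - k * x) ^ 2 + (γ * x - y) ^ 2 ≤ K₁ * (x ^ 2 + y ^ 2)) ∧
      ∀ x y : ℝ, x ^ 2 + y ^ 2 ≤ K₂ * ((y / β - k * x) ^ 2 + (γ * x - y) ^ 2) := by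
  have hβ := hp.β_pos
  have hk := hp.k_pos
  have hγ := hp.γ_pos
  have hθ := hp.θ_pos
  set θ := γ / β - k with hθd
  set K₁ := 2 * (1 / β ^ 2 + k ^ 2) + 2 * (γ ^ 2 + 1) with hK₁
  set K₂ := (2 + 2 / β ^ 2) / θ ^ 2 + (2 * γ ^ 2 + 2 * k ^ 2) / θ ^ 2 with hK₂
  have hK₁0 : 0 < K₁ := by positivity
  have hK₂0 : 0 < K₂ := by positivity
  have hcmp₁ : ∀ x y : ℝ, (y / β - k * x) ^ 2 + (γ * x - y) ^ 2 ≤ K₁ * (x ^ 2 + y ^ 2) := by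
    intro x y
    have q1 : (y / β - k * x) ^ 2 ≤ 2 * (1 / β ^ 2 + k ^ 2) * (x ^ 2 + y ^ 2) := by
      have e : y / β = y * (1 / β) := by ring
      have e' : 1 / β ^ 2 = (1 / β) ^ 2 := by ring
      rw [e, e']
      nlinarith [sq_nonneg (y * (1 / β) + k * x), sq_nonneg (x * (1 / β)), sq_nonneg (k * y)]
    have q2 : (γ * x - y) ^ 2 ≤ 2 * (γ ^ 2 + 1) * (x ^ 2 + y ^ 2) := by
      nlinarith [sq_nonneg (γ * x + y), sq_nonneg x, sq_nonneg (γ * y)]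
    rw [hK₁]; linarith
  have hcmp₂ : ∀ x y : ℝ, x ^ 2 + y ^ 2 ≤
      K₂ * ((y / β - k * x) ^ 2 + (γ * x - y) ^ 2) := by
    intro x y
    set a := y / β - k * x with ha
    set b := γ * x - y with hb
    -- The passage from `(ρ, Y)` to `(log A, log B)` at fixed `u` is affine and invertible because
    -- `θ ≠ 0`.
    have ex : x = (a + b / β) / θ := by
      rw [ha, hb, hθd, eq_div_iff (by rw [← hθd]; exact hθ.ne')]; field_simp; ring
    have ey : y = (γ * a + k * b) / θ := by
      rw [ha, hb, hθd, eq_div_iff (by rw [← hθd]; exact hθ.ne')]; field_simp; ring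
    have q1 : (a + b / β) ^ 2 ≤ (2 + 2 / β ^ 2) * (a ^ 2 + b ^ 2) := by
      have e : b / β = b * (1 / β) := by ring
      have e' : 2 / β ^ 2 = 2 * (1 / β) ^ 2 := by ring
      rw [e, e']
      nlinarith [sq_nonneg (a - b * (1 / β)), sq_nonneg (a * (1 / β)), sq_nonneg b]
    have q2 : (γ * a + k * b) ^ 2 ≤ (2 * γ ^ 2 + 2 * k ^ 2) * (a ^ 2 + b ^ 2) := by
      nlinarith [sq_nonneg (γ * a - k * b), sq_nonneg (γ * b), sq_nonneg (k * a)]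
    calc x ^ 2 + y ^ 2 = (a + b / β) ^ 2 / θ ^ 2 + (γ * a + k * b) ^ 2 / θ ^ 2 := by
          conv_lhs => rw [ex, ey]
          rw [div_pow, div_pow]
      _ ≤ (2 + 2 / β ^ 2) * (a ^ 2 + b ^ 2) / θ ^ 2 +
          (2 * γ ^ 2 + 2 * k ^ 2) * (a ^ 2 + b ^ 2) / θ ^ 2 := by gcongr
      _ = K₂ * (a ^ 2 + b ^ 2) := by rw [hK₂]; ring
  exact ⟨K₁, K₂, hK₁0, hK₂0, hcmp₁, hcmp₂⟩

/-- Two orbits near the equilibrium approach each other exponentially. -/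
theorem IsGrowth.exists_contraction (hg : IsGrowth β δ u₁ h L ω D) (hp : Admissible β k γ)
    (hh : Nonlinearity h) (h0 : 0 < u₁) :
    ∃ ε c C : ℝ, 0 < ε ∧ 0 < c ∧ 0 < C ∧ ∀ σ σ' e ρ Y ρ' Y' w₁ w₂, 0 ≤ σ → 0 ≤ σ' → u₁ ≤ e →
      IsOrbit β k γ h σ e ρ Y → IsOrbit β k γ h σ' e ρ' Y' →
      σ < w₁ → σ' < w₁ → w₁ ≤ w₂ → w₂ < u₁ →
      (∀ u ∈ Icc w₁ w₂, (|Acoord β k ω ρ Y u - Aeq β k γ δ| < ε ∧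
        |Bcoord γ h ρ Y u - Beq β k γ δ| < ε) ∧ (|Acoord β k ω ρ' Y' u - Aeq β k γ δ| < ε ∧
        |Bcoord γ h ρ' Y' u - Beq β k γ δ| < ε)) →
      (ρ w₂ - ρ' w₂) ^ 2 + (Y w₂ - Y' w₂) ^ 2 ≤
        C * ((ρ w₁ - ρ' w₁) ^ 2 + (Y w₁ - Y' w₁) ^ 2) * Real.exp (-c * (L w₂ - L w₁)) := by
  have hδ := hg.δ_nonneg h0
  have hβ := hp.β_pos
  have hk := hp.k_pos
  have hγ := hp.γ_pos
  have hθ := hp.θ_pos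
  obtain ⟨e₀, c, C, η, hc, hC, hη, hquad, hform⟩ := exists_contraction_form hp hδ
  obtain ⟨ε, hε, hnear⟩ := exists_near_radius hp hδ hη
  obtain ⟨K₁, K₂, hK₁0, hK₂0, hcmp₁, hcmp₂⟩ := exists_coordinate_comparison hp
  refine ⟨ε, c / C, K₂ * (C / c) * K₁, hε, by positivity, by positivity, ?_⟩
  intro σ σ' e ρ Y ρ' Y' w₁ w₂ hσ hσ' he ho ho' hσw hσw' hw hw₂ hn
  set a : ℝ → ℝ := fun u => (Y u - Y' u) / β - k * (ρ u - ρ' u) with ha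
  set b : ℝ → ℝ := fun u => γ * (ρ u - ρ' u) - (Y u - Y' u) with hb
  set E : ℝ → ℝ := fun u => β * a u ^ 2 + ratioEq β k γ δ / β * b u ^ 2 +
    2 * e₀ * (a u * b u) with hE
  -- The contraction form gives `E' ≤ -(c / C) ω E`, that is, decay at rate `c / C` in the time `L`.
  have hanti : AntitoneOn (fun u => E u * Real.exp (c / C * L u)) (Icc w₁ w₂) := by
    have hsub : ∀ u ∈ Icc w₁ w₂, u ∈ Ioo 0 u₁ := fun u hu =>
      ⟨(hσ.trans_lt hσw).trans_le hu.1, hu.2.trans_lt hw₂⟩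
    have hs1 : ∀ u ∈ Icc w₁ w₂, u ∈ Ioo σ e := fun u hu =>
      ⟨hσw.trans_le hu.1, (hu.2.trans_lt hw₂).trans_le he⟩
    have hs2 : ∀ u ∈ Icc w₁ w₂, u ∈ Ioo σ' e := fun u hu =>
      ⟨hσw'.trans_le hu.1, (hu.2.trans_lt hw₂).trans_le he⟩
    choose! p m hpη hmη hpe hme using fun u (hu : u ∈ Icc w₁ w₂) =>
      hg.linear_difference_near hh (hsub u hu) hnear (hn u hu).1 (hn u hu).2
    have da : ∀ u ∈ Icc w₁ w₂, HasDerivAt a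
        (ω u * (k * p u * a u + m u / β * (b u - a u))) u := by
      intro u hu
      refine ((((ho.deriv_Y u (hs1 u hu)).sub (ho'.deriv_Y u (hs2 u hu))).div_const β).sub
        (((ho.deriv_ρ u (hs1 u hu)).sub (ho'.deriv_ρ u (hs2 u hu))).const_mul k)).congr_deriv ?_
      rw [hpe u hu, hme u hu, ha, hb]; field_simp; ring
    have db : ∀ u ∈ Icc w₁ w₂, HasDerivAt b
        (ω u * (-γ * p u * a u - m u * (b u - a u))) u := by
      intro u hu
      refine ((((ho.deriv_ρ u (hs1 u hu)).sub (ho'.deriv_ρ u (hs2 u hu))).const_mul γ).sub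
        ((ho.deriv_Y u (hs1 u hu)).sub (ho'.deriv_Y u (hs2 u hu)))).congr_deriv ?_
      rw [hpe u hu, hme u hu, ha, hb]; field_simp; ring
    refine antitoneOn_of_hasDerivAt (convex_Icc _ _) (fun u hu =>
      ((((da u hu).pow 2).const_mul β).add (((db u hu).pow 2).const_mul
        (ratioEq β k γ δ / β)) |>.add (((da u hu).mul (db u hu)).const_mul (2 * e₀))).mul
      (((hg.deriv_L u (hsub u hu)).const_mul (c / C)).exp)) fun u hu => ?_
    have hω := hg.ω_pos u (hsub u hu)
    have f1 := hform (a u) (b u) (p u) (m u) _ _ (hpη u hu) (hmη u hu) rfl rfl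
    have f2 := (hquad (a u) (b u)).2
    have f3 : c / C * E u ≤ c * (a u ^ 2 + b u ^ 2) := by
      rw [div_mul_eq_mul_div, div_le_iff₀ hC]
      have := mul_le_mul_of_nonneg_left f2 hc.le
      simp only [hE]; linarith
    set a' := k * p u * a u + m u / β * (b u - a u) with ha'
    set b' := -γ * p u * a u - m u * (b u - a u) with hb'
    have f4 : 2 * (β * (a u * a') + ratioEq β k γ δ / β * (b u * b') +
        e₀ * (a' * b u + a u * b')) + c / C * E u ≤ 0 := by linarith
    have f5 := mul_nonpos_of_nonneg_of_nonpos
      (mul_nonneg hω.le (Real.exp_pos (c / C * L u)).le) f4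
    refine le_trans (le_of_eq ?_) f5
    simp only [hE]
    simp only [Pi.add_apply, Pi.mul_apply, Pi.pow_apply]
    push_cast
    ring
  have h1 := hanti ⟨le_rfl, hw⟩ ⟨hw, le_rfl⟩ hw
  dsimp only at h1
  have h2 : E w₂ ≤ E w₁ * Real.exp (-(c / C) * (L w₂ - L w₁)) := by
    have : Real.exp (c / C * L w₁) =
        Real.exp (-(c / C) * (L w₂ - L w₁)) * Real.exp (c / C * L w₂) := by
      rw [← Real.exp_add]; ring_nf
    rw [this, ← mul_assoc] at h1
    exact le_of_mul_le_mul_right h1 (Real.exp_pos _)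
  have h3 := (hquad (a w₂) (b w₂)).1
  have h4 := (hquad (a w₁) (b w₁)).2
  have h5 := hcmp₁ (ρ w₁ - ρ' w₁) (Y w₁ - Y' w₁)
  have h6 := hcmp₂ (ρ w₂ - ρ' w₂) (Y w₂ - Y' w₂)
  set X := Real.exp (-(c / C) * (L w₂ - L w₁)) with hX
  have hX0 : 0 < X := Real.exp_pos _
  calc _ ≤ K₂ * (a w₂ ^ 2 + b w₂ ^ 2) := h6
    _ ≤ K₂ * (E w₂ / c) := by
      gcongr; rw [le_div_iff₀ hc, mul_comm]; exact h3
    _ ≤ K₂ * (E w₁ * X / c) := by gcongr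
    _ ≤ K₂ * (C * (a w₁ ^ 2 + b w₁ ^ 2) * X / c) := by gcongr
    _ ≤ K₂ * (C * (K₁ * ((ρ w₁ - ρ' w₁) ^ 2 + (Y w₁ - Y' w₁) ^ 2)) * X / c) := by
      gcongr
    _ = _ := by ring

/-- Near the equilibrium the difference of two orbits rotates. -/
theorem IsGrowth.exists_rotation (hg : IsGrowth β δ u₁ h L ω D) (hp : Admissible β k γ)
    (hh : Nonlinearity h) (h0 : 0 < u₁)
    (hspiral : (ratioEq β k γ δ - δ) ^ 2 < 4 * ratioEq β k γ δ) :
    ∃ ε c : ℝ, 0 < ε ∧ 0 < c ∧ ∀ (ρ Y ρ' Y' : ℝ → ℝ), ∀ u ∈ Ioo 0 u₁,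
      (|Acoord β k ω ρ Y u - Aeq β k γ δ| < ε ∧ |Bcoord γ h ρ Y u - Beq β k γ δ| < ε) →
      (|Acoord β k ω ρ' Y' u - Aeq β k γ δ| < ε ∧ |Bcoord γ h ρ' Y' u - Beq β k γ δ| < ε) →
      c * ω u * ((ρ u - ρ' u) ^ 2 + (Y u - Y' u) ^ 2) ≤
        (ρ u - ρ' u) * (h u * Real.exp ((γ + k) * ρ u - (1 + 1 / β) * Y u) -
          h u * Real.exp ((γ + k) * ρ' u - (1 + 1 / β) * Y' u)) -
        (Y u - Y' u) * (Real.exp (k * ρ u - Y u / β) - Real.exp (k * ρ' u - Y' u / β)) := by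
  have hδ := hg.δ_nonneg h0
  have hβ := hp.β_pos
  have hk := hp.k_pos
  have hγ := hp.γ_pos
  have hθ := hp.θ_pos
  obtain ⟨c, η, hc, hη, hform⟩ := exists_rotation_form hp hδ hspiral
  obtain ⟨ε, hε, hnear⟩ := exists_near_radius hp hδ hη
  obtain ⟨-, K₂, -, hK₂0, -, hcmp₂⟩ := exists_coordinate_comparison hp
  refine ⟨ε, c / ((γ / β - k) * K₂), hε, by positivity, ?_⟩
  intro ρ Y ρ' Y' u hu hn hn'
  have hω := hg.ω_pos u hu
  obtain ⟨p, m, hpη, hmη, hpe, hme⟩ := hg.linear_difference_near hh hu hnear hn hn'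
  rw [hpe, hme]
  have h6 := hcmp₂ (ρ u - ρ' u) (Y u - Y' u)
  generalize ρ u - ρ' u = x at *
  generalize Y u - Y' u = y at *
  have f := hform (y / β - k * x) (γ * x - y) p m _ _ hpη hmη rfl rfl
  -- The map `(x, y) ↦ (y / β - k x, γ x - y)` has determinant `-θ`, so oriented areas change by
  -- this factor: a clockwise turn in `(log A, log B)` is a counterclockwise one in `(ρ, Y)`.
  have e : (γ / β - k) * (x * (m * ((γ + k) * x - (1 + 1 / β) * y)) -
      y * (p * (k * x - y / β))) =
      -((y / β - k * x) * (-γ * p * (y / β - k * x) - m * (γ * x - y - (y / β - k * x))) -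
      (γ * x - y) * (k * p * (y / β - k * x) + m / β * (γ * x - y - (y / β - k * x)))) := by
    field_simp; ring
  have g : c / ((γ / β - k) * K₂) * (x ^ 2 + y ^ 2) ≤
      x * (m * ((γ + k) * x - (1 + 1 / β) * y)) - y * (p * (k * x - y / β)) := by
    rw [div_mul_eq_mul_div, div_le_iff₀ (by positivity)]
    have h7 := mul_le_mul_of_nonneg_left h6 hc.le
    generalize (y / β - k * x) ^ 2 + (γ * x - y) ^ 2 = N at *
    have h8 : c * N ≤ (γ / β - k) * (x * (m * ((γ + k) * x - (1 + 1 / β) * y)) -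
      y * (p * (k * x - y / β))) := by rw [e]; linarith
    have := mul_le_mul_of_nonneg_left h8 hK₂0.le
    linarith
  have := mul_le_mul_of_nonneg_left g hω.le
  linarith

end MEMS
end

noncomputable section
namespace MEMS

/-! ### Uniqueness and continuous dependence of regular orbits -/

variable {β k γ σ σ' σ₀ e : ℝ} {h ρ Y ρ' Y' : ℝ → ℝ}

/-- This is half the derivative of `orbitEnergy`, `x` being the difference of `ρ` and `z` that of `Y
- γ ρ`. With `r = 4 (γ - B) / γ` and `t = 1 / β`, both in `[0, 1]`, it is at most `p (-θ x ^ 2 + (r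
- t) x z + (r t - 3) z ^ 2 / θ)`. Here `β ≥ 1` gives `t ≤ 1`, and `3 γ / 4 ≤ B ≤ γ` gives the range
of `r`. -/
lemma energy_deriv_nonpos {θ p P B B₁ x z : ℝ} (hβ : 1 ≤ β) (hγ : 0 < γ) (hθ : 0 < θ) (hp : 0 < p)
    (hP : p ≤ P) (hB₁ : 3 * γ / 4 ≤ B₁) (hB : 3 * γ / 4 ≤ B) (hBγ : B ≤ γ) :
    x * (-(p * (θ * x + z / β))) +
      4 / (γ * θ) * (z * (-(P * (B₁ * z)) + (γ - B) * (p * (θ * x + z / β)))) ≤ 0 := by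
  set r := 4 * (γ - B) / γ with hr
  have hr0 : 0 ≤ r := div_nonneg (by linarith) hγ.le
  have hr1 : r ≤ 1 := by rw [hr, div_le_one hγ]; linarith
  set t := 1 / β with ht
  have ht0 : 0 < t := by positivity
  have ht1 : t ≤ 1 := by rw [ht, div_le_one (by linarith)]; exact hβ
  have h1 : 3 * γ / 4 * p ≤ P * B₁ := by
    have := mul_le_mul hP hB₁ (by positivity) (hp.le.trans hP); linarith
  have h2 : 4 / (γ * θ) * (z * (-(P * (B₁ * z)))) ≤ -(3 * p / θ * z ^ 2) := by
    have := mul_le_mul_of_nonneg_right h1 (sq_nonneg z)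
    have h3 := mul_le_mul_of_nonneg_left this (show 0 ≤ 4 / (γ * θ) by positivity)
    have e : 4 / (γ * θ) * (3 * γ / 4 * p * z ^ 2) = 3 * p / θ * z ^ 2 := by field_simp
    linarith
  have h4 : 4 / (γ * θ) * (z * ((γ - B) * (p * (θ * x + z / β)))) =
      p * (r * (x * z) + r * t * z ^ 2 / θ) := by
    rw [hr, ht]; field_simp
  have h5 : x * (-(p * (θ * x + z / β))) = -(p * (θ * x ^ 2 + t * (x * z))) := by
    rw [ht]; ring
  have h6 : -(θ * x ^ 2) + (r - t) * (x * z) + (r * t - 3) * (z ^ 2 / θ) ≤ 0 := by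
    have q0 : 0 ≤ z ^ 2 / θ := by positivity
    have q1 : (r * t - 3) * (z ^ 2 / θ) ≤ -2 * (z ^ 2 / θ) := by
      refine mul_le_mul_of_nonneg_right ?_ q0
      nlinarith
    have q2 : (r - t) * (x * z) ≤ |x * z| := by
      calc (r - t) * (x * z) ≤ |(r - t) * (x * z)| := le_abs_self _
        _ = |r - t| * |x * z| := abs_mul _ _
        _ ≤ 1 * |x * z| := by
          refine mul_le_mul_of_nonneg_right ?_ (abs_nonneg _)
          rw [abs_le]; constructor <;> linarith
        _ = |x * z| := one_mul _
    have q3 : |x * z| ≤ θ * x ^ 2 + z ^ 2 / θ := by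
      have s1 : 0 ≤ (θ * x + z) ^ 2 / θ := by positivity
      have s2 : 0 ≤ (θ * x - z) ^ 2 / θ := by positivity
      have e1 : (θ * x + z) ^ 2 / θ = θ * x ^ 2 + 2 * (x * z) + z ^ 2 / θ := by
        field_simp; ring
      have e2 : (θ * x - z) ^ 2 / θ = θ * x ^ 2 - 2 * (x * z) + z ^ 2 / θ := by
        field_simp; ring
      have : 0 ≤ θ * x ^ 2 := by positivity
      rw [abs_le]; constructor <;> linarith
    linarith
  have h7 := mul_nonpos_of_nonneg_of_nonpos hp.le h6
  have e : 3 * p / θ * z ^ 2 = p * (3 * (z ^ 2 / θ)) := by ring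
  have e' : r * t * z ^ 2 / θ = r * t * (z ^ 2 / θ) := by ring
  rw [e] at h2
  rw [e'] at h4
  have e3 : 4 / (γ * θ) * (z * (-(P * (B₁ * z)) + (γ - B) * (p * (θ * x + z / β)))) =
      4 / (γ * θ) * (z * (-(P * (B₁ * z)))) +
        4 / (γ * θ) * (z * ((γ - B) * (p * (θ * x + z / β)))) := by ring
  rw [e3, h4, h5]
  linarith

/-- The squared distance of two orbits in the coordinates `(log r, log (y / r ^ γ))`. -/
def orbitEnergy (β k γ : ℝ) (ρ Y ρ' Y' : ℝ → ℝ) (u : ℝ) : ℝ :=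
  (ρ u - ρ' u) ^ 2 + 4 / (γ * (γ / β - k)) * ((Y u - γ * ρ u) - (Y' u - γ * ρ' u)) ^ 2

/-- At the start `ρ = -∞`, so a Gronwall estimate from there is not available. Instead the distance
in suitable coordinates does not increase while `B ≥ 3 γ / 4`, which holds near the start of a
regular orbit since `B` starts from `γ`. -/
lemma antitoneOn_orbitEnergy (hp : Admissible β k γ) (hh : Nonlinearity h) (hσ : 0 ≤ σ)
    (hσ' : 0 ≤ σ') (ho : IsOrbit β k γ h σ e ρ Y) (ho' : IsOrbit β k γ h σ' e ρ' Y') {s : Set ℝ}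
    (hs : Convex ℝ s) (hsσ : s ⊆ Ioo σ e) (hsσ' : s ⊆ Ioo σ' e)
    (hB : ∀ u ∈ s, 3 * γ / 4 ≤ Bcoord γ h ρ Y u ∧ 3 * γ / 4 ≤ Bcoord γ h ρ' Y' u) :
    AntitoneOn (orbitEnergy β k γ ρ Y ρ' Y') s := by
  refine antitoneOn_of_hasDerivAt hs (fun u hu =>
    (((ho.deriv_ρ u (hsσ hu)).sub (ho'.deriv_ρ u (hsσ' hu))).pow 2).add
    (((((ho.deriv_Y u (hsσ hu)).sub ((ho.deriv_ρ u (hsσ hu)).const_mul γ)).sub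
      ((ho'.deriv_Y u (hsσ' hu)).sub ((ho'.deriv_ρ u (hsσ' hu)).const_mul γ))).pow 2).const_mul
      (4 / (γ * (γ / β - k))))) fun u hu => ?_
  have hu0 : 0 < u := hσ.trans_lt (hsσ hu).1
  have hhu := hh.pos u hu0
  obtain ⟨p, -, hp0, -, ⟨hp1, hp2⟩, -, hpe, -⟩ :=
    exists_linear_difference (ρ := ρ) (Y := Y) (ρ' := ρ') (Y' := Y') (γ := γ) (k := k) (β := β)
      hh hu0
  obtain ⟨c, hc1, hc2, hce⟩ := exists_exp_sub_exp (γ * ρ u - Y u) (γ * ρ' u - Y' u)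
  have hM : ∀ ρ Y : ℝ → ℝ, h u * Real.exp ((γ + k) * ρ u - (1 + 1 / β) * Y u) =
      Bcoord γ h ρ Y u * Real.exp (k * ρ u - Y u / β) := by
    intro ρ Y
    unfold Bcoord
    rw [mul_assoc, ← Real.exp_add]; ring_nf
  have hB1 := ho.B_le hp hh hσ (hsσ hu)
  have hB2 := ho'.B_le hp hh hσ' (hsσ' hu)
  obtain ⟨hB3, hB4⟩ := hB u hu
  have hBe : Bcoord γ h ρ Y u - Bcoord γ h ρ' Y' u =
      -(h u * c * ((Y u - γ * ρ u) - (Y' u - γ * ρ' u))) := by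
    unfold Bcoord; rw [← mul_sub, hce]; ring
  have hcB : 3 * γ / 4 ≤ h u * c := by
    have : min (Bcoord γ h ρ Y u) (Bcoord γ h ρ' Y' u) ≤ h u * c := by
      unfold Bcoord
      rw [← mul_min_of_nonneg _ _ hhu.le]; exact mul_le_mul_of_nonneg_left hc1 hhu.le
    exact (le_min hB3 hB4).trans this
  change Bcoord γ h ρ Y u ≤ γ at hB1
  change Bcoord γ h ρ' Y' u ≤ γ at hB2
  rw [hM ρ Y, hM ρ' Y']
  set P := Real.exp (k * ρ u - Y u / β) with hP
  set P' := Real.exp (k * ρ' u - Y' u / β) with hP'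
  set B := Bcoord γ h ρ Y u with hBd
  set B' := Bcoord γ h ρ' Y' u with hBd'
  set z := (Y u - γ * ρ u) - (Y' u - γ * ρ' u) with hz
  set x := ρ u - ρ' u with hx
  have hpe' : P - P' = -(p * ((γ / β - k) * x + z / β)) := by
    have hβ := hp.β_pos
    rw [hpe, hz, hx]; field_simp; ring
  -- The difference `B P - B' P'` is split so that the difference of the `B`'s is multiplied by the
  -- larger of `P` and `P'`. This is at least the mean `p`, so its damping dominates the terms with
  -- `p`.
  have hzd : ∃ Q B₀, p ≤ Q ∧ 3 * γ / 4 ≤ B₀ ∧ B₀ ≤ γ ∧ B * P - γ * P - (B' * P' - γ * P') =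
      -(Q * (h u * c * z)) + (γ - B₀) * (p * ((γ / β - k) * x + z / β)) := by
    rcases le_total P' P with hPP | hPP
    · refine ⟨P, B', by rwa [max_eq_left hPP] at hp2, hB4, hB2, ?_⟩
      linear_combination P * hBe + (B' - γ) * hpe'
    · refine ⟨P', B, by rwa [max_eq_right hPP] at hp2, hB3, hB1, ?_⟩
      linear_combination P' * hBe + (B - γ) * hpe'
  obtain ⟨Q, B₀, hQ, hB₀, hB₀', hze⟩ := hzd
  have := energy_deriv_nonpos (x := x) (z := z) hp.one_le hp.γ_pos hp.θ_pos hp0 hQ hcB hB₀ hB₀'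
  simp only [Pi.sub_apply]
  rw [hpe', hze]
  simp only [Nat.cast_ofNat, Nat.add_one_sub_one, pow_one]
  linarith

/-- Distance of two regular orbits in terms of their starting points. -/
lemma abs_sub_le_of_orbits (hp : Admissible β k γ) (hh : Nonlinearity h) (hσ : 0 < σ)
    (hσ' : 0 < σ') (ho : IsOrbit β k γ h σ e ρ Y) (ho' : IsOrbit β k γ h σ' e ρ' Y') {u : ℝ}
    (hu : u ∈ Ioo σ e) (hu' : u ∈ Ioo σ' e) :
    |(γ / β - k) * (ρ u - ρ' u)| ≤
      (2 * Real.log (speed β k γ h u) - Real.log (speed β k γ h σ) -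
        Real.log (speed β k γ h σ')) + |Real.log (u - σ) - Real.log (u - σ')| ∧
    |(Y u - γ * ρ u) - (Y' u - γ * ρ' u)| ≤
      Real.log (h σ) + Real.log (h σ') - 2 * Real.log (h u) := by
  have key : ∀ σ ρ Y, 0 < σ → IsOrbit β k γ h σ e ρ Y → u ∈ Ioo σ e →
      (Real.log (speed β k γ h σ) + Real.log (u - σ) ≤ (γ / β - k) * ρ u ∧
        (γ / β - k) * ρ u ≤ Real.log (speed β k γ h u) + Real.log (u - σ)) ∧
      (Real.log (h u) - Real.log γ ≤ Y u - γ * ρ u ∧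
        Y u - γ * ρ u ≤ Real.log (h σ) - Real.log γ) ∧
      Real.log (h u) ≤ Real.log (h σ) ∧
      Real.log (speed β k γ h σ) ≤ Real.log (speed β k γ h u) := by
    intro σ ρ Y hσ ho hu
    have hu0 : 0 < u := hσ.trans hu.1
    have s1 := speed_pos hp hh hσ
    have s2 := speed_pos hp hh hu0
    have d : 0 < u - σ := by linarith [hu.1]
    have h1 := ho.le_exp_θρ hp hh hσ hu
    have h2 := ho.exp_θρ_le hp hh hσ.le hu
    have h3 := ho.B_le hp hh hσ.le hu
    have h4 := ho.le_B hp hh hσ hu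
    have hhu := hh.pos u hu0
    have hhσ := hh.pos σ hσ
    refine ⟨⟨?_, ?_⟩, ⟨?_, ?_⟩, Real.log_le_log hhu (hh.anti hσ hu0 hu.1.le),
      Real.log_le_log s1 (speed_mono hp hh hσ hu0 hu.1.le)⟩
    · rw [← Real.log_mul s1.ne' d.ne', Real.log_le_iff_le_exp (by positivity)]; exact h1
    · rw [← Real.log_mul s2.ne' d.ne', Real.le_log_iff_exp_le (by positivity)]; exact h2
    · have := Real.log_le_log (by positivity) h3
      rw [Real.log_mul hhu.ne' (Real.exp_pos _).ne', Real.log_exp] at this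
      linarith
    · have := Real.log_le_log hp.γ_pos h4
      rw [Real.log_mul hhσ.ne' (Real.exp_pos _).ne', Real.log_exp] at this
      linarith
  obtain ⟨⟨a1, a2⟩, ⟨a3, a4⟩, a5, a6⟩ := key σ ρ Y hσ ho hu
  obtain ⟨⟨b1, b2⟩, ⟨b3, b4⟩, b5, b6⟩ := key σ' ρ' Y' hσ' ho' hu'
  have c1 := le_abs_self (Real.log (u - σ) - Real.log (u - σ'))
  have c2 := neg_le_abs (Real.log (u - σ) - Real.log (u - σ'))
  constructor
  · rw [abs_le, mul_sub]; constructor <;> linarith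
  · rw [abs_le]; constructor <;> linarith

/-- A bound for the energy near the starting points. -/
def energyBound (β k γ : ℝ) (h : ℝ → ℝ) (σ₀ σ u : ℝ) : ℝ :=
  (((2 * Real.log (speed β k γ h u) - Real.log (speed β k γ h σ) -
        Real.log (speed β k γ h σ₀)) + |Real.log (u - σ) - Real.log (u - σ₀)|) /
      (γ / β - k)) ^ 2 +
    4 / (γ * (γ / β - k)) * (Real.log (h σ) + Real.log (h σ₀) - 2 * Real.log (h u)) ^ 2

lemma orbitEnergy_le (hp : Admissible β k γ) (hh : Nonlinearity h) (hσ : 0 < σ)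
    (hσ' : 0 < σ₀) (ho : IsOrbit β k γ h σ e ρ Y) (ho' : IsOrbit β k γ h σ₀ e ρ' Y') {u : ℝ}
    (hu : u ∈ Ioo σ e) (hu' : u ∈ Ioo σ₀ e) :
    orbitEnergy β k γ ρ Y ρ' Y' u ≤ energyBound β k γ h σ₀ σ u := by
  obtain ⟨h1, h2⟩ := abs_sub_le_of_orbits hp hh hσ hσ' ho ho' hu hu'
  have hθ := hp.θ_pos
  have hγ := hp.γ_pos
  refine add_le_add ?_ (mul_le_mul_of_nonneg_left ?_ (by positivity))
  · rw [abs_mul, abs_of_pos hθ, mul_comm, ← le_div_iff₀ hθ] at h1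
    rw [← sq_abs]; gcongr
  · rw [← sq_abs]; gcongr

lemma tendsto_energyBound (hp : Admissible β k γ) (hh : Nonlinearity h) (hσ₀ : 0 < σ₀) {u : ℝ}
    (hu : σ₀ < u) :
    Tendsto (fun σ => energyBound β k γ h σ₀ σ u) (𝓝 σ₀) (𝓝 (energyBound β k γ h σ₀ σ₀ u)) := by
  have c1 : ContinuousAt (speed β k γ h) σ₀ := (continuousOn_speed hp hh).continuousAt
    (Ioi_mem_nhds hσ₀)
  have c2 : ContinuousAt h σ₀ := hh.continuousOn.continuousAt (Ioi_mem_nhds hσ₀)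
  have l1 : ContinuousAt (fun σ => Real.log (speed β k γ h σ)) σ₀ :=
    c1.log (speed_pos hp hh hσ₀).ne'
  have l2 : ContinuousAt (fun σ => Real.log (h σ)) σ₀ := c2.log (hh.pos _ hσ₀).ne'
  have l3 : ContinuousAt (fun σ => Real.log (u - σ)) σ₀ :=
    (continuousAt_const.sub continuousAt_id).log (by simp; linarith)
  exact ((((continuousAt_const.sub l1).sub continuousAt_const).add
    (l3.sub continuousAt_const).abs).div_const _ |>.pow 2).add
    (continuousAt_const.mul (((l2.add continuousAt_const).sub continuousAt_const).pow 2))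

/-- For equal starting points the singular terms `log (u - σ)` cancel, and the rest is continuous
and vanishes at `u = σ₀`. -/
lemma tendsto_energyBound_self (hp : Admissible β k γ) (hh : Nonlinearity h) (hσ₀ : 0 < σ₀) :
    Tendsto (fun u => energyBound β k γ h σ₀ σ₀ u) (𝓝[>] σ₀) (𝓝 0) := by
  have c1 : ContinuousAt (speed β k γ h) σ₀ := (continuousOn_speed hp hh).continuousAt
    (Ioi_mem_nhds hσ₀)
  have c2 : ContinuousAt h σ₀ := hh.continuousOn.continuousAt (Ioi_mem_nhds hσ₀)
  have l1 : ContinuousAt (fun σ => Real.log (speed β k γ h σ)) σ₀ :=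
    c1.log (speed_pos hp hh hσ₀).ne'
  have l2 : ContinuousAt (fun σ => Real.log (h σ)) σ₀ := c2.log (hh.pos _ hσ₀).ne'
  have hc : ContinuousAt (fun u => (((2 * Real.log (speed β k γ h u) -
      Real.log (speed β k γ h σ₀) - Real.log (speed β k γ h σ₀)) + 0) / (γ / β - k)) ^ 2 +
    4 / (γ * (γ / β - k)) * (Real.log (h σ₀) + Real.log (h σ₀) - 2 * Real.log (h u)) ^ 2) σ₀ :=
    ((((((continuousAt_const.mul l1).sub continuousAt_const).sub continuousAt_const).add
    continuousAt_const).div_const _).pow 2).add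
    (continuousAt_const.mul ((continuousAt_const.sub (continuousAt_const.mul l2)).pow 2))
  have h0 : (((2 * Real.log (speed β k γ h σ₀) -
      Real.log (speed β k γ h σ₀) - Real.log (speed β k γ h σ₀)) + 0) / (γ / β - k)) ^ 2 +
    4 / (γ * (γ / β - k)) * (Real.log (h σ₀) + Real.log (h σ₀) - 2 * Real.log (h σ₀)) ^ 2 = 0 := by
    ring
  have := hc.tendsto
  rw [h0] at this
  refine (this.mono_left nhdsWithin_le_nhds).congr fun u => ?_
  simp [energyBound]

lemma orbitEnergy_nonneg (hp : Admissible β k γ) (u : ℝ) :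
    0 ≤ orbitEnergy β k γ ρ Y ρ' Y' u := by
  have hθ := hp.θ_pos
  have hγ := hp.γ_pos
  unfold orbitEnergy; positivity

/-- Convergence of regular orbits near the starting point. -/
lemma tendsto_orbitEnergy (hp : Admissible β k γ) (hh : Nonlinearity h) (hσ₀ : 0 < σ₀)
    (he : σ₀ < e) (ho : IsOrbit β k γ h σ₀ e ρ Y) :
    ∃ u₁ ∈ Ioo σ₀ e, ∀ u ∈ Ioc σ₀ u₁, ∀ ε > 0, ∀ᶠ σ in 𝓝 σ₀, σ < u ∧
      ∀ ρ' Y', IsOrbit β k γ h σ e ρ' Y' → orbitEnergy β k γ ρ' Y' ρ Y u < ε := by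
  have hhc : ContinuousAt h σ₀ := hh.continuousOn.continuousAt (Ioi_mem_nhds hσ₀)
  have hpos := hh.pos σ₀ hσ₀
  -- With the factor `9 / 8` below this gives `h σ ≤ (9 / 7) h x`, hence `B ≥ 7 γ / 9 ≥ 3 γ / 4` by
  -- `le_B`, as the energy estimate requires.
  have e1 : ∀ᶠ u in 𝓝[>] σ₀, 7 / 8 * h σ₀ < h u :=
    (hhc.tendsto.mono_left nhdsWithin_le_nhds).eventually (lt_mem_nhds (by linarith))
  obtain ⟨u₁, hu₁h, hu₁⟩ := (e1.and (Ioo_mem_nhdsGT he)).exists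
  refine ⟨u₁, hu₁, fun u hu ε hε => ?_⟩
  have hu0 : 0 < u := hσ₀.trans hu.1
  have huh : 7 / 8 * h σ₀ < h u :=
    hu₁h.trans_le (hh.anti hu0 (hσ₀.trans hu₁.1) hu.2)
  have e2 : ∀ᶠ σ in 𝓝 σ₀, h σ < 9 / 8 * h σ₀ :=
    hhc.tendsto.eventually (gt_mem_nhds (by linarith))
  -- The order of choices matters: `w` makes the bound small for `σ = σ₀`, and only for this fixed
  -- `w > σ₀` is `σ` moved. From `w` to `u` the energy cannot increase.
  obtain ⟨w, hwε, hw⟩ := (((tendsto_energyBound_self (β := β) (k := k) (γ := γ) hp hh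
    hσ₀).eventually (gt_mem_nhds hε)).and (Ioo_mem_nhdsGT hu.1)).exists
  have e3 := (tendsto_energyBound (β := β) (k := k) (γ := γ) hp hh hσ₀ hw.1).eventually
    (gt_mem_nhds hwε)
  filter_upwards [e2, e3, Iio_mem_nhds hw.1, Ioi_mem_nhds hσ₀] with σ h2 h3 h4 h5
  have h4 : σ < w := h4
  have h5 : 0 < σ := h5
  refine ⟨h4.trans hw.2, fun ρ' Y' ho' => ?_⟩
  have hue : u < e := hu.2.trans_lt hu₁.2
  have hanti := antitoneOn_orbitEnergy hp hh h5.le hσ₀.le ho' ho (s := Icc w u) (convex_Icc _ _)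
    (fun x hx => ⟨h4.trans_le hx.1, hx.2.trans_lt hue⟩)
    (fun x hx => ⟨hw.1.trans_le hx.1, hx.2.trans_lt hue⟩) (fun x hx => ?_)
  · refine lt_of_le_of_lt (hanti ⟨le_rfl, hw.2.le⟩ ⟨hw.2.le, le_rfl⟩ hw.2.le)
      (lt_of_le_of_lt (orbitEnergy_le hp hh h5 hσ₀ ho' ho ⟨h4, hw.2.trans hue⟩
        ⟨hw.1, hw.2.trans hue⟩) h3)
  · have hx0 : 0 < x := (hσ₀.trans hw.1).trans_le hx.1
    have hxh : 7 / 8 * h σ₀ < h x := huh.trans_le (hh.anti hx0 hu0 hx.2)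
    have key : ∀ σ ρ Y, 0 < σ → σ < x → h σ < 9 / 8 * h σ₀ → IsOrbit β k γ h σ e ρ Y →
        3 * γ / 4 ≤ Bcoord γ h ρ Y x := by
      intro σ ρ Y hσ hσx hhσ ho
      have b1 := ho.le_B hp hh hσ ⟨hσx, hx.2.trans_lt hue⟩
      have b2 : h σ ≤ 9 / 7 * h x := by linarith
      have b3 := mul_le_mul_of_nonneg_right b2 (Real.exp_pos (γ * ρ x - Y x)).le
      have := hp.γ_pos
      unfold Bcoord; linarith
    exact ⟨key σ ρ' Y' h5 (h4.trans_le hx.1) h2 ho',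
      key σ₀ ρ Y hσ₀ (hw.1.trans_le hx.1) (by linarith) ho⟩

/-- The energy controls the distance. -/
lemma exists_dist_le_energy (hp : Admissible β k γ) : ∃ K > 0, ∀ (ρ Y ρ' Y' : ℝ → ℝ) (u : ℝ),
    dist (ρ u, Y u) (ρ' u, Y' u) ≤ K * √(orbitEnergy β k γ ρ Y ρ' Y' u) := by
  have hθ := hp.θ_pos
  have hγ := hp.γ_pos
  set N := 4 / (γ * (γ / β - k)) with hN
  have hN0 : 0 < N := by positivity
  refine ⟨1 + γ + 1 / √N, by positivity, fun ρ Y ρ' Y' u => ?_⟩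
  have h1 : |ρ u - ρ' u| ≤ √(orbitEnergy β k γ ρ Y ρ' Y' u) := by
    refine Real.abs_le_sqrt ?_
    unfold orbitEnergy
    have : 0 ≤ 4 / (γ * (γ / β - k)) * ((Y u - γ * ρ u) - (Y' u - γ * ρ' u)) ^ 2 := by positivity
    linarith
  have h2 : |(Y u - γ * ρ u) - (Y' u - γ * ρ' u)| ≤
      1 / √N * √(orbitEnergy β k γ ρ Y ρ' Y' u) := by
    rw [one_div_mul_eq_div, le_div_iff₀ (by positivity)]
    have : |(Y u - γ * ρ u) - (Y' u - γ * ρ' u)| * √N =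
        √(((Y u - γ * ρ u) - (Y' u - γ * ρ' u)) ^ 2 * N) := by
      rw [Real.sqrt_mul (sq_nonneg _), Real.sqrt_sq_eq_abs]
    rw [this]
    refine Real.sqrt_le_sqrt ?_
    unfold orbitEnergy
    have : 0 ≤ (ρ u - ρ' u) ^ 2 := sq_nonneg _
    linarith
  set S := √(orbitEnergy β k γ ρ Y ρ' Y' u) with hS
  have hS0 : 0 ≤ S := Real.sqrt_nonneg _
  have h3 : |Y u - Y' u| ≤ 1 / √N * S + γ * S := by
    have e : Y u - Y' u = ((Y u - γ * ρ u) - (Y' u - γ * ρ' u)) + γ * (ρ u - ρ' u) := by ring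
    rw [e]
    refine (abs_add_le _ _).trans (add_le_add h2 ?_)
    rw [abs_mul, abs_of_pos hγ]
    exact mul_le_mul_of_nonneg_left h1 hγ.le
  have p1 : 0 ≤ 1 / √N * S := by positivity
  have p2 : 0 ≤ γ * S := by positivity
  rw [Prod.dist_eq]
  refine max_le ?_ ?_
  · rw [Real.dist_eq]; linarith
  · rw [Real.dist_eq]; linarith

/-- Regular orbits depend continuously on the starting point, locally uniformly. -/
theorem tendsto_orbit (hp : Admissible β k γ) (hh : Nonlinearity h) (hσ₀ : 0 < σ₀)
    (ho : IsOrbit β k γ h σ₀ e ρ Y) {w w' ε : ℝ} (hw : σ₀ < w) (hw' : w' < e) (hε : 0 < ε) :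
    ∀ᶠ σ in 𝓝 σ₀, σ < w ∧ ∀ ρ' Y', IsOrbit β k γ h σ e ρ' Y' → ∀ u ∈ Icc w w',
      dist (ρ' u, Y' u) (ρ u, Y u) < ε := by
  rcases lt_or_ge w' w with hww | hww
  · filter_upwards [Iio_mem_nhds hw] with σ hσ
    exact ⟨hσ, fun _ _ _ u hu => absurd (hu.1.trans hu.2) (not_le.2 hww)⟩
  have he : σ₀ < e := (hw.trans_le hww).trans hw'
  obtain ⟨u₁, hu₁, hE⟩ := tendsto_orbitEnergy hp hh hσ₀ he ho
  -- Up to `v` the energy controls the distance; beyond `v` the vector field is Lipschitz on the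
  -- relevant box and the distance grows by at most the factor `M`.
  set v := min u₁ w with hv
  have hv0 : σ₀ < v := lt_min hu₁.1 hw
  have hvp : 0 < v := hσ₀.trans hv0
  obtain ⟨K₁, hK₁, hdist⟩ := exists_dist_le_energy hp
  set C := |ρ v| + |Y v| + 1 with hC
  obtain ⟨K, hK⟩ := exists_dist_orbit_le (C := C) hp hh hvp hw'
  set M := Real.exp (|K| * (w' - v)) with hM
  have hM0 : 0 < M := Real.exp_pos _
  set η := min 1 (ε / (2 * M)) with hη
  have hη0 : 0 < η := by positivity
  filter_upwards [hE v ⟨hv0, min_le_left _ _⟩ ((η / K₁) ^ 2) (by positivity),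
    Ioi_mem_nhds hσ₀] with σ hσ hσ0
  have hσ0 : 0 < σ := hσ0
  refine ⟨hσ.1.trans_le (min_le_right _ _), fun ρ' Y' ho' u hu => ?_⟩
  have d1 : dist (ρ' v, Y' v) (ρ v, Y v) < η := by
    refine lt_of_le_of_lt (hdist ρ' Y' ρ Y v) ?_
    have := Real.sqrt_lt_sqrt (orbitEnergy_nonneg hp v) (hσ.2 ρ' Y' ho')
    rw [Real.sqrt_sq (by positivity)] at this
    calc _ < K₁ * (η / K₁) := mul_lt_mul_of_pos_left this hK₁
      _ = η := by field_simp
  have d2 : |ρ' v - ρ v| < 1 := by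
    have := (le_max_left _ _).trans_lt (lt_of_lt_of_le d1 (min_le_left _ _))
    rwa [← Real.dist_eq]
  have d3 : |Y' v - Y v| < 1 := by
    have := (le_max_right _ _).trans_lt (lt_of_lt_of_le d1 (min_le_left _ _))
    rwa [← Real.dist_eq]
  rw [abs_lt] at d2 d3
  have a1 := neg_abs_le (ρ v)
  have a2 := neg_abs_le (Y v)
  have a3 := le_abs_self (Y v)
  have a4 := abs_nonneg (Y v)
  have a5 := abs_nonneg (ρ v)
  have hvu : v ≤ u := (min_le_right _ _).trans hu.1
  have := hK σ σ₀ ρ' Y' ρ Y hσ0.le hσ.1 hσ₀.le hv0 ho' ho (by linarith)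
    (by rw [abs_le]; constructor <;> linarith) (by linarith)
    (by rw [abs_le]; constructor <;> linarith) u ⟨hvu, hu.2⟩
  have hexp : Real.exp (K * (u - v)) ≤ M := by
    refine Real.exp_le_exp.2 (mul_le_mul (le_abs_self K) (by linarith [hu.2]) (by linarith)
      (abs_nonneg _))
  calc _ ≤ dist (ρ' v, Y' v) (ρ v, Y v) * Real.exp (K * (u - v)) := this
    _ ≤ η * M := mul_le_mul d1.le hexp (Real.exp_pos _).le hη0.le
    _ ≤ ε / (2 * M) * M := mul_le_mul_of_nonneg_right (min_le_right _ _) hM0.le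
    _ = ε / 2 := by field_simp
    _ < ε := by linarith

/-- Regular orbits are determined by their starting point. -/
theorem IsOrbit.unique_regular (hp : Admissible β k γ) (hh : Nonlinearity h) (hσ : 0 < σ)
    (ho : IsOrbit β k γ h σ e ρ Y) (ho' : IsOrbit β k γ h σ e ρ' Y') :
    ∀ u ∈ Ioo σ e, ρ u = ρ' u ∧ Y u = Y' u := by
  intro u hu
  -- Continuity at `σ` concerns all orbits from nearby starting points, in particular a second orbit
  -- from `σ` itself.
  have key : ∀ ε > 0, dist (ρ' u, Y' u) (ρ u, Y u) < ε := fun ε hε =>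
    ((tendsto_orbit hp hh hσ ho hu.1 hu.2 hε).self_of_nhds).2 ρ' Y' ho' u ⟨le_rfl, le_rfl⟩
  have h0 : dist (ρ' u, Y' u) (ρ u, Y u) = 0 :=
    le_antisymm (le_of_forall_pos_lt_add fun ε hε => by simpa using key ε hε) dist_nonneg
  have := dist_eq_zero.1 h0
  exact ⟨(Prod.ext_iff.1 this).1.symm, (Prod.ext_iff.1 this).2.symm⟩

end MEMS
end

noncomputable section
namespace MEMS

/-! ### Existence of regular orbits -/

/-- The restriction of a function to `[a, b]`, extended to be constant outside. -/
def clampFun (f : ℝ → ℝ) (a b : ℝ) (y : ℝ) : ℝ := f (max a (min y b))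

lemma clampFun_eq {f : ℝ → ℝ} {a b y : ℝ} (hy : y ∈ Icc a b) : clampFun f a b y = f y := by
  rw [clampFun, min_eq_left hy.2, max_eq_right hy.1]

lemma clamp_mem {a b : ℝ} (hab : a ≤ b) (y : ℝ) : max a (min y b) ∈ Icc a b :=
  ⟨le_max_left _ _, max_le hab (min_le_right _ _)⟩

lemma exists_lipschitzWith_clampFun {f : ℝ → ℝ} (hf : ContDiffOn ℝ 1 f (Ioi 0)) {a b : ℝ}
    (ha : 0 < a) (hab : a ≤ b) : ∃ C : NNReal, LipschitzWith C (clampFun f a b) := by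
  have hsub : Icc a b ⊆ Ioi 0 := fun x hx => ha.trans_le hx.1
  obtain ⟨C, hC⟩ := (hf.mono hsub).exists_lipschitzOnWith one_ne_zero (convex_Icc a b)
    isCompact_Icc
  refine ⟨C, LipschitzWith.of_dist_le_mul fun x y => ?_⟩
  refine (hC.dist_le_mul _ (clamp_mem hab x) _ (clamp_mem hab y)).trans ?_
  refine mul_le_mul_of_nonneg_left ?_ C.2
  rw [Real.dist_eq, Real.dist_eq]
  refine (abs_max_sub_max_le_max _ _ _ _).trans ?_
  refine max_le (by simp) ?_
  exact (abs_min_sub_min_le_max _ _ _ _).trans (max_le le_rfl (by simp))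

/-- The integral equation `U x = σ + ∫₀ˣ F (∫₀¹ G (U (ξ t ^ ν)) dt) dξ`. -/
lemma exists_solution_integral_equation {F G : ℝ → ℝ} {CF CG : NNReal} (hF : LipschitzWith CF F)
    (hG : LipschitzWith CG G) {B : ℝ} (hB : ∀ y, |F y| ≤ B) {ν : ℝ} (hν : 0 < ν) (σ : ℝ) :
    ∃ U : ℝ → ℝ, Continuous U ∧ ∀ x, 0 ≤ x →
      U x = σ + ∫ ξ in (0:ℝ)..x, F (∫ t in (0:ℝ)..1, G (U (ξ * t ^ ν))) := by
  -- The unknown is the bounded function `φ` with `U = σ + exp (κ |x|) φ`. In this weighted norm the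
  -- map contracts with factor `CF * CG / κ ≤ 1 / 2`, whatever the length of the interval; `|x|`
  -- extends everything to the whole line.
  set κ : ℝ := CF * CG * 2 + 1 with hκ
  have hκ0 : 0 < κ := by positivity
  have hB0 : 0 ≤ B := (abs_nonneg _).trans (hB 0)
  let W : BoundedContinuousFunction ℝ ℝ → ℝ → ℝ := fun φ x => σ + Real.exp (κ * |x|) * φ x
  have hWc : ∀ φ, Continuous (W φ) := fun φ => by
    have := φ.continuous
    fun_prop
  let Kf : (ℝ → ℝ) → ℝ → ℝ := fun U ξ => F (∫ t in (0:ℝ)..1, G (U (ξ * t ^ ν)))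
  have hrp : Continuous fun t : ℝ => t ^ ν := Real.continuous_rpow_const hν.le
  have hcomp : ∀ U : ℝ → ℝ, Continuous U →
      Continuous (Function.uncurry fun ξ t : ℝ => G (U (ξ * t ^ ν))) := fun U hU =>
    hG.continuous.comp (hU.comp (continuous_fst.mul (hrp.comp continuous_snd)))
  have hcomp' : ∀ U : ℝ → ℝ, Continuous U → ∀ ξ : ℝ, Continuous fun t : ℝ => G (U (ξ * t ^ ν)) :=
    fun U hU ξ => hG.continuous.comp (hU.comp (continuous_const.mul hrp))
  have hKc : ∀ U : ℝ → ℝ, Continuous U → Continuous (Kf U) := fun U hU =>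
    hF.continuous.comp
      (intervalIntegral.continuous_parametric_intervalIntegral_of_continuous' (hcomp U hU) 0 1)
  have hIc : ∀ U : ℝ → ℝ, Continuous U → Continuous fun x => ∫ ξ in (0:ℝ)..x, Kf U ξ := fun U hU =>
    intervalIntegral.continuous_primitive (fun a b => (hKc U hU).intervalIntegrable a b) 0
  let Tf : BoundedContinuousFunction ℝ ℝ → ℝ → ℝ := fun φ x =>
    Real.exp (-(κ * |x|)) * ∫ ξ in (0:ℝ)..|x|, Kf (W φ) ξ
  have hTc : ∀ φ, Continuous (Tf φ) := fun φ => by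
    have h1 := (hIc _ (hWc φ)).comp continuous_abs
    have h2 : Continuous fun x : ℝ => Real.exp (-(κ * |x|)) := by fun_prop
    exact h2.mul h1
  have hTb : ∀ φ x, ‖Tf φ x‖ ≤ B / κ := fun φ x => by
    have h1 : ‖∫ ξ in (0:ℝ)..|x|, Kf (W φ) ξ‖ ≤ B * |(|x|) - 0| :=
      intervalIntegral.norm_integral_le_of_norm_le_const fun ξ _ => hB _
    rw [sub_zero, abs_abs] at h1
    have h2 : κ * |x| + 1 ≤ Real.exp (κ * |x|) := Real.add_one_le_exp _
    rw [norm_mul, Real.norm_of_nonneg (Real.exp_pos _).le, Real.exp_neg]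
    rw [inv_mul_le_iff₀ (Real.exp_pos _)]
    refine h1.trans ?_
    rw [mul_div_assoc', le_div_iff₀ hκ0]
    nlinarith [abs_nonneg x]
  let T : BoundedContinuousFunction ℝ ℝ → BoundedContinuousFunction ℝ ℝ := fun φ =>
    BoundedContinuousFunction.ofNormedAddCommGroup (Tf φ) (hTc φ) (B / κ) (hTb φ)
  have hdiff : ∀ φ ψ : BoundedContinuousFunction ℝ ℝ, ∀ ξ, 0 ≤ ξ →
      ‖Kf (W φ) ξ - Kf (W ψ) ξ‖ ≤ CF * (CG * dist φ ψ) * Real.exp (κ * ξ) := fun φ ψ ξ hξ => by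
    rw [← dist_eq_norm]
    refine (hF.dist_le_mul _ _).trans ?_
    rw [mul_assoc]
    refine mul_le_mul_of_nonneg_left ?_ CF.2
    rw [dist_eq_norm, ← intervalIntegral.integral_sub ((hcomp' _ (hWc φ) ξ).intervalIntegrable _ _)
      ((hcomp' _ (hWc ψ) ξ).intervalIntegrable _ _)]
    have h1 : ‖∫ t in (0:ℝ)..1, (G (W φ (ξ * t ^ ν)) - G (W ψ (ξ * t ^ ν)))‖
        ≤ (CG * dist φ ψ * Real.exp (κ * ξ)) * |(1:ℝ) - 0| := by
      refine intervalIntegral.norm_integral_le_of_norm_le_const fun t ht => ?_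
      rw [uIoc_of_le zero_le_one] at ht
      rw [← dist_eq_norm]
      refine (hG.dist_le_mul _ _).trans ?_
      rw [mul_assoc]
      refine mul_le_mul_of_nonneg_left ?_ CG.2
      have h2 : t ^ ν ≤ 1 := Real.rpow_le_one ht.1.le ht.2 hν.le
      have h3 : 0 ≤ t ^ ν := Real.rpow_nonneg ht.1.le _
      have h4 : dist (W φ (ξ * t ^ ν)) (W ψ (ξ * t ^ ν))
          = Real.exp (κ * |ξ * t ^ ν|) * dist (φ (ξ * t ^ ν)) (ψ (ξ * t ^ ν)) := by
        simp only [W, Real.dist_eq]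
        rw [add_sub_add_left_eq_sub, ← mul_sub, abs_mul, abs_of_pos (Real.exp_pos _)]
      rw [h4, mul_comm]
      refine mul_le_mul (BoundedContinuousFunction.dist_coe_le_dist _) ?_ (Real.exp_pos _).le
        dist_nonneg
      refine Real.exp_le_exp.2 (mul_le_mul_of_nonneg_left ?_ hκ0.le)
      rw [abs_of_nonneg (mul_nonneg hξ h3)]
      exact mul_le_of_le_one_right hξ h2
    simpa using h1
  have hTlip : ContractingWith (1 / 2) T := by
    refine ⟨by rw [← NNReal.coe_lt_coe]; norm_num, LipschitzWith.of_dist_le_mul fun φ ψ => ?_⟩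
    rw [BoundedContinuousFunction.dist_le (by positivity)]
    intro x
    change dist (Tf φ x) (Tf ψ x) ≤ _
    have e1 : Tf φ x - Tf ψ x = Real.exp (-(κ * |x|)) *
        ∫ ξ in (0:ℝ)..|x|, (Kf (W φ) ξ - Kf (W ψ) ξ) := by
      rw [intervalIntegral.integral_sub ((hKc _ (hWc φ)).intervalIntegrable _ _)
        ((hKc _ (hWc ψ)).intervalIntegrable _ _)]
      simp only [Tf]; ring
    rw [dist_eq_norm, e1, norm_mul, Real.norm_of_nonneg (Real.exp_pos _).le, Real.exp_neg,
      inv_mul_le_iff₀ (Real.exp_pos _)]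
    have h1 : ‖∫ ξ in (0:ℝ)..|x|, (Kf (W φ) ξ - Kf (W ψ) ξ)‖
        ≤ ∫ ξ in (0:ℝ)..|x|, CF * (CG * dist φ ψ) * Real.exp (κ * ξ) := by
      refine intervalIntegral.norm_integral_le_of_norm_le (abs_nonneg x) ?_ ?_
      · exact Eventually.of_forall fun ξ hξ => hdiff φ ψ ξ hξ.1.le
      · exact Continuous.intervalIntegrable (by fun_prop) _ _
    refine h1.trans ?_
    have h2 : ∫ ξ in (0:ℝ)..|x|, (CF * (CG * dist φ ψ) : ℝ) * Real.exp (κ * ξ)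
        = CF * (CG * dist φ ψ) * ((Real.exp (κ * |x|) - 1) / κ) := by
      rw [intervalIntegral.integral_const_mul]
      congr 1
      rw [intervalIntegral.integral_comp_mul_left (fun y => Real.exp y) hκ0.ne', integral_exp]
      simp [div_eq_inv_mul]
    rw [h2]
    have h3 : (CF * CG : ℝ) / κ ≤ 1 / 2 := by
      rw [div_le_div_iff₀ hκ0 two_pos]; linarith
    have h4 : (CF * (CG * dist φ ψ) * ((Real.exp (κ * |x|) - 1) / κ) : ℝ)
        = (CF * CG / κ) * (dist φ ψ * (Real.exp (κ * |x|) - 1)) := by ring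
    rw [h4]
    have h5 : 0 ≤ Real.exp (κ * |x|) - 1 := by
      have := Real.add_one_le_exp (κ * |x|)
      have : 0 ≤ κ * |x| := by positivity
      linarith
    have h6 : 0 ≤ dist φ ψ * (Real.exp (κ * |x|) - 1) := mul_nonneg dist_nonneg h5
    have h7 := mul_le_mul_of_nonneg_right h3 h6
    refine h7.trans ?_
    have h8 : 0 ≤ dist φ ψ := dist_nonneg
    push_cast
    nlinarith
  set φ := hTlip.fixedPoint with hφ
  have hfix : T φ = φ := hTlip.fixedPoint_isFixedPt
  refine ⟨W φ, hWc φ, fun x hx => ?_⟩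
  have h1 : Tf φ x = φ x := DFunLike.congr_fun hfix x
  have h2 : W φ x = σ + Real.exp (κ * |x|) * Tf φ x := by rw [h1]
  rw [h2]
  simp only [Tf]
  rw [← mul_assoc, ← Real.exp_add, add_neg_cancel, Real.exp_zero, one_mul, abs_of_nonneg hx]

variable {β k γ : ℝ} {h : ℝ → ℝ} {σ e : ℝ}

/-- A solution curve `(U, ρ, Y)` with any parameter gives an orbit. -/
lemma exists_isOrbit_of_curve {U U' ρ Y : ℝ → ℝ} {a b : ℝ} (hab : a < b)
    (hU : ∀ x ∈ Ioo a b, HasDerivAt U (U' x) x) (hU' : ∀ x ∈ Ioo a b, 0 < U' x)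
    (hρ : ∀ x ∈ Ioo a b, HasDerivAt ρ (Real.exp (k * ρ x - Y x / β) * U' x) x)
    (hY : ∀ x ∈ Ioo a b, HasDerivAt Y
      (h (U x) * Real.exp ((γ + k) * ρ x - (1 + 1 / β) * Y x) * U' x) x)
    (hUa : Tendsto U (𝓝[>] a) (𝓝 σ)) (hUb : Tendsto U (𝓝[<] b) (𝓝 e))
    (hρa : Tendsto ρ (𝓝[>] a) atBot) :
    ∃ ψ : ℝ → ℝ, (∀ x ∈ Ioo a b, U x ∈ Ioo σ e ∧ ψ (U x) = x) ∧
      (∀ u ∈ Ioo σ e, ψ u ∈ Ioo a b ∧ U (ψ u) = u) ∧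
      Tendsto ψ (𝓝[<] e) (𝓝[<] b) ∧
      IsOrbit β k γ h σ e (ρ ∘ ψ) (Y ∘ ψ) := by
  obtain ⟨ψ, h1, h2, -, h4, h5⟩ := exists_inverse_of_hasDerivAt_pos hab hU hU' hUa hUb
  refine ⟨ψ, h1, fun u hu => ⟨(h2 u hu).1, (h2 u hu).2.1⟩, h5, ⟨fun u hu => ?_, fun u hu => ?_,
    hρa.comp h4⟩⟩
  · obtain ⟨h6, h7, h8⟩ := h2 u hu
    have := (hρ _ h6).comp u h8
    rwa [mul_assoc, mul_inv_cancel₀ (hU' _ h6).ne', mul_one] at this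
  · obtain ⟨h6, h7, h8⟩ := h2 u hu
    have := (hY _ h6).comp u h8
    rw [mul_assoc, mul_inv_cancel₀ (hU' _ h6).ne', mul_one, h7] at this
    exact this

end MEMS
end

/-! ### Regular orbits from the integral equation -/

noncomputable section
namespace MEMS

variable {β k γ : ℝ} {h : ℝ → ℝ} {σ e : ℝ}

/-- There is a regular orbit starting from every `σ > 0`. -/
lemma exists_isOrbit (hp : Admissible β k γ) (hh : Nonlinearity h) (hσ : 0 < σ) (hσe : σ < e) :
    ∃ ρ Y, IsOrbit β k γ h σ e ρ Y := by
  have hβ := hp.β_pos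
  have hγ := hp.γ_pos
  have hθ := hp.θ_pos
  set θ := γ / β - k with hθd
  set m := h e with hm
  set M := h σ with hM
  have hm0 : 0 < m := hh.pos e (hσ.trans hσe)
  have hmM : m ≤ M := hh.anti hσ (hσ.trans hσe) hσe.le
  -- With `x = r ^ θ` and `z = γ y / r ^ γ` the equation reads `U' = (1 / θ) (z / γ) ^ (1 / β)`,
  -- where `z x` is the mean of `h (U (x t ^ ν))` over `t ∈ (0, 1)` and `ν = θ / γ`. Clamping `h` to
  -- `[σ, e]`, and this power to the range `[m, M]` of `h`, makes both globally Lipschitz without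
  -- changing the equation where it is used.
  have hrpow : ContDiffOn ℝ 1 (fun z : ℝ => (1 / θ) * (z / γ) ^ (1 / β)) (Ioi 0) := by
    refine contDiffOn_const.mul ?_
    exact ContDiffOn.rpow_const_of_ne (contDiffOn_id.div_const γ)
      fun z hz => (div_pos hz hγ).ne'
  obtain ⟨CG, hG⟩ := exists_lipschitzWith_clampFun hh.contDiffOn hσ hσe.le
  obtain ⟨CF, hF⟩ := exists_lipschitzWith_clampFun hrpow hm0 hmM
  set G := clampFun h σ e with hGd
  set F := clampFun (fun z : ℝ => (1 / θ) * (z / γ) ^ (1 / β)) m M with hFd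
  set c := (1 / θ) * (m / γ) ^ (1 / β) with hc
  set B := (1 / θ) * (M / γ) ^ (1 / β) with hB
  have hc0 : 0 < c := by positivity
  have hFc : ∀ y, F y ∈ Icc c B := fun y => by
    have hy := clamp_mem hmM y
    constructor
    · refine mul_le_mul_of_nonneg_left (Real.rpow_le_rpow (by positivity) ?_ (by positivity))
        (by positivity)
      exact div_le_div_of_nonneg_right hy.1 hγ.le
    · refine mul_le_mul_of_nonneg_left (Real.rpow_le_rpow ?_ ?_ (by positivity))
        (by positivity)
      · exact div_nonneg (hm0.le.trans hy.1) hγ.le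
      · exact div_le_div_of_nonneg_right hy.2 hγ.le
  have hGm : ∀ y, G y ∈ Icc m M := fun y => by
    have hy := clamp_mem hσe.le y
    exact ⟨hh.anti (hσ.trans_le hy.1) (hσ.trans hσe) hy.2, hh.anti hσ (hσ.trans_le hy.1) hy.1⟩
  set ν := θ / γ with hνd
  have hν : 0 < ν := by positivity
  obtain ⟨U, hUc, hU⟩ := exists_solution_integral_equation hF hG (B := B)
    (fun y => by rw [abs_of_pos (hc0.trans_le (hFc y).1)]; exact (hFc y).2) hν σ
  have hrp : Continuous fun t : ℝ => t ^ ν := Real.continuous_rpow_const hν.le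
  have hGU : ∀ ξ : ℝ, Continuous fun t : ℝ => G (U (ξ * t ^ ν)) := fun ξ =>
    hG.continuous.comp (hUc.comp (continuous_const.mul hrp))
  set z : ℝ → ℝ := fun ξ => ∫ t in (0:ℝ)..1, G (U (ξ * t ^ ν)) with hz
  have hzc : Continuous z :=
    intervalIntegral.continuous_parametric_intervalIntegral_of_continuous'
      (f := fun ξ t : ℝ => G (U (ξ * t ^ ν)))
      (hG.continuous.comp (hUc.comp (continuous_fst.mul (hrp.comp continuous_snd)))) 0 1
  have hzm : ∀ ξ, z ξ ∈ Icc m M := fun ξ => by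
    have h1 : ∫ _ in (0:ℝ)..1, m = m := by simp
    have h2 : ∫ _ in (0:ℝ)..1, M = M := by simp
    constructor
    · rw [← h1]
      exact intervalIntegral.integral_mono_on zero_le_one (by simp)
        ((hGU ξ).intervalIntegrable _ _) fun t _ => (hGm _).1
    · rw [← h2]
      exact intervalIntegral.integral_mono_on zero_le_one ((hGU ξ).intervalIntegrable _ _)
        (by simp) fun t _ => (hGm _).2
  have hz0 : ∀ ξ, 0 < z ξ := fun ξ => hm0.trans_le (hzm ξ).1
  have hFz : ∀ ξ, F (z ξ) = (1 / θ) * (z ξ / γ) ^ (1 / β) := fun ξ => clampFun_eq (hzm ξ)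
  have hFzc : Continuous fun ξ => F (z ξ) := hF.continuous.comp hzc
  have hU0 : U 0 = σ := by rw [hU 0 le_rfl]; simp
  have hUd : ∀ x, 0 < x → HasDerivAt U (F (z x)) x := fun x hx => by
    have h1 := (intervalIntegral.integral_hasDerivAt_right (hFzc.intervalIntegrable 0 x)
      hFzc.stronglyMeasurable.stronglyMeasurableAtFilter hFzc.continuousAt).const_add σ
    refine h1.congr_of_eventuallyEq ?_
    filter_upwards [Ioi_mem_nhds hx] with y hy
    exact hU y (le_of_lt hy)
  have hUlow : ∀ x, 0 ≤ x → σ + c * x ≤ U x := fun x hx => by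
    rw [hU x hx]
    have h1 : ∫ _ in (0:ℝ)..x, c = c * x := by simp [mul_comm]
    rw [← h1]
    gcongr
    exact intervalIntegral.integral_mono_on hx (by simp) (hFzc.intervalIntegrable _ _)
      fun t _ => (hFc _).1
  obtain ⟨X, hX, hUX⟩ : ∃ X ∈ Icc 0 ((e - σ) / c), U X = e := by
    have h1 : (0:ℝ) ≤ (e - σ) / c := div_nonneg (by linarith) hc0.le
    refine intermediate_value_Icc h1 hUc.continuousOn ⟨?_, ?_⟩
    · rw [hU0]; exact hσe.le
    · have := hUlow _ h1
      rw [mul_div_cancel₀ _ hc0.ne'] at this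
      linarith
  have hX0 : 0 < X := by
    refine lt_of_le_of_ne hX.1 fun h0 => ?_
    rw [← h0, hU0] at hUX
    exact hσe.ne hUX
  have hUmono : StrictMonoOn U (Ici 0) := by
    refine strictMonoOn_of_deriv_pos (convex_Ici 0) hUc.continuousOn fun x hx => ?_
    rw [interior_Ici] at hx
    rw [(hUd x hx).deriv]
    exact hc0.trans_le (hFc _).1
  have hUmem : ∀ x ∈ Ioo 0 X, U x ∈ Icc σ e := fun x hx => by
    constructor
    · rw [← hU0]; exact (hUmono self_mem_Ici hx.1.le hx.1).le
    · rw [← hUX]; exact (hUmono hx.1.le hX0.le hx.2).le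
  -- As `x ^ (1 / ν) = r ^ γ`, the substitution `w = x ^ (1 / ν) t` turns the mean back into a
  -- primitive, which can be differentiated in its upper limit.
  have hy : ∀ x, 0 < x → x ^ (1 / ν) * z x = ∫ w in (0:ℝ)..x ^ (1 / ν), G (U (w ^ ν)) := by
    intro x hx
    have hxp : 0 < x ^ (1 / ν) := Real.rpow_pos_of_pos hx _
    have h1 := intervalIntegral.mul_integral_comp_mul_left (a := 0) (b := 1)
      (f := fun w => G (U (w ^ ν))) (c := x ^ (1 / ν))
    rw [mul_zero, mul_one] at h1
    rw [← h1, hz]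
    congr 1
    refine intervalIntegral.integral_congr fun t ht => ?_
    rw [uIcc_of_le zero_le_one] at ht
    rw [Real.mul_rpow hxp.le ht.1, ← Real.rpow_mul hx.le, one_div_mul_cancel hν.ne', Real.rpow_one]
  have hyd : ∀ x, 0 < x →
      HasDerivAt (fun x => x ^ (1 / ν) * z x) (G (U x) * (1 / ν * x ^ (1 / ν - 1))) x := by
    intro x hx
    have hgc : Continuous fun w : ℝ => G (U (w ^ ν)) := hG.continuous.comp (hUc.comp hrp)
    have h1 := intervalIntegral.integral_hasDerivAt_right (hgc.intervalIntegrable 0 (x ^ (1 / ν)))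
      hgc.stronglyMeasurable.stronglyMeasurableAtFilter hgc.continuousAt
    have h2 : HasDerivAt (fun x : ℝ => x ^ (1 / ν)) (1 / ν * x ^ (1 / ν - 1)) x :=
      Real.hasDerivAt_rpow_const (Or.inl hx.ne')
    have h3 := h1.comp x h2
    rw [← Real.rpow_mul hx.le, one_div_mul_cancel hν.ne', Real.rpow_one] at h3
    refine h3.congr_of_eventuallyEq ?_
    filter_upwards [Ioi_mem_nhds hx] with y hy'
    exact hy y hy'
  set ρ : ℝ → ℝ := fun x => Real.log x / θ with hρ
  set Y : ℝ → ℝ := fun x => Real.log (x ^ (1 / ν) * z x / γ) with hYd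
  have hrel : ∀ x, 0 < x → Real.exp (Y x - γ * ρ x) = z x / γ := fun x hx => by
    have hxp : 0 < x ^ (1 / ν) := Real.rpow_pos_of_pos hx _
    rw [Real.exp_sub, Real.exp_log (by have := hz0 x; positivity)]
    have h1 : Real.exp (γ * ρ x) = x ^ (1 / ν) := by
      rw [Real.rpow_def_of_pos hx, hρ, hνd]; congr 1; field_simp
    rw [h1]; field_simp
  have hrel2 : ∀ x, 0 < x → Real.exp (k * ρ x - Y x / β) * F (z x) = 1 / (θ * x) := fun x hx => by
    have h1 : (z x / γ) ^ (1 / β) = Real.exp ((Y x - γ * ρ x) / β) := by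
      rw [← hrel x hx, ← Real.exp_mul]; congr 1; ring
    have h2 : Real.exp (k * ρ x - Y x / β) * Real.exp ((Y x - γ * ρ x) / β) = x⁻¹ := by
      rw [← Real.exp_add, ← Real.exp_log hx, ← Real.exp_neg]
      simp only [hρ, Real.log_exp]
      congr 1
      have : k * (Real.log x / θ) - γ * (Real.log x / θ) / β = - Real.log x := by
        have : -Real.log x = -(Real.log x / θ) * θ := by field_simp
        rw [this, hθd]; ring
      rw [← this]; ring
    rw [hFz, h1, ← mul_assoc, mul_comm (Real.exp _) (1 / θ), mul_assoc, h2]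
    field_simp
  obtain ⟨ψ, -, -, -, ho⟩ := exists_isOrbit_of_curve (β := β) (k := k) (γ := γ) (h := h) (σ := σ)
    (e := e) (U := U) (U' := fun x => F (z x)) (ρ := ρ) (Y := Y) hX0
    (fun x hx => hUd x hx.1) (fun x hx => hc0.trans_le (hFc _).1)
    (fun x hx => by
      rw [hrel2 x hx.1]
      have h1 := (Real.hasDerivAt_log hx.1.ne').div_const θ
      have h2 : 1 / (θ * x) = x⁻¹ / θ := by rw [one_div, mul_inv, mul_comm, div_eq_mul_inv]
      rw [h2]; exact h1)
    (fun x hx => by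
      have hx0 := hx.1
      have hxp : 0 < x ^ (1 / ν) := Real.rpow_pos_of_pos hx0 _
      have h1 := ((hyd x hx0).div_const γ).log (by have := hz0 x; positivity)
      have h3 : Real.exp ((γ + k) * ρ x - (1 + 1 / β) * Y x)
          = (z x / γ)⁻¹ * Real.exp (k * ρ x - Y x / β) := by
        rw [← hrel x hx0, ← Real.exp_neg, ← Real.exp_add]; congr 1; ring
      have h4 : h (U x) * Real.exp ((γ + k) * ρ x - (1 + 1 / β) * Y x) * F (z x)
          = h (U x) * (z x / γ)⁻¹ * (1 / (θ * x)) := by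
        rw [h3, ← hrel2 x hx0]; ring
      rw [h4]
      refine h1.congr_deriv ?_
      rw [hGd, clampFun_eq (hUmem x hx), Real.rpow_sub_one hx0.ne']
      have h5 := (hz0 x).ne'
      have h6 : 1 / ν = γ / θ := by rw [hνd, one_div_div]
      have h7 := hxp.ne'
      rw [div_div_eq_mul_div, div_mul_cancel₀ _ hγ.ne']
      generalize x ^ (1 / ν) = p at *
      rw [h6]
      field_simp)
    (by
      have := hUc.continuousAt (x := 0) |>.tendsto
      rw [hU0] at this
      exact this.mono_left nhdsWithin_le_nhds)
    (by
      have := hUc.continuousAt (x := X) |>.tendsto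
      rw [hUX] at this
      exact this.mono_left nhdsWithin_le_nhds)
    (Real.tendsto_log_nhdsGT_zero.atBot_div_const hθ)
  exact ⟨_, _, ho⟩

end MEMS
end

noncomputable section
namespace MEMS

/-! ### The singular orbit -/

variable {β k γ δ u₁ σ e : ℝ} {h L ω D ρ Y ρ' Y' : ℝ → ℝ}

lemma abs_log_sub_log_le {a b : ℝ} (hb : 0 < b) (h : |a - b| < b / 2) :
    |Real.log a - Real.log b| ≤ 1 := by
  rw [abs_lt] at h
  have ha : 0 < a := by linarith
  rw [← Real.log_div ha.ne' hb.ne', abs_le]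
  have h1 : a / b ≤ 3 / 2 := by rw [div_le_iff₀ hb]; linarith
  have h2 : b / a ≤ 2 := by rw [div_le_iff₀ ha]; linarith
  have h3 := Real.log_le_sub_one_of_pos (div_pos ha hb)
  have h4 := Real.log_le_sub_one_of_pos (div_pos hb ha)
  have h5 : Real.log (b / a) = -Real.log (a / b) := by rw [← Real.log_inv, inv_div]
  constructor <;> linarith

/-- Orbits near the equilibrium are bounded, and near each other. -/
lemma IsGrowth.exists_bound_near (hg : IsGrowth β δ u₁ h L ω D) (hp : Admissible β k γ)
    (hh : Nonlinearity h) (h0 : 0 < u₁) :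
    ∃ ε K : ℝ, 0 < ε ∧ 0 < K ∧
      (∀ u ∈ Ioo 0 u₁, ∃ C, ∀ ρ Y : ℝ → ℝ, |Acoord β k ω ρ Y u - Aeq β k γ δ| < ε →
        |Bcoord γ h ρ Y u - Beq β k γ δ| < ε → |ρ u| ≤ C ∧ |Y u| ≤ C) ∧
      ∀ u ∈ Ioo 0 u₁, ∀ ρ Y ρ' Y' : ℝ → ℝ, |Acoord β k ω ρ Y u - Aeq β k γ δ| < ε →
        |Bcoord γ h ρ Y u - Beq β k γ δ| < ε → |Acoord β k ω ρ' Y' u - Aeq β k γ δ| < ε →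
        |Bcoord γ h ρ' Y' u - Beq β k γ δ| < ε →
        (ρ u - ρ' u) ^ 2 + (Y u - Y' u) ^ 2 ≤ K := by
  have hδ := hg.δ_nonneg h0
  have hA := Aeq_pos hp hδ
  have hB := Beq_pos hp hδ
  obtain ⟨K₁, K₂, -, hK₂, -, hcmp⟩ := exists_coordinate_comparison hp
  -- `log A` and `log B` are affine in `(ρ, Y)` at fixed `u`. Within half of the equilibrium values
  -- they differ by at most `1` from their equilibrium values, and `hcmp` converts this into bounds
  -- for `ρ` and `Y`.
  have hlogA : ∀ u ∈ Ioo 0 u₁, ∀ ρ Y : ℝ → ℝ,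
      Real.log (Acoord β k ω ρ Y u) = Real.log (ω u) + (Y u / β - k * ρ u) := by
    intro u hu ρ Y
    rw [Acoord, Real.log_mul (hg.ω_pos u hu).ne' (Real.exp_pos _).ne', Real.log_exp]
  have hlogB : ∀ u ∈ Ioo 0 u₁, ∀ ρ Y : ℝ → ℝ,
      Real.log (Bcoord γ h ρ Y u) = Real.log (h u) + (γ * ρ u - Y u) := by
    intro u hu ρ Y
    rw [Bcoord, Real.log_mul (hh.pos u hu.1).ne' (Real.exp_pos _).ne', Real.log_exp]
  set ε := min (Aeq β k γ δ / 2) (Beq β k γ δ / 2) with hε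
  refine ⟨ε, K₂ * 8, by positivity, by positivity, ?_, ?_⟩
  · intro u hu
    set S := K₂ * ((1 + |Real.log (Aeq β k γ δ) - Real.log (ω u)|) ^ 2 +
      (1 + |Real.log (Beq β k γ δ) - Real.log (h u)|) ^ 2) with hS
    have hS0 : 0 ≤ S := by positivity
    refine ⟨S + 1, fun ρ Y h1 h2 => ?_⟩
    have a1 := abs_log_sub_log_le hA (h1.trans_le (min_le_left _ _))
    have b1 := abs_log_sub_log_le hB (h2.trans_le (min_le_right _ _))
    rw [hlogA u hu] at a1
    rw [hlogB u hu] at b1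
    have a2 : |Y u / β - k * ρ u| ≤ 1 + |Real.log (Aeq β k γ δ) - Real.log (ω u)| := by
      have : Y u / β - k * ρ u = (Real.log (ω u) + (Y u / β - k * ρ u) - Real.log (Aeq β k γ δ)) +
        (Real.log (Aeq β k γ δ) - Real.log (ω u)) := by ring
      rw [this]; exact (abs_add_le _ _).trans (by linarith)
    have b2 : |γ * ρ u - Y u| ≤ 1 + |Real.log (Beq β k γ δ) - Real.log (h u)| := by
      have : γ * ρ u - Y u = (Real.log (h u) + (γ * ρ u - Y u) - Real.log (Beq β k γ δ)) +
        (Real.log (Beq β k γ δ) - Real.log (h u)) := by ring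
      rw [this]; exact (abs_add_le _ _).trans (by linarith)
    have a3 := sq_le_sq' (by linarith [neg_abs_le (Y u / β - k * ρ u)] :
      -(1 + |Real.log (Aeq β k γ δ) - Real.log (ω u)|) ≤ _) ((le_abs_self _).trans a2)
    have b3 := sq_le_sq' (by linarith [neg_abs_le (γ * ρ u - Y u)] :
      -(1 + |Real.log (Beq β k γ δ) - Real.log (h u)|) ≤ _) ((le_abs_self _).trans b2)
    have key : (ρ u) ^ 2 + (Y u) ^ 2 ≤ S :=
      (hcmp (ρ u) (Y u)).trans (mul_le_mul_of_nonneg_left (add_le_add a3 b3) hK₂.le)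
    constructor
    · refine abs_le_of_sq_le_sq ?_ (by linarith)
      nlinarith [sq_nonneg (Y u)]
    · refine abs_le_of_sq_le_sq ?_ (by linarith)
      nlinarith [sq_nonneg (ρ u)]
  · intro u hu ρ Y ρ' Y' h1 h2 h3 h4
    have a1 := abs_log_sub_log_le hA (h1.trans_le (min_le_left _ _))
    have b1 := abs_log_sub_log_le hB (h2.trans_le (min_le_right _ _))
    have a1' := abs_log_sub_log_le hA (h3.trans_le (min_le_left _ _))
    have b1' := abs_log_sub_log_le hB (h4.trans_le (min_le_right _ _))
    rw [hlogA u hu, abs_le] at a1 a1'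
    rw [hlogB u hu, abs_le] at b1 b1'
    refine (hcmp _ _).trans (mul_le_mul_of_nonneg_left ?_ hK₂.le)
    have e1 : (Y u - Y' u) / β - k * (ρ u - ρ' u) = (Y u / β - k * ρ u) - (Y' u / β - k * ρ' u) := by
      ring
    have e2 : γ * (ρ u - ρ' u) - (Y u - Y' u) = (γ * ρ u - Y u) - (γ * ρ' u - Y' u) := by ring
    rw [e1, e2]
    have a4 : ((Y u / β - k * ρ u) - (Y' u / β - k * ρ' u)) ^ 2 ≤ 2 ^ 2 :=
      sq_le_sq' (by linarith) (by linarith)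
    have b4 : ((γ * ρ u - Y u) - (γ * ρ' u - Y' u)) ^ 2 ≤ 2 ^ 2 :=
      sq_le_sq' (by linarith) (by linarith)
    linarith

/-- Orbits starting near `0` are close to each other. -/
theorem IsGrowth.exists_close (hg : IsGrowth β δ u₁ h L ω D) (hp : Admissible β k γ)
    (hh : Nonlinearity h) (h0 : 0 < u₁) (he : u₁ ≤ e) {a b ε : ℝ} (ha : 0 < a) (hb : b < e)
    (hε : 0 < ε) :
    ∃ σ₁ : ℝ, 0 < σ₁ ∧ σ₁ < a ∧ ∀ σ σ' ρ Y ρ' Y', 0 ≤ σ → σ < σ₁ → 0 ≤ σ' → σ' < σ₁ →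
      IsOrbit β k γ h σ e ρ Y → IsOrbit β k γ h σ' e ρ' Y' →
      ∀ u ∈ Icc a b, dist (ρ u, Y u) (ρ' u, Y' u) < ε := by
  obtain ⟨ε₁, c, C, hε₁, hc, hC, hcontr⟩ := hg.exists_contraction hp hh h0
  obtain ⟨ε₂, K₀, hε₂, hK₀, hbd, hdiff⟩ := hg.exists_bound_near hp hh h0
  obtain ⟨T, u₀, hu₀, hreg, hsing⟩ := hg.exists_near_equilibrium hp hh h0 (lt_min hε₁ hε₂)
  set a' := min a (u₀ / 2) with ha'
  have ha'0 : 0 < a' := lt_min ha (by linarith [hu₀.1])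
  have ha'u : a' < u₀ := (min_le_right _ _).trans_lt (by linarith [hu₀.1])
  have ha'a : a' ≤ a := min_le_left _ _
  have ha'1 : a' ∈ Ioo 0 u₁ := ⟨ha'0, ha'u.trans hu₀.2⟩
  obtain ⟨B, hB⟩ := hbd a' ha'1
  obtain ⟨K, hK⟩ := exists_dist_orbit_le (C := B) hp hh ha'0 hb
  set M := Real.exp (|K| * (b - a')) with hM
  have hM0 : 0 < M := Real.exp_pos _
  set η := ε / (2 * M) with hη
  have hη0 : 0 < η := by positivity
  -- `N` is the `L`-time in which contraction reduces the squared distance `K₀` to `η ^ 2`. The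
  -- point `w₁` lies that long before `a'`, and `σ₁` a further `T` before `w₁`, so every orbit
  -- starting below `σ₁` is near the equilibrium throughout `[w₁, a']`.
  set N := Real.log (C * K₀ / η ^ 2) / c with hN
  have hNe : C * K₀ * Real.exp (-c * N) = η ^ 2 := by
    have : -c * N = - Real.log (C * K₀ / η ^ 2) := by rw [hN]; field_simp
    rw [this, Real.exp_neg, Real.exp_log (by positivity)]
    field_simp
  obtain ⟨w₁, hw₁, hLw⟩ := hg.eventually_lt ha'0 (L a' - N)
  obtain ⟨σ₁, hσ₁, hLσ⟩ := hg.eventually_lt hw₁.1 (L w₁ - T)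
  have hmono := hg.strictMono_L
  have hnear : ∀ σ ρ Y, 0 ≤ σ → σ < σ₁ → IsOrbit β k γ h σ e ρ Y → ∀ u ∈ Icc w₁ a',
      |Acoord β k ω ρ Y u - Aeq β k γ δ| < min ε₁ ε₂ ∧
      |Bcoord γ h ρ Y u - Beq β k γ δ| < min ε₁ ε₂ := by
    intro σ ρ Y hσ hσ' ho u hu
    have hu0 : 0 < u := hw₁.1.trans_le hu.1
    have huu : u < u₀ := hu.2.trans_lt ha'u
    rcases hσ.eq_or_lt with rfl | hσp
    · exact hsing e ρ Y he ho u ⟨hu0, huu⟩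
    · refine hreg σ e ρ Y hσp he ho u ⟨(hσ'.trans hσ₁.2).trans_le hu.1, huu⟩ ?_
      have h1 : L σ < L σ₁ := hmono ⟨hσp, (hσ'.trans hσ₁.2).trans (hw₁.2.trans ha'1.2)⟩
        ⟨hσ₁.1, hσ₁.2.trans (hw₁.2.trans ha'1.2)⟩ hσ'
      have h2 : L w₁ ≤ L u := hmono.monotoneOn ⟨hw₁.1, hw₁.2.trans ha'1.2⟩
        ⟨hu0, huu.trans hu₀.2⟩ hu.1
      linarith
  refine ⟨σ₁, hσ₁.1, (hσ₁.2.trans hw₁.2).trans_le ha'a, ?_⟩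
  intro σ σ' ρ Y ρ' Y' hσ hσ1 hσ' hσ1' ho ho' u hu
  have n1 := hnear σ ρ Y hσ hσ1 ho
  have n2 := hnear σ' ρ' Y' hσ' hσ1' ho'
  have hw₁m : w₁ ∈ Icc w₁ a' := ⟨le_rfl, hw₁.2.le⟩
  have ha'm : a' ∈ Icc w₁ a' := ⟨hw₁.2.le, le_rfl⟩
  have d1 := hcontr σ σ' e ρ Y ρ' Y' w₁ a' hσ hσ' he ho ho' (hσ1.trans hσ₁.2) (hσ1'.trans hσ₁.2)
    hw₁.2.le ha'1.2 fun v hv => ⟨⟨(n1 v hv).1.trans_le (min_le_left _ _),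
      (n1 v hv).2.trans_le (min_le_left _ _)⟩, (n2 v hv).1.trans_le (min_le_left _ _),
      (n2 v hv).2.trans_le (min_le_left _ _)⟩
  have d2 := hdiff w₁ ⟨hw₁.1, hw₁.2.trans ha'1.2⟩ ρ Y ρ' Y'
    ((n1 w₁ hw₁m).1.trans_le (min_le_right _ _)) ((n1 w₁ hw₁m).2.trans_le (min_le_right _ _))
    ((n2 w₁ hw₁m).1.trans_le (min_le_right _ _)) ((n2 w₁ hw₁m).2.trans_le (min_le_right _ _))
  have d3 : (ρ a' - ρ' a') ^ 2 + (Y a' - Y' a') ^ 2 ≤ η ^ 2 := by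
    refine d1.trans ?_
    rw [← hNe]
    refine mul_le_mul (mul_le_mul_of_nonneg_left d2 hC.le) ?_ (Real.exp_pos _).le (by positivity)
    refine Real.exp_le_exp.2 ?_
    nlinarith
  have d4 : dist (ρ a', Y a') (ρ' a', Y' a') ≤ η := by
    rw [Prod.dist_eq]
    refine max_le ?_ ?_
    · refine abs_le_of_sq_le_sq (by nlinarith [sq_nonneg (Y a' - Y' a')]) hη0.le
    · refine abs_le_of_sq_le_sq (by nlinarith [sq_nonneg (ρ a' - ρ' a')]) hη0.le
  have b1 := hB ρ Y ((n1 a' ha'm).1.trans_le (min_le_right _ _))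
    ((n1 a' ha'm).2.trans_le (min_le_right _ _))
  have b2 := hB ρ' Y' ((n2 a' ha'm).1.trans_le (min_le_right _ _))
    ((n2 a' ha'm).2.trans_le (min_le_right _ _))
  have hσa : σ₁ < a' := hσ₁.2.trans hw₁.2
  have d5 := hK σ σ' ρ Y ρ' Y' hσ (hσ1.trans hσa) hσ' (hσ1'.trans hσa) ho ho'
    (abs_le.1 b1.1).1 b1.2 (abs_le.1 b2.1).1 b2.2 u ⟨ha'a.trans hu.1, hu.2⟩
  have hexp : Real.exp (K * (u - a')) ≤ M :=
    Real.exp_le_exp.2 (mul_le_mul (le_abs_self K) (by linarith [hu.2])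
      (by linarith [hu.1]) (abs_nonneg _))
  calc _ ≤ _ := d5
    _ ≤ η * M := mul_le_mul d4 hexp (Real.exp_pos _).le hη0.le
    _ = ε / 2 := by rw [hη]; field_simp
    _ < ε := by linarith

/-- In `exists_close` both starting points may be `0`, and `ε` is arbitrary. -/
lemma IsGrowth.unique_singular (hg : IsGrowth β δ u₁ h L ω D) (hp : Admissible β k γ)
    (hh : Nonlinearity h) (h0 : 0 < u₁) (he : u₁ ≤ e) (ho : IsOrbit β k γ h 0 e ρ Y)
    (ho' : IsOrbit β k γ h 0 e ρ' Y') : ∀ u ∈ Ioo 0 e, ρ u = ρ' u ∧ Y u = Y' u := by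
  intro u hu
  have key : ∀ ε > 0, dist (ρ u, Y u) (ρ' u, Y' u) < ε := fun ε hε => by
    obtain ⟨σ₁, hσ₁, -, hcl⟩ := hg.exists_close hp hh h0 he hu.1 hu.2 hε
    exact hcl 0 0 ρ Y ρ' Y' le_rfl hσ₁ le_rfl hσ₁ ho ho' u ⟨le_rfl, le_rfl⟩
  have h0 : dist (ρ u, Y u) (ρ' u, Y' u) = 0 :=
    le_antisymm (le_of_forall_pos_lt_add fun ε hε => by simpa using key ε hε) dist_nonneg
  have := dist_eq_zero.1 h0
  exact ⟨(Prod.ext_iff.1 this).1, (Prod.ext_iff.1 this).2⟩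

/-- The singular orbit exists. -/
theorem IsGrowth.exists_singular (hg : IsGrowth β δ u₁ h L ω D) (hp : Admissible β k γ)
    (hh : Nonlinearity h) (h0 : 0 < u₁) (he : u₁ ≤ e) : ∃ ρ Y, IsOrbit β k γ h 0 e ρ Y := by
  have he0 : 0 < e := h0.trans_le he
  have hβ := hp.β_pos
  choose! R S hRS using fun σ (hσ : σ ∈ Ioo 0 e) => exists_isOrbit hp hh hσ.1 hσ.2
  have hclose : ∀ a b ε : ℝ, 0 < a → b < e → 0 < ε → ∃ σ₁ : ℝ, 0 < σ₁ ∧ σ₁ < a ∧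
      ∀ σ ∈ Ioo 0 σ₁, ∀ σ' ∈ Ioo 0 σ₁, ∀ u ∈ Icc a b,
        dist (R σ u, S σ u) (R σ' u, S σ' u) < ε := by
    intro a b ε ha hb hε
    obtain ⟨σ₁, h1, h2, h3⟩ := hg.exists_close hp hh h0 he ha hb hε
    refine ⟨min σ₁ e, lt_min h1 he0, (min_le_left _ _).trans_lt h2, fun σ hσ σ' hσ' u hu => ?_⟩
    exact h3 σ σ' _ _ _ _ hσ.1.le (hσ.2.trans_le (min_le_left _ _)) hσ'.1.le
      (hσ'.2.trans_le (min_le_left _ _)) (hRS σ ⟨hσ.1, hσ.2.trans_le (min_le_right _ _)⟩)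
      (hRS σ' ⟨hσ'.1, hσ'.2.trans_le (min_le_right _ _)⟩) u hu
  have hlim : ∀ u ∈ Ioo 0 e, ∃ z : ℝ × ℝ, Tendsto (fun σ => (R σ u, S σ u)) (𝓝[>] 0) (𝓝 z) := by
    intro u hu
    refine cauchy_map_iff_exists_tendsto.1 ?_
    rw [Metric.cauchy_iff]
    refine ⟨inferInstance, fun ε hε => ?_⟩
    obtain ⟨σ₁, h1, -, h3⟩ := hclose u u ε hu.1 hu.2 hε
    refine ⟨(fun σ => (R σ u, S σ u)) '' Ioo 0 σ₁, image_mem_map (Ioo_mem_nhdsGT h1), ?_⟩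
    rintro _ ⟨σ, hσ, rfl⟩ _ ⟨σ', hσ', rfl⟩
    exact h3 σ hσ σ' hσ' u ⟨le_rfl, le_rfl⟩
  choose! z hz using hlim
  have hunif : ∀ a b : ℝ, 0 < a → b < e →
      TendstoUniformlyOn (fun σ u => (u, R σ u, S σ u)) (fun u => (u, z u)) (𝓝[>] 0)
        (Icc a b) := by
    intro a b ha hb
    rw [Metric.tendstoUniformlyOn_iff]
    intro ε hε
    obtain ⟨σ₁, h1, -, h3⟩ := hclose a b (ε / 2) ha hb (half_pos hε)
    filter_upwards [Ioo_mem_nhdsGT h1] with σ hσ u hu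
    have hu' : u ∈ Ioo 0 e := ⟨ha.trans_le hu.1, hu.2.trans_lt hb⟩
    have : dist (z u) (R σ u, S σ u) ≤ ε / 2 := by
      refine le_of_tendsto ((hz u hu').dist tendsto_const_nhds) ?_
      filter_upwards [Ioo_mem_nhdsGT h1] with σ' hσ'
      exact (h3 σ' hσ' σ hσ u hu).le
    rw [Prod.dist_eq, dist_self]
    exact max_lt hε (this.trans_lt (half_lt_self hε))
  -- The limit of the regular orbits inherits each component of the equation. On `[a, b]` all graphs
  -- lie in one compact box on which the vector field is uniformly continuous, so the derivatives
  -- converge uniformly.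
  have hderiv : ∀ (g : ℝ × ℝ × ℝ → ℝ) (π : ℝ × ℝ → ℝ),
      ContinuousOn g (Ioi 0 ×ˢ univ) → Continuous π →
      (∀ σ ∈ Ioo 0 e, ∀ u ∈ Ioo σ e, HasDerivAt (fun u => π (R σ u, S σ u))
        (g (u, R σ u, S σ u)) u) →
      ∀ u ∈ Ioo 0 e, HasDerivAt (fun u => π (z u)) (g (u, z u)) u := by
    intro g π hg' hπ hd u hu
    set a := u / 2 with ha
    set b := (u + e) / 2 with hb
    have ha0 : 0 < a := half_pos hu.1
    have hbe : b < e := by rw [hb]; linarith [hu.2]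
    have hub : u ∈ Ioo a b := ⟨by rw [ha]; linarith [hu.1], by rw [hb]; linarith [hu.2]⟩
    have hTU := hunif a b ha0 hbe
    obtain ⟨σ₁, h1, h1a, h3⟩ := hclose a b 1 ha0 hbe one_pos
    have hs1 : σ₁ / 2 ∈ Ioo 0 e := ⟨half_pos h1, by linarith [hub.1, hub.2]⟩
    have hgraph : IsCompact ((fun u => (R (σ₁ / 2) u, S (σ₁ / 2) u)) '' Icc a b) := by
      refine isCompact_Icc.image_of_continuousOn ?_
      have hsub : Icc a b ⊆ Ioo (σ₁ / 2) e := fun v hv =>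
        ⟨by linarith [hv.1], hv.2.trans_lt hbe⟩
      exact ((hRS _ hs1).continuousOn_ρ.mono hsub).prodMk ((hRS _ hs1).continuousOn_Y.mono hsub)
    obtain ⟨Q, hQ⟩ := hgraph.isBounded.subset_closedBall (0 : ℝ × ℝ)
    have hbox : IsCompact (Icc a b ×ˢ Metric.closedBall (0 : ℝ × ℝ) (Q + 1)) :=
      isCompact_Icc.prod (isCompact_closedBall _ _)
    have hboxsub : Icc a b ×ˢ Metric.closedBall (0 : ℝ × ℝ) (Q + 1) ⊆ Ioi 0 ×ˢ univ :=
      fun p hp' => ⟨ha0.trans_le hp'.1.1, mem_univ _⟩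
    have hUC := hbox.uniformContinuousOn_of_continuous (hg'.mono hboxsub)
    have hin : ∀ σ ∈ Ioo 0 σ₁, ∀ v ∈ Icc a b,
        (R σ v, S σ v) ∈ Metric.closedBall (0 : ℝ × ℝ) (Q + 1) := by
      intro σ hσ v hv
      rw [Metric.mem_closedBall]
      have q1 := (h3 σ hσ (σ₁ / 2) ⟨half_pos h1, half_lt_self h1⟩ v hv).le
      have q2 := Metric.mem_closedBall.1 (hQ ⟨v, hv, rfl⟩)
      exact (dist_triangle _ _ _).trans (by linarith)
    have hTU2 := UniformContinuousOn.comp_tendstoUniformlyOn_eventually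
      (s := Icc a b ×ˢ Metric.closedBall (0 : ℝ × ℝ) (Q + 1)) (t := Icc a b)
      (by filter_upwards [Ioo_mem_nhdsGT h1] with σ hσ v hv using ⟨hv, hin σ hσ v hv⟩)
      (fun v hv => ⟨hv, Metric.isClosed_closedBall.mem_of_tendsto
        (hz v ⟨ha0.trans_le hv.1, hv.2.trans_lt hbe⟩)
        (by filter_upwards [Ioo_mem_nhdsGT h1] with σ hσ using hin σ hσ v hv)⟩) hUC hTU
    refine hasDerivAt_of_tendstoLocallyUniformlyOn (l := 𝓝[>] (0:ℝ)) (s := Ioo a b)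
      (f := fun σ u => π (R σ u, S σ u)) (g' := fun u => g (u, z u)) isOpen_Ioo
      ((hTU2.mono Ioo_subset_Icc_self).tendstoLocallyUniformlyOn) ?_ ?_ hub
    · filter_upwards [Ioo_mem_nhdsGT h1] with σ hσ v hv
      exact hd σ ⟨hσ.1, by linarith [hσ.2, hub.1, hub.2]⟩ v
        ⟨by linarith [hσ.2, hv.1], hv.2.trans hbe⟩
    · intro v hv
      exact (hπ.tendsto _).comp (hz v ⟨ha0.trans hv.1, hv.2.trans hbe⟩)
  refine ⟨fun u => (z u).1, fun u => (z u).2, ⟨?_, ?_, ?_⟩⟩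
  · exact hderiv (fun p => Real.exp (k * p.2.1 - p.2.2 / β)) Prod.fst
      (by fun_prop) continuous_fst fun σ hσ u hu => (hRS σ hσ).deriv_ρ u hu
  · refine hderiv (fun p => h p.1 * Real.exp ((γ + k) * p.2.1 - (1 + 1 / β) * p.2.2)) Prod.snd
      ?_ continuous_snd fun σ hσ u hu => (hRS σ hσ).deriv_Y u hu
    refine ContinuousOn.mul (hh.continuousOn.comp continuousOn_fst fun p hp' => hp'.1) ?_
    fun_prop
  · have hθ := hp.θ_pos
    -- The estimate of `r ^ θ` by a multiple of `u - σ` survives `σ → 0` and forces `ρ → -∞` at `0`.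
    have hbound : ∀ u ∈ Ioo 0 u₁, Real.exp ((γ / β - k) * (z u).1) ≤ speed β k γ h u₁ * u := by
      intro u hu
      have hue : u < e := hu.2.trans_le he
      have h1 : Real.exp ((γ / β - k) * (z u).1) ≤ speed β k γ h u * (u - 0) := by
        have t1 : Tendsto (fun σ => Real.exp ((γ / β - k) * R σ u)) (𝓝[>] 0)
            (𝓝 (Real.exp ((γ / β - k) * (z u).1))) :=
          (Real.continuous_exp.tendsto _).comp
            (((continuous_fst.tendsto _).comp (hz u ⟨hu.1, hue⟩)).const_mul _)
        have t2 : Tendsto (fun σ : ℝ => speed β k γ h u * (u - σ)) (𝓝[>] 0)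
            (𝓝 (speed β k γ h u * (u - 0))) :=
          Tendsto.mono_left (by
            have : Continuous fun σ : ℝ => speed β k γ h u * (u - σ) := by fun_prop
            exact this.tendsto 0) nhdsWithin_le_nhds
        refine le_of_tendsto_of_tendsto t1 t2 ?_
        filter_upwards [Ioo_mem_nhdsGT hu.1] with σ hσ
        exact (hRS σ ⟨hσ.1, hσ.2.trans hue⟩).exp_θρ_le hp hh hσ.1.le ⟨hσ.2, hue⟩
      rw [sub_zero] at h1
      exact h1.trans (mul_le_mul_of_nonneg_right (speed_mono hp hh hu.1 h0 hu.2.le) hu.1.le)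
    have t0 : Tendsto (fun u => Real.exp ((γ / β - k) * (z u).1)) (𝓝[>] 0) (𝓝 0) := by
      refine squeeze_zero' (Eventually.of_forall fun u => (Real.exp_pos _).le)
        (by filter_upwards [Ioo_mem_nhdsGT h0] with u hu using hbound u hu) ?_
      have : Continuous fun u : ℝ => speed β k γ h u₁ * u := by fun_prop
      have := this.tendsto 0
      rw [mul_zero] at this
      exact this.mono_left nhdsWithin_le_nhds
    rw [Real.tendsto_exp_comp_nhds_zero] at t0
    exact (tendsto_const_mul_atBot_of_pos hθ).1 t0

end MEMS
end

noncomputable section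
namespace MEMS

/-! ### Solutions and orbits -/

variable {α β k γ σ e lam : ℝ} {f ρ Y : ℝ → ℝ} {v : C(Icc (0 : ℝ) 1, ℝ)}

lemma continuous_onReal (v : C(Icc (0 : ℝ) 1, ℝ)) : Continuous (onReal v) :=
  v.continuous.Icc_extend'

lemma onReal_apply (v : C(Icc (0 : ℝ) 1, ℝ)) (s : Icc (0 : ℝ) 1) : onReal v s = v s :=
  IccExtend_val _ _ _

lemma onReal_zero (v : C(Icc (0 : ℝ) 1, ℝ)) : onReal v 0 = v 0 := onReal_apply v 0

lemma onReal_one (v : C(Icc (0 : ℝ) 1, ℝ)) : onReal v 1 = v 1 := onReal_apply v 1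

lemma abs_rpow_sub_one_mul {β x : ℝ} (hx : x < 0) : |x| ^ (β - 1) * x = -(-x) ^ β := by
  rw [abs_of_neg hx, Real.rpow_sub_one (neg_pos.2 hx).ne']
  have := hx.ne
  field_simp

/-- The flux of a solution is negative. -/
lemma IsSolution.flux (hv : IsSolution α β γ f lam v) (hβ : 1 ≤ β) (hαβ : β < α)
    (hf : ∀ u, 0 < u → 0 < f u) :
    ∀ s ∈ Ioo (0:ℝ) 1, deriv (onReal v) s < 0 ∧
      HasDerivAt (fun r => r ^ α * (|deriv (onReal v) r| ^ (β - 1) * deriv (onReal v) r))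
        (-(lam * (1 / f (1 - onReal v s)) * s ^ (γ - 1))) s := by
  have hβ0 : 0 < β := by linarith
  set w : ℝ → ℝ := fun r => r ^ α * (|deriv (onReal v) r| ^ (β - 1) * deriv (onReal v) r) with hw
  have hV : ∀ s ∈ Ioo (0:ℝ) 1, HasDerivAt (onReal v) (deriv (onReal v) s) s := fun s hs =>
    ((hv.contDiffOn.differentiableOn two_ne_zero).differentiableAt
      (Ioo_mem_nhds hs.1 hs.2)).hasDerivAt
  have hwneg : ∀ s ∈ Ioo (0:ℝ) 1, 0 < lam * (1 / f (1 - onReal v s)) * s ^ (γ - 1) := by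
    intro s hs
    have h1 := hf (1 - onReal v s) (by linarith [hv.lt_one s hs])
    have h2 := Real.rpow_pos_of_pos hs.1 (γ - 1)
    have h3 := hv.lam_pos
    positivity
  have hwd : ∀ s ∈ Ioo (0:ℝ) 1,
      HasDerivAt w (-(lam * (1 / f (1 - onReal v s)) * s ^ (γ - 1))) s := by
    intro s hs
    have h2 := Real.rpow_pos_of_pos hs.1 (γ - 1)
    have h1 : deriv w s = -(lam * (1 / f (1 - onReal v s)) * s ^ (γ - 1)) := by
      have := hv.equation s hs
      rw [Real.rpow_neg hs.1.le] at this
      have h3 : deriv w s = -(lam / f (1 - onReal v s)) * s ^ (γ - 1) := by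
        rw [← hw] at this
        field_simp at this ⊢
        linarith
      rw [h3]; ring
    -- The equation only prescribes the value of `deriv`, which is `0` by default where the flux is
    -- not differentiable; since this value is not `0`, the flux is differentiable.
    have hne : deriv w s ≠ 0 := by
      rw [h1]; exact (neg_neg_of_pos (hwneg s hs)).ne
    have := (differentiableAt_of_deriv_ne_zero hne).hasDerivAt
    rwa [h1] at this
  have hanti : ∀ s ∈ Ioo (0:ℝ) 1, ∀ t ∈ Ioo (0:ℝ) 1, s < t → w t < w s := by
    have : StrictMonoOn (fun s => -w s) (Ioo 0 1) :=
      strictMonoOn_of_hasDerivAt (convex_Ioo _ _) (fun s hs => (hwd s hs).neg) fun s hs => by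
        rw [neg_neg]; exact hwneg s hs
    intro s hs t ht hst
    exact neg_lt_neg_iff.1 (this hs ht hst)
  -- The flux `w` is strictly decreasing, so if it were non-negative at `s₀` it would exceed some `c
  -- > 0` near `0`. As `s ^ α ≤ s ^ β`, this gives `s v' ≥ c'`, and `v` would tend to `-∞`
  -- logarithmically at `0`, against `v > 0`.
  have hneg : ∀ s ∈ Ioo (0:ℝ) 1, w s < 0 := by
    intro s₀ hs₀
    by_contra! hcon
    set s₁ := s₀ / 2 with hs₁
    have hs₁m : s₁ ∈ Ioo (0:ℝ) 1 := ⟨half_pos hs₀.1, by linarith [hs₀.1, hs₀.2]⟩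
    set c := w s₁ with hc
    have hc0 : 0 < c := hcon.trans_lt (hanti _ hs₁m _ hs₀ (by linarith [hs₀.1]))
    set c' := c ^ (1 / β) with hc'
    have hc'0 : 0 < c' := Real.rpow_pos_of_pos hc0 _
    have hlow : ∀ s ∈ Ioc 0 s₁, c' * s⁻¹ ≤ deriv (onReal v) s := by
      intro s hs
      have hs1 : s ∈ Ioo (0:ℝ) 1 := ⟨hs.1, hs.2.trans_lt hs₁m.2⟩
      have hws : c ≤ w s := by
        rcases hs.2.eq_or_lt with rfl | hlt
        · exact le_rfl
        · exact (hanti _ hs1 _ hs₁m hlt).le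
      have hsα := Real.rpow_pos_of_pos hs.1 α
      have hdpos : 0 < deriv (onReal v) s := by
        by_contra! hd
        have : w s ≤ 0 := mul_nonpos_of_nonneg_of_nonpos hsα.le
          (mul_nonpos_of_nonneg_of_nonpos (Real.rpow_nonneg (abs_nonneg _) _) hd)
        linarith
      have h1 : w s = s ^ α * deriv (onReal v) s ^ β := by
        simp only [hw]
        rw [abs_of_pos hdpos, ← Real.rpow_add_one hdpos.ne', sub_add_cancel]
      have h2 : c ≤ (s * deriv (onReal v) s) ^ β := by
        rw [Real.mul_rpow hs.1.le hdpos.le]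
        refine hws.trans (h1.le.trans ?_)
        refine mul_le_mul_of_nonneg_right ?_ (Real.rpow_nonneg hdpos.le _)
        exact Real.rpow_le_rpow_of_exponent_ge hs.1 hs1.2.le hαβ.le
      have h3 : c' ≤ s * deriv (onReal v) s := by
        have := Real.rpow_le_rpow hc0.le h2 (one_div_pos.2 hβ0).le
        rwa [← Real.rpow_mul (mul_pos hs.1 hdpos).le, mul_one_div_cancel hβ0.ne',
          Real.rpow_one] at this
      rw [← div_eq_mul_inv, div_le_iff₀ hs.1]
      linarith
    have hmono : MonotoneOn (fun s => onReal v s - c' * Real.log s) (Ioc 0 s₁) :=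
      monotoneOn_of_hasDerivAt (convex_Ioc _ _)
        (fun s hs => (hV s ⟨hs.1, hs.2.trans_lt hs₁m.2⟩).sub
          ((Real.hasDerivAt_log hs.1.ne').const_mul c'))
        fun s hs => sub_nonneg.2 (hlow s hs)
    have hlog : Tendsto (fun s => c' * Real.log s) (𝓝[>] 0) atBot :=
      Real.tendsto_log_nhdsGT_zero.const_mul_atBot hc'0
    obtain ⟨s, hs1, hs2⟩ := ((hlog.eventually
      (eventually_lt_atBot (-(onReal v s₁ - c' * Real.log s₁)))).and
      (Ioo_mem_nhdsGT hs₁m.1)).exists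
    have := hmono ⟨hs2.1, hs2.2.le⟩ ⟨hs₁m.1, le_rfl⟩ hs2.2.le
    have hpos := hv.pos s ⟨hs2.1, hs2.2.trans hs₁m.2⟩
    simp only at this
    linarith
  intro s hs
  refine ⟨?_, hwd s hs⟩
  by_contra! hd
  have : 0 ≤ w s := mul_nonneg (Real.rpow_nonneg hs.1.le _)
    (mul_nonneg (Real.rpow_nonneg (abs_nonneg _) _) hd)
  linarith [hneg s hs]

/-- A solution gives an orbit. -/
theorem IsSolution.exists_isOrbit (hv : IsSolution α β γ f lam v) (hp : Admissible β k γ)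
    (hα : α = β * (k + 1)) (hf : ∀ u, 0 < u → 0 < f u) :
    (0 ≤ 1 - v 0 ∧ 1 - v 0 < 1) ∧ ∃ ρ Y, IsOrbit β k γ (fun u => 1 / f u) (1 - v 0) 1 ρ Y ∧
      Tendsto ρ (𝓝[<] 1) (𝓝 (Real.log lam / (β * (γ / β - k)))) ∧
      ∀ s ∈ Ioo (0:ℝ) 1, 1 - onReal v s ∈ Ioo (1 - v 0) 1 ∧
        ρ (1 - onReal v s) = Real.log s + Real.log lam / (β * (γ / β - k)) := by
  have hβ := hp.β_pos
  have hk := hp.k_pos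
  have hθ := hp.θ_pos
  have hlam := hv.lam_pos
  have hαβ : β < α := by rw [hα]; nlinarith
  have hflux := hv.flux hp.one_le hαβ hf
  -- The scaling `r = s exp c` removes `lam` from the equation; the flux is then multiplied by `exp
  -- ((α - β) c)`, whence the shift in `Y`.
  set c := Real.log lam / (β * (γ / β - k)) with hc
  set w : ℝ → ℝ := fun r => r ^ α * (|deriv (onReal v) r| ^ (β - 1) * deriv (onReal v) r) with hw
  set U : ℝ → ℝ := fun s => 1 - onReal v s with hU
  set ρ : ℝ → ℝ := fun s => Real.log s + c with hρ
  set Y : ℝ → ℝ := fun s => Real.log (-w s) + (α - β) * c with hY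
  have hUc : Continuous U := continuous_const.sub (continuous_onReal v)
  have hUd : ∀ s ∈ Ioo (0:ℝ) 1, HasDerivAt U (-deriv (onReal v) s) s := fun s hs =>
    (((hv.contDiffOn.differentiableOn two_ne_zero).differentiableAt
      (Ioo_mem_nhds hs.1 hs.2)).hasDerivAt).const_sub 1
  have hU'0 : ∀ s ∈ Ioo (0:ℝ) 1, 0 < -deriv (onReal v) s := fun s hs =>
    neg_pos.2 (hflux s hs).1
  have hwlog : ∀ s ∈ Ioo (0:ℝ) 1,
      -w s = Real.exp (α * Real.log s + β * Real.log (-deriv (onReal v) s)) := by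
    intro s hs
    simp only [hw]
    rw [abs_rpow_sub_one_mul (hflux s hs).1, Real.rpow_def_of_pos hs.1,
      Real.rpow_def_of_pos (hU'0 s hs), Real.exp_add]
    ring_nf
  have hYeq : ∀ s ∈ Ioo (0:ℝ) 1,
      Y s = α * Real.log s + β * Real.log (-deriv (onReal v) s) + (α - β) * c := by
    intro s hs
    simp only [hY]
    rw [hwlog s hs, Real.log_exp]
  have hkey : ∀ s ∈ Ioo (0:ℝ) 1,
      Real.exp (k * ρ s - Y s / β) * -deriv (onReal v) s = s⁻¹ := by
    intro s hs
    have e1 : k * ρ s - Y s / β = -Real.log s - Real.log (-deriv (onReal v) s) := by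
      rw [hYeq s hs, hα]
      simp only [hρ]
      field_simp
      ring
    rw [e1, Real.exp_sub, Real.exp_neg, Real.exp_log hs.1, Real.exp_log (hU'0 s hs),
      div_mul_cancel₀ _ (hU'0 s hs).ne']
  have hU0 : Tendsto U (𝓝[>] 0) (𝓝 (1 - v 0)) := by
    have := hUc.tendsto 0
    simp only [hU, onReal_zero] at this
    exact this.mono_left nhdsWithin_le_nhds
  have hU1 : Tendsto U (𝓝[<] 1) (𝓝 1) := by
    have := hUc.tendsto 1
    simp only [hU, onReal_one, hv.boundary, sub_zero] at this
    exact this.mono_left nhdsWithin_le_nhds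
  obtain ⟨ψ, h1, h2, h3, ho⟩ := exists_isOrbit_of_curve (β := β) (k := k) (γ := γ)
    (h := fun u => 1 / f u) (U := U) (U' := fun s => -deriv (onReal v) s) (ρ := ρ) (Y := Y)
    one_pos hUd hU'0
    (fun s hs => by
      rw [hkey s hs]
      exact (Real.hasDerivAt_log hs.1.ne').add_const c)
    (fun s hs => by
      have hws : 0 < -w s := by rw [hwlog s hs]; exact Real.exp_pos _
      have d1 := (((hflux s hs).2.neg).log hws.ne').add_const ((α - β) * c)
      refine d1.congr_deriv ?_
      have e2 : (γ + k) * ρ s - (1 + 1 / β) * Y s =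
          (γ * ρ s - Y s) + (k * ρ s - Y s / β) := by ring
      rw [e2, Real.exp_add, ← mul_assoc, mul_assoc _ _ (-deriv (onReal v) s), hkey s hs]
      have e3 : γ * ρ s - Y s = γ * Real.log s + Real.log lam - Real.log (-w s) := by
        have : c * (β * (γ / β - k)) = Real.log lam :=
          div_mul_cancel₀ _ (mul_pos hβ hθ).ne'
        rw [← this]
        simp only [hρ, hY]
        rw [hα]
        field_simp
        ring
      rw [e3, Real.exp_sub, Real.exp_add, Real.exp_log hlam, Real.exp_log hws, mul_comm γ,
        ← Real.rpow_def_of_pos hs.1, Real.rpow_sub_one hs.1.ne']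
      simp only [Pi.neg_apply, hw, hU]
      have := hws.ne'
      ring)
    hU0 hU1 (tendsto_atBot_add_const_right _ c Real.tendsto_log_nhdsGT_zero)
  have hle : 0 ≤ 1 - v 0 := by
    refine ge_of_tendsto hU0 ?_
    filter_upwards [Ioo_mem_nhdsGT one_pos] with s hs
    exact sub_nonneg.2 (hv.lt_one s hs).le
  have hlt : 1 - v 0 < 1 := by
    have := (h1 (1 / 2) ⟨by norm_num, by norm_num⟩).1
    exact this.1.trans this.2
  refine ⟨⟨hle, hlt⟩, _, _, ho, ?_, fun s hs => ⟨(h1 s hs).1, ?_⟩⟩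
  · have t1 : Tendsto ρ (𝓝[<] 1) (𝓝 c) := by
      have : ContinuousAt ρ 1 := (Real.continuousAt_log one_ne_zero).add continuousAt_const
      have := this.tendsto
      simp only [hρ, Real.log_one, zero_add] at this
      exact this.mono_left nhdsWithin_le_nhds
    exact t1.comp h3
  · change ρ (ψ (U s)) = _
    rw [(h1 s hs).2]

end MEMS
end

/-! ### From orbits back to solutions -/

noncomputable section
namespace MEMS

variable {α β k γ σ e lam : ℝ} {f ρ Y : ℝ → ℝ}

lemma contDiffOn_one_of_hasDerivAt {g g' : ℝ → ℝ} {s : Set ℝ} (hs : IsOpen s)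
    (hg : ∀ x ∈ s, HasDerivAt g (g' x) x) (hg' : ContinuousOn g' s) : ContDiffOn ℝ 1 g s := by
  have := (contDiffOn_succ_iff_deriv_of_isOpen (𝕜 := ℝ) (n := 0) (f := g) hs).2
    ⟨fun x hx => (hg x hx).differentiableAt.differentiableWithinAt, by simp,
      contDiffOn_zero.2 (hg'.congr fun x hx => (hg x hx).deriv)⟩
  simpa using this

lemma contDiffOn_two_of_hasDerivAt {g g' : ℝ → ℝ} {s : Set ℝ} (hs : IsOpen s)
    (hg : ∀ x ∈ s, HasDerivAt g (g' x) x) (hg' : ContDiffOn ℝ 1 g' s) : ContDiffOn ℝ 2 g s := by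
  have := (contDiffOn_succ_iff_deriv_of_isOpen (𝕜 := ℝ) (n := 1) (f := g) hs).2
    ⟨fun x hx => (hg x hx).differentiableAt.differentiableWithinAt, by simp,
      hg'.congr fun x hx => (hg x hx).deriv⟩
  exact this

/-- An orbit gives a solution. -/
theorem IsOrbit.exists_isSolution (ho : IsOrbit β k γ (fun u => 1 / f u) σ e ρ Y)
    (hp : Admissible β k γ) (hα : α = β * (k + 1)) (hf : ∀ u, 0 < u → 0 < f u)
    (hfc : ContinuousOn f (Ioi 0)) (hσ : 0 ≤ σ) (hσ1 : σ < 1) (he : 1 < e) :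
    ∃ v : C(Icc (0 : ℝ) 1, ℝ),
      IsSolution α β γ f (Real.exp (β * (γ / β - k) * ρ 1)) v ∧ v 0 = 1 - σ ∧
      ∀ s ∈ Ioo (0:ℝ) 1, 1 - onReal v s ∈ Ioo σ 1 ∧ ρ (1 - onReal v s) = Real.log s + ρ 1 := by
  have hβ := hp.β_pos
  set ρ₁ := ρ 1 with hρ₁
  have hsub : Ioo σ 1 ⊆ Ioo σ e := Ioo_subset_Ioo_right he.le
  -- The normalized radius `s = exp (ρ u - ρ 1)` equals `1` at `u = 1` and tends to `0` at `σ`; its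
  -- inverse is `1 - v`.
  obtain ⟨U, h1, h2, -, h4, h5⟩ := exists_inverse_of_hasDerivAt_pos
    (φ := fun u => Real.exp (ρ u - ρ₁))
    (φ' := fun u => Real.exp (ρ u - ρ₁) * Real.exp (k * ρ u - Y u / β)) (l := 0) (m := 1) hσ1
    (fun u hu => ((ho.deriv_ρ u (hsub hu)).sub_const ρ₁).exp)
    (fun u _ => mul_pos (Real.exp_pos _) (Real.exp_pos _))
    (Real.tendsto_exp_atBot.comp (tendsto_atBot_add_const_right _ (-ρ₁) ho.tendsto_ρ))
    (by
      have h : ContinuousAt (fun u => Real.exp (ρ u - ρ₁)) 1 :=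
        ((ho.deriv_ρ 1 ⟨hσ1, he⟩).continuousAt.sub continuousAt_const).rexp
      have := h.tendsto
      simp only [hρ₁, sub_self, Real.exp_zero] at this
      exact this.mono_left nhdsWithin_le_nhds)
  have hUm : ∀ s ∈ Ioo (0:ℝ) 1, U s ∈ Ioo σ 1 := fun s hs => (h2 s hs).1
  have hUp : ∀ s ∈ Ioo (0:ℝ) 1, 0 < U s := fun s hs => hσ.trans_lt (hUm s hs).1
  have hUρ : ∀ s ∈ Ioo (0:ℝ) 1, ρ (U s) = Real.log s + ρ₁ := fun s hs => by
    have := congrArg Real.log (h2 s hs).2.1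
    rw [Real.log_exp] at this
    linarith
  set η : ℝ → ℝ := fun s => Y (U s) with hη
  set d : ℝ → ℝ := fun s => s⁻¹ * Real.exp (η s / β - k * (Real.log s + ρ₁)) with hd
  have hd0 : ∀ s ∈ Ioo (0:ℝ) 1, 0 < d s := fun s hs =>
    mul_pos (inv_pos.2 hs.1) (Real.exp_pos _)
  have hUd : ∀ s ∈ Ioo (0:ℝ) 1, HasDerivAt U (d s) s := by
    intro s hs
    refine (h2 s hs).2.2.congr_deriv ?_
    rw [hUρ s hs, mul_inv, add_sub_cancel_right, Real.exp_log hs.1, ← Real.exp_neg, neg_sub]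
  have hUc : ContinuousOn U (Ioo 0 1) := fun s hs => (hUd s hs).continuousAt.continuousWithinAt
  set η' : ℝ → ℝ := fun s =>
    1 / f (U s) * Real.exp (γ * (Real.log s + ρ₁) - η s) * s⁻¹ with hη'
  have hηd : ∀ s ∈ Ioo (0:ℝ) 1, HasDerivAt η (η' s) s := by
    intro s hs
    have := (ho.deriv_Y _ (hsub (hUm s hs))).comp s (hUd s hs)
    refine this.congr_deriv ?_
    have e1 : (γ + k) * ρ (U s) - (1 + 1 / β) * Y (U s) =
        (γ * (Real.log s + ρ₁) - η s) - (η s / β - k * (Real.log s + ρ₁)) := by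
      rw [hUρ s hs]; simp only [hη]; ring
    rw [e1, Real.exp_sub]
    simp only [hd, hη']
    have := (Real.exp_pos (η s / β - k * (Real.log s + ρ₁))).ne'
    field_simp
  have hηc : ContinuousOn η (Ioo 0 1) := fun s hs => (hηd s hs).continuousAt.continuousWithinAt
  have hlogc : ContinuousOn Real.log (Ioo 0 1) := Real.continuousOn_log.mono fun s hs => by
    simpa using hs.1.ne'
  have hinvc : ContinuousOn (fun s : ℝ => s⁻¹) (Ioo 0 1) := continuousOn_inv₀.mono fun s hs => by
    simpa using hs.1.ne'
  have hη'c : ContinuousOn η' (Ioo 0 1) := by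
    refine ContinuousOn.mul (ContinuousOn.mul ?_ ?_) hinvc
    · refine continuousOn_const.div (hfc.comp hUc hUp) fun s hs => (hf _ (hUp s hs)).ne'
    · exact (((continuousOn_const.mul (hlogc.add continuousOn_const)).sub hηc)).rexp
  -- `U' = d` is a smooth expression in `s` and `η = Y ∘ U`, and `η` is `C¹` by the equation for
  -- `Y`; hence `U` is `C²`.
  have hdC : ContDiffOn ℝ 1 d (Ioo 0 1) := by
    have c1 := contDiffOn_one_of_hasDerivAt isOpen_Ioo hηd hη'c
    have c2 : ContDiffOn ℝ 1 Real.log (Ioo 0 1) := Real.contDiffOn_log.mono fun s hs => by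
      simpa using hs.1.ne'
    have c3 : ContDiffOn ℝ 1 (fun s : ℝ => s⁻¹) (Ioo 0 1) := contDiffOn_inv ℝ |>.mono fun s hs => by
      simpa using hs.1.ne'
    exact c3.mul (((c1.div_const β).sub (contDiffOn_const.mul (c2.add contDiffOn_const))).exp)
  have hUl : Tendsto U (𝓝[>] 0) (𝓝 σ) := h4.mono_right nhdsWithin_le_nhds
  have hUr : Tendsto U (𝓝[<] 1) (𝓝 1) := h5.mono_right nhdsWithin_le_nhds
  have hEc := continuousOn_Icc_extendFrom_Ioo hUc hUl hUr
  have hE0 : extendFrom (Ioo 0 1) U 0 = σ := eq_lim_at_left_extendFrom_Ioo one_pos hUl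
  have hE1 : extendFrom (Ioo 0 1) U 1 = 1 := eq_lim_at_right_extendFrom_Ioo one_pos hUr
  have hEi : ∀ s ∈ Ioo (0:ℝ) 1, extendFrom (Ioo 0 1) U s = U s := extendFrom_extends hUc
  let v : C(Icc (0 : ℝ) 1, ℝ) :=
    ⟨fun s => 1 - extendFrom (Ioo 0 1) U s, continuous_const.sub hEc.domRestrict⟩
  have hvi : ∀ s ∈ Ioo (0:ℝ) 1, onReal v s = 1 - U s := by
    intro s hs
    rw [← hEi s hs]
    exact onReal_apply v ⟨s, hs.1.le, hs.2.le⟩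
  have hvd : ∀ s ∈ Ioo (0:ℝ) 1, HasDerivAt (onReal v) (-d s) s := by
    intro s hs
    refine ((hUd s hs).const_sub 1).congr_of_eventuallyEq ?_
    filter_upwards [Ioo_mem_nhds hs.1 hs.2] with r hr using hvi r hr
  have hflux : ∀ s ∈ Ioo (0:ℝ) 1,
      s ^ α * (|deriv (onReal v) s| ^ (β - 1) * deriv (onReal v) s) =
        -(Real.exp (η s) * Real.exp (-(β * k * ρ₁))) := by
    intro s hs
    rw [(hvd s hs).deriv, abs_rpow_sub_one_mul (neg_neg_of_pos (hd0 s hs)), neg_neg, mul_neg,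
      Real.rpow_def_of_pos hs.1, Real.rpow_def_of_pos (hd0 s hs), ← Real.exp_add, ← Real.exp_add]
    simp only [hd]
    rw [Real.log_mul (inv_pos.2 hs.1).ne' (Real.exp_pos _).ne', Real.log_inv, Real.log_exp, hα]
    congr 2
    field_simp
    ring
  have hfd : ∀ s ∈ Ioo (0:ℝ) 1, HasDerivAt
      (fun s => s ^ α * (|deriv (onReal v) s| ^ (β - 1) * deriv (onReal v) s))
      (-(Real.exp (η s) * η' s * Real.exp (-(β * k * ρ₁)))) s := by
    intro s hs
    refine (((hηd s hs).exp.mul_const _).neg).congr_of_eventuallyEq ?_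
    filter_upwards [Ioo_mem_nhds hs.1 hs.2] with r hr using hflux r hr
  refine ⟨v, ⟨Real.exp_pos _, contDiffOn_two_of_hasDerivAt isOpen_Ioo hvd hdC.neg, ?_, ?_, ?_, ?_⟩,
    ?_, ?_⟩
  · intro s hs
    rw [hvi s hs]; linarith [(hUm s hs).2]
  · intro s hs
    rw [hvi s hs]; linarith [hUp s hs]
  · intro s hs
    rw [(hfd s hs).deriv, hvi s hs, sub_sub_cancel]
    simp only [hη']
    have e1 : s ^ (-(γ - 1)) = s * Real.exp (-(γ * Real.log s)) := by
      have : -(γ - 1) = -γ + 1 := by ring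
      rw [this, Real.rpow_add_one hs.1.ne', Real.rpow_def_of_pos hs.1]
      ring_nf
    have e2 : Real.exp (γ * (Real.log s + ρ₁) - η s) =
        Real.exp (γ * Real.log s) * Real.exp (γ * ρ₁) * (Real.exp (η s))⁻¹ := by
      rw [← Real.exp_neg, ← Real.exp_add, ← Real.exp_add]; ring_nf
    have e3 : Real.exp (β * (γ / β - k) * ρ₁) =
        Real.exp (γ * ρ₁) * Real.exp (-(β * k * ρ₁)) := by
      rw [← Real.exp_add]; congr 1; field_simp; ring
    have e4 : Real.exp (-(γ * Real.log s)) = (Real.exp (γ * Real.log s))⁻¹ := Real.exp_neg _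
    rw [e1, e2, e3, e4]
    have p1 := (Real.exp_pos (η s)).ne'
    have p2 := (Real.exp_pos (γ * Real.log s)).ne'
    have p3 := hs.1.ne'
    have p4 := (hf _ (hUp s hs)).ne'
    field_simp
    ring
  · change 1 - extendFrom (Ioo 0 1) U 1 = 0
    rw [hE1, sub_self]
  · change 1 - extendFrom (Ioo 0 1) U 0 = 1 - σ
    rw [hE0]
  · intro s hs
    rw [hvi s hs, sub_sub_cancel]
    exact ⟨hUm s hs, hUρ s hs⟩

end MEMS
end

/-! ### The one-parameter family of all solutions -/

noncomputable section
namespace MEMS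

/-- A family of orbits starting from every `σ ∈ [0, 1)`, containing all orbits. -/
structure IsOrbitFamily (β k γ : ℝ) (h : ℝ → ℝ) (R S : ℝ → ℝ → ℝ) : Prop where
  isOrbit : ∀ σ ∈ Ico (0:ℝ) 1, IsOrbit β k γ h σ 2 (R σ) (S σ)
  unique : ∀ σ ∈ Ico (0:ℝ) 1, ∀ ρ Y, IsOrbit β k γ h σ 1 ρ Y → ∀ u ∈ Ioo σ 1, ρ u = R σ u

variable {α β k γ lam : ℝ} {f h : ℝ → ℝ} {R S : ℝ → ℝ → ℝ}

/-- The value of `lam` for the orbit starting from `σ`. -/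
def orbitLam (β k γ : ℝ) (R : ℝ → ℝ → ℝ) (σ : ℝ) : ℝ := Real.exp (β * (γ / β - k) * R σ 1)

lemma continuousMap_eq_of_eq_on_Ioo {v v' : C(Icc (0:ℝ) 1, ℝ)} (h0 : v 0 = v' 0) (h1 : v 1 = v' 1)
    (hi : ∀ s ∈ Ioo (0:ℝ) 1, onReal v s = onReal v' s) : v = v' := by
  ext s
  rw [← onReal_apply, ← onReal_apply v']
  rcases s.2.1.eq_or_lt with hs | hs
  · rw [← hs, onReal_zero, onReal_zero, h0]
  · rcases s.2.2.eq_or_lt with hs' | hs'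
    · rw [hs', onReal_one, onReal_one, h1]
    · exact hi _ ⟨hs, hs'⟩

/-- The solutions are parametrized by the orbits. -/
theorem IsOrbitFamily.exists_solutions (hF : IsOrbitFamily β k γ (fun u => 1 / f u) R S)
    (hp : Admissible β k γ) (hα : α = β * (k + 1)) (hf : ∀ u, 0 < u → 0 < f u)
    (hfc : ContinuousOn f (Ioi 0)) :
    ∃ V : ℝ → C(Icc (0:ℝ) 1, ℝ),
      (∀ lam v, IsSolution α β γ f lam v ↔
        ∃ σ ∈ Ico (0:ℝ) 1, lam = orbitLam β k γ R σ ∧ v = V σ) ∧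
      ∀ σ ∈ Ico (0:ℝ) 1, V σ 0 = 1 - σ ∧ V σ 1 = 0 ∧
        ∀ s ∈ Ioo (0:ℝ) 1, 1 - onReal (V σ) s ∈ Ioo σ 1 ∧
          R σ (1 - onReal (V σ) s) = Real.log s + R σ 1 := by
  have hβθ : 0 < β * (γ / β - k) := mul_pos hp.β_pos hp.θ_pos
  choose! V hV1 hV2 hV3 using fun σ (hσ : σ ∈ Ico (0:ℝ) 1) =>
    (hF.isOrbit σ hσ).exists_isSolution hp hα hf hfc hσ.1 hσ.2 one_lt_two
  refine ⟨V, fun lam v => ⟨fun hv => ?_, ?_⟩, fun σ hσ => ⟨hV2 σ hσ, (hV1 σ hσ).boundary, hV3 σ hσ⟩⟩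
  · obtain ⟨⟨hσ0, hσ1⟩, ρ, Y, ho, hlim, hlev⟩ := hv.exists_isOrbit hp hα hf
    set σ := 1 - v 0 with hσ
    have hσm : σ ∈ Ico (0:ℝ) 1 := ⟨hσ0, hσ1⟩
    have hoR := hF.isOrbit σ hσm
    have heq := hF.unique σ hσm ρ Y ho
    -- Two orbits agree on `(σ, 1)`, so their limits at `1` agree; for the orbit built from `v` this
    -- limit encodes `lam`.
    have hR1 : R σ 1 = Real.log lam / (β * (γ / β - k)) := by
      have t1 : Tendsto (R σ) (𝓝[<] 1) (𝓝 (R σ 1)) :=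
        (hoR.deriv_ρ 1 ⟨hσ1, one_lt_two⟩).continuousAt.tendsto.mono_left nhdsWithin_le_nhds
      refine tendsto_nhds_unique t1 (hlim.congr' ?_)
      filter_upwards [Ioo_mem_nhdsLT hσ1] with u hu using heq u hu
    refine ⟨σ, hσm, ?_, ?_⟩
    · rw [orbitLam, hR1, mul_div_cancel₀ _ hβθ.ne', Real.exp_log hv.lam_pos]
    · refine continuousMap_eq_of_eq_on_Ioo ?_ ?_ fun s hs => ?_
      · rw [hV2 σ hσm, hσ, sub_sub_cancel]
      · rw [hv.boundary, (hV1 σ hσm).boundary]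
      · obtain ⟨m1, e1⟩ := hlev s hs
        obtain ⟨m2, e2⟩ := hV3 σ hσm s hs
        rw [heq _ m1, ← hR1, ← e2] at e1
        have := hoR.strictMono_ρ.injOn ⟨m1.1, m1.2.trans one_lt_two⟩
          ⟨m2.1, m2.2.trans one_lt_two⟩ e1
        linarith
  · rintro ⟨σ, hσ, rfl, rfl⟩
    exact hV1 σ hσ

/-- Pointwise convergence of orbits implies uniform convergence of solutions. -/
theorem IsOrbitFamily.tendsto_solution (hF : IsOrbitFamily β k γ h R S)
    {V : ℝ → C(Icc (0:ℝ) 1, ℝ)}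
    (hV : ∀ σ ∈ Ico (0:ℝ) 1, V σ 0 = 1 - σ ∧ V σ 1 = 0 ∧
        ∀ s ∈ Ioo (0:ℝ) 1, 1 - onReal (V σ) s ∈ Ioo σ 1 ∧
          R σ (1 - onReal (V σ) s) = Real.log s + R σ 1)
    {F : Filter ℝ} {σ₀ : ℝ} (hσ₀ : σ₀ ∈ Ico (0:ℝ) 1) (hFσ : Tendsto id F (𝓝 σ₀))
    (hFm : ∀ᶠ σ in F, σ ∈ Ico (0:ℝ) 1)
    (hconv : ∀ u ∈ Ioc σ₀ 1, Tendsto (fun σ => R σ u) F (𝓝 (R σ₀ u))) :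
    Tendsto V F (𝓝 (V σ₀)) := by
  -- The level `c` of `1 - V σ` is attained at the radius of the orbit at `c` divided by its radius
  -- at `1`. Hence pointwise convergence of orbits is convergence of level points.
  have hlev : ∀ σ ∈ Ico (0:ℝ) 1, ∀ c ∈ Ioo σ 1, Real.exp (R σ c - R σ 1) ∈ Ioo (0:ℝ) 1 ∧
      1 - onReal (V σ) (Real.exp (R σ c - R σ 1)) = c := by
    intro σ hσ c hc
    have hm := (hF.isOrbit σ hσ).strictMono_ρ
    have hlt : R σ c < R σ 1 := hm ⟨hc.1, hc.2.trans one_lt_two⟩ ⟨hσ.2, one_lt_two⟩ hc.2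
    have hs : Real.exp (R σ c - R σ 1) ∈ Ioo (0:ℝ) 1 :=
      ⟨Real.exp_pos _, by rw [Real.exp_lt_one_iff]; linarith⟩
    obtain ⟨m, e⟩ := (hV σ hσ).2.2 _ hs
    rw [Real.log_exp, sub_add_cancel] at e
    exact ⟨hs, hm.injOn ⟨m.1, m.2.trans one_lt_two⟩ ⟨hc.1, hc.2.trans one_lt_two⟩ e⟩
  have hmono : ∀ σ ∈ Ico (0:ℝ) 1, MonotoneOn (fun s => 1 - onReal (V σ) s) (Icc 0 1) := by
    intro σ hσ s hs t ht hst
    obtain ⟨h0, h1, hi⟩ := hV σ hσ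
    rcases hst.eq_or_lt with rfl | hlt
    · exact le_rfl
    simp only
    rcases hs.1.eq_or_lt with rfl | hs0
    · rw [onReal_zero, h0, sub_sub_cancel]
      rcases ht.2.eq_or_lt with rfl | ht1
      · rw [onReal_one, h1, sub_zero]; exact hσ.2.le
      · exact (hi t ⟨hlt, ht1⟩).1.1.le
    · have hs1 : s ∈ Ioo (0:ℝ) 1 := ⟨hs0, hlt.trans_le ht.2⟩
      rcases ht.2.eq_or_lt with rfl | ht1
      · rw [onReal_one, h1, sub_zero]; exact (hi s hs1).1.2.le
      · obtain ⟨m1, e1⟩ := hi s hs1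
        obtain ⟨m2, e2⟩ := hi t ⟨hs0.trans hlt, ht1⟩
        refine ((hF.isOrbit σ hσ).strictMono_ρ.le_iff_le ⟨m1.1, m1.2.trans one_lt_two⟩
          ⟨m2.1, m2.2.trans one_lt_two⟩).1 ?_
        rw [e1, e2]
        have := Real.log_lt_log hs0 hlt
        linarith
  have hpt : ∀ c ∈ Ioc σ₀ 1, Tendsto (fun σ => R σ c) F (𝓝 (R σ₀ c)) := hconv
  have hU := tendstoUniformlyOn_of_level_points (F := F) (w := fun σ s => 1 - onReal (V σ) s)
    (w₀ := fun s => 1 - onReal (V σ₀) s) (σ := id) (σ₀ := σ₀)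
    (s := fun σ c => Real.exp (R σ c - R σ 1)) (s₀ := fun c => Real.exp (R σ₀ c - R σ₀ 1)) hFσ
    (by filter_upwards [hFm] with σ hσ using hmono σ hσ)
    (hmono σ₀ hσ₀)
    (by filter_upwards [hFm] with σ hσ; rw [onReal_zero, (hV σ hσ).1, sub_sub_cancel]; rfl)
    (by filter_upwards [hFm] with σ hσ; rw [onReal_one, (hV σ hσ).2.1, sub_zero])
    (by rw [onReal_zero, (hV σ₀ hσ₀).1, sub_sub_cancel])
    (by rw [onReal_one, (hV σ₀ hσ₀).2.1, sub_zero])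
    (fun c hc => by
      filter_upwards [hFm, hFσ.eventually (Iio_mem_nhds hc.1)] with σ hσ hσc
      obtain ⟨m, e⟩ := hlev σ hσ c ⟨hσc, hc.2⟩
      exact ⟨Ioo_subset_Icc_self m, e⟩)
    (fun c hc => by
      obtain ⟨m, e⟩ := hlev σ₀ hσ₀ c hc
      exact ⟨Ioo_subset_Icc_self m, e⟩)
    (fun c hc => (Real.continuous_exp.tendsto _).comp
      ((hpt c ⟨hc.1, hc.2.le⟩).sub (hpt 1 ⟨hσ₀.2, le_rfl⟩)))
  rw [ContinuousMap.tendsto_iff_tendstoUniformly, Metric.tendstoUniformly_iff]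
  rw [Metric.tendstoUniformlyOn_iff] at hU
  intro ε hε
  filter_upwards [hU ε hε] with σ hσ s
  have := hσ s s.2
  rw [onReal_apply, onReal_apply, Real.dist_eq] at this
  rw [Real.dist_eq, abs_sub_comm]
  convert this using 2
  ring

end MEMS
end

/-! ### Continuity of the orbit family and separation of its members -/

noncomputable section
namespace MEMS

variable {β k γ δ u₁ σ σ' e : ℝ} {h L ω D ρ Y ρ' Y' : ℝ → ℝ} {R S : ℝ → ℝ → ℝ}

/-- The members are continued to `2` so that `u = 1` is an interior point; uniqueness is only needed
up to `1`, where orbits coming from solutions end. -/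
theorem IsGrowth.exists_orbitFamily (hg : IsGrowth β δ u₁ h L ω D) (hp : Admissible β k γ)
    (hh : Nonlinearity h) (h0 : 0 < u₁) (h1 : u₁ ≤ 1) : ∃ R S, IsOrbitFamily β k γ h R S := by
  have hex : ∀ σ ∈ Ico (0:ℝ) 1, ∃ ρ Y, IsOrbit β k γ h σ 2 ρ Y := by
    intro σ hσ
    rcases hσ.1.eq_or_lt with rfl | hσ0
    · exact hg.exists_singular hp hh h0 (by linarith)
    · exact MEMS.exists_isOrbit hp hh hσ0 (by linarith [hσ.2])
  choose! R S hRS using hex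
  refine ⟨R, S, hRS, fun σ hσ ρ Y ho u hu => ?_⟩
  have ho' := (hRS σ hσ).mono_right one_le_two
  rcases hσ.1.eq_or_lt with rfl | hσ0
  · exact (hg.unique_singular hp hh h0 h1 ho ho' u hu).1
  · exact (ho.unique_regular hp hh hσ0 ho' u hu).1

/-- At `σ₀ = 0` this is the closeness of all orbits with small starting points, at `σ₀ > 0` the
continuous dependence of regular orbits. The filter within `[0, 1)` covers both. -/
theorem IsOrbitFamily.tendsto_orbit (hF : IsOrbitFamily β k γ h R S)
    (hg : IsGrowth β δ u₁ h L ω D) (hp : Admissible β k γ) (hh : Nonlinearity h) (h0 : 0 < u₁)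
    (h1 : u₁ ≤ 1) {σ₀ a b ε : ℝ} (hσ₀ : σ₀ ∈ Ico (0:ℝ) 1) (ha : σ₀ < a) (hb : b < 2)
    (hε : 0 < ε) : ∀ᶠ σ in 𝓝[Ico 0 1] σ₀, σ < a ∧ ∀ u ∈ Icc a b,
      dist (R σ u, S σ u) (R σ₀ u, S σ₀ u) < ε := by
  rcases hσ₀.1.eq_or_lt with rfl | hσ0
  · obtain ⟨σ₁, p1, p2, p3⟩ := hg.exists_close (e := 2) hp hh h0 (by linarith) ha hb hε
    filter_upwards [self_mem_nhdsWithin, mem_nhdsWithin_of_mem_nhds (Iio_mem_nhds p1)]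
      with σ hσ hσ1
    exact ⟨hσ1.trans p2, p3 σ 0 _ _ _ _ hσ.1 hσ1 le_rfl p1 (hF.isOrbit σ hσ) (hF.isOrbit 0 hσ₀)⟩
  · filter_upwards [self_mem_nhdsWithin, mem_nhdsWithin_of_mem_nhds
      (MEMS.tendsto_orbit hp hh hσ0 (hF.isOrbit σ₀ hσ₀) ha hb hε)] with σ hσ hσ1
    exact ⟨hσ1.1, hσ1.2 _ _ (hF.isOrbit σ hσ)⟩

/-- Orbits with different starting points do not meet. -/
lemma IsOrbit.ne_of_lt (ho : IsOrbit β k γ h σ e ρ Y) (ho' : IsOrbit β k γ h σ' e ρ' Y')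
    (hp : Admissible β k γ) (hh : Nonlinearity h) (hσ' : 0 ≤ σ') (hσ : σ' < σ) :
    ∀ u ∈ Ioo σ e, (ρ u, Y u) ≠ (ρ' u, Y' u) := by
  intro u hu heq
  have hβ := hp.β_pos
  have hk := hp.k_pos
  have hγ := hp.γ_pos
  -- Backward uniqueness: for large `K` the squared distance times `exp (K v)` is monotone, so
  -- orbits that meet at `u` coincide on `(σ, u)`. There `ρ → -∞` at `σ`, whereas `ρ'` has a finite
  -- limit because `σ' < σ`.
  have key : ∀ a ∈ Ioo σ u, ρ a = ρ' a := by
    intro a ha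
    have hs : ∀ v ∈ Icc a u, v ∈ Ioo σ e := fun v hv => ⟨ha.1.trans_le hv.1, hv.2.trans_lt hu.2⟩
    have hs' : ∀ v ∈ Icc a u, v ∈ Ioo σ' e := fun v hv => ⟨hσ.trans (hs v hv).1, (hs v hv).2⟩
    have hpos : ∀ v ∈ Icc a u, 0 < v := fun v hv => hσ'.trans_lt (hs' v hv).1
    choose! p m p0 m0 p1 m1 pe me using fun v (hv : v ∈ Icc a u) =>
      exists_linear_difference (ρ := ρ) (Y := Y) (ρ' := ρ') (Y' := Y') (γ := γ) (k := k) (β := β)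
        hh (hpos v hv)
    have hbd : ∀ (σ : ℝ) (ρ Y : ℝ → ℝ), IsOrbit β k γ h σ e ρ Y → (∀ v ∈ Icc a u, v ∈ Ioo σ e) →
        ∃ B, ∀ v ∈ Icc a u, Real.exp (k * ρ v - Y v / β) ≤ B ∧
          h v * Real.exp ((γ + k) * ρ v - (1 + 1 / β) * Y v) ≤ B := by
      intro σ ρ Y ho hs
      have c1 := ho.continuousOn_ρ.mono hs
      have c2 := ho.continuousOn_Y.mono hs
      have c3 := hh.continuousOn.mono hpos
      have c4 : ContinuousOn (fun v => Real.exp (k * ρ v - Y v / β)) (Icc a u) :=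
        ((continuousOn_const.mul c1).sub (c2.div_const β)).rexp
      have c5 : ContinuousOn (fun v => h v * Real.exp ((γ + k) * ρ v - (1 + 1 / β) * Y v))
          (Icc a u) :=
        c3.mul ((continuousOn_const.mul c1).sub (continuousOn_const.mul c2)).rexp
      obtain ⟨B₁, hB₁⟩ := isCompact_Icc.bddAbove_image c4
      obtain ⟨B₂, hB₂⟩ := isCompact_Icc.bddAbove_image c5
      exact ⟨max B₁ B₂, fun v hv => ⟨(hB₁ ⟨v, hv, rfl⟩).trans (le_max_left _ _),
        (hB₂ ⟨v, hv, rfl⟩).trans (le_max_right _ _)⟩⟩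
    obtain ⟨B₁, hB₁⟩ := hbd σ ρ Y ho hs
    obtain ⟨B₂, hB₂⟩ := hbd σ' ρ' Y' ho' hs'
    set B := max B₁ B₂ with hB
    have hpB : ∀ v ∈ Icc a u, p v ≤ B := fun v hv =>
      (p1 v hv).2.trans (max_le_max (hB₁ v hv).1 (hB₂ v hv).1)
    have hmB : ∀ v ∈ Icc a u, m v ≤ B := fun v hv =>
      (m1 v hv).2.trans (max_le_max (hB₁ v hv).2 (hB₂ v hv).2)
    set K := 2 * B * (2 * k + γ + 1 + 2 / β) with hK
    set E : ℝ → ℝ := fun v => ((ρ v - ρ' v) ^ 2 + (Y v - Y' v) ^ 2) * Real.exp (K * v) with hE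
    have hmono : MonotoneOn E (Icc a u) := by
      have hd : ∀ v ∈ Icc a u, HasDerivAt E
          ((2 * (ρ v - ρ' v) * (p v * (k * (ρ v - ρ' v) - (Y v - Y' v) / β)) +
            2 * (Y v - Y' v) * (m v * ((γ + k) * (ρ v - ρ' v) - (1 + 1 / β) * (Y v - Y' v)))) *
            Real.exp (K * v) +
            ((ρ v - ρ' v) ^ 2 + (Y v - Y' v) ^ 2) * (Real.exp (K * v) * K)) v := by
        intro v hv
        have d1 := ((ho.deriv_ρ v (hs v hv)).sub (ho'.deriv_ρ v (hs' v hv))).pow 2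
        have d2 := ((ho.deriv_Y v (hs v hv)).sub (ho'.deriv_Y v (hs' v hv))).pow 2
        have d3 := ((hasDerivAt_id v).const_mul K).exp
        refine ((d1.add d2).mul d3).congr_deriv ?_
        simp only [Pi.sub_apply, Pi.add_apply, Pi.pow_apply, id, mul_one]
        rw [pe v hv, me v hv]
        norm_num
      refine monotoneOn_of_hasDerivAt (convex_Icc _ _) hd fun v hv => ?_
      have q1 := hpB v hv
      have q2 := hmB v hv
      have q3 := p0 v hv
      have q4 := m0 v hv
      have hx := Real.exp_pos (K * v)
      generalize ρ v - ρ' v = x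
      generalize Y v - Y' v = y
      generalize p v = p at *
      generalize m v = m at *
      have t1 : -(B * (k + 1 / β) * (x ^ 2 + y ^ 2)) ≤ x * (p * (k * x - y / β)) := by
        have : |x * (p * (k * x - y / β))| ≤ B * ((k + 1 / β) * (x ^ 2 + y ^ 2)) := by
          have e : x * (p * (k * x - y / β)) = p * (k * x ^ 2 - x * y * (1 / β)) := by ring
          rw [e, abs_mul, abs_of_pos q3]
          refine mul_le_mul q1 ?_ (abs_nonneg _) (q3.le.trans q1)
          have : 0 < 1 / β := by positivity
          rw [abs_le]
          constructor <;> nlinarith [sq_nonneg (x + y), sq_nonneg (x - y),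
            mul_nonneg this.le (sq_nonneg (x + y)), mul_nonneg this.le (sq_nonneg (x - y)),
            mul_nonneg this.le (sq_nonneg x), mul_nonneg this.le (sq_nonneg y),
            mul_nonneg hk.le (sq_nonneg x), mul_nonneg hk.le (sq_nonneg y)]
        linarith [(abs_le.1 this).1]
      have t2 : -(B * (γ + k + (1 + 1 / β)) * (x ^ 2 + y ^ 2)) ≤
          y * (m * ((γ + k) * x - (1 + 1 / β) * y)) := by
        have : |y * (m * ((γ + k) * x - (1 + 1 / β) * y))| ≤
            B * ((γ + k + (1 + 1 / β)) * (x ^ 2 + y ^ 2)) := by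
          have e : y * (m * ((γ + k) * x - (1 + 1 / β) * y)) =
            m * ((γ + k) * (x * y) - (1 + 1 / β) * y ^ 2) := by ring
          rw [e, abs_mul, abs_of_pos q4]
          refine mul_le_mul q2 ?_ (abs_nonneg _) (q4.le.trans q2)
          have h1 : 0 < 1 + 1 / β := by positivity
          have h2 : 0 < γ + k := by positivity
          generalize 1 + 1 / β = c1 at *
          generalize γ + k = c2 at *
          rw [abs_le]
          constructor <;> nlinarith [mul_nonneg h2.le (sq_nonneg (x + y)),
            mul_nonneg h2.le (sq_nonneg (x - y)), mul_nonneg h1.le (sq_nonneg x),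
            mul_nonneg h1.le (sq_nonneg y), mul_nonneg h2.le (sq_nonneg x),
            mul_nonneg h2.le (sq_nonneg y)]
        linarith [(abs_le.1 this).1]
      have t3 : 0 ≤ 2 * x * (p * (k * x - y / β)) +
          2 * y * (m * ((γ + k) * x - (1 + 1 / β) * y)) + (x ^ 2 + y ^ 2) * K := by
        rw [hK]
        have : 2 / β = 2 * (1 / β) := by ring
        rw [this]
        linarith
      have := mul_nonneg t3 hx.le
      linarith
    have h1 := hmono ⟨le_rfl, ha.2.le⟩ ⟨ha.2.le, le_rfl⟩ ha.2.le
    have h2 : E u = 0 := by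
      have e1 := (Prod.ext_iff.1 heq).1
      have e2 := (Prod.ext_iff.1 heq).2
      simp only at e1 e2
      simp [hE, e1, e2]
    rw [h2] at h1
    have h3 : (ρ a - ρ' a) ^ 2 + (Y a - Y' a) ^ 2 ≤ 0 := by
      by_contra! hcon
      exact absurd h1 (not_le.2 (mul_pos hcon (Real.exp_pos _)))
    have h4 : (ρ a - ρ' a) ^ 2 = 0 :=
      le_antisymm (by nlinarith [sq_nonneg (Y a - Y' a)]) (sq_nonneg _)
    exact sub_eq_zero.1 (pow_eq_zero_iff two_ne_zero |>.1 h4)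
  have t1 : Tendsto ρ' (𝓝[>] σ) (𝓝 (ρ' σ)) :=
    (ho'.deriv_ρ σ ⟨hσ, hu.1.trans hu.2⟩).continuousAt.tendsto.mono_left nhdsWithin_le_nhds
  refine not_tendsto_nhds_of_tendsto_atBot ho.tendsto_ρ (ρ' σ) (t1.congr' ?_)
  filter_upwards [Ioo_mem_nhdsGT hu.1] with a ha using (key a ha).symm

/-- Near its starting point a regular orbit lies below the singular one, locally uniformly. -/
lemma IsOrbitFamily.eventually_lt_singular (hF : IsOrbitFamily β k γ h R S)
    (hp : Admissible β k γ) (hh : Nonlinearity h) {σ₀ : ℝ} (hσ₀ : σ₀ ∈ Ioo (0:ℝ) 1) :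
    ∃ w ∈ Ioo σ₀ 1, ∀ᶠ σ in 𝓝 σ₀, σ ∈ Ioo 0 w ∧
      ∀ u ∈ Ioc σ w, R σ u < R 0 u ∧ S σ u < S 0 u := by
  have hγ := hp.γ_pos
  have hθ := hp.θ_pos
  have ho0 := hF.isOrbit 0 ⟨le_rfl, one_pos⟩
  set a := σ₀ / 2 with ha
  have ha0 : 0 < a := half_pos hσ₀.1
  have ha2 : a ∈ Ioo (0:ℝ) 2 := ⟨ha0, by linarith [hσ₀.2]⟩
  have hha := hh.pos a ha0
  -- If `R σ u < m`, then `R σ u < R 0 a`, and the flux bound `h a exp (γ R σ u) / γ` is below `exp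
  -- (S 0 a)`. The singular orbit increases, so comparison with its values at `a < u` is enough.
  set m := min (R 0 a) (Real.log (γ * Real.exp (S 0 a) / h a) / γ) with hm
  have hs1 := speed_pos hp hh (u := 1) one_pos
  -- For `σ` and `u` within `η` of `σ₀` one has `u - σ ≤ 2 η`, and the growth estimate for `r ^ θ`
  -- keeps `R σ u` below `m`. The other bounds keep `σ` above `a` and `u` below `1`.
  set η := min (Real.exp ((γ / β - k) * m) / (2 * speed β k γ h 1))
    (min (σ₀ / 2) ((1 - σ₀) / 2)) with hη
  have hη0 : 0 < η := lt_min (by positivity) (lt_min (half_pos hσ₀.1) (by linarith [hσ₀.2]))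
  have hη1 : η ≤ σ₀ / 2 := (min_le_right _ _).trans (min_le_left _ _)
  have hη2 : η ≤ (1 - σ₀) / 2 := (min_le_right _ _).trans (min_le_right _ _)
  have hη3 : speed β k γ h 1 * (2 * η) ≤ Real.exp ((γ / β - k) * m) := by
    have := min_le_left (Real.exp ((γ / β - k) * m) / (2 * speed β k γ h 1))
      (min (σ₀ / 2) ((1 - σ₀) / 2))
    rw [← hη, le_div_iff₀ (by positivity)] at this
    linarith
  refine ⟨σ₀ + η, ⟨by linarith, by linarith [hσ₀.2]⟩, ?_⟩
  filter_upwards [Ioo_mem_nhds (show σ₀ - η < σ₀ by linarith) (show σ₀ < σ₀ + η by linarith)]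
    with σ hσ
  have hσ0 : 0 < σ := by linarith [hσ.1, hσ₀.1]
  refine ⟨⟨hσ0, hσ.2⟩, fun u hu => ?_⟩
  have hu1 : u < 1 := by linarith [hu.2, hσ₀.2]
  have hu0 : 0 < u := hσ0.trans hu.1
  have hau : a < u := by linarith [hu.1, hσ.1]
  have ho := hF.isOrbit σ ⟨hσ0.le, hu.1.trans hu1⟩
  have hum : u ∈ Ioo σ 2 := ⟨hu.1, by linarith⟩
  have hum0 : u ∈ Ioo (0:ℝ) 2 := ⟨hu0, by linarith⟩
  have b1 : R σ u < m := by
    have h1 := ho.exp_θρ_le hp hh hσ0.le hum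
    have h2 := speed_mono hp hh (show u ∈ Ioi (0:ℝ) from hu0) (show (1:ℝ) ∈ Ioi (0:ℝ) from mem_Ioi.2 one_pos)
      hu1.le
    have h3 : speed β k γ h u * (u - σ) ≤ speed β k γ h 1 * (u - σ) :=
      mul_le_mul_of_nonneg_right h2 (by linarith [hu.1])
    have h4 : speed β k γ h 1 * (u - σ) < speed β k γ h 1 * (2 * η) :=
      mul_lt_mul_of_pos_left (by linarith [hu.2, hσ.1]) hs1
    have h5 : Real.exp ((γ / β - k) * R σ u) < Real.exp ((γ / β - k) * m) := by linarith
    exact lt_of_mul_lt_mul_left (Real.exp_lt_exp.1 h5) hθ.le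
  constructor
  · exact (b1.trans_le (min_le_left _ _)).trans (ho0.strictMono_ρ ha2 hum0 hau)
  · refine lt_trans ?_ (ho0.strictMono_Y hh le_rfl ha2 hum0 hau)
    have b2 := b1.trans_le (min_le_right _ _)
    rw [lt_div_iff₀ hγ, Real.lt_log_iff_exp_lt (by positivity), lt_div_iff₀ hha] at b2
    rw [← Real.exp_lt_exp]
    refine (ho.exp_Y_le hp hh hσ0 hum).trans_lt ?_
    have hhσ : h σ ≤ h a := hh.anti (show a ∈ Ioi (0:ℝ) from ha0) (show σ ∈ Ioi (0:ℝ) from hσ0)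
      (by linarith [hσ.1])
    rw [← mul_div_assoc, div_lt_iff₀ hγ]
    rw [mul_comm γ (R σ u)]
    have := mul_le_mul_of_nonneg_right hhσ (Real.exp_pos (R σ u * γ)).le
    linarith

end MEMS
end

noncomputable section
namespace MEMS

/-! ### Rotation of regular orbits about the singular one -/

variable {β k γ δ u₁ σ σ' e : ℝ} {h L ω D ρ Y ρ' Y' : ℝ → ℝ} {R S : ℝ → ℝ → ℝ}

/-- The difference of two points of the `(ρ, Y)`-plane as a complex number. -/
def complexDiff (q q' : ℝ × ℝ) : ℂ := ((q.1 - q'.1 : ℝ) : ℂ) + ((q.2 - q'.2 : ℝ) : ℂ) * Complex.I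

/-- The derivative of the difference of two orbits. -/
def complexDiffDeriv (β k γ : ℝ) (h : ℝ → ℝ) (u : ℝ) (q q' : ℝ × ℝ) : ℂ :=
  ((Real.exp (k * q.1 - q.2 / β) - Real.exp (k * q'.1 - q'.2 / β) : ℝ) : ℂ) +
    ((h u * Real.exp ((γ + k) * q.1 - (1 + 1 / β) * q.2) -
      h u * Real.exp ((γ + k) * q'.1 - (1 + 1 / β) * q'.2) : ℝ) : ℂ) * Complex.I

lemma ofReal_add_mul_I_re (a b : ℝ) : ((a : ℂ) + (b : ℂ) * Complex.I).re = a := by simp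

lemma ofReal_add_mul_I_im (a b : ℝ) : ((a : ℂ) + (b : ℂ) * Complex.I).im = b := by simp

lemma complexDiff_re (q q' : ℝ × ℝ) : (complexDiff q q').re = q.1 - q'.1 :=
  ofReal_add_mul_I_re _ _

lemma complexDiff_im (q q' : ℝ × ℝ) : (complexDiff q q').im = q.2 - q'.2 :=
  ofReal_add_mul_I_im _ _

lemma complexDiffDeriv_re (u : ℝ) (q q' : ℝ × ℝ) : (complexDiffDeriv β k γ h u q q').re =
    Real.exp (k * q.1 - q.2 / β) - Real.exp (k * q'.1 - q'.2 / β) :=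
  ofReal_add_mul_I_re _ _

lemma complexDiffDeriv_im (u : ℝ) (q q' : ℝ × ℝ) : (complexDiffDeriv β k γ h u q q').im =
    h u * Real.exp ((γ + k) * q.1 - (1 + 1 / β) * q.2) -
      h u * Real.exp ((γ + k) * q'.1 - (1 + 1 / β) * q'.2) :=
  ofReal_add_mul_I_im _ _

lemma complexDiff_ne_zero {q q' : ℝ × ℝ} (hq : q ≠ q') : complexDiff q q' ≠ 0 := by
  intro h0
  have h1 := congrArg Complex.re h0
  have h2 := congrArg Complex.im h0
  rw [complexDiff_re] at h1
  rw [complexDiff_im] at h2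
  exact hq (Prod.ext (sub_eq_zero.1 h1) (sub_eq_zero.1 h2))

lemma IsOrbit.hasDerivAt_complexDiff (ho : IsOrbit β k γ h σ e ρ Y)
    (ho' : IsOrbit β k γ h σ' e ρ' Y') {u : ℝ} (hu : u ∈ Ioo σ e) (hu' : u ∈ Ioo σ' e) :
    HasDerivAt (fun u => complexDiff (ρ u, Y u) (ρ' u, Y' u))
      (complexDiffDeriv β k γ h u (ρ u, Y u) (ρ' u, Y' u)) u := by
  have d1 := ((ho.deriv_ρ u hu).sub (ho'.deriv_ρ u hu')).ofReal_comp
  have d2 := (((ho.deriv_Y u hu).sub (ho'.deriv_Y u hu')).ofReal_comp).mul_const Complex.I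
  exact d1.add d2

lemma im_div_eq (z w : ℂ) : (z / w).im = (w.re * z.im - w.im * z.re) / (w.re ^ 2 + w.im ^ 2) := by
  rw [Complex.div_im, Complex.normSq_apply]
  ring

/-- Where the `ρ`-difference vanishes, the difference of two orbits turns counterclockwise. -/
lemma im_complexDiff_pos (hp : Admissible β k γ) (hh : Nonlinearity h) {u : ℝ} (hu : 0 < u)
    {q q' : ℝ × ℝ} (hq : q ≠ q') (h0 : (complexDiff q q').re = 0) :
    0 < (complexDiffDeriv β k γ h u q q' / complexDiff q q').im := by
  have hβ := hp.β_pos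
  obtain ⟨p, m, hp0, -, -, -, hpe, -⟩ := exists_linear_difference (ρ := fun _ => q.1)
    (Y := fun _ => q.2) (ρ' := fun _ => q'.1) (Y' := fun _ => q'.2) (γ := γ) (k := k) (β := β) hh hu
  have him : (complexDiff q q').im ≠ 0 := by
    intro h1
    exact complexDiff_ne_zero hq (Complex.ext h0 h1)
  rw [im_div_eq, h0, complexDiffDeriv_re, hpe]
  rw [complexDiff_re] at h0
  rw [complexDiff_im] at him ⊢
  rw [h0]
  generalize q.2 - q'.2 = y at *
  -- At a zero of the `ρ`-difference its derivative is `-p y / β`, so the angular speed is `p / β >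
  -- 0`.
  have e : (0 * (complexDiffDeriv β k γ h u q q').im - y * (p * (k * 0 - y / β))) / (0 ^ 2 + y ^ 2)
      = p / β := by
    field_simp
    ring
  rw [e]
  positivity

/-- The family of functions composed with a continuous function converges uniformly. -/
lemma tendstoUniformlyOn_comp_of_isCompact {ι E G : Type*} [PseudoMetricSpace E] [ProperSpace E]
    [PseudoMetricSpace G] {F : Filter ι} {f : ι → ℝ → E} {f₀ : ℝ → E} {g : E → G} {W : Set E}
    {s : Set ℝ} (hs : IsCompact s) (hf₀ : ContinuousOn f₀ s) (hW : IsOpen W)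
    (hsW : ∀ x ∈ s, f₀ x ∈ W) (hg : ContinuousOn g W) (hf : TendstoUniformlyOn f f₀ F s) :
    TendstoUniformlyOn (fun i x => g (f i x)) (fun x => g (f₀ x)) F s := by
  have hc := hs.image_of_continuousOn hf₀
  obtain ⟨δ, hδ, hsub⟩ := hc.exists_cthickening_subset_open hW (by
    rintro _ ⟨x, hx, rfl⟩; exact hsW x hx)
  have hK : IsCompact (Metric.cthickening δ (f₀ '' s)) := hc.cthickening
  have hUC := hK.uniformContinuousOn_of_continuous (hg.mono hsub)
  refine UniformContinuousOn.comp_tendstoUniformlyOn_eventually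
    (s := Metric.cthickening δ (f₀ '' s)) ?_ ?_ hUC hf
  · filter_upwards [Metric.tendstoUniformlyOn_iff.1 hf δ hδ] with i hi x hx
    exact Metric.mem_cthickening_of_dist_le _ (f₀ x) _ _ ⟨x, hx, rfl⟩
      (by rw [dist_comm]; exact (hi x hx).le)
  · exact fun x hx => Metric.self_subset_cthickening _ ⟨x, hx, rfl⟩

/-- The difference between an orbit of a family and the singular one. -/
def famDiff (R S : ℝ → ℝ → ℝ) (σ u : ℝ) : ℂ := complexDiff (R σ u, S σ u) (R 0 u, S 0 u)

/-- Its logarithmic derivative. -/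
def famLogDeriv (β k γ : ℝ) (h : ℝ → ℝ) (R S : ℝ → ℝ → ℝ) (σ u : ℝ) : ℂ :=
  complexDiffDeriv β k γ h u (R σ u, S σ u) (R 0 u, S 0 u) / famDiff R S σ u

/-- A continuous logarithm of the difference, started at `w`. -/
def famLog (β k γ : ℝ) (h : ℝ → ℝ) (R S : ℝ → ℝ → ℝ) (σ w u : ℝ) : ℂ :=
  Complex.log (-famDiff R S σ w) + Real.pi * Complex.I + ∫ x in w..u, famLogDeriv β k γ h R S σ x

/-- `w` belongs to the initial interval where both components of the difference are negative. -/
def IsInitial (R S : ℝ → ℝ → ℝ) (σ w : ℝ) : Prop :=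
  w ∈ Ioo σ 1 ∧ ∀ u ∈ Ioc σ w, R σ u < R 0 u ∧ S σ u < S 0 u

lemma IsInitial.of_le {w w' : ℝ} (hw : IsInitial R S σ w) (h1 : σ < w') (h2 : w' ≤ w) :
    IsInitial R S σ w' :=
  ⟨⟨h1, h2.trans_lt hw.1.2⟩, fun u hu => hw.2 u ⟨hu.1, hu.2.trans h2⟩⟩

namespace IsOrbitFamily

lemma famDiff_ne_zero (hF : IsOrbitFamily β k γ h R S) (hp : Admissible β k γ)
    (hh : Nonlinearity h) (hσ : σ ∈ Ioo (0:ℝ) 1) {u : ℝ} (hu : u ∈ Ioo σ 2) :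
    famDiff R S σ u ≠ 0 :=
  complexDiff_ne_zero ((hF.isOrbit σ ⟨hσ.1.le, hσ.2⟩).ne_of_lt
    (hF.isOrbit 0 ⟨le_rfl, one_pos⟩) hp hh le_rfl hσ.1 u hu)

lemma hasDerivAt_famDiff (hF : IsOrbitFamily β k γ h R S) (hp : Admissible β k γ)
    (hh : Nonlinearity h) (hσ : σ ∈ Ioo (0:ℝ) 1) {u : ℝ} (hu : u ∈ Ioo σ 2) :
    HasDerivAt (famDiff R S σ) (famLogDeriv β k γ h R S σ u * famDiff R S σ u) u := by
  have := (hF.isOrbit σ ⟨hσ.1.le, hσ.2⟩).hasDerivAt_complexDiff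
    (hF.isOrbit 0 ⟨le_rfl, one_pos⟩) hu ⟨hσ.1.trans hu.1, hu.2⟩
  rwa [famLogDeriv, div_mul_cancel₀ _ (hF.famDiff_ne_zero hp hh hσ hu)]

/-- The point of evaluation for the logarithmic derivative. -/
lemma continuousOn_point (hF : IsOrbitFamily β k γ h R S) (hσ : σ ∈ Ioo (0:ℝ) 1) :
    ContinuousOn (fun u => (u, (R σ u, S σ u), (R 0 u, S 0 u))) (Ioo σ 2) := by
  have ho := hF.isOrbit σ ⟨hσ.1.le, hσ.2⟩
  have ho0 := hF.isOrbit 0 ⟨le_rfl, one_pos⟩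
  have hsub : Ioo σ 2 ⊆ Ioo 0 2 := Ioo_subset_Ioo_left hσ.1.le
  exact continuousOn_id.prodMk ((ho.continuousOn_ρ.prodMk ho.continuousOn_Y).prodMk
    ((ho0.continuousOn_ρ.mono hsub).prodMk (ho0.continuousOn_Y.mono hsub)))

end IsOrbitFamily

lemma continuousOn_logDeriv (hh : Nonlinearity h) :
    ContinuousOn (fun x : ℝ × (ℝ × ℝ) × (ℝ × ℝ) =>
      complexDiffDeriv β k γ h x.1 x.2.1 x.2.2 / complexDiff x.2.1 x.2.2)
      {x | 0 < x.1 ∧ x.2.1 ≠ x.2.2} := by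
  have ch : ContinuousOn (fun x : ℝ × (ℝ × ℝ) × (ℝ × ℝ) => h x.1)
      {x | 0 < x.1 ∧ x.2.1 ≠ x.2.2} := hh.continuousOn.comp continuousOn_fst fun x hx => hx.1
  refine ContinuousOn.div ?_ ?_ fun x hx => complexDiff_ne_zero hx.2
  · unfold complexDiffDeriv
    refine ContinuousOn.add ?_ (ContinuousOn.mul ?_ continuousOn_const)
    · exact Continuous.continuousOn (by fun_prop)
    · refine Complex.continuous_ofReal.comp_continuousOn (ContinuousOn.sub ?_ ?_)
      · exact ch.mul (Continuous.continuousOn (by fun_prop))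
      · exact ch.mul (Continuous.continuousOn (by fun_prop))
  · unfold complexDiff
    exact Continuous.continuousOn (by fun_prop)

lemma isOpen_logDeriv_domain :
    IsOpen {x : ℝ × (ℝ × ℝ) × (ℝ × ℝ) | 0 < x.1 ∧ x.2.1 ≠ x.2.2} :=
  (isOpen_lt continuous_const continuous_fst).inter
    (isOpen_ne_fun (continuous_fst.comp continuous_snd) (continuous_snd.comp continuous_snd))

namespace IsOrbitFamily

lemma continuousOn_famLogDeriv (hF : IsOrbitFamily β k γ h R S) (hp : Admissible β k γ)
    (hh : Nonlinearity h) (hσ : σ ∈ Ioo (0:ℝ) 1) :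
    ContinuousOn (famLogDeriv β k γ h R S σ) (Ioo σ 2) := by
  have hmaps : MapsTo (fun u => (u, (R σ u, S σ u), (R 0 u, S 0 u))) (Ioo σ 2)
      {x : ℝ × (ℝ × ℝ) × (ℝ × ℝ) | 0 < x.1 ∧ x.2.1 ≠ x.2.2} := fun u hu =>
    ⟨hσ.1.trans hu.1, (hF.isOrbit σ ⟨hσ.1.le, hσ.2⟩).ne_of_lt
      (hF.isOrbit 0 ⟨le_rfl, one_pos⟩) hp hh le_rfl hσ.1 u hu⟩
  have hcomp := (continuousOn_logDeriv (β := β) (k := k) (γ := γ) hh).comp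
    (hF.continuousOn_point hσ) hmaps
  exact hcomp

lemma intervalIntegrable_famLogDeriv (hF : IsOrbitFamily β k γ h R S) (hp : Admissible β k γ)
    (hh : Nonlinearity h) (hσ : σ ∈ Ioo (0:ℝ) 1) {a b : ℝ} (ha : a ∈ Ioo σ 2) (hb : b ∈ Ioo σ 2) :
    IntervalIntegrable (famLogDeriv β k γ h R S σ) MeasureTheory.volume a b :=
  ((hF.continuousOn_famLogDeriv hp hh hσ).mono
    (ordConnected_Ioo.uIcc_subset ha hb)).intervalIntegrable

lemma hasDerivAt_famLog (hF : IsOrbitFamily β k γ h R S) (hp : Admissible β k γ)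
    (hh : Nonlinearity h) (hσ : σ ∈ Ioo (0:ℝ) 1) {w u : ℝ} (hw : w ∈ Ioo σ 2) (hu : u ∈ Ioo σ 2) :
    HasDerivAt (famLog β k γ h R S σ w) (famLogDeriv β k γ h R S σ u) u := by
  have hc := hF.continuousOn_famLogDeriv hp hh hσ
  refine (intervalIntegral.integral_hasDerivAt_right
    (hF.intervalIntegrable_famLogDeriv hp hh hσ hw hu) ?_
    (hc.continuousAt (isOpen_Ioo.mem_nhds hu))).const_add _
  exact hc.stronglyMeasurableAtFilter isOpen_Ioo u hu

/-- The product of the difference with `exp (-famLog)` has derivative zero and equals `1` at `w`,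
because the added `π i` undoes the sign in the logarithm. -/
lemma exp_famLog (hF : IsOrbitFamily β k γ h R S) (hp : Admissible β k γ)
    (hh : Nonlinearity h) (hσ : σ ∈ Ioo (0:ℝ) 1) {w u : ℝ} (hw : w ∈ Ioo σ 2) (hu : u ∈ Ioo σ 2) :
    Complex.exp (famLog β k γ h R S σ w u) = famDiff R S σ u := by
  set φ : ℝ → ℂ := fun u => famDiff R S σ u * Complex.exp (-famLog β k γ h R S σ w u) with hφ
  have hd : ∀ x ∈ Ioo σ 2, HasDerivAt φ 0 x := by
    intro x hx
    refine ((hF.hasDerivAt_famDiff hp hh hσ hx).mul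
      ((hF.hasDerivAt_famLog hp hh hσ hw hx).neg.cexp)).congr_deriv ?_
    ring
  have hconst : φ u = φ w := by
    refine (convex_Ioo σ 2).is_const_of_fderivWithin_eq_zero (𝕜 := ℝ)
      (fun x hx => (hd x hx).differentiableAt.differentiableWithinAt) (fun x hx => ?_) hu hw
    rw [fderivWithin_of_isOpen isOpen_Ioo hx]
    have := (hd x hx).hasFDerivAt.fderiv
    rw [this]
    ext
    simp
  have hw1 : φ w = 1 := by
    simp only [hφ, famLog, intervalIntegral.integral_same, add_zero]
    rw [Complex.exp_neg, Complex.exp_add, Complex.exp_pi_mul_I,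
      Complex.exp_log (neg_ne_zero.2 (hF.famDiff_ne_zero hp hh hσ hw))]
    have := hF.famDiff_ne_zero hp hh hσ hw
    field_simp
  rw [hw1] at hconst
  simp only [hφ] at hconst
  rw [Complex.exp_neg] at hconst
  have := Complex.exp_ne_zero (famLog β k γ h R S σ w u)
  field_simp at hconst
  exact hconst.symm

/-- On the initial interval the negative of the difference lies in the right half-plane. There the
principal logarithm is a primitive of the logarithmic derivative, so moving the base point changes
nothing. This is why the logarithm is taken of `-famDiff`. -/
lemma famLog_eq_of_le (hF : IsOrbitFamily β k γ h R S) (hp : Admissible β k γ)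
    (hh : Nonlinearity h) (hσ : σ ∈ Ioo (0:ℝ) 1) {w w' u : ℝ} (hw : IsInitial R S σ w)
    (hw' : σ < w') (hle : w' ≤ w) (hu : u ∈ Ioo σ 2) :
    famLog β k γ h R S σ w' u = famLog β k γ h R S σ w u := by
  have hwm : w ∈ Ioo σ 2 := ⟨hw.1.1, by linarith [hw.1.2]⟩
  have hwm' : w' ∈ Ioo σ 2 := ⟨hw', by linarith [hw.1.2]⟩
  have hint := intervalIntegral.integral_eq_sub_of_hasDerivAt (a := w') (b := w)
    (f := fun x => Complex.log (-famDiff R S σ x)) (f' := famLogDeriv β k γ h R S σ)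
    (fun x hx => by
      rw [uIcc_of_le hle] at hx
      have hxm : x ∈ Ioo σ 2 := ⟨hw'.trans_le hx.1, hx.2.trans_lt hwm.2⟩
      have hne := hF.famDiff_ne_zero hp hh hσ hxm
      have hslit : -famDiff R S σ x ∈ Complex.slitPlane := by
        refine Or.inl ?_
        rw [Complex.neg_re, famDiff, complexDiff_re]
        have := (hw.2 x ⟨hxm.1, hx.2⟩).1
        simp only
        linarith
      refine ((hF.hasDerivAt_famDiff hp hh hσ hxm).neg.clog_real hslit).congr_deriv ?_
      simp only [Pi.neg_apply]
      field_simp) (hF.intervalIntegrable_famLogDeriv hp hh hσ hwm' hwm)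
  have hadd := intervalIntegral.integral_add_adjacent_intervals
    (hF.intervalIntegrable_famLogDeriv hp hh hσ hwm' hwm)
    (hF.intervalIntegrable_famLogDeriv hp hh hσ hwm hu)
  simp only [famLog]
  rw [← hadd, hint]
  ring

lemma famLog_eq (hF : IsOrbitFamily β k γ h R S) (hp : Admissible β k γ)
    (hh : Nonlinearity h) (hσ : σ ∈ Ioo (0:ℝ) 1) {w w' u : ℝ} (hw : IsInitial R S σ w)
    (hw' : IsInitial R S σ w') (hu : u ∈ Ioo σ 2) :
    famLog β k γ h R S σ w' u = famLog β k γ h R S σ w u := by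
  rcases le_total w' w with hle | hle
  · exact hF.famLog_eq_of_le hp hh hσ hw hw'.1.1 hle hu
  · exact (hF.famLog_eq_of_le hp hh hσ hw' hw.1.1 hle hu).symm

end IsOrbitFamily

end MEMS
end

/-! ### The winding angle, its continuity and its limit -/

noncomputable section
namespace MEMS

variable {β k γ δ u₁ σ : ℝ} {h L ω D : ℝ → ℝ} {R S : ℝ → ℝ → ℝ}

/-- The angle by which the orbit starting from `σ` has turned about the singular one at `u = 1`. -/
def winding (β k γ : ℝ) (h : ℝ → ℝ) (R S : ℝ → ℝ → ℝ) (σ : ℝ) : ℝ :=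
  (famLog β k γ h R S σ (Classical.epsilon (IsInitial R S σ)) 1).im

namespace IsOrbitFamily

lemma winding_eq (hF : IsOrbitFamily β k γ h R S) (hp : Admissible β k γ)
    (hh : Nonlinearity h) (hσ : σ ∈ Ioo (0:ℝ) 1) {w : ℝ} (hw : IsInitial R S σ w) :
    winding β k γ h R S σ = (famLog β k γ h R S σ w 1).im := by
  rw [winding, hF.famLog_eq hp hh hσ hw (Classical.epsilon_spec ⟨w, hw⟩)
    ⟨hσ.2, one_lt_two⟩]

/-- With the base point `w` fixed, the orbit from `σ` and the singular one are distinct on the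
compact interval `[w, 1]`, so the logarithmic derivatives converge uniformly there as `s → σ`, and
so do their integrals. -/
lemma tendsto_famLog (hF : IsOrbitFamily β k γ h R S) (hg : IsGrowth β δ u₁ h L ω D)
    (hp : Admissible β k γ) (hh : Nonlinearity h) (h0 : 0 < u₁) (h1 : u₁ ≤ 1)
    (hσ : σ ∈ Ioo (0:ℝ) 1) {w : ℝ} (hw : IsInitial R S σ w) :
    Tendsto (fun s => famLog β k γ h R S s w 1) (𝓝 σ) (𝓝 (famLog β k γ h R S σ w 1)) := by
  have hnhds : 𝓝[Ico 0 1] σ = 𝓝 σ :=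
    nhdsWithin_eq_nhds.2 (Filter.mem_of_superset (Ioo_mem_nhds hσ.1 hσ.2) Ioo_subset_Ico_self)
  have hwm : w ∈ Ioo σ 2 := ⟨hw.1.1, by linarith [hw.1.2]⟩
  have hsub : Icc w 1 ⊆ Ioo σ 2 := fun u hu => ⟨hw.1.1.trans_le hu.1, by linarith [hu.2]⟩
  have hTU : TendstoUniformlyOn (fun s u => (u, (R s u, S s u), (R 0 u, S 0 u)))
      (fun u => (u, (R σ u, S σ u), (R 0 u, S 0 u))) (𝓝 σ) (Icc w 1) := by
    rw [Metric.tendstoUniformlyOn_iff]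
    intro ε hε
    have := hF.tendsto_orbit hg hp hh h0 h1 (Ioo_subset_Ico_self hσ) hw.1.1 (b := 1) one_lt_two hε
    rw [hnhds] at this
    filter_upwards [this] with s hs u hu
    rw [Prod.dist_eq, Prod.dist_eq, dist_self, dist_self]
    refine max_lt hε (max_lt ?_ hε)
    rw [dist_comm]
    exact hs.2 u hu
  have hmaps : ∀ u ∈ Icc w 1, (u, (R σ u, S σ u), (R 0 u, S 0 u)) ∈
      {x : ℝ × (ℝ × ℝ) × (ℝ × ℝ) | 0 < x.1 ∧ x.2.1 ≠ x.2.2} := fun u hu =>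
    ⟨hσ.1.trans (hsub hu).1, (hF.isOrbit σ ⟨hσ.1.le, hσ.2⟩).ne_of_lt
      (hF.isOrbit 0 ⟨le_rfl, one_pos⟩) hp hh le_rfl hσ.1 u (hsub hu)⟩
  have hG := tendstoUniformlyOn_comp_of_isCompact isCompact_Icc
    ((hF.continuousOn_point hσ).mono hsub) isOpen_logDeriv_domain hmaps
    (continuousOn_logDeriv (β := β) (k := k) (γ := γ) hh) hTU
  have hG' : TendstoUniformlyOn (famLogDeriv β k γ h R S) (famLogDeriv β k γ h R S σ) (𝓝 σ)
      (Icc w 1) := hG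
  have hint : Tendsto (fun s => ∫ x in w..1, famLogDeriv β k γ h R S s x) (𝓝 σ)
      (𝓝 (∫ x in w..1, famLogDeriv β k γ h R S σ x)) := by
    rw [Metric.tendsto_nhds]
    intro ε hε
    filter_upwards [Metric.tendstoUniformlyOn_iff.1 hG' (ε / 2) (half_pos hε),
      Ioo_mem_nhds hσ.1 hw.1.1] with s hs hsm
    have hs1 : s ∈ Ioo (0:ℝ) 1 := ⟨hsm.1, hsm.2.trans hw.1.2⟩
    rw [dist_eq_norm, ← intervalIntegral.integral_sub
      (hF.intervalIntegrable_famLogDeriv hp hh hs1 ⟨hsm.2, hwm.2⟩ ⟨hs1.2, one_lt_two⟩)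
      (hF.intervalIntegrable_famLogDeriv hp hh hσ hwm ⟨hσ.2, one_lt_two⟩)]
    have := intervalIntegral.norm_integral_le_of_norm_le_const (a := w) (b := 1) (C := ε / 2)
      (f := fun x => famLogDeriv β k γ h R S s x - famLogDeriv β k γ h R S σ x) fun x hx => by
        rw [uIoc_of_le hw.1.2.le] at hx
        rw [← dist_eq_norm, dist_comm]
        exact (hs x (Ioc_subset_Icc_self hx)).le
    refine this.trans_lt ?_
    have hw0 : 0 < w := hσ.1.trans hw.1.1
    rw [abs_of_pos (by linarith [hw.1.2])]
    nlinarith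
  have hslit : -famDiff R S σ w ∈ Complex.slitPlane := by
    refine Or.inl ?_
    rw [Complex.neg_re, famDiff, complexDiff_re]
    have := (hw.2 w ⟨hw.1.1, le_rfl⟩).1
    simp only
    linarith
  have hdiff : Tendsto (fun s => famDiff R S s w) (𝓝 σ) (𝓝 (famDiff R S σ w)) := by
    have hpt := hTU.tendsto_at (show w ∈ Icc w 1 from ⟨le_rfl, hw.1.2.le⟩)
    have hc : Continuous fun x : ℝ × (ℝ × ℝ) × (ℝ × ℝ) => complexDiff x.2.1 x.2.2 := by
      unfold complexDiff; fun_prop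
    exact (hc.tendsto _).comp hpt
  exact ((hdiff.neg.clog hslit).add_const _).add hint

/-- One initial point `w` serves all starting points near `σ`; since the winding does not depend on
the initial point, the arbitrary choice in its definition may be replaced by this common one. -/
lemma continuousOn_winding (hF : IsOrbitFamily β k γ h R S) (hg : IsGrowth β δ u₁ h L ω D)
    (hp : Admissible β k γ) (hh : Nonlinearity h) (h0 : 0 < u₁) (h1 : u₁ ≤ 1) :
    ContinuousOn (winding β k γ h R S) (Ioo 0 1) := by
  intro σ hσ
  refine ContinuousAt.continuousWithinAt ?_
  obtain ⟨w, hw, hev⟩ := hF.eventually_lt_singular hp hh hσ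
  have hini : ∀ᶠ s in 𝓝 σ, s ∈ Ioo (0:ℝ) 1 ∧ IsInitial R S s w := by
    filter_upwards [hev] with s hs
    exact ⟨⟨hs.1.1, hs.1.2.trans hw.2⟩, ⟨hs.1.2, hw.2⟩, hs.2⟩
  have hσi := hini.self_of_nhds
  have ht := (Complex.continuous_im.tendsto _).comp
    (hF.tendsto_famLog hg hp hh h0 h1 hσ hσi.2)
  rw [ContinuousAt, hF.winding_eq hp hh hσ hσi.2]
  refine ht.congr' ?_
  filter_upwards [hini] with s hs
  exact (hF.winding_eq hp hh hs.1 hs.2).symm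

/-- The angle never returns below an odd multiple of `π / 2`. -/
lemma famLog_barrier (hF : IsOrbitFamily β k γ h R S) (hp : Admissible β k γ)
    (hh : Nonlinearity h) (hσ : σ ∈ Ioo (0:ℝ) 1) {w a b : ℝ} (hw : w ∈ Ioo σ 2) (ha : σ < a)
    (hab : a ≤ b) (hb : b < 2) (m : ℤ)
    (hm : Real.pi / 2 + m * Real.pi ≤ (famLog β k γ h R S σ w a).im) :
    Real.pi / 2 + m * Real.pi ≤ (famLog β k γ h R S σ w b).im := by
  refine barrier_le (f := fun u => (famLog β k γ h R S σ w u).im)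
    (f' := fun u => (famLogDeriv β k γ h R S σ u).im) (a := a) (b := b) (fun u hu => ?_)
    (fun u hu heq => ?_) hm b ⟨hab, le_rfl⟩
  · exact (Complex.imCLM.hasFDerivAt.comp_hasDerivAt u
      (hF.hasDerivAt_famLog hp hh hσ hw ⟨ha.trans_le hu.1, hu.2.trans_lt hb⟩))
  · have hum : u ∈ Ioo σ 2 := ⟨ha.trans_le hu.1, hu.2.trans_lt hb⟩
    refine im_complexDiff_pos hp hh (hσ.1.trans hum.1)
      ((hF.isOrbit σ ⟨hσ.1.le, hσ.2⟩).ne_of_lt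
        (hF.isOrbit 0 ⟨le_rfl, one_pos⟩) hp hh le_rfl hσ.1 u hum) ?_
    have := hF.exp_famLog hp hh hσ hw hum
    change (famDiff R S σ u).re = 0
    rw [← this, Complex.exp_re, heq]
    have hcos : Real.cos (Real.pi / 2 + m * Real.pi) = 0 :=
      Real.cos_eq_zero_iff.2 ⟨m, by ring⟩
    rw [hcos, mul_zero]

/-- In the spiral case the winding angle tends to infinity. -/
theorem tendsto_winding (hF : IsOrbitFamily β k γ h R S) (hg : IsGrowth β δ u₁ h L ω D)
    (hp : Admissible β k γ) (hh : Nonlinearity h) (h0 : 0 < u₁) (h1 : u₁ ≤ 1)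
    (hspiral : (ratioEq β k γ δ - δ) ^ 2 < 4 * ratioEq β k γ δ) :
    Tendsto (winding β k γ h R S) (𝓝[>] 0) atTop := by
  obtain ⟨ε, c, hε, hc, hrot⟩ := hg.exists_rotation hp hh h0 hspiral
  obtain ⟨T₀, u₀, hu₀, hreg, hsing⟩ := hg.exists_near_equilibrium hp hh h0 hε
  set T := max T₀ 1 with hT
  have hT0 : 0 < T := lt_max_of_lt_right one_pos
  set v := u₀ / 2 with hv
  have hv0 : 0 < v := half_pos hu₀.1
  have hvu : v < u₀ := half_lt_self hu₀.1
  have hv1 : v < u₁ := hvu.trans hu₀.2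
  have hmono := hg.strictMono_L
  -- Both orbits are near the equilibrium on `[w₁, v]`, where the angle gains at least `c (L v - L
  -- w₁)`. At `w₁` it is at least `π / 2`, by the barrier from the initial interval, and after `v`
  -- less than `π` is lost, again by the barriers.
  have hmain : ∀ᶠ σ in 𝓝[>] 0,
      -(Real.pi / 2) + c * (L v - T) + c * (-L σ) ≤ winding β k γ h R S σ := by
    filter_upwards [Ioo_mem_nhdsGT hv0,
      hg.tendsto_L.eventually (eventually_lt_atBot (L v - T))] with σ hσv hσL
    have hσ : σ ∈ Ioo (0:ℝ) 1 := ⟨hσv.1, by linarith [hσv.2]⟩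
    obtain ⟨w₁, hw₁, hLw⟩ : ∃ w₁ ∈ Icc σ v, L w₁ = L σ + T := by
      refine intermediate_value_Icc hσv.2.le (fun x hx => ?_) ⟨by linarith, by linarith⟩
      exact (hg.deriv_L x ⟨hσv.1.trans_le hx.1, hx.2.trans_lt hv1⟩).continuousAt.continuousWithinAt
    have hσw : σ < w₁ := by
      refine lt_of_le_of_ne hw₁.1 fun heq => ?_
      rw [← heq] at hLw
      linarith
    obtain ⟨w₀, hw₀, hev⟩ := hF.eventually_lt_singular hp hh hσ
    have hini₀ : IsInitial R S σ w₀ := ⟨hw₀, hev.self_of_nhds.2⟩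
    have hini : IsInitial R S σ (min w₀ w₁) :=
      hini₀.of_le (lt_min hw₀.1 hσw) (min_le_left _ _)
    set w := min w₀ w₁ with hw
    have hwm : w ∈ Ioo σ 2 := ⟨hini.1.1, by linarith [hini.1.2]⟩
    have hpi := Real.pi_pos
    rw [hF.winding_eq hp hh hσ hini]
    set φ : ℝ → ℝ := fun u => (famLog β k γ h R S σ w u).im with hφ
    have hφd : ∀ u ∈ Ioo σ 2, HasDerivAt φ (famLogDeriv β k γ h R S σ u).im u := fun u hu =>
      Complex.imCLM.hasFDerivAt.comp_hasDerivAt u (hF.hasDerivAt_famLog hp hh hσ hwm hu)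
    have hφw : Real.pi / 2 + (0:ℤ) * Real.pi ≤ φ w := by
      have harg : 0 ≤ (-famDiff R S σ w).arg := by
        rw [Complex.arg_nonneg_iff, Complex.neg_im, famDiff, complexDiff_im]
        have := (hini.2 w ⟨hini.1.1, le_rfl⟩).2
        simp only
        linarith
      have : φ w = (-famDiff R S σ w).arg + Real.pi := by
        simp [hφ, famLog, Complex.log_im]
      rw [this]
      push_cast
      linarith
    have hφw₁ := hF.famLog_barrier hp hh hσ hwm hini.1.1 (min_le_right _ _)
      (show w₁ < 2 by linarith [hw₁.2]) 0 hφw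
    have hgain : φ w₁ - c * L w₁ ≤ φ v - c * L v := by
      have hm : MonotoneOn (fun u => φ u - c * L u) (Icc w₁ v) := by
        refine monotoneOn_of_hasDerivAt (convex_Icc _ _)
          (φ' := fun u => (famLogDeriv β k γ h R S σ u).im - c * ω u) (fun u hu => ?_)
          fun u hu => ?_
        · exact (hφd u ⟨hσw.trans_le hu.1, by linarith [hu.2]⟩).sub
            ((hg.deriv_L u ⟨(hσv.1.trans hσw).trans_le hu.1, hu.2.trans_lt hv1⟩).const_mul c)
        · have hu0 : 0 < u := (hσv.1.trans hσw).trans_le hu.1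
          have huu : u < u₀ := hu.2.trans_lt hvu
          have hum : u ∈ Ioo (0:ℝ) u₁ := ⟨hu0, huu.trans hu₀.2⟩
          have hLu : L w₁ ≤ L u := hmono.monotoneOn
            ⟨hσv.1.trans hσw, hw₁.2.trans_lt hv1⟩ hum hu.1
          have n1 := hreg σ 2 (R σ) (S σ) hσ.1 (by linarith) (hF.isOrbit σ ⟨hσ.1.le, hσ.2⟩) u
            ⟨hσw.trans_le hu.1, huu⟩ (by linarith [le_max_left T₀ 1])
          have n2 := hsing 2 (R 0) (S 0) (by linarith) (hF.isOrbit 0 ⟨le_rfl, one_pos⟩) u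
            ⟨hu0, huu⟩
          have hr := hrot (R σ) (S σ) (R 0) (S 0) u hum n1 n2
          have hne := (hF.isOrbit σ ⟨hσ.1.le, hσ.2⟩).ne_of_lt
            (hF.isOrbit 0 ⟨le_rfl, one_pos⟩) hp hh le_rfl hσ.1 u
            ⟨hσw.trans_le hu.1, by linarith⟩
          have hpos : 0 < (R σ u - R 0 u) ^ 2 + (S σ u - S 0 u) ^ 2 := by
            by_contra! hcon
            have e1 : (R σ u - R 0 u) ^ 2 = 0 :=
              le_antisymm (by nlinarith [sq_nonneg (S σ u - S 0 u)]) (sq_nonneg _)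
            have e2 : (S σ u - S 0 u) ^ 2 = 0 :=
              le_antisymm (by nlinarith [sq_nonneg (R σ u - R 0 u)]) (sq_nonneg _)
            exact hne (Prod.ext (sub_eq_zero.1 (pow_eq_zero_iff two_ne_zero |>.1 e1))
              (sub_eq_zero.1 (pow_eq_zero_iff two_ne_zero |>.1 e2)))
          have him : (famLogDeriv β k γ h R S σ u).im =
              ((R σ u - R 0 u) * (h u * Real.exp ((γ + k) * R σ u - (1 + 1 / β) * S σ u) -
                h u * Real.exp ((γ + k) * R 0 u - (1 + 1 / β) * S 0 u)) -
              (S σ u - S 0 u) * (Real.exp (k * R σ u - S σ u / β) -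
                Real.exp (k * R 0 u - S 0 u / β))) /
              ((R σ u - R 0 u) ^ 2 + (S σ u - S 0 u) ^ 2) := by
            rw [famLogDeriv, im_div_eq, famDiff, complexDiff_re, complexDiff_im,
              complexDiffDeriv_re, complexDiffDeriv_im]
          rw [sub_nonneg, him, le_div_iff₀ hpos]
          exact hr
      exact hm ⟨le_rfl, hw₁.2⟩ ⟨hw₁.2, le_rfl⟩ hw₁.2
    -- The last barrier `π / 2 + m π` at or below `φ v` is less than `π` below it, and the angle
    -- never falls back past it.
    have hφ1 : φ v - Real.pi ≤ φ 1 := by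
      set m : ℤ := ⌊(φ v - Real.pi / 2) / Real.pi⌋ with hm
      have q1 : (m : ℝ) ≤ (φ v - Real.pi / 2) / Real.pi := Int.floor_le _
      have q2 : (φ v - Real.pi / 2) / Real.pi < m + 1 := Int.lt_floor_add_one _
      rw [le_div_iff₀ hpi] at q1
      rw [div_lt_iff₀ hpi] at q2
      have := hF.famLog_barrier hp hh hσ hwm hσv.2 (by linarith : v ≤ 1) one_lt_two m
        (by change _ ≤ φ v; linarith)
      change _ ≤ φ 1 at this
      linarith
    push_cast at hφw₁
    change _ ≤ φ w₁ at hφw₁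
    change _ ≤ φ 1
    rw [hLw] at hgain
    linarith
  refine tendsto_atTop_mono' _ hmain ?_
  refine tendsto_atTop_add_const_left _ _ ?_
  exact (tendsto_neg_atBot_atTop.comp hg.tendsto_L).const_mul_atTop hc

/-- In the spiral case the values at `1` lie on both sides of the singular one. -/
theorem exists_alternating (hF : IsOrbitFamily β k γ h R S) (hg : IsGrowth β δ u₁ h L ω D)
    (hp : Admissible β k γ) (hh : Nonlinearity h) (h0 : 0 < u₁) (h1 : u₁ ≤ 1)
    (hspiral : (ratioEq β k γ δ - δ) ^ 2 < 4 * ratioEq β k γ δ) {ε : ℝ} (hε : 0 < ε) :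
    (∃ σ ∈ Ioo 0 ε, σ < 1 ∧ R 0 1 < R σ 1) ∧ ∃ σ ∈ Ioo 0 ε, σ < 1 ∧ R σ 1 < R 0 1 := by
  have hlim := hF.tendsto_winding hg hp hh h0 h1 hspiral
  have hcont := hF.continuousOn_winding hg hp hh h0 h1
  have hpi := Real.pi_pos
  -- A continuous angle tending to infinity at `0` takes some value congruent to `c` modulo `2 π` at
  -- an arbitrarily small `σ`.
  have hval : ∀ c : ℝ, ∃ N : ℕ, ∃ σ ∈ Ioo 0 ε, σ < 1 ∧
      winding β k γ h R S σ = c + N * (2 * Real.pi) := by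
    intro c
    set s := min ε 1 / 2 with hs
    have hm : 0 < min ε 1 := lt_min hε one_pos
    have hs0 : 0 < s := half_pos hm
    have hsε : s < ε := (half_lt_self hm).trans_le (min_le_left _ _)
    have hs1 : s < 1 := (half_lt_self hm).trans_le (min_le_right _ _)
    obtain ⟨N, hN⟩ := exists_nat_ge ((winding β k γ h R S s - c) / (2 * Real.pi))
    rw [div_le_iff₀ (by positivity)] at hN
    obtain ⟨σ₁, hσ₁, hσ₁s⟩ := ((hlim.eventually
      (eventually_ge_atTop (c + N * (2 * Real.pi)))).and (Ioo_mem_nhdsGT hs0)).exists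
    obtain ⟨σ, hσ, hσe⟩ := intermediate_value_Icc' hσ₁s.2.le
      (hcont.mono fun x hx => ⟨hσ₁s.1.trans_le hx.1, hx.2.trans_lt hs1⟩)
      (show c + N * (2 * Real.pi) ∈ Icc _ _ from ⟨by linarith, hσ₁⟩)
    exact ⟨N, σ, ⟨hσ₁s.1.trans_le hσ.1, hσ.2.trans_lt hsε⟩, hσ.2.trans_lt hs1, hσe⟩
  -- The difference of the `ρ`-values is the real part of the exponential of its logarithm, so its
  -- sign is that of the cosine of the angle.
  have hsign : ∀ σ ∈ Ioo (0:ℝ) 1, ∃ r > 0,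
      R σ 1 - R 0 1 = r * Real.cos (winding β k γ h R S σ) := by
    intro σ hσ
    obtain ⟨w, hw, hev⟩ := hF.eventually_lt_singular hp hh hσ
    have hini : IsInitial R S σ w := ⟨hw, hev.self_of_nhds.2⟩
    have hex := congrArg Complex.re (hF.exp_famLog hp hh hσ
      (show w ∈ Ioo σ 2 from ⟨hw.1, by linarith [hw.2]⟩) (show (1:ℝ) ∈ Ioo σ 2 from
      ⟨hσ.2, one_lt_two⟩))
    rw [Complex.exp_re, famDiff, complexDiff_re, ← hF.winding_eq hp hh hσ hini] at hex
    exact ⟨_, Real.exp_pos _, hex.symm⟩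
  constructor
  · obtain ⟨N, σ, hσ, hσ1, hw⟩ := hval 0
    refine ⟨σ, hσ, hσ1, ?_⟩
    obtain ⟨r, hr, hre⟩ := hsign σ ⟨hσ.1, hσ1⟩
    rw [hw, Real.cos_add_nat_mul_two_pi, Real.cos_zero] at hre
    linarith
  · obtain ⟨N, σ, hσ, hσ1, hw⟩ := hval Real.pi
    refine ⟨σ, hσ, hσ1, ?_⟩
    obtain ⟨r, hr, hre⟩ := hsign σ ⟨hσ.1, hσ1⟩
    rw [hw, Real.cos_add_nat_mul_two_pi, Real.cos_pi] at hre
    linarith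

end IsOrbitFamily

end MEMS
end

noncomputable section
namespace MEMS

/-! ### The hypotheses on `f` -/

variable {α β k γ δ ubar q : ℝ} {f : ℝ → ℝ}

lemma ratioEq_eq (hp : Admissible β k γ) (hδ : 0 ≤ δ) :
    ratioEq β k γ δ = γ * (1 + δ) / (γ / β - k) - β := by
  have h1 : 1 + δ ≠ 0 := by linarith
  have h2 := hp.θ_pos.ne'
  rw [ratioEq, Beq, sub_div, mul_div_cancel_right₀ _ (Aeq_pos hp hδ).ne', Aeq]
  generalize γ / β - k = θ at *
  field_simp

/-- Let `t = √(1 + δ)`, let `a` and `b` be the two square roots in `hlt` with `a = √θ`, and put `y =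
t (b - a) / (a (1 + β))`; the hypothesis says `y < 1`. Since `b ^ 2 - a ^ 2 = (γ - θ) (1 + β)`, one
finds `μ = y (y (1 + β) + 2 t) + 1 + δ - β`, which increases to `(1 + t) ^ 2` at `y = 1`. So `|√μ -
1| < t`, that is `μ - δ < 2 √μ`; and `μ > δ`. -/
lemma spiral_of_lt (hp : Admissible β k γ) (hδ : 0 ≤ δ)
    (hlt : (1 + δ) * (√(β * γ + β * k) - √(γ / β - k)) ^ 2 < (γ / β - k) * (β + 1) ^ 2) :
    (ratioEq β k γ δ - δ) ^ 2 < 4 * ratioEq β k γ δ := by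
  have hβ := hp.β_pos
  have hβ1 := hp.one_le
  have hk := hp.k_pos
  have hγ := hp.γ_pos
  have hθ := hp.θ_pos
  have hμ0 := ratioEq_pos hp hδ
  have hμ := ratioEq_eq hp hδ
  have hβθ : β * (γ / β - k) = γ - β * k := by field_simp
  set μ := ratioEq β k γ δ with hμd
  set θ := γ / β - k with hθd
  set a := √θ with ha
  set b := √(β * γ + β * k) with hb
  have ha0 : 0 < a := Real.sqrt_pos.2 hθ
  have ha2 : a ^ 2 = θ := Real.sq_sqrt hθ.le
  have hb2 : b ^ 2 = β * γ + β * k := Real.sq_sqrt (by positivity)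
  have hγθ : 0 < γ - θ := by
    by_contra! hcon
    have h1 := mul_le_mul_of_nonneg_left hcon hβ.le
    have h2 : 0 ≤ γ * (β - 1) := mul_nonneg hγ.le (by linarith)
    have h3 : 0 < β * k := by positivity
    nlinarith
  have hdiff : b ^ 2 - a ^ 2 = (γ - θ) * (1 + β) := by rw [hb2, ha2]; linarith
  have hab : a < b := by
    refine lt_of_pow_lt_pow_left₀ 2 (Real.sqrt_nonneg _) ?_
    have : 0 < (γ - θ) * (1 + β) := by positivity
    linarith
  set t := √(1 + δ) with ht
  have ht2 : t ^ 2 = 1 + δ := Real.sq_sqrt (by linarith)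
  have ht1 : 1 ≤ t := Real.one_le_sqrt.2 (by linarith)
  set m := √μ with hm
  have hm0 : 0 < m := Real.sqrt_pos.2 hμ0
  have hm2 : m ^ 2 = μ := Real.sq_sqrt hμ0.le
  set y := t * (b - a) / (a * (1 + β)) with hy
  have hy0 : 0 < y := div_pos (mul_pos (by linarith) (by linarith)) (by positivity)
  have hy1 : y < 1 := by
    rw [hy, div_lt_one (by positivity)]
    refine lt_of_pow_lt_pow_left₀ 2 (by positivity) ?_
    rw [mul_pow, mul_pow, ht2, ha2, add_comm 1 β]
    exact hlt
  have hct : γ * (1 + δ) / θ - (1 + δ) = y * (y * (1 + β) + 2 * t) := by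
    have e1 : γ * (1 + δ) / θ - (1 + δ) = (γ - θ) * (1 + δ) / θ := by field_simp
    have e2 : γ - θ = (b ^ 2 - a ^ 2) / (1 + β) := by rw [hdiff]; field_simp
    rw [e1, e2, ← ha2, ← ht2, hy]
    field_simp
    ring
  have hlt2 : μ < (1 + t) ^ 2 := by
    have : y * (y * (1 + β) + 2 * t) < 1 + β + 2 * t := by
      have h1 : y * (1 + β) < 1 + β := by nlinarith
      have h2 : 0 < y * (1 + β) + 2 * t := by positivity
      nlinarith
    have h3 : μ = y * (y * (1 + β) + 2 * t) + (1 + δ) - β := by linarith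
    nlinarith
  have hm1 : m < 1 + t := lt_of_pow_lt_pow_left₀ 2 (by linarith) (by rw [hm2]; exact hlt2)
  have hpos : 0 < μ - δ := by
    have e : (μ - δ) * θ = β * k + (γ - θ) * δ := by
      rw [hμ, sub_sub, sub_mul, div_mul_cancel₀ _ hθ.ne']
      linarith
    have : 0 < (μ - δ) * θ := by rw [e]; positivity
    exact (mul_pos_iff_of_pos_right hθ).1 this
  have hsq : (m - 1) ^ 2 < t ^ 2 := sq_lt_sq' (by linarith) (by linarith)
  have h2m : μ - δ < 2 * m := by nlinarith
  calc (μ - δ) ^ 2 < (2 * m) ^ 2 := pow_lt_pow_left₀ h2m hpos.le two_ne_zero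
    _ = 4 * μ := by rw [mul_pow, hm2]; norm_num

lemma theta_eq (hβ : 0 < β) : theta α β γ = γ / β - (α / β - 1) := by
  rw [theta]; field_simp; ring

lemma admissible_of_lt (hβ : 1 ≤ β) (hαβ : β < α) (hγα : α < γ) :
    Admissible β (α / β - 1) γ := by
  have hβ0 : 0 < β := by linarith
  refine ⟨hβ, ?_, by linarith, ?_⟩
  · rw [sub_pos, lt_div_iff₀ hβ0]; linarith
  · have : γ / β - (α / β - 1) = 1 + (γ - α) / β := by field_simp; ring
    rw [this]
    have : 0 < (γ - α) / β := div_pos (by linarith) hβ0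
    linarith

/-- As `1 + δ = (2 q - 1) / q`, clearing denominators in `q < q_c` gives the hypothesis of
`spiral_of_lt`. If the denominator of `q_c` is not positive, that hypothesis holds for every `q ≥
1`, in accordance with `q_c = ∞`. -/
lemma spiral_of_lt_qc (hβ : 1 ≤ β) (hαβ : β < α) (hγα : α < γ) (hq : 1 ≤ q)
    (hqc : (q : EReal) < qc α β γ) :
    (ratioEq β (α / β - 1) γ (1 - 1 / q) - (1 - 1 / q)) ^ 2 <
      4 * ratioEq β (α / β - 1) γ (1 - 1 / q) := by
  have hβ0 : 0 < β := by linarith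
  have hp := admissible_of_lt hβ hαβ hγα
  have hq0 : 0 < q := by linarith
  have hδ : 0 ≤ 1 - 1 / q := by
    rw [sub_nonneg, div_le_one hq0]; exact hq
  refine spiral_of_lt hp hδ ?_
  have e1 : β * γ + β * (α / β - 1) = β * γ + α - β := by field_simp; ring
  have hθ := hp.θ_pos
  rw [e1]
  rw [qc, qcDenom] at hqc
  rw [theta_eq hβ0] at hqc
  set X := (√(β * γ + α - β) - √(γ / β - (α / β - 1))) ^ 2 with hX
  generalize γ / β - (α / β - 1) = θ at *
  set N := θ * (β + 1) ^ 2 with hN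
  have hN0 : 0 < N := by positivity
  have hX0 : 0 ≤ X := sq_nonneg _
  have e2 : 2 * θ * (β + 1) ^ 2 = 2 * N := by rw [hN]; ring
  rw [e2] at hqc
  have e3 : 1 + (1 - 1 / q) = (2 * q - 1) / q := by field_simp; ring
  rw [e3, div_mul_eq_mul_div, div_lt_iff₀ hq0]
  split_ifs at hqc with hc
  · nlinarith
  · rw [EReal.coe_lt_coe_iff] at hqc
    push Not at hc
    have h1 : q - 1 / 2 < N / (4 * X - 2 * N) := by linarith
    rw [lt_div_iff₀ hc] at h1
    nlinarith

/-- The standing assumptions on `f`. -/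
structure Hypotheses (β ubar q : ℝ) (f : ℝ → ℝ) : Prop where
  one_le : 1 ≤ β
  ubar_pos : 0 < ubar
  cont : ContinuousOn f (Ici 0)
  zero : f 0 = 0
  pos : ∀ u, 0 < u → 0 < f u
  C1 : ContDiffOn ℝ 1 f (Ioi 0)
  G1 : ∀ u ∈ Ioo 0 ubar, 0 < deriv (gOf β f) u ∧ 0 < deriv (deriv (gOf β f)) u
  G2 : Tendsto (growthQuotient β f) (𝓝[>] 0) (𝓝 q)
  G3 : q = 1 → ∀ᶠ u in 𝓝[>] 0, 1 ≤ growthQuotient β f u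
  G4 : ∀ u, 0 < u → 0 < deriv (gOf β f) u

namespace Hypotheses

lemma g_pos (H : Hypotheses β ubar q f) {u : ℝ} (hu : 0 < u) : 0 < gOf β f u :=
  Real.rpow_pos_of_pos (H.pos u hu) _

lemma nonlinearity (H : Hypotheses β ubar q f) : Nonlinearity fun u => 1 / f u := by
  have hβ0 : 0 < β := by linarith [H.one_le]
  refine ⟨fun u hu => one_div_pos.2 (H.pos u hu), fun u hu w hw huw => ?_, ?_⟩
  · have hg : ContinuousOn (gOf β f) (Ioi 0) := fun x hx =>
      (differentiableAt_of_deriv_ne_zero (H.G4 x hx).ne').continuousAt.continuousWithinAt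
    have hmono : StrictMonoOn (gOf β f) (Ioi 0) :=
      strictMonoOn_of_deriv_pos (convex_Ioi 0) hg fun x hx => by
        rw [interior_Ioi] at hx; exact H.G4 x hx
    have h1 := hmono.monotoneOn hu hw huw
    refine one_div_le_one_div_of_le (H.pos u hu) ?_
    exact (Real.rpow_le_rpow_iff (H.pos u hu).le (H.pos w hw).le (one_div_pos.2 hβ0)).1 h1
  · exact contDiffOn_const.div H.C1 fun u hu => (H.pos u hu).ne'

/-- A non-zero value of `deriv` forces differentiability, so the sign in (G4) suffices; (G1) does
the same for `g'`. -/
lemma hasDerivAt_g (H : Hypotheses β ubar q f) {u : ℝ} (hu : 0 < u) :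
    HasDerivAt (gOf β f) (deriv (gOf β f) u) u :=
  (differentiableAt_of_deriv_ne_zero (H.G4 u hu).ne').hasDerivAt

lemma hasDerivAt_deriv_g (H : Hypotheses β ubar q f) {u : ℝ} (hu : u ∈ Ioo 0 ubar) :
    HasDerivAt (deriv (gOf β f)) (deriv (deriv (gOf β f)) u) u :=
  (differentiableAt_of_deriv_ne_zero (H.G1 u hu).2.ne').hasDerivAt

lemma tendsto_log_g (H : Hypotheses β ubar q f) :
    Tendsto (fun u => Real.log (gOf β f u)) (𝓝[>] 0) atBot := by
  have hβ0 : 0 < β := by linarith [H.one_le]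
  have h1 : Tendsto f (𝓝[>] 0) (𝓝 0) := by
    have := (H.cont 0 self_mem_Ici).tendsto
    rw [H.zero] at this
    exact this.mono_left (nhdsWithin_mono _ Ioi_subset_Ici_self)
  have h2 : Tendsto (gOf β f) (𝓝[>] 0) (𝓝 0) := by
    have := h1.rpow_const (p := 1 / β) (Or.inr (one_div_pos.2 hβ0).le)
    rwa [Real.zero_rpow (one_div_pos.2 hβ0).ne'] at this
  refine Real.tendsto_log_nhdsGT_zero.comp (tendsto_nhdsWithin_iff.2 ⟨h2, ?_⟩)
  filter_upwards [self_mem_nhdsWithin] with u hu using H.g_pos hu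

lemma hasDerivAt_log_g (H : Hypotheses β ubar q f) {u : ℝ} (hu : 0 < u) :
    HasDerivAt (fun u => Real.log (gOf β f u)) (deriv (gOf β f) u / gOf β f u) u :=
  (H.hasDerivAt_g hu).log (H.g_pos hu).ne'

lemma hasDerivAt_ω (H : Hypotheses β ubar q f) {u : ℝ} (hu : u ∈ Ioo 0 ubar) :
    HasDerivAt (fun u => deriv (gOf β f) u / gOf β f u)
      (-((deriv (gOf β f) u / gOf β f u) ^ 2 * (1 - 1 / growthQuotient β f u))) u := by
  refine ((H.hasDerivAt_deriv_g hu).div (H.hasDerivAt_g hu.1) (H.g_pos hu.1).ne').congr_deriv ?_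
  have h1 := (H.g_pos hu.1).ne'
  have h2 := (H.G1 u hu).1.ne'
  have h3 := (H.G1 u hu).2.ne'
  rw [growthQuotient]
  field_simp
  ring

lemma growthQuotient_pos (H : Hypotheses β ubar q f) {u : ℝ} (hu : u ∈ Ioo 0 ubar) :
    0 < growthQuotient β f u :=
  div_pos (pow_pos (H.G1 u hu).1 2) (mul_pos (H.g_pos hu.1) (H.G1 u hu).2)

/-- The limit of the growth quotient is at least one. -/
lemma one_le_q (H : Hypotheses β ubar q f) : 1 ≤ q := by
  by_contra! hq
  obtain ⟨c, hc0, hc⟩ := (mem_nhdsGT_iff_exists_Ioo_subset).1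
    ((H.G2.eventually (Iio_mem_nhds hq)).and (Ioo_mem_nhdsGT H.ubar_pos))
  -- If `q < 1`, then `g' / g` increases near `0`, so `log g` has bounded slope there and cannot
  -- tend to `-∞`, although `g` vanishes at `0`.
  have hmono : MonotoneOn (fun u => deriv (gOf β f) u / gOf β f u) (Ioo 0 c) := by
    refine monotoneOn_of_hasDerivAt (convex_Ioo _ _) (fun u hu => H.hasDerivAt_ω (hc hu).2)
      fun u hu => ?_
    have h1 : 1 ≤ 1 / growthQuotient β f u := by
      rw [le_div_iff₀ (H.growthQuotient_pos (hc hu).2), one_mul]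
      exact (le_of_lt (hc hu).1)
    have h2 := sq_nonneg (deriv (gOf β f) u / gOf β f u)
    nlinarith
  set a := c / 2 with ha
  have hc0 : 0 < c := hc0
  have ham : a ∈ Ioo 0 c := ⟨half_pos hc0, half_lt_self hc0⟩
  set K := deriv (gOf β f) a / gOf β f a with hK
  have hanti : AntitoneOn (fun u => Real.log (gOf β f u) - K * u) (Ioc 0 a) := by
    refine antitoneOn_of_hasDerivAt (convex_Ioc _ _)
      (fun u hu => (H.hasDerivAt_log_g hu.1).sub ((hasDerivAt_id u).const_mul K)) fun u hu => ?_
    have := hmono ⟨hu.1, hu.2.trans_lt ham.2⟩ ham hu.2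
    simp only [mul_one] at this ⊢
    linarith
  have hK0 : 0 < K := div_pos (H.G4 a ham.1) (H.g_pos ham.1)
  obtain ⟨u, hu1, hu2⟩ := ((H.tendsto_log_g.eventually
    (eventually_lt_atBot (Real.log (gOf β f a) - K * a))).and (Ioo_mem_nhdsGT ham.1)).exists
  have h1 := hanti ⟨hu2.1, hu2.2.le⟩ ⟨ham.1, le_rfl⟩ hu2.2.le
  simp only at h1
  nlinarith [mul_pos hK0 hu2.1]

/-- `D ≥ 0` near `0` says that the growth quotient is at least `1`: for `q > 1` this follows from
the limit, for `q = 1` it is (G3). The bound `D ≤ δ + 1` holds because `D < 1` and `δ ≥ 0`. -/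
lemma exists_isGrowth (H : Hypotheses β ubar q f) :
    ∃ (u₁ : ℝ) (L ω D : ℝ → ℝ), 0 < u₁ ∧ u₁ ≤ 1 ∧
      IsGrowth β (1 - 1 / q) u₁ (fun u => 1 / f u) L ω D := by
  have hβ0 : 0 < β := by linarith [H.one_le]
  have hq := H.one_le_q
  have hq0 : 0 < q := by linarith
  have hev : ∀ᶠ u in 𝓝[>] 0, 1 ≤ growthQuotient β f u := by
    rcases hq.eq_or_lt with h1 | h1
    · exact H.G3 h1.symm
    · filter_upwards [H.G2.eventually (Ioi_mem_nhds h1)] with u hu using le_of_lt hu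
  obtain ⟨c, hc0, hc⟩ := (mem_nhdsGT_iff_exists_Ioo_subset).1
    (hev.and (Ioo_mem_nhdsGT H.ubar_pos))
  have hc0 : 0 < c := hc0
  refine ⟨min c 1, fun u => Real.log (gOf β f u), fun u => deriv (gOf β f) u / gOf β f u,
    fun u => 1 - 1 / growthQuotient β f u, lt_min hc0 one_pos, min_le_right _ _, ?_⟩
  have hm : ∀ u ∈ Ioo 0 (min c 1), 1 ≤ growthQuotient β f u ∧ u ∈ Ioo 0 ubar := fun u hu =>
    hc ⟨hu.1, hu.2.trans_le (min_le_left _ _)⟩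
  refine ⟨fun u hu => H.hasDerivAt_log_g hu.1, fun u hu => div_pos (H.G4 u hu.1) (H.g_pos hu.1),
    fun u hu => H.hasDerivAt_ω (hm u hu).2, fun u hu => ?_, fun u hu => ?_, ?_, H.tendsto_log_g,
    fun u hu => ?_⟩
  · rw [sub_nonneg, div_le_one (H.growthQuotient_pos (hm u hu).2)]
    exact (hm u hu).1
  · have h1 : 0 < 1 / growthQuotient β f u := one_div_pos.2 (H.growthQuotient_pos (hm u hu).2)
    have h2 : 1 / q ≤ 1 := (div_le_one hq0).2 hq
    linarith
  · exact tendsto_const_nhds.sub (tendsto_const_nhds.div H.G2 hq0.ne')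
  · have hf := H.pos u hu.1
    rw [gOf, Real.log_rpow hf]
    have : -β * (1 / β * Real.log (f u)) = -Real.log (f u) := by field_simp
    rw [this, Real.exp_neg, Real.exp_log hf, one_div]

end Hypotheses

end MEMS
end

noncomputable section
namespace MEMS

/-! ### Turning points -/

/-- A continuous function taking values above and below `lbar` arbitrarily near `1` turns
infinitely often. -/
theorem infinitely_many_turning_points {Λ : ℝ → ℝ} {lbar : ℝ} (hΛ : ContinuousOn Λ (Ioo 0 1))
    (hhigh : ∀ ε > 0, ∃ τ ∈ Ioo (0:ℝ) 1, 1 - ε < τ ∧ lbar < Λ τ)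
    (hlow : ∀ ε > 0, ∃ τ ∈ Ioo (0:ℝ) 1, 1 - ε < τ ∧ Λ τ < lbar) :
    HasInfinitelyManyTurningPointsAround Λ lbar ∧ {τ ∈ Ioo (0:ℝ) 1 | Λ τ = lbar}.Infinite := by
  -- The sample points have alternating signs of `Λ - lbar`, starting below `lbar`, so that the
  -- first extremum enclosed is a maximum. For `x ≥ 1` a dummy value makes the choice total in `x`.
  have hstep : ∀ (n : ℕ) (x : ℝ), ∃ y, x < 1 → y ∈ Ioo (0:ℝ) 1 ∧ x < y ∧
      1 - 1 / ((n:ℝ) + 1) < y ∧ 0 < (-1) ^ (n + 1) * (Λ y - lbar) := by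
    intro n x
    by_cases hx : x < 1
    · have hε : 0 < min (1 - x) (1 / ((n:ℝ) + 1)) := lt_min (by linarith) (by positivity)
      rcases Nat.even_or_odd n with hn | hn
      · obtain ⟨τ, hτ, h1, h2⟩ := hlow _ hε
        refine ⟨τ, fun _ => ⟨hτ, ?_, ?_, ?_⟩⟩
        · linarith [min_le_left (1 - x) (1 / ((n:ℝ) + 1))]
        · linarith [min_le_right (1 - x) (1 / ((n:ℝ) + 1))]
        · rw [hn.add_one.neg_one_pow]; linarith
      · obtain ⟨τ, hτ, h1, h2⟩ := hhigh _ hε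
        refine ⟨τ, fun _ => ⟨hτ, ?_, ?_, ?_⟩⟩
        · linarith [min_le_left (1 - x) (1 / ((n:ℝ) + 1))]
        · linarith [min_le_right (1 - x) (1 / ((n:ℝ) + 1))]
        · rw [hn.add_one.neg_one_pow]; linarith
    · exact ⟨0, fun h => absurd h hx⟩
  choose N hN using hstep
  let s : ℕ → ℝ := fun n => Nat.rec (N 0 0) (fun m x => N (m + 1) x) n
  have hsucc : ∀ n, s (n + 1) = N (n + 1) (s n) := fun n => rfl
  have hs1 : ∀ n, s n ∈ Ioo (0:ℝ) 1 := by
    intro n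
    induction n with
    | zero => exact (hN 0 0 one_pos).1
    | succ n ih => rw [hsucc]; exact (hN (n + 1) (s n) ih.2).1
  have hs2 : ∀ n, s n < s (n + 1) := fun n => by
    rw [hsucc]; exact (hN (n + 1) (s n) (hs1 n).2).2.1
  have hs3 : ∀ n : ℕ, 1 - 1 / ((n:ℝ) + 1) < s n ∧ 0 < (-1) ^ (n + 1) * (Λ (s n) - lbar) := by
    intro n
    cases n with
    | zero => exact (hN 0 0 one_pos).2.2
    | succ n => rw [hsucc]; exact (hN (n + 1) (s n) (hs1 n).2).2.2
  have hz : ∀ n, ∃ z ∈ Ioo (s n) (s (n + 1)), Λ z = lbar := by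
    intro n
    have hc : ContinuousOn (fun x => (-1) ^ n * (Λ x - lbar)) (Icc (s n) (s (n + 1))) :=
      continuousOn_const.mul ((hΛ.mono fun x hx =>
        ⟨(hs1 n).1.trans_le hx.1, hx.2.trans_lt (hs1 (n + 1)).2⟩).sub continuousOn_const)
    have h1 : (-1) ^ n * (Λ (s n) - lbar) < 0 := by
      have := (hs3 n).2
      rw [pow_succ] at this
      linarith
    have h2 : 0 < (-1) ^ n * (Λ (s (n + 1)) - lbar) := by
      have := (hs3 (n + 1)).2
      rw [pow_succ, pow_succ] at this
      linarith
    obtain ⟨z, hz, hz0⟩ := intermediate_value_Ioo (hs2 n).le hc ⟨h1, h2⟩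
    refine ⟨z, hz, ?_⟩
    have := (mul_eq_zero.1 hz0).resolve_left (pow_ne_zero _ (by norm_num))
    linarith
  choose z hzm hz0 using hz
  have hzz : ∀ n, z n < z (n + 1) := fun n => (hzm n).2.trans (hzm (n + 1)).1
  have hz1 : ∀ n, z n ∈ Ioo (0:ℝ) 1 := fun n =>
    ⟨(hs1 n).1.trans (hzm n).1, (hzm n).2.trans (hs1 (n + 1)).2⟩
  -- Between the zeros `z n` and `z (n + 1)` of `Λ - lbar` lies `s (n + 1)`, where `(-1) ^ n (Λ -
  -- lbar)` is positive. Its maximum is therefore positive and interior, and the zeros serve as the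
  -- end points at which the curve has left the extremal value.
  have ht : ∀ n, ∃ t ∈ Ioo (z n) (z (n + 1)), 0 < (-1) ^ n * (Λ t - lbar) ∧
      ∀ τ ∈ Icc (z n) (z (n + 1)), (-1) ^ n * (Λ τ - lbar) ≤ (-1) ^ n * (Λ t - lbar) := by
    intro n
    have hc : ContinuousOn (fun x => (-1) ^ n * (Λ x - lbar)) (Icc (z n) (z (n + 1))) :=
      continuousOn_const.mul ((hΛ.mono fun x hx =>
        ⟨(hz1 n).1.trans_le hx.1, hx.2.trans_lt (hz1 (n + 1)).2⟩).sub continuousOn_const)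
    obtain ⟨t, htm, hmax⟩ := isCompact_Icc.exists_isMaxOn (nonempty_Icc.2 (hzz n).le) hc
    have hpos : 0 < (-1) ^ n * (Λ t - lbar) := by
      refine lt_of_lt_of_le ?_ (hmax ⟨(hzm n).2.le, (hzm (n + 1)).1.le⟩)
      have := (hs3 (n + 1)).2
      rw [pow_succ, pow_succ] at this
      simp only
      linarith
    refine ⟨t, ⟨lt_of_le_of_ne htm.1 fun h => ?_, lt_of_le_of_ne htm.2 fun h => ?_⟩, hpos,
      fun τ hτ => hmax hτ⟩
    · rw [← h, hz0, sub_self, mul_zero] at hpos; exact hpos.false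
    · rw [h, hz0, sub_self, mul_zero] at hpos; exact hpos.false
  choose t htm htpos htmax using ht
  refine ⟨⟨t, strictMono_nat_of_lt_succ fun n => (htm n).2.trans (htm (n + 1)).1, fun n =>
    ⟨(hz1 n).1.trans (htm n).1, (htm n).2.trans (hz1 (n + 1)).2⟩, ?_, fun n => ?_, fun n => ?_⟩, ?_⟩
  · have h1 : Tendsto (fun n : ℕ => 1 - 1 / ((n:ℝ) + 1)) atTop (𝓝 1) := by
      have := (tendsto_const_nhds (x := (1:ℝ))).sub tendsto_one_div_add_atTop_nhds_zero_nat
      rwa [sub_zero] at this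
    refine tendsto_of_tendsto_of_tendsto_of_le_of_le h1 tendsto_const_nhds (fun n => ?_) fun n => ?_
    · exact ((hs3 n).1.trans ((hzm n).1.trans (htm n).1)).le
    · exact ((htm n).2.trans (hz1 (n + 1)).2).le
  · have h1 := htpos (2 * n)
    have h2 := htmax (2 * n)
    rw [(even_two_mul n).neg_one_pow] at h1 h2
    refine ⟨⟨z (2 * n), z (2 * n + 1), (hz1 _).1, (htm _).1, (htm _).2, (hz1 _).2,
      fun τ hτ => by linarith [h2 τ hτ], ?_, ?_⟩, by linarith⟩
    · rw [hz0]; linarith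
    · rw [hz0]; linarith
  · have h1 := htpos (2 * n + 1)
    have h2 := htmax (2 * n + 1)
    rw [(odd_two_mul_add_one n).neg_one_pow] at h1 h2
    refine ⟨⟨z (2 * n + 1), z (2 * n + 1 + 1), (hz1 _).1, (htm _).1, (htm _).2, (hz1 _).2,
      fun τ hτ => by linarith [h2 τ hτ], ?_, ?_⟩, by linarith⟩
    · rw [hz0]; linarith
    · rw [hz0]; linarith
  · exact (infinite_range_of_injective (strictMono_nat_of_lt_succ hzz).injective).mono
      (by rintro _ ⟨n, rfl⟩; exact ⟨hz1 n, hz0 n⟩)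

end MEMS
end

/-! ### Assembly, with the parameter `τ = 1 - σ` -/

theorem corollary1 (α β γ ubar q : ℝ) (f : ℝ → ℝ)
    (hβ : 1 ≤ β) (hαβ : β < α) (hγα : α < γ) (hubar : 0 < ubar)
    (hf_cont : ContinuousOn f (Ici 0)) (hf_zero : f 0 = 0) (hf_pos : ∀ u, 0 < u → 0 < f u)
    (hf_C1 : ContDiffOn ℝ 1 f (Ioi 0)) (hf_C2 : ContDiffOn ℝ 2 f (Ioo 0 ubar))
    (hG1 : ∀ u ∈ Ioo 0 ubar,
      0 < deriv (MEMS.gOf β f) u ∧ 0 < deriv (deriv (MEMS.gOf β f)) u)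
    (hG2 : Tendsto (MEMS.growthQuotient β f) (𝓝[>] 0) (𝓝 q))
    (hG3 : q = 1 → ∀ᶠ u in 𝓝[>] 0, 1 ≤ MEMS.growthQuotient β f u)
    (hG4 : ∀ u, 0 < u → 0 < deriv (MEMS.gOf β f) u) :
    ∃ (lbar : ℝ) (vbar : C(Icc (0 : ℝ) 1, ℝ)),
      (∀ lam v, MEMS.IsDegenerateSolution α β γ f lam v ↔ lam = lbar ∧ v = vbar) ∧
      ∃ (Λ : ℝ → ℝ) (V : ℝ → C(Icc (0 : ℝ) 1, ℝ)),
        MEMS.IsBifurcationCurve α β γ f Λ V ∧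
        Tendsto Λ (𝓝[<] 1) (𝓝 lbar) ∧
        Tendsto V (𝓝[<] 1) (𝓝 vbar) ∧
        ((q : EReal) < MEMS.qc α β γ →
          MEMS.HasInfinitelyManyTurningPointsAround Λ lbar ∧
          {v | MEMS.IsRegularSolution α β γ f lbar v}.Infinite) := by
  have hβ0 : 0 < β := by linarith
  have H : MEMS.Hypotheses β ubar q f :=
    ⟨hβ, hubar, hf_cont, hf_zero, hf_pos, hf_C1, hG1, hG2, hG3, hG4⟩
  have hp := MEMS.admissible_of_lt hβ hαβ hγα
  have hh := H.nonlinearity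
  have hα : α = β * ((α / β - 1) + 1) := by field_simp; ring
  set k := α / β - 1 with hk
  have hβθ : 0 < β * (γ / β - k) := mul_pos hβ0 hp.θ_pos
  obtain ⟨u₁, L, ω, D, h0, h1, hg⟩ := H.exists_isGrowth
  obtain ⟨R, S, hF⟩ := hg.exists_orbitFamily hp hh h0 h1
  obtain ⟨V, hsol, hV⟩ := hF.exists_solutions hp hα hf_pos hf_C1.continuousOn
  have hR : ∀ σ₀ ∈ Ico (0:ℝ) 1, ∀ u ∈ Ioc σ₀ 1,
      Tendsto (fun σ => R σ u) (𝓝[Ico 0 1] σ₀) (𝓝 (R σ₀ u)) := by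
    intro σ₀ hσ₀ u hu
    rw [Metric.tendsto_nhds]
    intro ε hε
    filter_upwards [hF.tendsto_orbit hg hp hh h0 h1 hσ₀ hu.1 (b := u) (by linarith [hu.2]) hε]
      with σ hσ
    exact (le_max_left _ _).trans_lt (hσ.2 u ⟨le_rfl, le_rfl⟩)
  have hlamt : ∀ σ₀ ∈ Ico (0:ℝ) 1, Tendsto (MEMS.orbitLam β k γ R) (𝓝[Ico 0 1] σ₀)
      (𝓝 (MEMS.orbitLam β k γ R σ₀)) := fun σ₀ hσ₀ =>
    (Real.continuous_exp.tendsto _).comp ((hR σ₀ hσ₀ 1 ⟨hσ₀.2, le_rfl⟩).const_mul _)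
  have hVt : ∀ σ₀ ∈ Ico (0:ℝ) 1, Tendsto V (𝓝[Ico 0 1] σ₀) (𝓝 (V σ₀)) := fun σ₀ hσ₀ =>
    hF.tendsto_solution hV hσ₀ (tendsto_id.mono_left nhdsWithin_le_nhds) self_mem_nhdsWithin
      (hR σ₀ hσ₀)
  have hrefl : ∀ τ ∈ Ioo (0:ℝ) 1, 1 - τ ∈ Ico (0:ℝ) 1 := fun τ hτ =>
    ⟨by linarith [hτ.2], by linarith [hτ.1]⟩
  have hcont : Continuous fun τ : ℝ => 1 - τ := by fun_prop
  have hflip : ∀ τ ∈ Ioo (0:ℝ) 1,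
      Tendsto (fun τ : ℝ => 1 - τ) (𝓝[Ioo 0 1] τ) (𝓝[Ico 0 1] (1 - τ)) := fun τ hτ =>
    tendsto_nhdsWithin_iff.2 ⟨(hcont.tendsto τ).mono_left nhdsWithin_le_nhds,
      by filter_upwards [self_mem_nhdsWithin] with x hx using hrefl x hx⟩
  have hflip1 : Tendsto (fun τ : ℝ => 1 - τ) (𝓝[<] 1) (𝓝[Ico 0 1] 0) := by
    refine tendsto_nhdsWithin_iff.2 ⟨?_, ?_⟩
    · have := hcont.tendsto 1
      rw [sub_self] at this
      exact this.mono_left nhdsWithin_le_nhds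
    · filter_upwards [Ioo_mem_nhdsLT one_pos] with x hx using hrefl x hx
  have h00 : (0:ℝ) ∈ Ico (0:ℝ) 1 := ⟨le_rfl, one_pos⟩
  have hcentral : ∀ τ ∈ Ioo (0:ℝ) 1, V (1 - τ) 0 = τ := fun τ hτ => by
    rw [(hV _ (hrefl τ hτ)).1, sub_sub_cancel]
  have hreg : ∀ lam v, MEMS.IsRegularSolution α β γ f lam v ↔
      ∃ τ ∈ Ioo (0 : ℝ) 1, lam = MEMS.orbitLam β k γ R (1 - τ) ∧ v = V (1 - τ) := by
    intro lam v
    constructor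
    · rintro ⟨hv, hb⟩
      obtain ⟨σ, hσ, rfl, rfl⟩ := (hsol lam v).1 hv
      have := (hb 0).2
      rw [(hV σ hσ).1] at this
      exact ⟨1 - σ, ⟨by linarith [hσ.2], by linarith⟩, by rw [sub_sub_cancel],
        by rw [sub_sub_cancel]⟩
    · rintro ⟨τ, hτ, rfl, rfl⟩
      have hs := (hsol _ _).2 ⟨1 - τ, hrefl τ hτ, rfl, rfl⟩
      refine ⟨hs, fun s => ?_⟩
      rcases s.2.1.eq_or_lt with hs0 | hs0
      · have : s = 0 := Subtype.ext hs0.symm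
        rw [this, hcentral τ hτ]
        exact ⟨hτ.1.le, hτ.2⟩
      · rcases s.2.2.eq_or_lt with hs1 | hs1
        · have : s = 1 := Subtype.ext hs1
          rw [this, hs.boundary]
          exact ⟨le_rfl, one_pos⟩
        · rw [← MEMS.onReal_apply]
          exact ⟨(hs.pos _ ⟨hs0, hs1⟩).le, hs.lt_one _ ⟨hs0, hs1⟩⟩
  have hΛc : ContinuousOn (fun τ => MEMS.orbitLam β k γ R (1 - τ)) (Ioo 0 1) := fun τ hτ =>
    (hlamt _ (hrefl τ hτ)).comp (hflip τ hτ)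
  refine ⟨MEMS.orbitLam β k γ R 0, V 0, fun lam v => ⟨?_, ?_⟩,
    fun τ => MEMS.orbitLam β k γ R (1 - τ), fun τ => V (1 - τ),
    ⟨hcentral, hreg, hΛc, fun τ hτ => (hVt _ (hrefl τ hτ)).comp (hflip τ hτ)⟩,
    (hlamt 0 h00).comp hflip1, (hVt 0 h00).comp hflip1, fun hqc => ?_⟩
  · rintro ⟨hv, hv0⟩
    obtain ⟨σ, hσ, rfl, rfl⟩ := (hsol lam v).1 hv
    rw [(hV σ hσ).1] at hv0
    have : σ = 0 := by linarith
    subst this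
    exact ⟨rfl, rfl⟩
  · rintro ⟨rfl, rfl⟩
    exact ⟨(hsol _ _).2 ⟨0, h00, rfl, rfl⟩, by rw [(hV 0 h00).1, sub_zero]⟩
  · have hspiral := MEMS.spiral_of_lt_qc hβ hαβ hγα H.one_le_q hqc
    have halt := fun ε (hε : (0:ℝ) < ε) => hF.exists_alternating hg hp hh h0 h1 hspiral hε
    -- `λ` is an increasing function of the value of `ρ` at `1`, so the alternation carries over.
    have hlt : ∀ σ σ', R σ 1 < R σ' 1 →
        MEMS.orbitLam β k γ R σ < MEMS.orbitLam β k γ R σ' := fun σ σ' h =>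
      Real.exp_lt_exp.2 (mul_lt_mul_of_pos_left h hβθ)
    obtain ⟨ht, hz⟩ := MEMS.infinitely_many_turning_points hΛc
      (lbar := MEMS.orbitLam β k γ R 0)
      (fun ε hε => by
        obtain ⟨σ, hσ, hσ1, hlt'⟩ := (halt ε hε).1
        exact ⟨1 - σ, ⟨by linarith, by linarith [hσ.1]⟩, by linarith [hσ.2],
          by rw [sub_sub_cancel]; exact hlt _ _ hlt'⟩)
      (fun ε hε => by
        obtain ⟨σ, hσ, hσ1, hlt'⟩ := (halt ε hε).2
        exact ⟨1 - σ, ⟨by linarith, by linarith [hσ.1]⟩, by linarith [hσ.2],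
          by rw [sub_sub_cancel]; exact hlt _ _ hlt'⟩)
    -- Different parameters give different solutions, since the value at the centre is the
    -- parameter.
    refine ⟨ht, (hz.image (f := fun τ => V (1 - τ)) fun τ hτ τ' hτ' heq => ?_).mono ?_⟩
    · rw [← hcentral τ hτ.1, ← hcentral τ' hτ'.1]
      exact congrArg (fun v : C(Icc (0 : ℝ) 1, ℝ) => v 0) heq
    · rintro _ ⟨τ, ⟨hτ, hτ0⟩, rfl⟩
      exact (hreg _ _).2 ⟨τ, hτ, hτ0.symm, rfl⟩
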